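/- **Setting.** Let $V=\mathbb C^N$. For an operator $X$ on $V\otimes V$ write $X_i$ for $X$ acting in the factors $i,i+1$ of a tensor power of $V$. An *R-matrix* is an invertible operator $X$ on $V\otimes V$ with $X_1X_2X_1=X_2X_1X_2$. A pair $\{R,F\}$ of R-matrices is *compatible* if $R_1F_2F_1=F_2F_1R_2$ and $R_2F_1F_2=F_1F_2R_1$. $X$ is *skew invertible* if there is an operator $\Psi_X$ on $V\otimes V$ with $\mathrm{Tr}_{(2)}X_{12}(\Psi_X)_{23}=P_{13}=\mathrm{Tr}_{(2)}(\Psi_X)_{12}X_{23}$, $P$ the permutation; put $C_X=\mathrm{Tr}_{(1)}\Psi_X$, $D_X=\mathrm{Tr}_{(2)}\Psi_X$. $X$ is *strict skew invertible* if, moreover, $C_X$ or $D_X$ is invertible. For skew invertible $R$, the R-trace of a matrix $Y$ is $\mathrm{Tr}_R\,Y=\mathrm{Tr}(D_RY)$. *BMW type.* Let $q\in\mathbb C\setminus\{0,1,-1\}$ and $\mu\in\mathbb C\setminus\{0,q,-q^{-1}\}$. An R-matrix $R$ is of BMW type with parameters $q,\mu$ if its minimal polynomial is $(x-q)(x+q^{-1})(x-\mu)$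 and, with $K=\frac{(qI-R)(q^{-1}I+R)}{\mu(q-q^{-1})}$, one has $K_2K_1=R_1R_2K_1=R_1^{-1}R_2^{-1}K_1$ and $K_1K_2K_1=K_1$. Let $\rho_R$ be the representation $\sigma_i\mapsto R_i$ of the group algebra $\mathbb C\mathcal B_n$ of the braid group on $n$ strands. Put $$i_q=\frac{q^i-q^{-i}}{q-q^{-1}},\quad \kappa_i=\frac{(q-\sigma_i)(q^{-1}+\sigma_i)}{\mu(q-q^{-1})},\quad \eta=\frac{(q-\mu)(q^{-1}+\mu)}{\mu(q-q^{-1})},\quad \sigma^-_i(x)=1+\frac{x-1}{q-q^{-1}}\,\sigma_i+\frac{x-1}{q\mu^{-1}x+1}\,\kappa_i,$$ and define the antisymmetrizers by $a^{(1)}=1$, $a^{(i+1)}=\frac{q^i}{(i+1)_q}\,a^{(i)}\sigma^-_i(q^{-2i})\,a^{(i)}$. Let $\alpha\mapsto\alpha^{\uparrow s}$ be the shift $\sigma_i\mapsto\sigma_{i+s}$. *$O(k)$ type.* A skew invertible R-matrix $R$ of BMW type is of $O(k)$ type, $k\ge 2$, if $i_q\ne0$ for $2\le i\le k$; $\mu=q^{1-k}$;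 $\mathrm{rk}\,\rho_R(a^{(i)})\neq 0$ for $2\le i\le k$; $\rho_R\big(a^{(k)\uparrow 1}\sigma^-_1(q^{-2k})\,a^{(k)\uparrow1}\big)=0$; and $\mathrm{rk}\,\rho_R(a^{(k)})=1$. *Extended quantum matrix algebra.* For an $N\times N$ matrix $M$ over a unital $\mathbb C$-algebra put $M_{\overline 1}=M\otimes I\otimes\cdots\otimes I$, $M_{\overline{i+1}}=F_iM_{\overline i}F_i^{-1}$, and for $\alpha\in\mathbb C\mathcal B_n$, $n\ge1$, $$M^{\alpha}=\mathrm{Tr}_R{}_{(2,\dots,n)}\,M_{\overline1}\cdots M_{\overline n}\,\rho_R(\alpha),\qquad ch(\alpha)=\mathrm{Tr}_R{}_{(1,\dots,n)}\,M_{\overline1}\cdots M_{\overline n}\,\rho_R(\alpha),$$ $$a_0=1,\qquad a_i=ch(a^{(i)})\ (i\ge1),\qquad g=\eta^{-1}ch(\kappa_1).$$ Let $R$ be of $O(2\ell)$ type, and let $G$ be the operator on $V$ with $G_1=\mathrm{Tr}_{(2,3)}K_2F_1^{-1}F_2^{-1}$. The extended algebra $\mathcal M^\bullet(R,F)$ is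 the unital associative $\mathbb C$-algebra generated by the entries of $M$ and by $g^{-1}$, with the relations $R_1M_{\overline1}M_{\overline2}=M_{\overline1}M_{\overline2}R_1$, $g^{-1}g=gg^{-1}=1$, $g^{-1}M=(G^{-1}MG)\,g^{-1}$. Its component $O^{\pm}(2\ell)$ is its quotient by the relation $a_{2\ell}=\pm g^{\ell}$. *The $\star$-product.* In the component $O^\pm(2\ell)$, let $\mathcal C^\pm$ be the subalgebra generated by $g^{-1}$ and all $ch(\alpha)$, and let $\mathcal P^\pm$ be the space of matrices spanned by all $Ic$ and $M^\alpha c$ with $c\in\mathcal C^\pm$, $\alpha\in\mathbb C\mathcal B_n$, $n\ge1$. The $\star$-product is the bilinear product on $\mathcal P^\pm$ with unit $I$ such that $(Xc)\star Y=(X\star Y)c=X\star(Yc)$ for $c\in\mathcal C^\pm$, and, for $\alpha\in\mathbb C\mathcal B_n$, $\beta\in\mathbb C\mathcal B_i$, $$M^{\alpha}\star M^{\beta}=M^{\alpha\star\beta},\qquad \alpha\star\beta=\alpha\,\beta^{\uparrow n}\,(\sigma_n\cdots\sigma_2\sigma_1\sigma_2^{-1}\cdots\sigma_n^{-1})\in\mathbb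 C\mathcal B_{n+i}.$$ Put $M^{\overline0}=I$ and $M^{\overline{n+1}}=M\star M^{\overline n}$. **Theorem.** Let $\{R,F\}$ be a compatible pair of R-matrices with $F$ strict skew invertible and $R$ of $O(2\ell)$ type (so $\ell\ge1$), and assume $q^{2\ell+2}\neq-1$. Then on each of $\mathcal P^{+}$, $\mathcal P^-$ the $\star$-product exists and is unique, and the matrix $M$ of generators satisfies the following identities. In the component $O^+(2\ell)$, $$\sum_{i=0}^{2\ell}(-q)^i\,M^{\overline{2\ell-i}}\,a_i=0 .$$ In the component $O^-(2\ell)$, $$\big(M^{\overline2}-gI\big)\star\sum_{i=0}^{2\ell-2}(-q)^i\,M^{\overline{2\ell-i-2}}\,\epsilon_i=0 ,$$ where $$\epsilon_i=\sum_{j=0}^{[i/2]}a_{i-2j}\,g^j\qquad\text{and}\qquad \epsilon_{\ell-1+i}=\epsilon_{\ell-1-i}\,g^i\qquad\text{for } i=0,1,\dots,\ell-1 .$$ -/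

import Mathlib

open scoped BigOperators

noncomputable section

/-! ### Operators on tensor powers -/

/-- Matrices of operators on `V^{⊗ n}`, `dim V = N`, with entries in `A`. A multi-index is a
function `Fin n → Fin N`; the tensor factors are numbered `0, …, n - 1`. -/
abbrev TensorMat (N n : ℕ) (A : Type*) : Type _ := Matrix (Fin n → Fin N) (Fin n → Fin N) A

/-- `onSites e X`: the operator `X` on `V^{⊗ k}` acting in the factors `e 0, …, e (k - 1)` of
`V^{⊗ n}`, and as the identity in the other factors. -/
def onSites {N k n : ℕ} {A : Type*} [Zero A] (e : Fin k → Fin n) (X : TensorMat N k A) :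
    TensorMat N n A :=
  Matrix.of fun a b => open Classical in
    if ∀ j, j ∉ Set.range e → a j = b j then X (a ∘ e) (b ∘ e) else 0

theorem onSites_one {N k n : ℕ} (e : Fin k → Fin n) :
    onSites e (1 : TensorMat N k ℂ) = 1 := by
  classical
  ext a b
  simp only [onSites, Matrix.of_apply, Matrix.one_apply]
  by_cases hab : a = b
  · subst hab; simp
  · rw [if_neg hab]
    split_ifs with h1 h2
    · exfalso
      apply hab
      funext j
      by_cases hj : j ∈ Set.range e
      · obtain ⟨i, rfl⟩ := hj
        exact congrFun h2 i
      · exact h1 j hj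
    · rfl
    · rfl

theorem onSites_mul {N k n : ℕ} (e : Fin k → Fin n) (he : Function.Injective e)
    (X Y : TensorMat N k ℂ) : onSites e (X * Y) = onSites e X * onSites e Y := by
  classical
  ext a b
  rw [Matrix.mul_apply]
  simp only [onSites, Matrix.of_apply, Matrix.mul_apply]
  by_cases hab : ∀ j, j ∉ Set.range e → a j = b j
  · rw [if_pos hab]
    have hcomp : ∀ d : Fin k → Fin N, (Function.extend e d a) ∘ e = d := fun d =>
      funext fun i => he.extend_apply d a i
    have hout : ∀ (d : Fin k → Fin N) j, j ∉ Set.range e → Function.extend e d a j = a j :=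
      fun d j hj => Function.extend_apply' d a j hj
    symm
    rw [← Finset.sum_subset (Finset.subset_univ
      ((Finset.univ : Finset (Fin k → Fin N)).image fun d => Function.extend e d a))]
    · rw [Finset.sum_image]
      · refine Finset.sum_congr rfl fun d _ => ?_
        rw [hcomp d, if_pos (fun j hj => (hout d j hj).symm),
          if_pos (fun j hj => (hout d j hj).trans (hab j hj))]
      · intro d _ d' _ hdd
        have := congrArg (fun f => f ∘ e) hdd
        simpa [hcomp] using this
    · intro c _ hc
      have : ¬ ∀ j, j ∉ Set.range e → a j = c j := by
        intro h
        apply hc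
        refine Finset.mem_image.2 ⟨c ∘ e, Finset.mem_univ _, ?_⟩
        funext j
        by_cases hj : j ∈ Set.range e
        · obtain ⟨i, rfl⟩ := hj
          exact he.extend_apply (c ∘ e) a i
        · rw [hout _ j hj, h j hj]
      rw [if_neg this, zero_mul]
  · rw [if_neg hab]
    symm
    refine Finset.sum_eq_zero fun c _ => ?_
    by_cases h1 : ∀ j, j ∉ Set.range e → a j = c j
    · rw [if_neg (fun h2 : ∀ j, j ∉ Set.range e → c j = b j =>
        hab fun j hj => (h1 j hj).trans (h2 j hj)), mul_zero]
    · rw [if_neg h1, zero_mul]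

theorem onSites_onSites {N k l n : ℕ} (e : Fin l → Fin n) (he : Function.Injective e)
    (f : Fin k → Fin l) (X : TensorMat N k ℂ) :
    onSites e (onSites f X) = onSites (e ∘ f) X := by
  classical
  ext a b
  simp only [onSites, Matrix.of_apply, Function.comp_assoc, Function.comp_apply]
  by_cases h : ∀ j, j ∉ Set.range (e ∘ f) → a j = b j
  · rw [if_pos h, if_pos, if_pos]
    · intro j hj
      apply h
      rintro ⟨i, hi⟩
      exact hj ⟨i, he hi⟩
    · intro j hj
      apply h
      rintro ⟨i, hi⟩
      exact hj ⟨f i, hi⟩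
  · rw [if_neg h]
    split_ifs with h1 h2
    · exfalso
      apply h
      intro j hj
      by_cases hje : j ∈ Set.range e
      · obtain ⟨i, rfl⟩ := hje
        apply h2
        rintro ⟨i', rfl⟩
        exact hj ⟨i', rfl⟩
      · exact h1 j hje
    · rfl
    · rfl

theorem onSites_comm {N k l n : ℕ} (e : Fin k → Fin n) (f : Fin l → Fin n)
    (hef : Disjoint (Set.range e) (Set.range f))
    (X : TensorMat N k ℂ) (Y : TensorMat N l ℂ) :
    onSites e X * onSites f Y = onSites f Y * onSites e X := by
  classical
  have key : ∀ (k l : ℕ) (e : Fin k → Fin n) (f : Fin l → Fin n)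
      (_ : Disjoint (Set.range e) (Set.range f)) (X : TensorMat N k ℂ) (Y : TensorMat N l ℂ)
      (a b : Fin n → Fin N), (onSites e X * onSites f Y) a b =
        if ∀ j, j ∉ Set.range e → j ∉ Set.range f → a j = b j then
          X (a ∘ e) (b ∘ e) * Y (a ∘ f) (b ∘ f) else 0 := by
    intro k l e f hef X Y a b
    rw [Matrix.mul_apply]
    let c₀ : Fin n → Fin N := fun j => if j ∈ Set.range e then b j else a j
    have hc₀ : ∀ c, (∀ j, j ∉ Set.range e → a j = c j) →
        (∀ j, j ∉ Set.range f → c j = b j) → c = c₀ := by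
      intro c h1 h2
      funext j
      by_cases hj : j ∈ Set.range e
      · simp only [c₀, if_pos hj]
        exact h2 j (Set.disjoint_left.1 hef hj)
      · simp only [c₀, if_neg hj]
        exact (h1 j hj).symm
    rw [Finset.sum_eq_single c₀]
    · have e1 : c₀ ∘ e = b ∘ e := by
        funext i; simp [c₀]
      have e2 : c₀ ∘ f = a ∘ f := by
        funext i
        have : f i ∉ Set.range e := Set.disjoint_right.1 hef ⟨i, rfl⟩
        simp only [Function.comp_apply, c₀, if_neg this]
      simp only [onSites, Matrix.of_apply, e1, e2]
      rw [if_pos (fun j hj => by simp only [c₀, if_neg hj])]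
      by_cases h : ∀ j, j ∉ Set.range e → j ∉ Set.range f → a j = b j
      · rw [if_pos h, if_pos]
        intro j hj
        by_cases hje : j ∈ Set.range e
        · simp only [c₀, if_pos hje]
        · simp only [c₀, if_neg hje]
          exact h j hje hj
      · rw [if_neg h, if_neg, mul_zero]
        intro h2
        apply h
        intro j hj hjf
        have := h2 j hjf
        simpa only [c₀, if_neg hj] using this
    · intro c _ hc
      simp only [onSites, Matrix.of_apply]
      by_cases h1 : ∀ j, j ∉ Set.range e → a j = c j
      · rw [if_neg (fun h2 => hc (hc₀ c h1 h2)), mul_zero]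
      · rw [if_neg h1, zero_mul]
    · intro h; exact absurd (Finset.mem_univ _) h
  ext a b
  rw [key k l e f hef, key l k f e hef.symm]
  have : (∀ j, j ∉ Set.range e → j ∉ Set.range f → a j = b j) ↔
      (∀ j, j ∉ Set.range f → j ∉ Set.range e → a j = b j) :=
    ⟨fun h j h1 h2 => h j h2 h1, fun h j h1 h2 => h j h2 h1⟩
  simp only [this, mul_comm (X _ _)]


/-- The pair of neighbouring tensor factors `i, i + 1`. -/
def adj {m : ℕ} (i : Fin m) : Fin 2 → Fin (m + 1) := ![i.castSucc, i.succ]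

theorem adj_injective {m : ℕ} (i : Fin m) : Function.Injective (adj i) := by
  intro a b h
  fin_cases a <;> fin_cases b <;> simp_all [adj, Fin.ext_iff]

/-- For an operator `X` on `V ⊗ V`, the operator acting as `X` in the factors `i, i + 1` of
`V^{⊗ (m + 1)}` (entries embedded in the algebra `A`). -/
def locA (A : Type*) [Ring A] [Algebra ℂ A] {N m : ℕ} (i : Fin m) (X : TensorMat N 2 ℂ) :
    TensorMat N (m + 1) A :=
  (onSites (adj i) X).map (algebraMap ℂ A)

/-- The same with complex entries. -/
def loc {N m : ℕ} (i : Fin m) (X : TensorMat N 2 ℂ) : TensorMat N (m + 1) ℂ :=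
  onSites (adj i) X

/-- The matrix `T` acting in the first tensor factor. -/
def firstSite {A : Type*} [Zero A] {N : ℕ} (m : ℕ) (T : Matrix (Fin N) (Fin N) A) :
    TensorMat N (m + 1) A :=
  onSites ![0] (Matrix.of fun a b : Fin 1 → Fin N => T (a 0) (b 0))

/-- The ordinary trace over all tensor factors but the first one. -/
def traceTail {A : Type*} [AddCommMonoid A] {N m : ℕ} (Y : TensorMat N (m + 1) A) :
    Matrix (Fin N) (Fin N) A :=
  Matrix.of fun i j => ∑ c : Fin m → Fin N,
    Y (Fin.cons i c : Fin (m + 1) → Fin N) (Fin.cons j c : Fin (m + 1) → Fin N)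

/-! ### R-matrices -/

/-- An R-matrix: an invertible operator on `V ⊗ V` obeying the Yang-Baxter equation. -/
structure RMatrix (N : ℕ) where
  op : (TensorMat N 2 ℂ)ˣ
  ybe : loc (0 : Fin 2) op.val * loc (1 : Fin 2) op.val * loc (0 : Fin 2) op.val =
    loc (1 : Fin 2) op.val * loc (0 : Fin 2) op.val * loc (1 : Fin 2) op.val

/-- The operator underlying an R-matrix. -/
def RMatrix.mat {N : ℕ} (R : RMatrix N) : TensorMat N 2 ℂ := R.op.val

/-- The inverse of the operator underlying an R-matrix. -/
def RMatrix.inv {N : ℕ} (R : RMatrix N) : TensorMat N 2 ℂ := (R.op⁻¹).val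

/-- `R₁ F₂ F₁ = F₂ F₁ R₂` and `R₂ F₁ F₂ = F₁ F₂ R₁`. -/
def IsCompatible {N : ℕ} (R F : RMatrix N) : Prop :=
  (loc (0 : Fin 2) R.mat * loc (1 : Fin 2) F.mat * loc (0 : Fin 2) F.mat =
    loc (1 : Fin 2) F.mat * loc (0 : Fin 2) F.mat * loc (1 : Fin 2) R.mat) ∧
  (loc (1 : Fin 2) R.mat * loc (0 : Fin 2) F.mat * loc (1 : Fin 2) F.mat =
    loc (0 : Fin 2) F.mat * loc (1 : Fin 2) F.mat * loc (0 : Fin 2) R.mat)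

/-- `Tr₍₂₎ X₁₂ Ψ₂₃ = P₁₃ = Tr₍₂₎ Ψ₁₂ X₂₃`, where `P` is the permutation; written in entries. -/
def IsSkewInverse {N : ℕ} (X Ψ : TensorMat N 2 ℂ) : Prop :=
  ∀ a c a' c' : Fin N,
    (∑ b, ∑ b', X ![a, b] ![a', b'] * Ψ ![b', c] ![b, c'] =
      if a = c' ∧ c = a' then 1 else 0) ∧
    (∑ b, ∑ b', Ψ ![a, b] ![a', b'] * X ![b', c] ![b, c'] =
      if a = c' ∧ c = a' then 1 else 0)

/-- Skew invertibility of an operator on `V ⊗ V`. -/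
def IsSkewInvertible {N : ℕ} (X : TensorMat N 2 ℂ) : Prop := ∃ Ψ, IsSkewInverse X Ψ

open Classical in
/-- The (unique) skew inverse of a skew invertible operator. -/
def skewInv {N : ℕ} (X : TensorMat N 2 ℂ) : TensorMat N 2 ℂ :=
  if h : IsSkewInvertible X then h.choose else 0

/-- `C_X = Tr₍₁₎ Ψ_X`. -/
def skewC {N : ℕ} (X : TensorMat N 2 ℂ) : Matrix (Fin N) (Fin N) ℂ :=
  Matrix.of fun i j => ∑ a, skewInv X ![a, i] ![a, j]

/-- `D_X = Tr₍₂₎ Ψ_X`. -/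
def skewD {N : ℕ} (X : TensorMat N 2 ℂ) : Matrix (Fin N) (Fin N) ℂ :=
  Matrix.of fun i j => ∑ a, skewInv X ![i, a] ![j, a]

/-- Strict skew invertibility: one of `C_X`, `D_X` is invertible. -/
def IsStrictSkewInvertible {N : ℕ} (X : TensorMat N 2 ℂ) : Prop :=
  IsSkewInvertible X ∧ (IsUnit (skewC X) ∨ IsUnit (skewD X))

/-- `K = μ⁻¹ (q - q⁻¹)⁻¹ (q I - R)(q⁻¹ I + R)`. -/
def opK {N : ℕ} (q μ : ℂ) (R : RMatrix N) : TensorMat N 2 ℂ :=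
  (μ * (q - q⁻¹))⁻¹ • ((q • 1 - R.mat) * (q⁻¹ • 1 + R.mat))

/-- R-matrices of the Birman-Murakami-Wenzl type with parameters `q, μ`. -/
structure IsBMW {N : ℕ} (q μ : ℂ) (R : RMatrix N) : Prop where
  q_ne : q ≠ 0 ∧ q ≠ 1 ∧ q ≠ -1
  μ_ne : μ ≠ 0 ∧ μ ≠ q ∧ μ ≠ -q⁻¹
  minpoly_eq : minpoly ℂ R.mat = (Polynomial.X - Polynomial.C q) *
    (Polynomial.X - Polynomial.C (-q⁻¹)) * (Polynomial.X - Polynomial.C μ)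
  K_K : loc (1 : Fin 2) (opK q μ R) * loc (0 : Fin 2) (opK q μ R) =
    loc (0 : Fin 2) R.mat * loc (1 : Fin 2) R.mat * loc (0 : Fin 2) (opK q μ R)
  K_K_inv : loc (1 : Fin 2) (opK q μ R) * loc (0 : Fin 2) (opK q μ R) =
    loc (0 : Fin 2) R.inv * loc (1 : Fin 2) R.inv * loc (0 : Fin 2) (opK q μ R)
  K_K_K : loc (0 : Fin 2) (opK q μ R) * loc (1 : Fin 2) (opK q μ R) *
    loc (0 : Fin 2) (opK q μ R) = loc (0 : Fin 2) (opK q μ R)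

/-! ### Braid groups and their representations -/

/-- The braid relations between the generators `σ_i`, `i : Fin m`. -/
def braidRels (m : ℕ) : Set (FreeGroup (Fin m)) :=
  {w | ∃ i j : Fin m, (i : ℕ) + 1 = j ∧
      w = FreeGroup.of i * FreeGroup.of j * FreeGroup.of i *
        (FreeGroup.of j * FreeGroup.of i * FreeGroup.of j)⁻¹} ∪
  {w | ∃ i j : Fin m, (i : ℕ) + 1 < j ∧
      w = FreeGroup.of i * FreeGroup.of j * (FreeGroup.of j * FreeGroup.of i)⁻¹}

/-- `Braid m` is the braid group on `m + 1` strands, with `m` generators `σ_0, …, σ_{m - 1}`. -/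
abbrev Braid (m : ℕ) : Type := PresentedGroup (braidRels m)

/-- The Artin generators. -/
def sig {m : ℕ} (i : Fin m) : Braid m := PresentedGroup.of i

theorem sig_braid {m : ℕ} (i j : Fin m) (h : (i : ℕ) + 1 = j) :
    sig i * sig j * sig i = sig j * sig i * sig j := by
  have : (PresentedGroup.mk (braidRels m) (FreeGroup.of i * FreeGroup.of j * FreeGroup.of i *
        (FreeGroup.of j * FreeGroup.of i * FreeGroup.of j)⁻¹)) = 1 :=
    PresentedGroup.one_of_mem (Or.inl ⟨i, j, h, rfl⟩)
  rw [map_mul, map_inv, mul_inv_eq_one] at this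
  simp only [map_mul] at this
  exact this

theorem sig_comm {m : ℕ} (i j : Fin m) (h : (i : ℕ) + 1 < j) :
    sig i * sig j = sig j * sig i := by
  have : (PresentedGroup.mk (braidRels m) (FreeGroup.of i * FreeGroup.of j *
        (FreeGroup.of j * FreeGroup.of i)⁻¹)) = 1 :=
    PresentedGroup.one_of_mem (Or.inr ⟨i, j, h, rfl⟩)
  rw [map_mul, map_inv, mul_inv_eq_one] at this
  simp only [map_mul] at this
  exact this

/-- A family satisfying the braid relations defines a homomorphism from the braid group. -/
def Braid.lift {m : ℕ} {G : Type*} [Group G] (f : Fin m → G)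
    (h₁ : ∀ i j : Fin m, (i : ℕ) + 1 = j → f i * f j * f i = f j * f i * f j)
    (h₂ : ∀ i j : Fin m, (i : ℕ) + 1 < j → f i * f j = f j * f i) : Braid m →* G :=
  PresentedGroup.toGroup (f := f) (by
    rintro r (⟨i, j, hij, rfl⟩ | ⟨i, j, hij, rfl⟩)
    · simp only [map_mul, map_inv, FreeGroup.lift_apply_of]
      rw [mul_inv_eq_one]
      exact h₁ i j hij
    · simp only [map_mul, map_inv, FreeGroup.lift_apply_of]
      rw [mul_inv_eq_one]
      exact h₂ i j hij)

/-- The homomorphism `σ_i ↦ σ_{i + s}` from `Braid m` to `Braid m'`, `s + m ≤ m'`. -/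
def Braid.shift {m m' : ℕ} (s : ℕ) (h : s + m ≤ m') : Braid m →* Braid m' :=
  Braid.lift (fun i => sig ⟨s + i, by omega⟩)
    (fun i j hij => sig_braid _ _ (by simp only; omega))
    (fun i j hij => sig_comm _ _ (by simp only; omega))

theorem onSites_units_mul {N k n : ℕ} (e : Fin k → Fin n) (he : Function.Injective e)
    (X Y : TensorMat N k ℂ) (h : X * Y = 1) : onSites e X * onSites e Y = 1 := by
  rw [← onSites_mul e he, h, onSites_one]

/-- The invertible operator `R_i` on `V^{⊗ (m + 1)}`. -/
def RMatrix.unitAt {N m : ℕ} (R : RMatrix N) (i : Fin m) : (TensorMat N (m + 1) ℂ)ˣ where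
  val := loc i R.mat
  inv := loc i R.inv
  val_inv := onSites_units_mul _ (adj_injective i) _ _ R.op.mul_inv
  inv_val := onSites_units_mul _ (adj_injective i) _ _ R.op.inv_mul

theorem RMatrix.unitAt_braid {N m : ℕ} (R : RMatrix N) (i j : Fin m) (h : (i : ℕ) + 1 = j) :
    R.unitAt i * R.unitAt j * R.unitAt i = R.unitAt j * R.unitAt i * R.unitAt j := by
  have hm : (i : ℕ) + 2 ≤ m := by have := j.2; omega
  let e : Fin 3 → Fin (m + 1) := fun k => ⟨(i : ℕ) + k, by have := k.2; omega⟩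
  have he : Function.Injective e := by
    intro a b hab
    have := congrArg Fin.val hab
    simp only [e] at this
    exact Fin.ext (by omega)
  have h0 : e ∘ adj (0 : Fin 2) = adj i := by
    funext k; fin_cases k <;> simp [e, adj, Fin.ext_iff]
  have h1 : e ∘ adj (1 : Fin 2) = adj j := by
    funext k; fin_cases k <;> simp [e, adj, Fin.ext_iff] <;> omega
  apply Units.ext
  change loc i R.mat * loc j R.mat * loc i R.mat = loc j R.mat * loc i R.mat * loc j R.mat
  have := congrArg (onSites e) R.ybe
  simp only [onSites_mul e he, loc, onSites_onSites e he, h0, h1] at this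
  exact this

theorem RMatrix.unitAt_comm {N m : ℕ} (R : RMatrix N) (i j : Fin m) (h : (i : ℕ) + 1 < j) :
    R.unitAt i * R.unitAt j = R.unitAt j * R.unitAt i := by
  apply Units.ext
  refine onSites_comm _ _ ?_ _ _
  rw [Set.disjoint_left]
  rintro _ ⟨a, rfl⟩ ⟨b, hb⟩
  have := congrArg Fin.val hb
  fin_cases a <;> fin_cases b <;> simp [adj] at this <;> omega

/-- The representation `ρ_R` of the group algebra of the braid group, `σ_i ↦ R_i`. -/
def rho {N m : ℕ} (R : RMatrix N) : MonoidAlgebra ℂ (Braid m) →ₐ[ℂ] TensorMat N (m + 1) ℂ :=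
  MonoidAlgebra.lift ℂ _ _ ((Units.coeHom _).comp
    (Braid.lift R.unitAt R.unitAt_braid R.unitAt_comm))

/-- The generator `σ_i` in the group algebra. -/
def sigA {m : ℕ} (i : Fin m) : MonoidAlgebra ℂ (Braid m) := MonoidAlgebra.of ℂ _ (sig i)

/-- `Braid.shift` on group algebras. -/
def shiftA {m m' : ℕ} (s : ℕ) (h : s + m ≤ m') :
    MonoidAlgebra ℂ (Braid m) →ₐ[ℂ] MonoidAlgebra ℂ (Braid m') :=
  MonoidAlgebra.mapDomainAlgHom ℂ ℂ (Braid.shift s h)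

/-! ### Antisymmetrizers

The BMW algebra is a quotient of the group algebra of the braid group, and for an R-matrix of the
BMW type the map `rho R` factors through it. Elements of the BMW algebra are given here by their
standard representatives in the group algebra; only their images under `rho R` are used. -/

/-- `κ_i = (q - σ_i)(q⁻¹ + σ_i) / (μ (q - q⁻¹))`. -/
def kap {m : ℕ} (q μ : ℂ) (i : Fin m) : MonoidAlgebra ℂ (Braid m) :=
  (μ * (q - q⁻¹))⁻¹ • ((q • 1 - sigA i) * (q⁻¹ • 1 + sigA i))

/-- `η = (q - μ)(q⁻¹ + μ) / (μ (q - q⁻¹))`. -/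
def bmwEta (q μ : ℂ) : ℂ := (q - μ) * (q⁻¹ + μ) / (μ * (q - q⁻¹))

/-- The `q`-number `i_q`. -/
def qNum (q : ℂ) (i : ℕ) : ℂ := (q ^ i - (q ^ i)⁻¹) / (q - q⁻¹)

/-- The baxterized element
`σ⁻_i(x) = 1 + (x - 1)/(q - q⁻¹) σ_i + (x - 1)/(q μ⁻¹ x + 1) κ_i`. -/
def baxMinus {m : ℕ} (q μ : ℂ) (i : Fin m) (x : ℂ) : MonoidAlgebra ℂ (Braid m) :=
  1 + ((x - 1) / (q - q⁻¹)) • sigA i + ((x - 1) / (q * μ⁻¹ * x + 1)) • kap q μ i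

/-- `antisym q μ n` is the antisymmetrizer `a^{(n + 1)}` on `n + 1` strands:
`a^{(1)} = 1`, `a^{(i + 1)} = q^i / (i + 1)_q · a^{(i)} σ⁻_i(q^{-2i}) a^{(i)}`. -/
def antisym (q μ : ℂ) : (n : ℕ) → MonoidAlgebra ℂ (Braid n)
  | 0 => 1
  | n + 1 => (q ^ (n + 1) / qNum q (n + 2)) •
      (shiftA 0 (by omega) (antisym q μ n) *
        baxMinus q μ (Fin.last n) (q ^ (2 * (n + 1)))⁻¹ *
        shiftA 0 (by omega) (antisym q μ n))

/-- R-matrices of the type `O(k)`. The `k`-th antisymmetrizer is `antisym q μ (k - 1)`. -/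
structure IsOrthogonalType {N : ℕ} (k : ℕ) (q μ : ℂ) (R : RMatrix N) : Prop where
  two_le : 2 ≤ k
  skew : IsSkewInvertible R.mat
  bmw : IsBMW q μ R
  qNum_ne : ∀ i, 2 ≤ i → i ≤ k → qNum q i ≠ 0
  μ_ne : ∀ i, 1 ≤ i → i ≤ k → μ ≠ -q ^ (1 - 2 * (i : ℤ))
  rank_ne : ∀ i, 2 ≤ i → i ≤ k → (rho R (antisym q μ (i - 1))).rank ≠ 0
  vanish : rho R (shiftA (m' := k) 1 (by omega) (antisym q μ (k - 1)) *
    baxMinus q μ ⟨0, by omega⟩ (q ^ (2 * k))⁻¹ *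
    shiftA (m' := k) 1 (by omega) (antisym q μ (k - 1))) = 0
  μ_eq : μ = q ^ (1 - (k : ℤ))
  rank_one : (rho R (antisym q μ (k - 1))).rank = 1

/-! ### Matrix copies, characteristic elements, matrix descendants

Here `T` is a matrix with entries in an algebra `A`. -/

section Copies

variable {A : Type*} [Ring A] [Algebra ℂ A] {N : ℕ}

/-- The copies `T_(1) = T ⊗ I ⊗ ⋯ ⊗ I`, `T_(i + 1) = F_i T_(i) F_i⁻¹` in
`V^{⊗ (m + 1)}` (numbered from zero). -/
def matCopy (F : RMatrix N) (T : Matrix (Fin N) (Fin N) A) (m : ℕ) (k : Fin (m + 1)) :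
    TensorMat N (m + 1) A :=
  Fin.induction (motive := fun _ => TensorMat N (m + 1) A) (firstSite m T)
    (fun i X => locA A i F.mat * X * locA A i F.inv) k

/-- `T_(1) T_(2) ⋯ T_(m + 1) ρ_R(α)`, for `α` in the group algebra of the
braid group on `m + 1` strands. -/
def copyProd (R F : RMatrix N) (T : Matrix (Fin N) (Fin N) A) {m : ℕ}
    (α : MonoidAlgebra ℂ (Braid m)) : TensorMat N (m + 1) A :=
  (List.ofFn (matCopy F T m)).prod * (rho R α).map (algebraMap ℂ A)

/-- The operator `D_2 ⋯ D_{m + 1}` on `V^{⊗ (m + 1)}`, where `D = D_R`. -/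
def dTail (A : Type*) [Ring A] [Algebra ℂ A] (R : RMatrix N) (m : ℕ) :
    TensorMat N (m + 1) A :=
  Matrix.of fun a b => if a 0 = b 0 then
    algebraMap ℂ A (∏ k : Fin m, skewD R.mat (a k.succ) (b k.succ)) else 0

/-- The R-trace `Tr_R(T) = Tr(D_R T)`. -/
def rTrace (R : RMatrix N) (T : Matrix (Fin N) (Fin N) A) : A :=
  ((skewD R.mat).map (algebraMap ℂ A) * T).trace

/-- The descendant `T^α`: the R-trace over all tensor factors but the first one of
`T_(1) T_(2) ⋯ T_(m + 1) ρ_R(α)`. -/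
def matPow (R F : RMatrix N) (T : Matrix (Fin N) (Fin N) A) {m : ℕ}
    (α : MonoidAlgebra ℂ (Braid m)) : Matrix (Fin N) (Fin N) A :=
  traceTail (dTail A R m * copyProd R F T α)

/-- `ch(α)`: the R-trace over all tensor factors of
`T_(1) T_(2) ⋯ T_(m + 1) ρ_R(α)`. -/
def chr (R F : RMatrix N) (T : Matrix (Fin N) (Fin N) A) {m : ℕ}
    (α : MonoidAlgebra ℂ (Braid m)) : A :=
  rTrace R (matPow R F T α)

/-- `a_0 = 1`, `a_i = ch(a^{(i)})`. -/
def aElt (R F : RMatrix N) (q μ : ℂ) (T : Matrix (Fin N) (Fin N) A) : ℕ → A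
  | 0 => 1
  | n + 1 => chr R F T (antisym q μ n)

/-- The 2-contraction `g = η⁻¹ ch(κ_1)`. -/
def gElt (R F : RMatrix N) (q μ : ℂ) (T : Matrix (Fin N) (Fin N) A) : A :=
  chr R F T ((bmwEta q μ)⁻¹ • kap q μ (0 : Fin 1))

end Copies

/-! ### Quantum matrix algebras -/

/-- `G_1 = Tr_{(23)} K_2 F_1⁻¹ F_2⁻¹`. -/
def matG {N : ℕ} (R F : RMatrix N) (q μ : ℂ) : Matrix (Fin N) (Fin N) ℂ :=
  traceTail (loc (1 : Fin 2) (opK q μ R) * loc (0 : Fin 2) F.inv * loc (1 : Fin 2) F.inv)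

/-- The free algebra on the entries of the matrix of generators (`some (i, j)`) and on one more
generator (`none`), which becomes `g⁻¹`. -/
abbrev FreeQM (N : ℕ) : Type := FreeAlgebra ℂ (Option (Fin N × Fin N))

/-- The matrix of generators of the free algebra. -/
def freeM (N : ℕ) : Matrix (Fin N) (Fin N) (FreeQM N) :=
  Matrix.of fun i j => FreeAlgebra.ι ℂ (some (i, j))

/-- The additional generator of the free algebra. -/
def freeGInv (N : ℕ) : FreeQM N := FreeAlgebra.ι ℂ none

/-- The relations of the extended quantum matrix algebra: `R_1 M_(1) M_(2) =
M_(1) M_(2) R_1`, `g⁻¹ g = g g⁻¹ = 1`, `g⁻¹ M = (G⁻¹ M G) g⁻¹`. -/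
inductive ExtRel {N : ℕ} (R F : RMatrix N) (q μ : ℂ) : FreeQM N → FreeQM N → Prop
  | rmm (a b : Fin 2 → Fin N) : ExtRel R F q μ
      ((locA (FreeQM N) (0 : Fin 1) R.mat * matCopy F (freeM N) 1 0 *
        matCopy F (freeM N) 1 1) a b)
      ((matCopy F (freeM N) 1 0 * matCopy F (freeM N) 1 1 *
        locA (FreeQM N) (0 : Fin 1) R.mat) a b)
  | inv_mul : ExtRel R F q μ (freeGInv N * gElt R F q μ (freeM N)) 1
  | mul_inv : ExtRel R F q μ (gElt R F q μ (freeM N) * freeGInv N) 1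
  | twist (i j : Fin N) : ExtRel R F q μ (freeGInv N * freeM N i j)
      (((matG R F q μ)⁻¹.map (algebraMap ℂ (FreeQM N)) * freeM N *
        (matG R F q μ).map (algebraMap ℂ (FreeQM N))) i j * freeGInv N)

/-- The extended quantum matrix algebra. -/
def ExtQM {N : ℕ} (R F : RMatrix N) (q μ : ℂ) : Type := RingQuot (ExtRel R F q μ)

instance {N : ℕ} (R F : RMatrix N) (q μ : ℂ) : Ring (ExtQM R F q μ) :=
  inferInstanceAs (Ring (RingQuot (ExtRel R F q μ)))

instance {N : ℕ} (R F : RMatrix N) (q μ : ℂ) : Algebra ℂ (ExtQM R F q μ) :=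
  inferInstanceAs (Algebra ℂ (RingQuot (ExtRel R F q μ)))

/-- The projection from the free algebra to the extended quantum matrix algebra. -/
def extProj {N : ℕ} (R F : RMatrix N) (q μ : ℂ) : FreeQM N →ₐ[ℂ] ExtQM R F q μ :=
  RingQuot.mkAlgHom ℂ (ExtRel R F q μ)

/-- The matrix of generators of the extended quantum matrix algebra. -/
def extM {N : ℕ} (R F : RMatrix N) (q μ : ℂ) : Matrix (Fin N) (Fin N) (ExtQM R F q μ) :=
  (freeM N).map (extProj R F q μ)

/-- The relation `a_{2ℓ} = s g^ℓ`. -/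
inductive ComponentRel {N : ℕ} (R F : RMatrix N) (q μ : ℂ) (ℓ : ℕ) (s : ℂ) :
    ExtQM R F q μ → ExtQM R F q μ → Prop
  | rel : ComponentRel R F q μ ℓ s (aElt R F q μ (extM R F q μ) (2 * ℓ))
      (s • gElt R F q μ (extM R F q μ) ^ ℓ)

/-- The component `O⁺(2ℓ)` (for `s = 1`) or `O⁻(2ℓ)` (for `s = -1`) of the extended quantum matrix
algebra: its quotient by the relation `a_{2ℓ} = s g^ℓ`. -/
def ComponentQM {N : ℕ} (R F : RMatrix N) (q μ : ℂ) (ℓ : ℕ) (s : ℂ) : Type :=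
  RingQuot (ComponentRel R F q μ ℓ s)

instance {N : ℕ} (R F : RMatrix N) (q μ : ℂ) (ℓ : ℕ) (s : ℂ) :
    Ring (ComponentQM R F q μ ℓ s) :=
  inferInstanceAs (Ring (RingQuot (ComponentRel R F q μ ℓ s)))

instance {N : ℕ} (R F : RMatrix N) (q μ : ℂ) (ℓ : ℕ) (s : ℂ) :
    Algebra ℂ (ComponentQM R F q μ ℓ s) :=
  inferInstanceAs (Algebra ℂ (RingQuot (ComponentRel R F q μ ℓ s)))

/-- The projection from the extended quantum matrix algebra to its component. -/
def componentProj {N : ℕ} (R F : RMatrix N) (q μ : ℂ) (ℓ : ℕ) (s : ℂ) :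
    ExtQM R F q μ →ₐ[ℂ] ComponentQM R F q μ ℓ s :=
  RingQuot.mkAlgHom ℂ (ComponentRel R F q μ ℓ s)

/-- The matrix `M` of generators in the component. -/
def componentM {N : ℕ} (R F : RMatrix N) (q μ : ℂ) (ℓ : ℕ) (s : ℂ) :
    Matrix (Fin N) (Fin N) (ComponentQM R F q μ ℓ s) :=
  (extM R F q μ).map (componentProj R F q μ ℓ s)

/-- The element `g⁻¹` of the component. -/
def componentGInv {N : ℕ} (R F : RMatrix N) (q μ : ℂ) (ℓ : ℕ) (s : ℂ) : ComponentQM R F q μ ℓ s :=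
  componentProj R F q μ ℓ s (extProj R F q μ (freeGInv N))

/-! ### The characteristic subalgebra, the space of descendants, the star product -/

section Star

set_option linter.unusedSectionVars false

variable {A : Type*} [Ring A] [Algebra ℂ A] {N : ℕ}

/-- The extended characteristic subalgebra: generated by all `ch(α)` and by `gi = g⁻¹`. -/
def charAlg (R F : RMatrix N) (T : Matrix (Fin N) (Fin N) A) (gi : A) : Subalgebra ℂ A :=
  Algebra.adjoin ℂ ({x | ∃ (m : ℕ) (α : MonoidAlgebra ℂ (Braid m)), x = chr R F T α} ∪ {gi})

/-- Entrywise right multiplication of a matrix by an element of `A`. -/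
def rightMul (X : Matrix (Fin N) (Fin N) A) (c : A) : Matrix (Fin N) (Fin N) A :=
  X.map fun x => x * c

/-- The space `P`: spanned by the matrices `I c` and `T^α c`, where `α` runs over the group
algebras of the braid groups and `c` over the characteristic subalgebra. -/
def descSpace (R F : RMatrix N) (T : Matrix (Fin N) (Fin N) A) (gi : A) :
    Submodule ℂ (Matrix (Fin N) (Fin N) A) :=
  Submodule.span ℂ
    ({X | ∃ c ∈ charAlg R F T gi, X = rightMul 1 c} ∪
     {X | ∃ (m : ℕ) (α : MonoidAlgebra ℂ (Braid m)), ∃ c ∈ charAlg R F T gi,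
        X = rightMul (matPow R F T α) c})

theorem chr_mem (R F : RMatrix N) (T : Matrix (Fin N) (Fin N) A) (gi : A) {m : ℕ}
    (α : MonoidAlgebra ℂ (Braid m)) : chr R F T α ∈ charAlg R F T gi :=
  Algebra.subset_adjoin (Or.inl ⟨m, α, rfl⟩)

theorem rightMul_one (X : Matrix (Fin N) (Fin N) A) : rightMul X 1 = X := by
  ext i j; simp [rightMul]

theorem rightMul_rightMul (X : Matrix (Fin N) (Fin N) A) (c d : A) :
    rightMul (rightMul X c) d = rightMul X (c * d) := by
  ext i j; simp [rightMul, mul_assoc]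

/-- `X ↦ X c` as a linear map. -/
def rightMulLin (c : A) : Matrix (Fin N) (Fin N) A →ₗ[ℂ] Matrix (Fin N) (Fin N) A where
  toFun X := rightMul X c
  map_add' X Y := by ext i j; simp [rightMul, add_mul]
  map_smul' z X := by ext i j; simp [rightMul]

theorem rightMul_mem (R F : RMatrix N) (T : Matrix (Fin N) (Fin N) A) (gi : A)
    {X : Matrix (Fin N) (Fin N) A} (hX : X ∈ descSpace R F T gi) {c : A}
    (hc : c ∈ charAlg R F T gi) : rightMul X c ∈ descSpace R F T gi := by
  have : descSpace R F T gi ≤ (descSpace R F T gi).comap (rightMulLin c) := by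
    refine Submodule.span_le.2 ?_
    rintro _ (⟨d, hd, rfl⟩ | ⟨m, α, d, hd, rfl⟩)
    · change rightMul (rightMul 1 d) c ∈ descSpace R F T gi
      rw [rightMul_rightMul]
      exact Submodule.subset_span (Or.inl ⟨_, mul_mem hd hc, rfl⟩)
    · change rightMul (rightMul (matPow R F T α) d) c ∈ descSpace R F T gi
      rw [rightMul_rightMul]
      exact Submodule.subset_span (Or.inr ⟨m, α, _, mul_mem hd hc, rfl⟩)
  exact this hX

theorem one_mem_descSpace (R F : RMatrix N) (T : Matrix (Fin N) (Fin N) A) (gi : A) :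
    (1 : Matrix (Fin N) (Fin N) A) ∈ descSpace R F T gi :=
  Submodule.subset_span (Or.inl ⟨1, one_mem _, (rightMul_one _).symm⟩)

theorem matPow_mem (R F : RMatrix N) (T : Matrix (Fin N) (Fin N) A) (gi : A) {m : ℕ}
    (α : MonoidAlgebra ℂ (Braid m)) : matPow R F T α ∈ descSpace R F T gi :=
  Submodule.subset_span (Or.inr ⟨m, α, 1, one_mem _, (rightMul_one _).symm⟩)

/-- The descendant on one strand is the matrix itself. -/
theorem matPow_zero_one (R F : RMatrix N) (T : Matrix (Fin N) (Fin N) A) :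
    matPow R F T (1 : MonoidAlgebra ℂ (Braid 0)) = T := by
  classical
  have hd : dTail A R 0 = 1 := by
    ext a b
    have hab : a 0 = b 0 ↔ a = b :=
      ⟨fun h => funext fun k => by
        have hk : k = 0 := Fin.fin_one_eq_zero k
        rw [hk]; exact h, fun h => h ▸ rfl⟩
    simp only [dTail, Matrix.of_apply, Matrix.one_apply, hab]
    simp
  have hc : copyProd R F T (1 : MonoidAlgebra ℂ (Braid 0)) = firstSite 0 T := by
    simp only [copyProd, map_one, List.ofFn_succ, List.ofFn_zero, List.prod_cons, List.prod_nil,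
      mul_one]
    rw [Matrix.map_one _ (map_zero _) (map_one _), mul_one]
    rfl
  ext i j
  simp only [matPow, hd, hc, one_mul, traceTail, Matrix.of_apply, Finset.univ_unique,
    Finset.sum_singleton, firstSite, onSites]
  rw [if_pos]
  · simp
  · intro k hk
    exact absurd ⟨0, (Fin.fin_one_eq_zero k).symm⟩ hk

theorem self_mem_descSpace (R F : RMatrix N) (T : Matrix (Fin N) (Fin N) A) (gi : A) :
    T ∈ descSpace R F T gi := by
  have := matPow_mem R F T gi (1 : MonoidAlgebra ℂ (Braid 0))
  rwa [matPow_zero_one] at this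

/-- `σ_n ⋯ σ_2 σ_1 σ_2⁻¹ ⋯ σ_n⁻¹` (`n = j + 1`; the generators are numbered from zero). -/
def sigConj {m : ℕ} : (j : ℕ) → j < m → Braid m
  | 0, h => sig ⟨0, h⟩
  | j + 1, h => sig ⟨j + 1, h⟩ * sigConj j (by omega) * (sig ⟨j + 1, h⟩)⁻¹

/-- The product of exponents: for `α` on `n = m + 1` strands and `β` on `i = p + 1` strands,
`α ⋆ β = α β^{↑ n} (σ_n ⋯ σ_2 σ_1 σ_2⁻¹ ⋯ σ_n⁻¹)` on `n + i` strands. -/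
def starExp {m p : ℕ} (α : MonoidAlgebra ℂ (Braid m)) (β : MonoidAlgebra ℂ (Braid p)) :
    MonoidAlgebra ℂ (Braid (m + p + 1)) :=
  shiftA 0 (by omega) α * shiftA (m + 1) (by omega) β *
    MonoidAlgebra.of ℂ _ (sigConj m (by omega))

/-- The element `I` of `P`. -/
def descOne (R F : RMatrix N) (T : Matrix (Fin N) (Fin N) A) (gi : A) : descSpace R F T gi :=
  ⟨1, one_mem_descSpace R F T gi⟩

/-- The element `T` of `P`. -/
def descSelf (R F : RMatrix N) (T : Matrix (Fin N) (Fin N) A) (gi : A) : descSpace R F T gi :=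
  ⟨T, self_mem_descSpace R F T gi⟩

/-- The element `T^α` of `P`. -/
def descPow (R F : RMatrix N) (T : Matrix (Fin N) (Fin N) A) (gi : A) {m : ℕ}
    (α : MonoidAlgebra ℂ (Braid m)) : descSpace R F T gi :=
  ⟨matPow R F T α, matPow_mem R F T gi α⟩

/-- The right action of the characteristic subalgebra on `P`. -/
def descMul {R F : RMatrix N} {T : Matrix (Fin N) (Fin N) A} {gi : A}
    (X : descSpace R F T gi) (c : charAlg R F T gi) : descSpace R F T gi :=
  ⟨rightMul X.1 c.1, rightMul_mem R F T gi X.2 c.2⟩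

/-- The star product on `P`: the bilinear product with
`T^α ⋆ T^β = T^{α ⋆ β}`, with unit `I`, and bilinear over the characteristic subalgebra, so that
`(I c) ⋆ X = X ⋆ (I c) = X c`. It is determined by these properties. -/
structure IsStarProduct {R F : RMatrix N} {T : Matrix (Fin N) (Fin N) A} {gi : A}
    (star : descSpace R F T gi →ₗ[ℂ] descSpace R F T gi →ₗ[ℂ] descSpace R F T gi) : Prop where
  pow_pow : ∀ (m p : ℕ) (α : MonoidAlgebra ℂ (Braid m)) (β : MonoidAlgebra ℂ (Braid p)),
    star (descPow R F T gi α) (descPow R F T gi β) = descPow R F T gi (starExp α β)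
  one_left : ∀ X, star (descOne R F T gi) X = X
  one_right : ∀ X, star X (descOne R F T gi) = X
  mul_left : ∀ X Y c, star (descMul X c) Y = descMul (star X Y) c
  mul_right : ∀ X Y c, star X (descMul Y c) = descMul (star X Y) c

/-- The powers `T^(n) = T ⋆ ⋯ ⋆ T` (`n` factors). -/
def starPow {R F : RMatrix N} {T : Matrix (Fin N) (Fin N) A} {gi : A}
    (star : descSpace R F T gi →ₗ[ℂ] descSpace R F T gi →ₗ[ℂ] descSpace R F T gi) :
    ℕ → descSpace R F T gi
  | 0 => descOne R F T gi
  | n + 1 => star (descSelf R F T gi) (starPow star n)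

/-- The element `a_i` of the characteristic subalgebra. -/
def aChar (R F : RMatrix N) (q μ : ℂ) (T : Matrix (Fin N) (Fin N) A) (gi : A) (i : ℕ) :
    charAlg R F T gi :=
  ⟨aElt R F q μ T i, by
    cases i with
    | zero => exact one_mem _
    | succ n => exact chr_mem R F T gi _⟩

/-- The element `g` of the characteristic subalgebra. -/
def gChar (R F : RMatrix N) (q μ : ℂ) (T : Matrix (Fin N) (Fin N) A) (gi : A) :
    charAlg R F T gi :=
  ⟨gElt R F q μ T, chr_mem R F T gi _⟩

/-- `ε_i = ∑_{j ≤ i/2} a_{i - 2j} g^j` for `i ≤ ℓ - 1`, and `ε_{ℓ - 1 + i} = ε_{ℓ - 1 - i} g^i`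
for `0 ≤ i ≤ ℓ - 1`. -/
def epsChar (R F : RMatrix N) (q μ : ℂ) (T : Matrix (Fin N) (Fin N) A) (gi : A) (ℓ i : ℕ) :
    charAlg R F T gi :=
  if i + 1 ≤ ℓ then
    ∑ j ∈ Finset.range (i / 2 + 1), aChar R F q μ T gi (i - 2 * j) * gChar R F q μ T gi ^ j
  else
    (∑ j ∈ Finset.range ((2 * ℓ - 2 - i) / 2 + 1),
      aChar R F q μ T gi (2 * ℓ - 2 - i - 2 * j) * gChar R F q μ T gi ^ j) *
      gChar R F q μ T gi ^ (i + 1 - ℓ)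

end Star

/-- The space `P^±` of the component `O^±(2ℓ)` (`s = ±1`). -/
abbrev ComponentP {N : ℕ} (R F : RMatrix N) (q μ : ℂ) (ℓ : ℕ) (s : ℂ) :
    Submodule ℂ (Matrix (Fin N) (Fin N) (ComponentQM R F q μ ℓ s)) :=
  descSpace R F (componentM R F q μ ℓ s) (componentGInv R F q μ ℓ s)

/-- Bilinear products on `P^±`. -/
abbrev ComponentStar {N : ℕ} (R F : RMatrix N) (q μ : ℂ) (ℓ : ℕ) (s : ℂ) : Type :=
  ComponentP R F q μ ℓ s →ₗ[ℂ] ComponentP R F q μ ℓ s →ₗ[ℂ] ComponentP R F q μ ℓ s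

/-- The identity matrix in `P^±`. -/
abbrev componentOne {N : ℕ} (R F : RMatrix N) (q μ : ℂ) (ℓ : ℕ) (s : ℂ) :
    ComponentP R F q μ ℓ s :=
  descOne R F (componentM R F q μ ℓ s) (componentGInv R F q μ ℓ s)

/-- The extended characteristic subalgebra `C^±` of the component `O^±(2ℓ)`. -/
abbrev ComponentC {N : ℕ} (R F : RMatrix N) (q μ : ℂ) (ℓ : ℕ) (s : ℂ) :
    Subalgebra ℂ (ComponentQM R F q μ ℓ s) :=
  charAlg R F (componentM R F q μ ℓ s) (componentGInv R F q μ ℓ s)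

/-- The element `a_i` of `C^±`. -/
abbrev componentA {N : ℕ} (R F : RMatrix N) (q μ : ℂ) (ℓ : ℕ) (s : ℂ) (i : ℕ) :
    ComponentC R F q μ ℓ s :=
  aChar R F q μ (componentM R F q μ ℓ s) (componentGInv R F q μ ℓ s) i

/-- The element `g` of `C^±`. -/
abbrev componentG {N : ℕ} (R F : RMatrix N) (q μ : ℂ) (ℓ : ℕ) (s : ℂ) :
    ComponentC R F q μ ℓ s :=
  gChar R F q μ (componentM R F q μ ℓ s) (componentGInv R F q μ ℓ s)

/-- The element `ε_i` of `C^±`. -/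
abbrev componentEps {N : ℕ} (R F : RMatrix N) (q μ : ℂ) (ℓ : ℕ) (s : ℂ) (i : ℕ) :
    ComponentC R F q μ ℓ s :=
  epsChar R F q μ (componentM R F q μ ℓ s) (componentGInv R F q μ ℓ s) ℓ i

end

/-! The whole problem is moved into one algebra H of operators on V ⊗ V ⊗ ⋯ with entries in the
algebra A of the component. There R_n and F_n are units, the R-trace over one factor is a linear map
E_n, and the matrices M^α and the elements ch(α) become `pw` and `ch`. The relations between these
objects are collected in `QMTower`. The ones that need an argument are the invariance of E under
conjugation by R and F (`IsCompatible.ptrace_conj`), the cyclicity of the double trace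
(`actU_cyclic`), and the values of the R-trace on 1 and on K (`IsBMW.trace_skewD`,
`IsBMW.ptrace_contr`).

Star product. Let C be the characteristic subalgebra and P the space of descendants. Exchanging two
blocks of strands shows that the elements ch(α) commute, so C is commutative (`ch_comm`,
`charAlg_comm`). Left and right multiplication by a descendant are each induced by a linear operator
on H (`starL_pw`, `starR_pw`). Hence neither depends on how an element of P is written, and the
product exists; it is unique because its rules fix it on a spanning set. Since M^α with α = σ_2⁻¹κ_1
satisfies M ⋆ M^α = M^α ⋆ M = μ⁻¹g², the map Θ = M ⋆ (·) is an invertible C-linear operator on P.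

Recurrences. Put k = 2ℓ, x_n = n_q M^{a^(n)} and y_n = n_q M^{a^(n)↑1 κ_1}. The antisymmetrizers can
equally be built by adding strands on the left (`asymL_eq_asym`). Expanding the baxterized factor
then gives x_{n+1} = q^n a_n ΘI − Θx_n − c_n y_n, Θy_{n+1} = g (μ⁻¹q^{−n} a_n ΘI + d_n Θx_n − y_n),
with x_0 = y_0 = 0 and, by the definition of the O(k) type, x_{k+1} = y_{k+1} = 0. The R-traces of
x_n and y_n are known multiples of a_n and a_{n−1}g. All this takes place in the cyclic module
generated by I over C[Θ, Θ⁻¹], so it may be computed in a commutative ring with an invertible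
element t in place of Θ (`exists_cyclic_model`, `DescentSystem`).

Algebra. For μ = q^{1−k} the reflection n ↦ k − n exchanges the recurrences run forward from 0 with
those run backward from k + 1. Together with the R-trace this gives a_n a_k = g^n a_{k−n}
(`reciprocity`). A first integral of the recurrences gives (t² − g)χ = 0 for χ = ∑ (−q)^i t^{k−i}
a_i, and the value of x_k gives a second linear relation for χ (`exists_char_sequences`). If a_{2ℓ}
= g^ℓ, the reversed polynomial is a multiple of χ and the second relation becomes a nonzero constant
times χ, so χ = 0 (`plus_identity`). If a_{2ℓ} = −g^ℓ, reciprocity gives a_j = ε_j − gε_{j−2}, so χ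
= (t² − q²g)E with E = ∑ (−q)^i t^{2ℓ−2−i} ε_i, and the two relations together leave (t² − g)E = 0
(`minus_identity`). The assumption q^{2ℓ+2} ≠ −1 keeps the denominators 1 + μq^{2n−1} nonzero up to
n = k + 1. -/

noncomputable section

/-! ### Pairs of neighbouring BMW generators -/

section BMWAlgebra

variable {B : Type*} [Ring B] [Algebra ℂ B]

/-- The contractor `(q - x)(q⁻¹ + x) / (μ (q - q⁻¹))` attached to a braid generator `x`. -/
def contr (q μ : ℂ) (x : B) : B := (μ * (q - q⁻¹))⁻¹ • ((q • 1 - x) * (q⁻¹ • 1 + x))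

/-- The baxterized element `1 + (z - 1)/(q - q⁻¹) x + (z - 1)/(q μ⁻¹ z + 1) κ`. -/
def bax (q μ : ℂ) (x : B) (z : ℂ) : B :=
  1 + ((z - 1) / (q - q⁻¹)) • x + ((z - 1) / (q * μ⁻¹ * z + 1)) • contr q μ x

theorem contr_aux {q : ℂ} (q0 : q ≠ 0) (x : B) :
    (q • 1 - x) * (q⁻¹ • 1 + x) = 1 + (q - q⁻¹) • x - x * x := by
  simp only [sub_mul, mul_add, smul_mul_assoc, one_mul, mul_smul_comm, mul_one]
  match_scalars <;> field_simp
  ring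

theorem contr_comm (q μ : ℂ) (x : B) : x * contr q μ x = contr q μ x * x := by
  simp only [contr, mul_smul_comm, smul_mul_assoc]
  congr 1
  have h1 : Commute x (q • 1 - x) :=
    ((Commute.one_right x).smul_right _).sub_right (Commute.refl x)
  have h2 : Commute x (q⁻¹ • 1 + x) :=
    ((Commute.one_right x).smul_right _).add_right (Commute.refl x)
  exact (h1.mul_right h2).eq

theorem Commute.contr_right {y x : B} (h : Commute y x) (q μ : ℂ) : Commute y (contr q μ x) := by
  unfold contr
  refine Commute.smul_right ?_ _
  exact Commute.mul_right (((Commute.one_right y).smul_right _).sub_right h)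
    (((Commute.one_right y).smul_right _).add_right h)

theorem Commute.bax_right {y x : B} (h : Commute y x) (q μ z : ℂ) : Commute y (bax q μ x z) :=
  ((Commute.one_right y).add_right (h.smul_right _)).add_right ((h.contr_right q μ).smul_right _)

theorem contr_intertwine {q μ : ℂ} {u x y : B} (h : u * x = y * u) :
    u * contr q μ x = contr q μ y * u := by
  simp only [contr, mul_smul_comm, smul_mul_assoc]
  congr 1
  have h1 : u * (q • 1 - x) = (q • 1 - y) * u := by
    rw [mul_sub, sub_mul, h]; simp
  have h2 : u * (q⁻¹ • 1 + x) = (q⁻¹ • 1 + y) * u := by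
    rw [mul_add, add_mul, h]; simp
  rw [← mul_assoc, h1, mul_assoc, h2, mul_assoc]

theorem contr_map {B' : Type*} [Ring B'] [Algebra ℂ B'] (φ : B →ₐ[ℂ] B') (q μ : ℂ) (x : B) :
    φ (contr q μ x) = contr q μ (φ x) := by
  simp [contr]

theorem bax_map {B' : Type*} [Ring B'] [Algebra ℂ B'] (φ : B →ₐ[ℂ] B') (q μ : ℂ) (x : B) (z : ℂ) :
    φ (bax q μ x z) = bax q μ (φ x) z := by
  simp [bax, contr_map]

/-- The two factors of the contractor commute, so the order of multiplication does not matter. This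
is what allows right-handed statements to be read off from left-handed ones in the opposite algebra.
-/
theorem contr_op (q μ : ℂ) (x : B) :
    contr q μ (MulOpposite.op x) = MulOpposite.op (contr q μ x) := by
  apply MulOpposite.unop_injective
  simp only [contr, MulOpposite.unop_smul, MulOpposite.unop_mul, MulOpposite.unop_sub,
    MulOpposite.unop_add, MulOpposite.unop_op, MulOpposite.unop_one]
  congr 1
  simp only [sub_mul, mul_add, mul_sub, smul_mul_assoc, one_mul, mul_smul_comm, mul_one, smul_add,
    smul_sub, add_mul]
  match_scalars <;> ring

theorem bax_op (q μ : ℂ) (x : B) (z : ℂ) :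
    bax q μ (MulOpposite.op x) z = MulOpposite.op (bax q μ x z) := by
  apply MulOpposite.unop_injective
  simp [bax, contr_op]

/-- The parameters of the BMW algebra are generic enough for the definitions to make sense. -/
structure GoodParams (q μ : ℂ) : Prop where
  q0 : q ≠ 0
  q2 : q - q⁻¹ ≠ 0
  m0 : μ ≠ 0

theorem contr_sq_expand {q μ : ℂ} (hp : GoodParams q μ) (x : B) :
    x * x = 1 + (q - q⁻¹) • x - (μ * (q - q⁻¹)) • contr q μ x := by
  have h := hp.q2
  have h1 := hp.m0
  have h0 := hp.q0
  simp only [contr, smul_smul]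
  rw [mul_inv_cancel₀ (mul_ne_zero h1 h), contr_aux h0]
  module

/-- Once κx = μκ is known, the definition of κ solved for x² becomes the skein relation x − x⁻¹ = (q
− q⁻¹)(1 − κ). -/
theorem inv_eq_of_contr {q μ : ℂ} (hp : GoodParams q μ) {x : Bˣ}
    (hx : contr q μ (x : B) * x = μ • contr q μ (x : B)) :
    ((x⁻¹ : Bˣ) : B) = x - (q - q⁻¹) • (1 - contr q μ (x : B)) := by
  have h : (x : B) * (x - (q - q⁻¹) • (1 - contr q μ (x : B))) = 1 := by
    rw [mul_sub, mul_smul_comm, mul_sub, contr_comm, hx, mul_one, contr_sq_expand hp]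
    module
  calc ((x⁻¹ : Bˣ) : B) = (x⁻¹ : Bˣ) * ((x : B) * (x - (q - q⁻¹) • (1 - contr q μ (x : B)))) := by
        rw [h, mul_one]
    _ = _ := by rw [← mul_assoc, Units.inv_mul, one_mul]

theorem contr_mul_inv {q μ : ℂ} (hp : GoodParams q μ) {x : Bˣ}
    (hx : contr q μ (x : B) * x = μ • contr q μ (x : B)) :
    contr q μ (x : B) * (x⁻¹ : Bˣ) = μ⁻¹ • contr q μ (x : B) := by
  have : μ • (contr q μ (x : B) * (x⁻¹ : Bˣ)) = contr q μ (x : B) := by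
    rw [← smul_mul_assoc, ← hx, mul_assoc, Units.mul_inv, mul_one]
  rw [← this, smul_smul, inv_mul_cancel₀ hp.m0, one_smul, this]

/-- To the right of κ the generator acts as μ, so the second contractor may be evaluated at x = μ,
where its value is η. -/
theorem contr_sq {q μ : ℂ} {x : B}
    (hx : contr q μ x * x = μ • contr q μ x) :
    contr q μ x * contr q μ x = bmwEta q μ • contr q μ x := by
  conv_lhs => enter [2]; unfold contr
  rw [mul_smul_comm, ← mul_assoc, mul_sub (contr q μ x), mul_smul_comm, mul_one, hx, ← sub_smul,
    smul_mul_assoc, mul_add (contr q μ x), mul_smul_comm, mul_one, hx, ← add_smul, smul_smul,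
    smul_smul]
  congr 1
  unfold bmwEta
  ring

/-- Neighbouring generators of a BMW algebra. -/
structure BMWPair (q μ : ℂ) (x y : Bˣ) : Prop where
  braid : (x * y * x : B) = y * x * y
  cubic : contr q μ (x : B) * x = μ • contr q μ (x : B)
  kk : contr q μ (y : B) * contr q μ (x : B) = x * y * contr q μ (x : B)
  kk_inv : contr q μ (y : B) * contr q μ (x : B) =
    (x⁻¹ : Bˣ) * (y⁻¹ : Bˣ) * contr q μ (x : B)
  kkk : contr q μ (x : B) * contr q μ (y : B) * contr q μ (x : B) = contr q μ (x : B)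

namespace BMWPair

variable {q μ : ℂ} {x y : Bˣ}

theorem braid_units (h : BMWPair q μ x y) : x * y * x = y * x * y := Units.ext h.braid

/-- The braid relation says that xy conjugates x into y, and the contractors are polynomials in x
and y. -/
theorem slide (h : BMWPair q μ x y) :
    (x * y : B) * contr q μ (x : B) = contr q μ (y : B) * (x * y) :=
  contr_intertwine (by rw [h.braid, mul_assoc])

theorem slide' (h : BMWPair q μ x y) :
    (y * x : B) * contr q μ (y : B) = contr q μ (x : B) * (y * x) :=
  contr_intertwine (by rw [← h.braid, mul_assoc])

/-- Conjugation by the half twist D = xyx interchanges x and y, hence also their inverses and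
contractors. Each required relation, multiplied by D on the right, becomes the given relation
multiplied by D on the left. -/
theorem symm (h : BMWPair q μ x y) : BMWPair q μ y x := by
  let D : Bˣ := x * y * x
  have hDx : (D : B) * x = y * D := by
    simp only [D, Units.val_mul]; rw [h.braid]; simp only [mul_assoc]; rw [← mul_assoc (y : B) x y,
      ← h.braid]; simp only [mul_assoc]
  have hDy : (D : B) * y = x * D := by
    simp only [D, Units.val_mul]; rw [mul_assoc, mul_assoc, ← mul_assoc (y : B) x y, ← h.braid]
  have uDx : D * x = y * D := Units.ext hDx
  have uDy : D * y = x * D := Units.ext hDy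
  have hix : (D : B) * (x⁻¹ : Bˣ) = (y⁻¹ : Bˣ) * D := by
    rw [← Units.val_mul, ← Units.val_mul]; congr 1
    rw [mul_inv_eq_iff_eq_mul, mul_assoc, uDx, inv_mul_cancel_left]
  have hiy : (D : B) * (y⁻¹ : Bˣ) = (x⁻¹ : Bˣ) * D := by
    rw [← Units.val_mul, ← Units.val_mul]; congr 1
    rw [mul_inv_eq_iff_eq_mul, mul_assoc, uDy, inv_mul_cancel_left]
  have hkx := contr_intertwine (q := q) (μ := μ) hDx
  have hky := contr_intertwine (q := q) (μ := μ) hDy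
  have cancel : ∀ a b : B, a * D = b * D → a = b := fun a b hab =>
    (Units.mul_left_inj D).1 hab
  have hDx' : ∀ z : B, (D : B) * (x * z) = y * (D * z) := fun z => by
    rw [← mul_assoc, hDx, mul_assoc]
  have hDy' : ∀ z : B, (D : B) * (y * z) = x * (D * z) := fun z => by
    rw [← mul_assoc, hDy, mul_assoc]
  have hix' : ∀ z : B, (D : B) * ((x⁻¹ : Bˣ) * z) = (y⁻¹ : Bˣ) * (D * z) := fun z => by
    rw [← mul_assoc, hix, mul_assoc]
  have hiy' : ∀ z : B, (D : B) * ((y⁻¹ : Bˣ) * z) = (x⁻¹ : Bˣ) * (D * z) := fun z => by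
    rw [← mul_assoc, hiy, mul_assoc]
  refine ⟨h.braid.symm, ?_, ?_, ?_, ?_⟩ <;> apply cancel
  · rw [mul_assoc, ← hDx, ← mul_assoc, ← hkx, mul_assoc, h.cubic, mul_smul_comm, smul_mul_assoc,
      hkx]
  · rw [mul_assoc, ← hkx, ← mul_assoc, ← hky, mul_assoc, h.kk]
    simp only [mul_assoc, hDx', hDy', hkx]
  · rw [mul_assoc, ← hkx, ← mul_assoc, ← hky, mul_assoc, h.kk_inv]
    simp only [mul_assoc, hix', hiy', hkx]
  · rw [mul_assoc, ← hkx, ← mul_assoc, mul_assoc (contr q μ (y : B)), ← hky, ← mul_assoc, ← hkx]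
    rw [mul_assoc, mul_assoc, ← mul_assoc (contr q μ (x : B)), h.kkk]

theorem kk_right (h : BMWPair q μ x y) :
    contr q μ (x : B) * contr q μ (y : B) = contr q μ (x : B) * (y * x) := by
  rw [h.symm.kk, h.slide']

theorem kk_right_inv (h : BMWPair q μ x y) :
    contr q μ (x : B) * contr q μ (y : B) =
      contr q μ (x : B) * ((y⁻¹ : Bˣ) * (x⁻¹ : Bˣ)) := by
  rw [h.symm.kk_inv]
  refine contr_intertwine ?_
  have : y⁻¹ * x⁻¹ * y = x * (y⁻¹ * x⁻¹) := by
    rw [← mul_inv_rev, inv_mul_eq_iff_eq_mul, ← mul_assoc, eq_mul_inv_iff_mul_eq, ← mul_assoc,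
      h.braid_units]
  simpa using congrArg Units.val this

/-- The relations read from right to left also hold (`kk_right`, `kk_right_inv`), so results about
left multiplication transfer to right multiplication. -/
theorem op (h : BMWPair q μ x y) :
    BMWPair q μ (Units.opEquiv.symm (MulOpposite.op x)) (Units.opEquiv.symm (MulOpposite.op y)) := by
  refine ⟨?_, ?_, ?_, ?_, ?_⟩
  · simp only [Units.coe_opEquiv_symm, MulOpposite.unop_op, ← MulOpposite.op_mul]
    rw [← mul_assoc, h.braid, mul_assoc]
  · simp only [Units.coe_opEquiv_symm, MulOpposite.unop_op, ← MulOpposite.op_mul, contr_op,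
      ← MulOpposite.op_smul]
    rw [contr_comm, h.cubic]
  · simp only [Units.coe_opEquiv_symm, MulOpposite.unop_op, ← MulOpposite.op_mul, contr_op]
    rw [h.kk_right]
  · have e : ∀ z : Bˣ, (((Units.opEquiv.symm (MulOpposite.op z))⁻¹ : (Bᵐᵒᵖ)ˣ) : Bᵐᵒᵖ) =
        MulOpposite.op ((z⁻¹ : Bˣ) : B) := fun z => rfl
    simp only [e, Units.coe_opEquiv_symm, MulOpposite.unop_op, ← MulOpposite.op_mul, contr_op]
    rw [h.kk_right_inv]
  · simp only [Units.coe_opEquiv_symm, MulOpposite.unop_op, ← MulOpposite.op_mul, contr_op]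
    rw [← mul_assoc, h.kkk]

/-- The fusion identity behind the construction of the antisymmetrizers. -/
theorem fusion (hp : GoodParams q μ) (h : BMWPair q μ x y) {p : B}
    (hx : (x : B) * p = -q⁻¹ • p) {u : ℂ} (hu : q * μ⁻¹ * u + 1 ≠ 0)
    (hv : q * μ⁻¹ * (u * (q ^ 2)⁻¹) + 1 ≠ 0) :
    (y : B) * (bax q μ (x : B) u * bax q μ (y : B) (u * (q ^ 2)⁻¹) * p) =
      -q⁻¹ • (bax q μ (x : B) u * bax q μ (y : B) (u * (q ^ 2)⁻¹) * p) := by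
  set K := contr q μ (x : B) with hK
  set L := contr q μ (y : B) with hL
  have q0 := hp.q0
  have m0 := hp.m0
  have q2 := hp.q2
  have hKp : K * p = 0 := by
    rw [hK, contr, smul_mul_assoc, mul_assoc, add_mul, hx]; simp
  have hxi : ((x⁻¹ : Bˣ) : B) * p = -q • p := by
    have : -q • ((x⁻¹ : Bˣ) : B) * ((x : B) * p) = -q • p := by
      rw [smul_mul_assoc, ← mul_assoc, Units.inv_mul, one_mul]
    rw [← this, hx, smul_mul_assoc, mul_smul_comm, smul_smul]
    simp [q0]
  -- The source is κ_xκ_y = κ_x y x together with x p = −q⁻¹ p.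
  have hKyp : K * (y * p) = -q • (K * (L * p)) := by
    rw [← mul_assoc K L, h.kk_right_inv, mul_assoc, mul_assoc, hxi]
    rw [inv_eq_of_contr hp h.symm.cubic, ← hL, mul_smul_comm, mul_smul_comm, smul_smul, sub_mul,
      mul_sub, smul_mul_assoc, sub_mul, one_mul, mul_smul_comm, mul_sub, hKp, zero_sub]
    have e1 : K * (L * p) = K * (y * (x * p)) := by
      rw [← mul_assoc, h.kk_right]; simp only [mul_assoc, hK]
    rw [e1, hx, mul_smul_comm, mul_smul_comm]
    match_scalars
    field_simp
    ring
  have hyy : (y : B) * (y * p) = p + (q - q⁻¹) • ((y : B) * p) -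
      (μ * (q - q⁻¹)) • (L * p) := by
    rw [← mul_assoc, contr_sq_expand hp, sub_mul, add_mul, one_mul, smul_mul_assoc, smul_mul_assoc]
  have hyxy : (y : B) * (x * (y * p)) = -q⁻¹ • ((x : B) * (y * p)) := by
    rw [← mul_assoc, ← mul_assoc, ← h.braid, mul_assoc, mul_assoc, hx, mul_smul_comm, mul_smul_comm]
  have hyL : (y : B) * (L * p) = μ • (L * p) := by
    rw [← mul_assoc, contr_comm, h.symm.cubic, smul_mul_assoc]
  have hyxL : (y : B) * (x * (L * p)) = K * (L * p) := by
    rw [← mul_assoc K, h.symm.kk]; simp only [mul_assoc, hL]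
  have hyKL : (y : B) * (K * (L * p)) = x * (L * p) - (q - q⁻¹) • (L * p - K * (L * p)) := by
    have : (y : B) * (K * (L * p)) = ((x⁻¹ : Bˣ) : B) * (L * p) := by
      rw [← mul_assoc K, h.symm.kk_inv]
      simp only [← mul_assoc, Units.mul_inv, one_mul, hL]
    rw [this, inv_eq_of_contr hp h.cubic, sub_mul, smul_mul_assoc, sub_mul, one_mul]
  -- Both sides reduce to combinations of p, yp, xyp, κ_y p, xκ_y p and κ_xκ_y p; it suffices to
  -- compare coefficients.
  rw [mul_assoc (bax q μ (x : B) u)]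
  simp only [bax, ← hK, ← hL, add_mul, mul_add, one_mul, smul_mul_assoc, mul_smul_comm, hx, hKp,
    hKyp, hyy, hyxy, hyL, hyxL, hyKL, smul_zero, smul_smul, add_zero, smul_add, smul_sub,
    mul_sub]
  have hu' : q * u + μ ≠ 0 := by
    intro h0; apply hu; field_simp; linear_combination h0
  have hv' : u + μ * q ≠ 0 := by
    intro h0; apply hv; field_simp; linear_combination h0
  have q2' : q ^ 2 - 1 ≠ 0 := by
    intro h0; apply q2; field_simp; linear_combination h0
  have hu2 : q * μ⁻¹ * u + 1 = (q * u + μ) / μ := by field_simp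
  have hv2 : q * μ⁻¹ * (u * (q ^ 2)⁻¹) + 1 = (u + μ * q) / (μ * q) := by field_simp
  have q22 : q - q⁻¹ = (q ^ 2 - 1) / q := by field_simp
  rw [hu2, hv2, q22]
  -- The two inverse denominators become free symbols. They satisfy G − qE + μ(q² − 1)EG = 0, which
  -- is the combination of `hE1` and `hG1` recurring in the certificates below.
  set E := (q * u + μ)⁻¹ with hE
  set G := (u + μ * q)⁻¹ with hG
  rw [show q * u + μ = E⁻¹ by rw [hE, inv_inv], show u + μ * q = G⁻¹ by rw [hG, inv_inv]]
  have hE1 : (q * u + μ) * E = 1 := by rw [hE, mul_inv_cancel₀ hu']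
  have hG1 : (u + μ * q) * G = 1 := by rw [hG, mul_inv_cancel₀ hv']
  clear_value E G
  match_scalars <;> field_simp
  · ring
  · ring
  · linear_combination (u - q ^ 2) * (q ^ 2 - 1) *
      (hG1 - (u - 1) * (-G * hE1 + q * E * hG1))
  · linear_combination (u - q ^ 2) * (u - 1) * (-G * hE1 + q * E * hG1)
  · linear_combination (u - q ^ 2) * (u - 1) * q ^ 2 * (-G * hE1 + q * E * hG1)

end BMWPair

/-! ### Antisymmetrizers attached to a sequence of BMW generators. -/

/-- The first `n` members of the sequence `s` satisfy the relations of a BMW algebra. -/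
structure IsBMWSeq (q μ : ℂ) (n : ℕ) (s : ℕ → Bˣ) : Prop where
  pair : ∀ i, i + 1 < n → BMWPair q μ (s i) (s (i + 1))
  far : ∀ i j, i + 2 ≤ j → j < n → Commute (s i : B) (s j)
  cubic : ∀ i, i < n → contr q μ (s i : B) * s i = μ • contr q μ (s i : B)

/-- The antisymmetrizer on `n + 1` strands built from a sequence of generators. -/
def asym (q μ : ℂ) (s : ℕ → B) : ℕ → B
  | 0 => 1
  | n + 1 => (q ^ (n + 1) / qNum q (n + 2)) •
      (asym q μ s n * bax q μ (s n) (q ^ (2 * (n + 1)))⁻¹ * asym q μ s n)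

/-- The antisymmetrizer built by adding strands on the left. -/
def asymL (q μ : ℂ) : (ℕ → B) → ℕ → B
  | _, 0 => 1
  | s, n + 1 => (q ^ (n + 1) / qNum q (n + 2)) •
      (asymL q μ (fun i => s (i + 1)) n * bax q μ (s 0) (q ^ (2 * (n + 1)))⁻¹ *
        asymL q μ (fun i => s (i + 1)) n)

/-- The denominators in the definition of the antisymmetrizer on `n + 1` strands do not vanish. -/
structure GoodUpTo (q μ : ℂ) (n : ℕ) : Prop extends GoodParams q μ where
  num : ∀ i, 1 ≤ i → i ≤ n → qNum q (i + 1) ≠ 0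
  den : ∀ i, 1 ≤ i → i ≤ n → q * μ⁻¹ * (q ^ (2 * i))⁻¹ + 1 ≠ 0

theorem GoodUpTo.mono {q μ : ℂ} {m n : ℕ} (h : GoodUpTo q μ n) (hmn : m ≤ n) :
    GoodUpTo q μ m :=
  ⟨h.toGoodParams, fun i h1 h2 => h.num i h1 (h2.trans hmn),
    fun i h1 h2 => h.den i h1 (h2.trans hmn)⟩

theorem IsBMWSeq.mono {q μ : ℂ} {m n : ℕ} {s : ℕ → Bˣ} (h : IsBMWSeq q μ n s) (hmn : m ≤ n) :
    IsBMWSeq q μ m s :=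
  ⟨fun i hi => h.pair i (by omega), fun i j hij hj => h.far i j hij (by omega),
    fun i hi => h.cubic i (by omega)⟩

theorem Commute.asym_right {q μ : ℂ} {z : B} {s : ℕ → B} {n : ℕ}
    (h : ∀ i < n, Commute z (s i)) : Commute z (asym q μ s n) := by
  induction n with
  | zero => exact Commute.one_right z
  | succ n ih =>
    have h1 := ih fun i hi => h i (by omega)
    exact ((h1.mul_right ((h n (by omega)).bax_right q μ _)).mul_right h1).smul_right _

theorem asym_intertwine {q μ : ℂ} {u : B} {s t : ℕ → B} {n : ℕ}
    (h : ∀ i < n, u * s i = t i * u) : u * asym q μ s n = asym q μ t n * u := by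
  induction n with
  | zero => simp [asym]
  | succ n ih =>
    have h1 := ih fun i hi => h i (by omega)
    have h2 : ∀ z, u * bax q μ (s n) z = bax q μ (t n) z * u := by
      intro z
      simp only [bax, mul_add, add_mul, mul_one, one_mul, mul_smul_comm, smul_mul_assoc,
        h n (by omega), contr_intertwine (h n (by omega))]
    simp only [asym, mul_smul_comm, smul_mul_assoc]
    rw [← mul_assoc, ← mul_assoc, h1, mul_assoc (asym q μ t n), h2, mul_assoc, mul_assoc, h1]
    simp only [mul_assoc]

theorem asym_congr {q μ : ℂ} {s t : ℕ → B} {n : ℕ} (h : ∀ i < n, s i = t i) :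
    asym q μ s n = asym q μ t n := by
  have := asym_intertwine (q := q) (μ := μ) (u := (1 : B)) (s := s) (t := t) (n := n)
    (fun i hi => by rw [one_mul, mul_one, h i hi])
  rwa [one_mul, mul_one] at this

theorem one_ne_q_sq {q μ : ℂ} (hp : GoodParams q μ) : q ^ 2 - 1 ≠ 0 := by
  intro h
  apply hp.q2
  have := hp.q0
  field_simp
  linear_combination h

/-- The value of the baxterized element on an antisymmetric vector. -/
theorem bax_scalar {q μ : ℂ} (hp : GoodParams q μ) {x p : B} (hx : x * p = -q⁻¹ • p) (n : ℕ) :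
    bax q μ x (q ^ (2 * n))⁻¹ * p = ((q ^ n)⁻¹ * qNum q (n + 1)) • p := by
  have hK : contr q μ x * p = 0 := by
    rw [contr, smul_mul_assoc, mul_assoc, add_mul, hx]; simp
  have q0 := hp.q0
  have h2 := one_ne_q_sq hp
  have e2 : q - q⁻¹ = (q ^ 2 - 1) / q := by field_simp
  rw [bax, add_mul, add_mul, one_mul, smul_mul_assoc, smul_mul_assoc, hK, hx]
  match_scalars
  rw [qNum, e2]
  field_simp
  ring

/-- Baxterized elements at `q⁻²` are antisymmetric. -/
theorem mul_bax_two {q μ : ℂ} (hp : GoodParams q μ) (hd : q * μ⁻¹ * (q ^ (2 * 1))⁻¹ + 1 ≠ 0)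
    {x : B} (hx : contr q μ x * x = μ • contr q μ x) :
    x * bax q μ x (q ^ (2 * 1))⁻¹ = -q⁻¹ • bax q μ x (q ^ (2 * 1))⁻¹ := by
  have q0 := hp.q0
  have m0 := hp.m0
  have h2 := one_ne_q_sq hp
  have hd' : 1 + μ * q ≠ 0 := by
    intro h0; apply hd; field_simp; linear_combination q * h0
  set E := (1 + μ * q)⁻¹ with hE
  have e1 : q * μ⁻¹ * (q ^ (2 * 1))⁻¹ + 1 = (1 + μ * q) / (μ * q) := by field_simp; ring
  have e2 : q - q⁻¹ = (q ^ 2 - 1) / q := by field_simp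
  simp only [bax, mul_add, mul_one, mul_smul_comm, contr_sq_expand hp, contr_comm, hx]
  rw [e1, e2]
  match_scalars
  · field_simp
    ring
  · field_simp
    ring
  · rw [show 1 + μ * q = E⁻¹ by rw [hE, inv_inv]]
    have hE1 : (1 + μ * q) * E = 1 := by rw [hE, mul_inv_cancel₀ hd']
    clear_value E
    field_simp
    linear_combination (1 - q ^ 2) * hE1

/-- Both claims go through one induction. The lower generators act on the outer factor. For the
newest one, the next smaller antisymmetrizer e is pulled out, which leaves two consecutive
baxterized elements on an antisymmetric vector, the situation of `fusion`. Idempotence follows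
because the baxterized factor acts on antisymmetric vectors by the scalar that the normalization
cancels. -/
theorem asym_left {q μ : ℂ} {n : ℕ} (hp : GoodUpTo q μ n) {s : ℕ → Bˣ} (hs : IsBMWSeq q μ n s) :
    (∀ j < n, (s j : B) * asym q μ (fun i => (s i : B)) n =
      -q⁻¹ • asym q μ (fun i => (s i : B)) n) ∧
    asym q μ (fun i => (s i : B)) n * asym q μ (fun i => (s i : B)) n =
      asym q μ (fun i => (s i : B)) n := by
  have q0 := hp.q0
  induction n using Nat.strong_induction_on with
  | _ n ih =>
  cases n with
  | zero => simp [asym]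
  | succ n =>
    obtain ⟨ih1, ih2⟩ := ih n (by omega) (hp.mono (by omega)) (hs.mono (by omega))
    set a := asym q μ (fun i => (s i : B)) n with ha
    set c := q ^ (n + 1) / qNum q (n + 2) with hc
    set b := bax q μ (s n : B) (q ^ (2 * (n + 1)))⁻¹ with hb
    have hA : asym q μ (fun i => (s i : B)) (n + 1) = c • (a * b * a) := rfl
    have hlow : ∀ j < n, (s j : B) * (c • (a * b * a)) = -q⁻¹ • c • (a * b * a) := by
      intro j hj
      rw [mul_smul_comm, ← mul_assoc, ← mul_assoc, ih1 j hj]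
      simp only [smul_mul_assoc]
      rw [smul_comm]
    have htop : (s n : B) * (c • (a * b * a)) = -q⁻¹ • c • (a * b * a) := by
      cases n with
      | zero =>
        simp only [ha, asym, one_mul, mul_one, mul_smul_comm]
        rw [hb, mul_bax_two hp.toGoodParams (hp.den 1 le_rfl (by omega)) (hs.cubic 0 (by omega)),
          smul_comm]
      | succ m =>
        set e := asym q μ (fun i => (s i : B)) m with he
        obtain ⟨_, he2⟩ := ih m (by omega) (hp.mono (by omega)) (hs.mono (by omega))
        set c' := q ^ (m + 1) / qNum q (m + 2)
        set b' := bax q μ (s m : B) (q ^ (2 * (m + 1)))⁻¹ with hb'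
        have hae : a = c' • (e * b' * e) := rfl
        have hce : Commute (s (m + 1) : B) e :=
          Commute.asym_right fun i hi => (hs.far i (m + 1) (by omega) (by omega)).symm
        have hcb : Commute e b := (hce.symm.bax_right q μ _)
        have hea : e * a = a := by
          rw [hae, mul_smul_comm, ← mul_assoc, ← mul_assoc, he2]
        -- The smallest antisymmetrizer e involves only generators far from `s (m + 1)`, so it
        -- commutes past b and is absorbed by the second a.
        have key : a * b * a = c' • (e * (b' * b * a)) := by
          conv_lhs => rw [mul_assoc]; enter [1]; rw [hae]
          rw [smul_mul_assoc, mul_assoc (e * b'), ← mul_assoc e b a, hcb.eq, mul_assoc b e a, hea]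
          simp only [mul_assoc]
        have hfus := (hs.pair m (by omega)).fusion hp.toGoodParams (ih1 m (by omega))
          (hp.den (m + 1) (by omega) (by omega)) (u := (q ^ (2 * (m + 1)))⁻¹) (by
            have := hp.den (m + 2) (by omega) (by omega)
            rwa [show (q ^ (2 * (m + 1)))⁻¹ * (q ^ 2)⁻¹ = (q ^ (2 * (m + 2)))⁻¹ by
              rw [← mul_inv, ← pow_add]; congr 2])
        rw [show (q ^ (2 * (m + 1)))⁻¹ * (q ^ 2)⁻¹ = (q ^ (2 * (m + 1 + 1)))⁻¹ by
              rw [← mul_inv, ← pow_add]; congr 2] at hfus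
        rw [key, mul_smul_comm, mul_smul_comm, ← mul_assoc, hce.eq, mul_assoc, hfus, mul_smul_comm,
          smul_comm c', smul_comm c]
    have hall : ∀ j < n + 1, (s j : B) * (c • (a * b * a)) = -q⁻¹ • c • (a * b * a) := by
      intro j hj
      rcases Nat.lt_succ_iff_lt_or_eq.1 hj with h | rfl
      · exact hlow j h
      · exact htop
    refine ⟨hall, ?_⟩
    rw [hA]
    have h1 : a * (c • (a * b * a)) = c • (a * b * a) := by
      rw [mul_smul_comm, ← mul_assoc, ← mul_assoc, ih2]
    have h3 := hp.num (n + 1) (by omega) le_rfl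
    have h4 : c * ((q ^ (n + 1))⁻¹ * qNum q (n + 1 + 1)) = 1 := by
      rw [hc]; field_simp
    calc c • (a * b * a) * c • (a * b * a)
        = c • (a * (b * (a * (c • (a * b * a))))) := by
          rw [smul_mul_assoc]; simp only [mul_assoc]
      _ = c • (a * b * a) := by
          rw [h1, hb, bax_scalar hp.toGoodParams htop, mul_smul_comm, h1, smul_smul, h4, one_smul]

theorem asym_op (q μ : ℂ) (s : ℕ → B) (n : ℕ) :
    asym q μ (fun i => MulOpposite.op (s i)) n = MulOpposite.op (asym q μ s n) := by
  induction n with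
  | zero => simp [asym]
  | succ n ih => simp [asym, ih, bax_op, mul_assoc]

theorem IsBMWSeq.op {q μ : ℂ} {n : ℕ} {s : ℕ → Bˣ} (hs : IsBMWSeq q μ n s) :
    IsBMWSeq q μ n (fun i => Units.opEquiv.symm (MulOpposite.op (s i))) := by
  refine ⟨fun i hi => (hs.pair i hi).op, fun i j hij hj => ?_, fun i hi => ?_⟩
  · exact (hs.far i j hij hj).op
  · simp only [Units.coe_opEquiv_symm, MulOpposite.unop_op, ← MulOpposite.op_mul, contr_op,
      ← MulOpposite.op_smul]
    rw [contr_comm, hs.cubic i hi]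

/-- The recursive formula is a palindrome, so this is `asym_left` in the opposite algebra. -/
theorem asym_right {q μ : ℂ} {n : ℕ} (hp : GoodUpTo q μ n) {s : ℕ → Bˣ} (hs : IsBMWSeq q μ n s)
    {j : ℕ} (hj : j < n) : asym q μ (fun i => (s i : B)) n * s j =
      -q⁻¹ • asym q μ (fun i => (s i : B)) n := by
  have h := (asym_left hp hs.op).1 j hj
  simp only [Units.coe_opEquiv_symm, MulOpposite.unop_op, asym_op, ← MulOpposite.op_mul,
    ← MulOpposite.op_smul] at h
  exact MulOpposite.op_injective h

theorem IsBMWSeq.shift {q μ : ℂ} {m n p : ℕ} {s : ℕ → Bˣ} (hs : IsBMWSeq q μ n s)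
    (h : m + p ≤ n) : IsBMWSeq q μ p (fun i => s (m + i)) :=
  ⟨fun i hi => hs.pair (m + i) (by omega),
    fun i j hij hj => hs.far (m + i) (m + j) (by omega) (by omega),
    fun i hi => hs.cubic (m + i) (by omega)⟩

theorem IsBMWSeq.reverse {q μ : ℂ} {n : ℕ} {s : ℕ → Bˣ} (hs : IsBMWSeq q μ n s) :
    IsBMWSeq q μ n (fun i => s (n - 1 - i)) := by
  refine ⟨fun i hi => ?_, fun i j hij hj => ?_, fun i hi => hs.cubic _ (by omega)⟩
  · have := (hs.pair (n - 1 - (i + 1)) (by omega)).symm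
    rwa [show n - 1 - (i + 1) + 1 = n - 1 - i by omega] at this
  · exact (hs.far (n - 1 - j) (n - 1 - i) (by omega) (by omega)).symm

/-- Adding strands on the left is adding strands on the right with the generators numbered
backwards. -/
theorem asymL_eq_reverse (q μ : ℂ) (s : ℕ → B) (n : ℕ) :
    asymL q μ s n = asym q μ (fun i => s (n - 1 - i)) n := by
  induction n generalizing s with
  | zero => rfl
  | succ n ih =>
    have : asymL q μ (fun i => s (i + 1)) n = asym q μ (fun i => s (n + 1 - 1 - i)) n := by
      rw [ih]
      exact asym_congr fun i hi => by congr 1; omega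
    rw [asymL, asym, this]
    simp

/-- An element on which all the generators act as on the antisymmetrizer absorbs it. -/
theorem asym_mul_of_antisymmetric {q μ : ℂ} {n : ℕ} (hp : GoodUpTo q μ n) {s : ℕ → B} {p : B}
    (h : ∀ j < n, s j * p = -q⁻¹ • p) : asym q μ s n * p = p := by
  induction n with
  | zero => simp [asym]
  | succ n ih =>
    have h1 := ih (hp.mono (by omega)) fun j hj => h j (by omega)
    rw [asym, smul_mul_assoc, mul_assoc, h1, mul_assoc,
      bax_scalar hp.toGoodParams (h n (by omega)), mul_smul_comm, h1, smul_smul]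
    have h3 := hp.num (n + 1) (by omega) le_rfl
    have q0 := hp.q0
    have : q ^ (n + 1) / qNum q (n + 2) * ((q ^ (n + 1))⁻¹ * qNum q (n + 1 + 1)) = 1 := by
      field_simp
    rw [this, one_smul]

theorem mul_asym_of_antisymmetric {q μ : ℂ} {n : ℕ} (hp : GoodUpTo q μ n) {s : ℕ → B} {p : B}
    (h : ∀ j < n, p * s j = -q⁻¹ • p) : p * asym q μ s n = p := by
  have := asym_mul_of_antisymmetric hp (s := fun i => MulOpposite.op (s i))
    (p := MulOpposite.op p) (fun j hj => by rw [← MulOpposite.op_mul, h j hj, MulOpposite.op_smul])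
  rw [asym_op, ← MulOpposite.op_mul] at this
  exact MulOpposite.op_injective this

/-- The two recursive definitions of the antisymmetrizers agree. -/
theorem asymL_eq_asym {q μ : ℂ} {n : ℕ} (hp : GoodUpTo q μ n) {s : ℕ → Bˣ}
    (hs : IsBMWSeq q μ n s) :
    asymL q μ (fun i => (s i : B)) n = asym q μ (fun i => (s i : B)) n := by
  rw [asymL_eq_reverse]
  have h1 := (asym_left hp hs.reverse).1
  have h2 : ∀ j < n, (s j : B) * asym q μ (fun i => (s (n - 1 - i) : B)) n =
      -q⁻¹ • asym q μ (fun i => (s (n - 1 - i) : B)) n := by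
    intro j hj
    have := h1 (n - 1 - j) (by omega)
    rwa [show n - 1 - (n - 1 - j) = j by omega] at this
  -- Each of the two antisymmetrizers absorbs the other, so their product equals both.
  have h3 := asym_mul_of_antisymmetric hp h2
  have h4 := mul_asym_of_antisymmetric hp (s := fun i => (s (n - 1 - i) : B))
    (p := asym q μ (fun i => (s i : B)) n) (fun j hj => asym_right hp hs (by omega))
  rw [← h3, h4]

/-- The descendant recurrences need the first strand split off: it then carries M itself, and the
remaining antisymmetrizer appears star-multiplied by M. -/
theorem asym_succ_left {q μ : ℂ} {n : ℕ} (hp : GoodUpTo q μ (n + 1)) {s : ℕ → Bˣ}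
    (hs : IsBMWSeq q μ (n + 1) s) :
    asym q μ (fun i => (s i : B)) (n + 1) = (q ^ (n + 1) / qNum q (n + 2)) •
      (asym q μ (fun i => (s (1 + i) : B)) n * bax q μ (s 0 : B) (q ^ (2 * (n + 1)))⁻¹ *
        asym q μ (fun i => (s (1 + i) : B)) n) := by
  rw [← asymL_eq_asym hp hs, asymL]
  have := asymL_eq_asym (hp.mono (Nat.le_succ n)) (hs.shift (m := 1) (p := n) (by omega))
  simp only [add_comm 1] at this ⊢
  rw [this]

end BMWAlgebra

/-! ### Operators on an infinite tensor power -/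

section InfiniteTensor

variable {A : Type*} [Ring A] [Algebra ℂ A] {N : ℕ}

/-- Operators on `V ⊗ V ⊗ ⋯` with coefficients in `A`. -/
abbrev TOp (N : ℕ) (A : Type*) [Ring A] [Algebra ℂ A] : Type _ :=
  Module.End ℂ ((ℕ → Fin N) → A)

theorem extend_extend_self {k : ℕ} (e : Fin k ↪ ℕ) (b c : Fin k → Fin N) (a : ℕ → Fin N) :
    Function.extend e c (Function.extend e b a) = Function.extend e c a := by
  classical
  funext j
  by_cases h : ∃ i, e i = j
  · obtain ⟨i, rfl⟩ := h
    rw [e.injective.extend_apply, e.injective.extend_apply]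
  · rw [Function.extend_apply' _ _ _ h, Function.extend_apply' _ _ _ h,
      Function.extend_apply' _ _ _ h]

theorem extend_comp_embedding {k : ℕ} (e : Fin k ↪ ℕ) (b : Fin k → Fin N) (a : ℕ → Fin N) :
    Function.extend e b a ∘ e = b := funext fun i => e.injective.extend_apply b a i

theorem extend_comp_same {k : ℕ} (e : Fin k ↪ ℕ) (a : ℕ → Fin N) :
    Function.extend e (a ∘ e) a = a := by
  funext j
  by_cases h : ∃ i, e i = j
  · obtain ⟨i, rfl⟩ := h
    rw [e.injective.extend_apply]; rfl
  · rw [Function.extend_apply' _ _ _ h]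

/-- The operator `X` acting in the tensor factors `e 0, …, e (k - 1)`, as a linear map. -/
def actLin {k : ℕ} (e : Fin k ↪ ℕ) (X : TensorMat N k A) : TOp N A where
  toFun F a := ∑ b : Fin k → Fin N, X (a ∘ e) b * F (Function.extend e b a)
  map_add' F G := by
    funext a
    simp [mul_add, Finset.sum_add_distrib]
  map_smul' z F := by
    funext a
    simp [Finset.smul_sum]

/-- The operator `X` acting in the tensor factors `e 0, …, e (k - 1)`. -/
def act {k : ℕ} (e : Fin k ↪ ℕ) : TensorMat N k A →ₐ[ℂ] TOp N A := by
  refine AlgHom.ofLinearMap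
    { toFun := actLin e
      map_add' := fun X Y => ?_
      map_smul' := fun z X => ?_ } ?_ ?_
  · ext F a
    simp [actLin, add_mul, Finset.sum_add_distrib]
  · ext F a
    simp [actLin, Finset.smul_sum]
  · ext F a
    simp only [LinearMap.coe_mk, AddHom.coe_mk, actLin, Module.End.one_apply, Matrix.one_apply]
    rw [Finset.sum_eq_single (a ∘ e)]
    · simp [extend_comp_same]
    · intro b _ hb
      rw [if_neg (Ne.symm hb), zero_mul]
    · intro h; exact absurd (Finset.mem_univ _) h
  · intro X Y
    ext F a
    simp only [LinearMap.coe_mk, AddHom.coe_mk, actLin, Module.End.mul_apply, Matrix.mul_apply,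
      extend_comp_embedding, extend_extend_self, Finset.sum_mul, Finset.mul_sum, mul_assoc]
    rw [Finset.sum_comm]

theorem act_apply {k : ℕ} (e : Fin k ↪ ℕ) (X : TensorMat N k A) (F : (ℕ → Fin N) → A)
    (a : ℕ → Fin N) :
    act e X F a = ∑ b : Fin k → Fin N, X (a ∘ e) b * F (Function.extend e b a) := rfl

/-- The numerical operator `X` acting in the tensor factors `e 0, …, e (k - 1)`. -/
def actC (A : Type*) [Ring A] [Algebra ℂ A] {k : ℕ} (e : Fin k ↪ ℕ) :
    TensorMat N k ℂ →ₐ[ℂ] TOp N A :=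
  (act e).comp (Algebra.ofId ℂ A).mapMatrix

theorem actC_eq {k : ℕ} (e : Fin k ↪ ℕ) (X : TensorMat N k ℂ) :
    actC A e X = act e (X.map (algebraMap ℂ A)) := rfl

theorem actC_apply {k : ℕ} (e : Fin k ↪ ℕ) (X : TensorMat N k ℂ) (F : (ℕ → Fin N) → A)
    (a : ℕ → Fin N) :
    actC A e X F a = ∑ b : Fin k → Fin N, X (a ∘ e) b • F (Function.extend e b a) := by
  simp [actC_eq, act_apply, Algebra.smul_def]

theorem act_onSites {k n : ℕ} (e : Fin n ↪ ℕ) (f : Fin k ↪ Fin n) (X : TensorMat N k A) :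
    act e (onSites f X) = act (f.trans e) X := by
  classical
  ext F a
  rw [act_apply, act_apply]
  have hcomp : ∀ d : Fin k → Fin N, (Function.extend f d (a ∘ e)) ∘ f = d := fun d =>
    funext fun i => f.injective.extend_apply d _ i
  have hext : ∀ d : Fin k → Fin N, Function.extend e (Function.extend f d (a ∘ e)) a =
      Function.extend (f.trans e) d a := by
    intro d
    funext j
    by_cases h : ∃ i, e i = j
    · obtain ⟨i, rfl⟩ := h
      rw [e.injective.extend_apply]
      by_cases h' : ∃ l, f l = i
      · obtain ⟨l, rfl⟩ := h'
        rw [f.injective.extend_apply]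
        exact ((f.trans e).injective.extend_apply d a l).symm
      · rw [Function.extend_apply' _ _ _ h', Function.extend_apply']
        · rfl
        · rintro ⟨l, hl⟩
          exact h' ⟨l, e.injective hl⟩
    · rw [Function.extend_apply' _ _ _ h, Function.extend_apply']
      rintro ⟨l, hl⟩
      exact h ⟨f l, hl⟩
  rw [← Finset.sum_subset (Finset.subset_univ
      ((Finset.univ : Finset (Fin k → Fin N)).image fun d => Function.extend f d (a ∘ e)))]
  · rw [Finset.sum_image]
    · refine Finset.sum_congr rfl fun d _ => ?_
      rw [hext, onSites, Matrix.of_apply, if_pos, hcomp]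
      · rfl
      · intro j hj
        rw [Function.extend_apply' _ _ _ (by simpa using hj)]
    · intro d _ d' _ hdd
      have := congrArg (fun g => g ∘ f) hdd
      simpa [hcomp] using this
  · intro c _ hc
    rw [onSites, Matrix.of_apply, if_neg, zero_mul]
    intro h
    apply hc
    refine Finset.mem_image.2 ⟨c ∘ f, Finset.mem_univ _, ?_⟩
    funext j
    by_cases hj : ∃ i, f i = j
    · obtain ⟨i, rfl⟩ := hj
      exact f.injective.extend_apply (c ∘ f) _ i
    · rw [Function.extend_apply' _ _ _ hj, h j (by simpa using hj)]

theorem onSites_map {k n : ℕ} (f : Fin k → Fin n) (X : TensorMat N k ℂ) :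
    (onSites f X).map (algebraMap ℂ A) = onSites f (X.map (algebraMap ℂ A)) := by
  ext a b
  simp only [onSites, Matrix.map_apply, Matrix.of_apply]
  split_ifs <;> simp

theorem actC_onSites {k n : ℕ} (e : Fin n ↪ ℕ) (f : Fin k ↪ Fin n) (X : TensorMat N k ℂ) :
    actC A e (onSites f X) = actC A (f.trans e) X := by
  rw [actC_eq, onSites_map, act_onSites, actC_eq]

/-- Disjoint supports alone would not suffice, because entries in A need not commute; here one of
the operators has numerical entries. -/
theorem act_commute {k l : ℕ} (e : Fin k ↪ ℕ) (f : Fin l ↪ ℕ) (hef : ∀ i j, e i ≠ f j)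
    (X : TensorMat N k A) (Y : TensorMat N l ℂ) : Commute (act e X) (actC A f Y) := by
  have h1 : ∀ (a : ℕ → Fin N) b, Function.extend e b a ∘ f = a ∘ f := fun a b => by
    funext i
    exact Function.extend_apply' _ _ _ (fun ⟨j, hj⟩ => hef j i hj)
  have h2 : ∀ (a : ℕ → Fin N) b, Function.extend f b a ∘ e = a ∘ e := fun a b => by
    funext i
    exact Function.extend_apply' _ _ _ (fun ⟨j, hj⟩ => hef i j hj.symm)
  have h3 : ∀ (a : ℕ → Fin N) b c, Function.extend f c (Function.extend e b a) =
      Function.extend e b (Function.extend f c a) := by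
    intro a b c
    funext j
    by_cases he : ∃ i, e i = j
    · obtain ⟨i, rfl⟩ := he
      rw [e.injective.extend_apply, Function.extend_apply' _ _ _ (fun ⟨j, hj⟩ => hef i j hj.symm),
        e.injective.extend_apply]
    · rw [Function.extend_apply' (f := e) _ _ _ he]
      by_cases hf : ∃ i, f i = j
      · obtain ⟨i, rfl⟩ := hf
        rw [f.injective.extend_apply, f.injective.extend_apply]
      · rw [Function.extend_apply' (f := f) _ _ _ hf, Function.extend_apply' (f := f) _ _ _ hf,
          Function.extend_apply' (f := e) _ _ _ he]
  refine LinearMap.ext fun F => funext fun a => ?_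
  simp only [Module.End.mul_apply, act_apply, actC_apply, h1, h2, h3, Finset.mul_sum,
    Finset.smul_sum, mul_smul_comm]
  rw [Finset.sum_comm]

/-- Left multiplication by an element of `A`. -/
def coef (N : ℕ) (A : Type*) [Ring A] [Algebra ℂ A] : A →ₐ[ℂ] TOp N A where
  toFun c :=
    { toFun := fun F a => c * F a
      map_add' := fun F G => by funext a; simp [mul_add]
      map_smul' := fun z F => by funext a; simp }
  map_one' := by ext F a; simp
  map_mul' c d := by ext F a; simp [mul_assoc]
  map_zero' := by ext F a; simp
  map_add' c d := by ext F a; simp [add_mul]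
  commutes' z := by ext F a; simp [Algebra.smul_def]

theorem coef_apply (c : A) (F : (ℕ → Fin N) → A) (a : ℕ → Fin N) :
    coef N A c F a = c * F a := rfl

theorem coef_commute {k : ℕ} (f : Fin k ↪ ℕ) (c : A) (Y : TensorMat N k ℂ) :
    Commute (coef N A c) (actC A f Y) := by
  refine LinearMap.ext fun F => funext fun a => ?_
  simp only [Module.End.mul_apply, coef_apply, actC_apply, Finset.mul_sum, mul_smul_comm]

theorem coef_injective [Nonempty (Fin N)] : Function.Injective (coef N A) := by
  intro c d h
  obtain ⟨i⟩ := ‹Nonempty (Fin N)›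
  have := congrFun (LinearMap.congr_fun h (fun _ => 1)) (fun _ => i)
  simpa [coef_apply] using this

/-- The embedding of one site. -/
def site (n : ℕ) : Fin 1 ↪ ℕ := ⟨fun _ => n, fun _ _ _ => Subsingleton.elim _ _⟩

/-- A matrix acting in the tensor factor `n`. -/
def actOne (n : ℕ) : Matrix (Fin N) (Fin N) A →ₐ[ℂ] TOp N A :=
  (act (site n)).comp
    (Matrix.reindexAlgEquiv ℂ A (Equiv.funUnique (Fin 1) (Fin N)).symm).toAlgHom

theorem actOne_eq (n : ℕ) (X : Matrix (Fin N) (Fin N) A) :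
    actOne n X = act (site n) (Matrix.of fun a b : Fin 1 → Fin N => X (a 0) (b 0)) := rfl

theorem extend_site (n : ℕ) (b : Fin 1 → Fin N) (a : ℕ → Fin N) :
    Function.extend (site n) b a = Function.update a n (b 0) := by
  funext j
  by_cases h : j = n
  · subst h
    rw [Function.update_self]
    exact (site j).injective.extend_apply b a 0
  · rw [Function.update_of_ne h, Function.extend_apply']
    rintro ⟨_, hi⟩
    exact h hi.symm

theorem actOne_apply (n : ℕ) (X : Matrix (Fin N) (Fin N) A) (F : (ℕ → Fin N) → A)
    (a : ℕ → Fin N) : actOne n X F a = ∑ j, X (a n) j * F (Function.update a n j) := by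
  rw [actOne_eq, act_apply, ← (Equiv.funUnique (Fin 1) (Fin N)).symm.sum_comp]
  refine Finset.sum_congr rfl fun j _ => ?_
  rw [extend_site]
  rfl

/-- A numerical matrix acting in the tensor factor `n`. -/
def actOneC (A : Type*) [Ring A] [Algebra ℂ A] (n : ℕ) : Matrix (Fin N) (Fin N) ℂ →ₐ[ℂ] TOp N A :=
  (actOne n).comp (Algebra.ofId ℂ A).mapMatrix

/-- Matrix units in the tensor factor `n`. -/
def munit (A : Type*) [Ring A] [Algebra ℂ A] (n : ℕ) (i j : Fin N) : TOp N A :=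
  actOneC A n (Matrix.single i j 1)

theorem munit_apply (n : ℕ) (i j : Fin N) (F : (ℕ → Fin N) → A) (a : ℕ → Fin N) :
    munit A n i j F a = if a n = i then F (Function.update a n j) else 0 := by
  change actOne n ((Matrix.single i j (1 : ℂ)).map (algebraMap ℂ A)) F a = _
  rw [actOne_apply]
  simp only [Matrix.map_apply, Matrix.single_apply]
  split_ifs with h
  · rw [Finset.sum_eq_single j]
    · simp [h]
    · intro k _ hk
      rw [if_neg (by tauto)]; simp
    · simp
  · refine Finset.sum_eq_zero fun k _ => ?_
    rw [if_neg (by tauto)]; simp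

theorem munit_mul (n : ℕ) (i j k l : Fin N) :
    munit A n i j * munit A n k l = if j = k then munit A n i l else 0 := by
  rw [munit, munit, ← map_mul]
  split_ifs with h
  · subst h; rw [Matrix.single_mul_single_same, mul_one]; rfl
  · rw [Matrix.single_mul_single_of_ne 1 i j k h, map_zero]

theorem sum_munit (n : ℕ) : ∑ i : Fin N, munit A n i i = 1 := by
  have : ∑ i : Fin N, Matrix.single i i (1 : ℂ) = 1 := by
    ext a b
    rw [Matrix.sum_apply, Finset.sum_eq_single a]
    · simp [Matrix.single_apply, Matrix.one_apply]
    · intro i _ hi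
      simp [hi]
    · simp
  simp only [munit]
  rw [← map_sum, this, map_one]

theorem munit_commute {m n : ℕ} (h : m ≠ n) (i j k l : Fin N) :
    Commute (munit A m i j) (munit A n k l) :=
  act_commute (site m) (site n) (fun _ _ => h) _ _

theorem coef_commute_munit (c : A) (n : ℕ) (i j : Fin N) :
    Commute (coef N A c) (munit A n i j) := coef_commute (site n) c _

theorem actOne_eq_sum (n : ℕ) (X : Matrix (Fin N) (Fin N) A) :
    actOne n X = ∑ i, ∑ j, coef N A (X i j) * munit A n i j := by
  refine LinearMap.ext fun F => funext fun a => ?_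
  simp only [actOne_apply, LinearMap.sum_apply, Finset.sum_apply, Module.End.mul_apply,
    coef_apply, munit_apply]
  symm
  rw [Finset.sum_eq_single (a n)]
  · simp
  · intro i _ hi
    simp [hi.symm]
  · simp

theorem actOne_scalar (n : ℕ) (c : A) :
    actOne n (Matrix.diagonal fun _ : Fin N => c) = coef N A c := by
  rw [actOne_eq_sum]
  have : ∀ i : Fin N, ∑ j, coef N A ((Matrix.diagonal fun _ : Fin N => c) i j) * munit A n i j =
      coef N A c * munit A n i i := by
    intro i
    rw [Finset.sum_eq_single i]
    · simp
    · intro j _ hj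
      rw [Matrix.diagonal_apply_ne _ hj.symm, map_zero, zero_mul]
    · simp
  simp only [this]
  rw [← Finset.mul_sum, sum_munit, mul_one]

set_option linter.unusedSectionVars false in
theorem rightMul_eq_mul_diagonal (X : Matrix (Fin N) (Fin N) A) (c : A) :
    rightMul X c = X * Matrix.diagonal fun _ => c := by
  ext i j; simp [rightMul]

theorem actOne_rightMul (n : ℕ) (X : Matrix (Fin N) (Fin N) A) (c : A) :
    actOne n (rightMul X c) = actOne n X * coef N A c := by
  rw [rightMul_eq_mul_diagonal, map_mul, actOne_scalar]

/-- The matrix elements of an operator in the first tensor factor. -/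
def firstEntries : TOp N A →ₗ[ℂ] Matrix (Fin N) (Fin N) A where
  toFun X := Matrix.of fun i j => X (fun b => if b 0 = j then 1 else 0) (fun _ => i)
  map_add' X Y := by ext i j; simp
  map_smul' z X := by ext i j; simp

/-- Applying X to the indicator function of b₀ = j and evaluating at the constant sequence i reads
off the entry (i, j). So identities between matrices may be proved in the operator algebra. -/
theorem firstEntries_actOne (X : Matrix (Fin N) (Fin N) A) : firstEntries (actOne 0 X) = X := by
  ext i j
  simp only [firstEntries, LinearMap.coe_mk, AddHom.coe_mk, Matrix.of_apply, actOne_apply,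
    Function.update_self]
  simp

theorem actOne_injective : Function.Injective (actOne (N := N) (A := A) 0) :=
  Function.LeftInverse.injective firstEntries_actOne

/-! ### Operators in two factors -/

/-- The embedding of two sites. -/
def sites (m n : ℕ) (h : m ≠ n) : Fin 2 ↪ ℕ := ⟨![m, n], by
  intro a b hab
  fin_cases a <;> fin_cases b <;> simp_all [h.symm]⟩

/-- A numerical operator on `V ⊗ V` acting in the tensor factors `m` and `n`. -/
def actTwo (A : Type*) [Ring A] [Algebra ℂ A] (m n : ℕ) (h : m ≠ n) :
    TensorMat N 2 ℂ →ₐ[ℂ] TOp N A := actC A (sites m n h)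

theorem actTwo_eq_sum (m n : ℕ) (h : m ≠ n) (X : TensorMat N 2 ℂ) :
    actTwo A m n h X = ∑ a, ∑ b, ∑ c, ∑ d,
      X ![a, b] ![c, d] • (munit A m a c * munit A n b d) := by
  refine LinearMap.ext fun F => funext fun s => ?_
  simp only [LinearMap.sum_apply, Finset.sum_apply, LinearMap.smul_apply, Pi.smul_apply,
    Module.End.mul_apply, munit_apply]
  rw [Finset.sum_eq_single (s m)]
  · rw [Finset.sum_eq_single (s n)]
    · rw [actTwo, actC_apply, ← (finTwoArrowEquiv (Fin N)).symm.sum_comp, Fintype.sum_prod_type]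
      refine Finset.sum_congr rfl fun c _ => Finset.sum_congr rfl fun d _ => ?_
      have e1 : s ∘ sites m n h = ![s m, s n] := by
        funext i; fin_cases i <;> rfl
      have e2 : Function.extend (sites m n h) ((finTwoArrowEquiv (Fin N)).symm (c, d)) s =
          Function.update (Function.update s m c) n d := by
        funext j
        by_cases h1 : j = n
        · subst h1
          rw [Function.update_self]
          exact (sites m j h).injective.extend_apply _ s 1
        · rw [Function.update_of_ne h1]
          by_cases h2 : j = m
          · subst h2
            rw [Function.update_self]
            exact (sites j n h).injective.extend_apply _ s 0
          · rw [Function.update_of_ne h2, Function.extend_apply']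
            rintro ⟨i, hi⟩
            fin_cases i
            · exact h2 hi.symm
            · exact h1 hi.symm
      rw [e1, e2, if_pos rfl, if_pos (by rw [Function.update_of_ne h.symm])]
      rfl
    · intro b _ hb
      refine Finset.sum_eq_zero fun c _ => Finset.sum_eq_zero fun d _ => ?_
      rw [if_pos rfl, if_neg, smul_zero]
      rw [Function.update_of_ne h.symm]
      exact hb.symm
    · simp
  · intro a _ ha
    refine Finset.sum_eq_zero fun b _ => Finset.sum_eq_zero fun c _ =>
      Finset.sum_eq_zero fun d _ => ?_
    rw [if_neg ha.symm, smul_zero]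
  · simp

end InfiniteTensor

/-! ### Partial traces -/

section PartialTrace

variable {A : Type*} [Ring A] [Algebra ℂ A] {N : ℕ}

/-- The operators acting trivially in the tensor factor `n`. -/
def awayFrom (N : ℕ) (A : Type*) [Ring A] [Algebra ℂ A] (n : ℕ) : Subalgebra ℂ (TOp N A) :=
  Subalgebra.centralizer ℂ (Set.range fun p : Fin N × Fin N => munit A n p.1 p.2)

theorem mem_awayFrom {n : ℕ} {X : TOp N A} :
    X ∈ awayFrom N A n ↔ ∀ i j, Commute (munit A n i j) X := by
  rw [awayFrom, Subalgebra.mem_centralizer_iff]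
  exact ⟨fun h i j => h _ ⟨(i, j), rfl⟩, fun h => by rintro _ ⟨p, rfl⟩; exact h p.1 p.2⟩

theorem coef_mem_awayFrom (c : A) (n : ℕ) : coef N A c ∈ awayFrom N A n :=
  mem_awayFrom.2 fun i j => (coef_commute_munit c n i j).symm

theorem munit_mem_awayFrom {m n : ℕ} (h : m ≠ n) (i j : Fin N) :
    munit A m i j ∈ awayFrom N A n :=
  mem_awayFrom.2 fun _ _ => munit_commute h.symm _ _ _ _

theorem actTwo_mem_awayFrom {m n p : ℕ} (h : m ≠ n) (hm : m ≠ p) (hn : n ≠ p)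
    (X : TensorMat N 2 ℂ) : actTwo A m n h X ∈ awayFrom N A p := by
  rw [actTwo_eq_sum]
  refine sum_mem fun a _ => sum_mem fun b _ => sum_mem fun c _ => sum_mem fun d _ => ?_
  exact Subalgebra.smul_mem _ (mul_mem (munit_mem_awayFrom hm a c) (munit_mem_awayFrom hn b d)) _

theorem actOne_mem_awayFrom {m n : ℕ} (h : m ≠ n) (X : Matrix (Fin N) (Fin N) A) :
    actOne m X ∈ awayFrom N A n := by
  rw [actOne_eq_sum]
  exact sum_mem fun a _ => sum_mem fun b _ =>
    mul_mem (coef_mem_awayFrom _ n) (munit_mem_awayFrom h a b)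

theorem actOneC_eq_sum (n : ℕ) (D : Matrix (Fin N) (Fin N) ℂ) :
    actOneC A n D = ∑ i, ∑ j, D i j • munit A n i j := by
  change actOne n (D.map (algebraMap ℂ A)) = _
  rw [actOne_eq_sum]
  refine Finset.sum_congr rfl fun i _ => Finset.sum_congr rfl fun j _ => ?_
  rw [Matrix.map_apply, AlgHom.commutes, Algebra.smul_def]

theorem actOneC_mem_awayFrom {m n : ℕ} (h : m ≠ n) (D : Matrix (Fin N) (Fin N) ℂ) :
    actOneC A m D ∈ awayFrom N A n := actOne_mem_awayFrom h _

theorem actOneC_commute {n : ℕ} (D : Matrix (Fin N) (Fin N) ℂ) {X : TOp N A}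
    (hX : X ∈ awayFrom N A n) : Commute (actOneC A n D) X := by
  rw [actOneC_eq_sum]
  exact Commute.sum_left _ _ _ fun i _ => Commute.sum_left _ _ _ fun j _ =>
    ((mem_awayFrom.1 hX) i j).smul_left _

theorem actTwo_commute {m n : ℕ} (h : m ≠ n) (Y : TensorMat N 2 ℂ) {X : TOp N A}
    (hm : X ∈ awayFrom N A m) (hn : X ∈ awayFrom N A n) : Commute (actTwo A m n h Y) X := by
  rw [actTwo_eq_sum]
  exact Commute.sum_left _ _ _ fun a _ => Commute.sum_left _ _ _ fun b _ =>
    Commute.sum_left _ _ _ fun c _ => Commute.sum_left _ _ _ fun d _ =>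
    (((mem_awayFrom.1 hm) a c).mul_left ((mem_awayFrom.1 hn) b d)).smul_left _

/-- The matrix element of an operator in the tensor factor `n`. -/
def entry (n : ℕ) (i j : Fin N) : TOp N A →ₗ[ℂ] TOp N A where
  toFun X := ∑ e, munit A n e i * X * munit A n j e
  map_add' X Y := by simp [mul_add, add_mul, Finset.sum_add_distrib]
  map_smul' z X := by simp [Finset.smul_sum]

theorem entry_apply (n : ℕ) (i j : Fin N) (X : TOp N A) :
    entry n i j X = ∑ e, munit A n e i * X * munit A n j e := rfl

/-- Summing E_{ei} X E_{je} over e spreads one block of X over the whole diagonal of site n, and the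
result commutes with all matrix units there. -/
theorem entry_mem (n : ℕ) (i j : Fin N) (X : TOp N A) : entry n i j X ∈ awayFrom N A n := by
  refine mem_awayFrom.2 fun k l => ?_
  change munit A n k l * entry n i j X = entry n i j X * munit A n k l
  rw [entry_apply, Finset.mul_sum, Finset.sum_mul, Finset.sum_eq_single l, Finset.sum_eq_single k]
  · rw [mul_assoc _ _ (munit A n k l), munit_mul, if_pos rfl, ← mul_assoc, ← mul_assoc, munit_mul,
      if_pos rfl]
  · intro e _ he
    rw [mul_assoc, munit_mul, if_neg he, mul_zero]
  · simp
  · intro e _ he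
    rw [← mul_assoc, ← mul_assoc, munit_mul, if_neg he.symm, zero_mul, zero_mul]
  · simp

/-- With `entry_munit_mul` this makes the operators a free module over those trivial at site n, with
the matrix units as basis. -/
theorem sum_entry (n : ℕ) (X : TOp N A) : ∑ i, ∑ j, munit A n i j * entry n i j X = X := by
  have : ∀ i j, munit A n i j * entry n i j X = munit A n i i * X * munit A n j j := by
    intro i j
    rw [entry_apply, Finset.mul_sum, Finset.sum_eq_single j]
    · rw [← mul_assoc, ← mul_assoc, munit_mul, if_pos rfl]
    · intro e _ he
      rw [← mul_assoc, ← mul_assoc, munit_mul, if_neg he.symm, zero_mul, zero_mul]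
    · simp
  simp only [this]
  simp only [← Finset.mul_sum, sum_munit, mul_one]
  rw [← Finset.sum_mul, sum_munit, one_mul]

theorem entry_munit_mul (n : ℕ) (i j k l : Fin N) {X : TOp N A} (hX : X ∈ awayFrom N A n) :
    entry n i j (munit A n k l * X) = if i = k ∧ l = j then X else 0 := by
  have h1 : ∀ e, munit A n e i * (munit A n k l * X) * munit A n j e =
      if i = k ∧ l = j then munit A n e e * X else 0 := by
    intro e
    rw [((mem_awayFrom.1 hX) k l).eq, mul_assoc, mul_assoc, munit_mul]
    by_cases hl : l = j
    · subst hl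
      rw [if_pos rfl, ← ((mem_awayFrom.1 hX) k e).eq, ← mul_assoc, munit_mul]
      by_cases hk : i = k
      · simp [hk]
      · simp [hk]
    · rw [if_neg hl, if_neg (by tauto)]; simp
  rw [entry_apply, Finset.sum_congr rfl fun e _ => h1 e]
  split_ifs
  · rw [← Finset.sum_mul, sum_munit, one_mul]
  · simp

/-- The partial trace of `X` over the tensor factor `n`, weighted by the matrix `D`. -/
def ptrace (D : Matrix (Fin N) (Fin N) ℂ) (n : ℕ) : TOp N A →ₗ[ℂ] TOp N A :=
  ∑ i, ∑ j, D j i • entry n i j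

variable (D : Matrix (Fin N) (Fin N) ℂ)

theorem ptrace_apply (n : ℕ) (X : TOp N A) :
    ptrace D n X = ∑ i, ∑ j, D j i • entry n i j X := by
  simp [ptrace, LinearMap.sum_apply]

theorem ptrace_mem_self (n : ℕ) (X : TOp N A) : ptrace D n X ∈ awayFrom N A n := by
  rw [ptrace_apply]
  exact sum_mem fun i _ => sum_mem fun j _ => Subalgebra.smul_mem _ (entry_mem n i j X) _

theorem entry_mem_of_mem {m n : ℕ} (i j : Fin N) {X : TOp N A} (hX : X ∈ awayFrom N A m)
    (h : n ≠ m) : entry n i j X ∈ awayFrom N A m := by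
  rw [entry_apply]
  exact sum_mem fun e _ => mul_mem (mul_mem (munit_mem_awayFrom h _ _) hX)
    (munit_mem_awayFrom h _ _)

theorem ptrace_mem {m n : ℕ} {X : TOp N A} (hX : X ∈ awayFrom N A m) :
    ptrace D n X ∈ awayFrom N A m := by
  by_cases h : n = m
  · subst h; exact ptrace_mem_self D n X
  rw [ptrace_apply]
  exact sum_mem fun i _ => sum_mem fun j _ => Subalgebra.smul_mem _ (entry_mem_of_mem i j hX h) _

theorem ptrace_mul_left {n : ℕ} {a : TOp N A} (ha : a ∈ awayFrom N A n) (X : TOp N A) :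
    ptrace D n (a * X) = a * ptrace D n X := by
  have : ∀ i j, entry n i j (a * X) = a * entry n i j X := by
    intro i j
    rw [entry_apply, entry_apply, Finset.mul_sum]
    refine Finset.sum_congr rfl fun e _ => ?_
    rw [← mul_assoc, ((mem_awayFrom.1 ha) e i).eq]; simp only [mul_assoc]
  simp only [ptrace_apply, this, Finset.mul_sum, mul_smul_comm]

theorem ptrace_mul_right {n : ℕ} {a : TOp N A} (ha : a ∈ awayFrom N A n) (X : TOp N A) :
    ptrace D n (X * a) = ptrace D n X * a := by
  have : ∀ i j, entry n i j (X * a) = entry n i j X * a := by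
    intro i j
    rw [entry_apply, entry_apply, Finset.sum_mul]
    refine Finset.sum_congr rfl fun e _ => ?_
    rw [mul_assoc, mul_assoc, ← ((mem_awayFrom.1 ha) j e).eq]; simp only [mul_assoc]
  simp only [ptrace_apply, this, Finset.sum_mul, smul_mul_assoc]

theorem ptrace_munit_mul (n : ℕ) (k l : Fin N) {X : TOp N A} (hX : X ∈ awayFrom N A n) :
    ptrace D n (munit A n k l * X) = D l k • X := by
  rw [ptrace_apply]
  simp only [entry_munit_mul n _ _ k l hX]
  rw [Finset.sum_eq_single k]
  · rw [Finset.sum_eq_single l]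
    · simp
    · intro j _ hj; simp [hj.symm]
    · simp
  · intro i _ hi; simp [hi]
  · simp

theorem ptrace_munit (n : ℕ) (k l : Fin N) :
    ptrace D n (munit A n k l) = algebraMap ℂ (TOp N A) (D l k) := by
  have := ptrace_munit_mul (A := A) D n k l (one_mem _)
  rwa [mul_one, ← Algebra.algebraMap_eq_smul_one] at this

theorem ptrace_one (n : ℕ) :
    ptrace D n (1 : TOp N A) = algebraMap ℂ (TOp N A) D.trace := by
  rw [← sum_munit n, map_sum]
  simp only [ptrace_munit, Matrix.trace, Matrix.diag, map_sum]

theorem ptrace_actOne (n : ℕ) (X : Matrix (Fin N) (Fin N) A) :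
    ptrace D n (actOne n X) = coef N A ((D.map (algebraMap ℂ A) * X).trace) := by
  rw [actOne_eq_sum]
  simp only [map_sum, ptrace_mul_left D (coef_mem_awayFrom _ n), ptrace_munit, Matrix.trace,
    Matrix.diag, Matrix.mul_apply, Matrix.map_apply]
  rw [Finset.sum_comm]
  refine Finset.sum_congr rfl fun i _ => Finset.sum_congr rfl fun j _ => ?_
  rw [map_mul, AlgHom.commutes, Algebra.commutes]

/-- The weight is absorbed into the operator, which reduces cyclicity to the unweighted trace. -/
theorem ptrace_eq_one (n : ℕ) (X : TOp N A) :
    ptrace D n X = ptrace 1 n (X * actOneC A n D) := by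
  have h1 : ∀ i e, actOneC A n D * munit A n i e = ∑ j, D j i • munit A n j e := by
    intro i e
    rw [actOneC_eq_sum, Finset.sum_mul]
    refine Finset.sum_congr rfl fun a _ => ?_
    rw [Finset.sum_mul, Finset.sum_eq_single i]
    · rw [smul_mul_assoc, munit_mul, if_pos rfl]
    · intro b _ hb
      rw [smul_mul_assoc, munit_mul, if_neg hb, smul_zero]
    · simp
  rw [ptrace_apply, ptrace_apply]
  refine Finset.sum_congr rfl fun i _ => ?_
  rw [Finset.sum_eq_single i (f := fun j => (1 : Matrix (Fin N) (Fin N) ℂ) j i • _)]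
  · simp only [entry_apply, Matrix.one_apply_eq, one_smul, Finset.smul_sum]
    rw [Finset.sum_comm]
    refine Finset.sum_congr rfl fun e _ => ?_
    rw [← mul_assoc, mul_assoc _ (actOneC A n D), h1, Finset.mul_sum]
    simp only [mul_smul_comm]
  · intro j _ hj
    rw [Matrix.one_apply_ne hj, zero_smul]
  · simp

theorem ptrace_one_apply (n : ℕ) (X : TOp N A) :
    ptrace 1 n X = ∑ i, ∑ e, munit A n e i * X * munit A n i e := by
  rw [ptrace_apply]
  refine Finset.sum_congr rfl fun i _ => ?_
  rw [Finset.sum_eq_single i]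
  · simp [entry_apply]
  · intro j _ hj
    rw [Matrix.one_apply_ne hj, zero_smul]
  · simp

/-- Both sides single out the same block of X. Cyclicity is restricted to numerical factors because
coefficients in A do not commute. -/
theorem ptrace_one_munit_cyclic (n : ℕ) (k l : Fin N) (X : TOp N A) :
    ptrace 1 n (munit A n k l * X) = ptrace 1 n (X * munit A n k l) := by
  trans ∑ e, munit A n e l * X * munit A n k e
  · refine (ptrace_one_apply n _).trans ((Finset.sum_eq_single k ?_ ?_).trans ?_)
    rotate_left 2
    · refine Finset.sum_congr rfl fun e _ => ?_
      rw [← mul_assoc, munit_mul, if_pos rfl]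
    · intro i _ hi
      refine Finset.sum_eq_zero fun e _ => ?_
      rw [← mul_assoc, munit_mul, if_neg hi, zero_mul, zero_mul]
    · simp
  · symm
    refine (ptrace_one_apply n _).trans ((Finset.sum_eq_single l ?_ ?_).trans ?_)
    rotate_left 2
    · refine Finset.sum_congr rfl fun e _ => ?_
      rw [mul_assoc, mul_assoc, mul_assoc, munit_mul, if_pos rfl]
    · intro i _ hi
      refine Finset.sum_eq_zero fun e _ => ?_
      rw [mul_assoc, mul_assoc, munit_mul, if_neg hi.symm, mul_zero, mul_zero]
    · simp

/-- The trace over two factors is cyclic for operators that commute with the weights. -/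
theorem ptrace_ptrace_cyclic {m n : ℕ} (h : m ≠ n) (Y : TensorMat N 2 ℂ)
    (hY : Commute (actTwo A m n h Y) (actOneC A n D * actOneC A m D)) (X : TOp N A) :
    ptrace D m (ptrace D n (actTwo A m n h Y * X)) =
      ptrace D m (ptrace D n (X * actTwo A m n h Y)) := by
  have hD : ∀ Z : TOp N A, ptrace D m (ptrace D n Z) =
      ptrace 1 m (ptrace 1 n (Z * (actOneC A n D * actOneC A m D))) := by
    intro Z
    rw [ptrace_eq_one D m, ptrace_eq_one D n, ← ptrace_mul_right _ (actOneC_mem_awayFrom h _),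
      mul_assoc]
  have hc : ∀ Z : TOp N A, ptrace 1 m (ptrace 1 n (actTwo A m n h Y * Z)) =
      ptrace 1 m (ptrace 1 n (Z * actTwo A m n h Y)) := by
    intro Z
    have h1 : ∀ a b c d, ptrace 1 m (ptrace 1 n (munit A m a c * munit A n b d * Z)) =
        ptrace 1 m (ptrace 1 n (Z * (munit A m a c * munit A n b d))) := by
      intro a b c d
      rw [mul_assoc, ptrace_mul_left _ (munit_mem_awayFrom h a c), ptrace_one_munit_cyclic n,
        ptrace_one_munit_cyclic m, ← ptrace_mul_right _ (munit_mem_awayFrom h a c), mul_assoc,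
        (munit_commute h.symm b d a c).eq]
    simp only [actTwo_eq_sum, Finset.sum_mul, Finset.mul_sum, map_sum, smul_mul_assoc,
      mul_smul_comm, map_smul, h1]
  rw [hD, hD, mul_assoc, hc, mul_assoc, ← hY.eq, mul_assoc]

/-! ### Partial traces of matrices of operators -/

/-- The partial trace over the last tensor factor, weighted by `D`. -/
def traceLast {n : ℕ} (Y : TensorMat N (n + 1) A) : TensorMat N n A :=
  Matrix.of fun a b => ∑ i, ∑ j, D j i • Y (Fin.snoc a i) (Fin.snoc b j)

/-- The embedding of the first `n` sites. -/
def firstSites (n : ℕ) : Fin n ↪ ℕ := ⟨Fin.val, Fin.val_injective⟩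

theorem extend_firstSites_succ {n : ℕ} (b : Fin n → Fin N) (j : Fin N) (a : ℕ → Fin N) :
    Function.extend (firstSites (n + 1)) (Fin.snoc b j : Fin (n + 1) → Fin N) a =
      Function.update (Function.extend (firstSites n) b a) n j := by
  funext k
  rcases lt_trichotomy k n with h | h | h
  · rw [Function.update_of_ne h.ne]
    have e1 := (firstSites (n + 1)).injective.extend_apply
      (Fin.snoc b j : Fin (n + 1) → Fin N) a (⟨k, h⟩ : Fin n).castSucc
    have e2 := (firstSites n).injective.extend_apply b a ⟨k, h⟩
    rw [Fin.snoc_castSucc] at e1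
    exact e1.trans e2.symm
  · subst h
    rw [Function.update_self]
    have e1 := (firstSites (k + 1)).injective.extend_apply
      (Fin.snoc b j : Fin (k + 1) → Fin N) a (Fin.last k)
    rw [Fin.snoc_last] at e1
    exact e1
  · rw [Function.update_of_ne h.ne', Function.extend_apply', Function.extend_apply']
    · rintro ⟨i, hi⟩
      have : (i : ℕ) = k := hi
      omega
    · rintro ⟨i, hi⟩
      have : (i : ℕ) = k := hi
      omega

theorem extend_firstSites_update {n : ℕ} (b : Fin n → Fin N) (i j : Fin N) (a : ℕ → Fin N) :
    Function.update (Function.extend (firstSites n) b (Function.update a n i)) n j =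
      Function.update (Function.extend (firstSites n) b a) n j := by
  funext k
  rcases eq_or_ne k n with rfl | h
  · simp
  · rw [Function.update_of_ne h, Function.update_of_ne h]
    by_cases hk : ∃ l, firstSites n l = k
    · obtain ⟨l, rfl⟩ := hk
      rw [(firstSites n).injective.extend_apply, (firstSites n).injective.extend_apply]
    · rw [Function.extend_apply' _ _ _ hk, Function.extend_apply' _ _ _ hk,
        Function.update_of_ne h]

theorem sum_snoc {M : Type*} [AddCommMonoid M] {n : ℕ} (f : (Fin (n + 1) → Fin N) → M) :
    ∑ b, f b = ∑ b : Fin n → Fin N, ∑ j, f (Fin.snoc b j) := by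
  rw [← (Fin.snocEquiv fun _ => Fin N).sum_comp, Fintype.sum_prod_type, Finset.sum_comm]
  rfl

theorem sum_cons {M : Type*} [AddCommMonoid M] {n : ℕ} (f : (Fin (n + 1) → Fin N) → M) :
    ∑ b, f b = ∑ j, ∑ b : Fin n → Fin N, f (Fin.cons j b) := by
  rw [← (Fin.consEquiv fun _ => Fin N).sum_comp, Fintype.sum_prod_type]
  rfl

theorem comp_firstSites_succ {n : ℕ} (a : ℕ → Fin N) :
    a ∘ firstSites (n + 1) = (Fin.snoc (a ∘ firstSites n) (a n) : Fin (n + 1) → Fin N) := by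
  funext k
  refine Fin.lastCases ?_ (fun i => ?_) k
  · rw [Fin.snoc_last]; rfl
  · rw [Fin.snoc_castSucc]; rfl

theorem act_traceLast {n : ℕ} (Y : TensorMat N (n + 1) A) :
    act (firstSites n) (traceLast D Y) = ptrace D n (act (firstSites (n + 1)) Y) := by
  refine LinearMap.ext fun F => funext fun a => ?_
  have h1 : ∀ i j, entry n i j (act (firstSites (n + 1)) Y) F a =
      ∑ b : Fin n → Fin N, Y (Fin.snoc (a ∘ firstSites n) i) (Fin.snoc b j) *
        F (Function.extend (firstSites n) b a) := by
    intro i j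
    simp only [entry_apply, LinearMap.sum_apply, Finset.sum_apply, Module.End.mul_apply,
      munit_apply]
    rw [Finset.sum_eq_single (a n)]
    · rw [if_pos rfl, act_apply, sum_snoc]
      refine Finset.sum_congr rfl fun b _ => ?_
      rw [Finset.sum_eq_single j]
      · have e1 : Function.update (Function.extend (firstSites n) b (Function.update a n i)) n j n = j :=
          Function.update_self ..
        have e2 : Function.update (Function.update
            (Function.extend (firstSites n) b (Function.update a n i)) n j) n (a n) =
            Function.extend (firstSites n) b a := by
          rw [Function.update_idem, extend_firstSites_update, Function.update_eq_self_iff,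
            Function.extend_apply']
          rintro ⟨l, hl⟩
          exact Nat.ne_of_lt l.2 hl
        have e3 : Function.update a n i ∘ firstSites n = a ∘ firstSites n :=
          funext fun l => Function.update_of_ne (Nat.ne_of_lt l.2) _ _
        rw [extend_firstSites_succ, comp_firstSites_succ, munit_apply, Function.update_self,
          if_pos e1, e2, e3]
      · intro k _ hk
        rw [extend_firstSites_succ, munit_apply, Function.update_self, if_neg hk, mul_zero]
      · simp
    · intro e _ he
      rw [if_neg he.symm]
    · simp
  rw [ptrace_apply]
  simp only [LinearMap.sum_apply, Finset.sum_apply, LinearMap.smul_apply, Pi.smul_apply, h1,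
    act_apply, traceLast, Matrix.of_apply, Finset.sum_mul, Finset.smul_sum, smul_mul_assoc]
  rw [Finset.sum_comm]
  refine Finset.sum_congr rfl fun i _ => ?_
  rw [Finset.sum_comm]

/-- The composition of the maps `E s, …, E (s + n - 1)`. -/
def mtrace {H : Type*} [AddCommMonoid H] [Module ℂ H] (E : ℕ → H →ₗ[ℂ] H) (s : ℕ) : ℕ → H →ₗ[ℂ] H
  | 0 => LinearMap.id
  | n + 1 => mtrace E s n ∘ₗ E (s + n)

theorem traceTail_apply (R : RMatrix N) {m : ℕ} (Y : TensorMat N (m + 1) A) (i j : Fin N) :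
    traceTail (dTail A R m * Y) i j = ∑ c : Fin m → Fin N, ∑ b : Fin m → Fin N,
      (∏ k, skewD R.mat (c k) (b k)) • Y (Fin.cons i b) (Fin.cons j c) := by
  simp only [traceTail, Matrix.of_apply, Matrix.mul_apply]
  refine Finset.sum_congr rfl fun c _ => ?_
  rw [sum_cons, Finset.sum_eq_single i]
  · refine Finset.sum_congr rfl fun b _ => ?_
    simp [dTail, Algebra.smul_def]
  · intro k _ hk
    refine Finset.sum_eq_zero fun b _ => ?_
    simp [dTail, hk.symm]
  · simp

theorem traceTail_succ (R : RMatrix N) {m : ℕ} (Y : TensorMat N (m + 1 + 1) A) :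
    traceTail (dTail A R (m + 1) * Y) =
      traceTail (dTail A R m * traceLast (skewD R.mat) Y) := by
  ext i j
  rw [traceTail_apply, traceTail_apply, sum_snoc]
  refine Finset.sum_congr rfl fun c _ => ?_
  simp only [traceLast, Matrix.of_apply, Finset.smul_sum]
  simp only [sum_snoc (n := m)]
  rw [Finset.sum_comm]
  refine Finset.sum_congr rfl fun b _ => ?_
  rw [Finset.sum_comm]
  refine Finset.sum_congr rfl fun k _ => Finset.sum_congr rfl fun l _ => ?_
  rw [Fin.prod_univ_castSucc, smul_smul]
  simp only [Fin.snoc_castSucc, Fin.snoc_last, Fin.cons_snoc_eq_snoc_cons]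

/-- The weighted trace over all factors but the first is a composition of one-site traces, the last
site being traced first; the induction splits off the last factor. -/
theorem actOne_traceTail (R : RMatrix N) {m : ℕ} (Y : TensorMat N (m + 1) A) :
    actOne 0 (traceTail (dTail A R m * Y)) =
      mtrace (ptrace (skewD R.mat)) 1 m (act (firstSites (m + 1)) Y) := by
  induction m with
  | zero =>
    have h : firstSites 1 = site 0 := by
      ext i; exact congrArg Fin.val (Subsingleton.elim i 0)
    rw [mtrace, h, actOne_eq, LinearMap.id_apply]
    congr 1
    ext a b
    rw [Matrix.of_apply, traceTail_apply]
    have h2 : ∀ (a : Fin 1 → Fin N) (c : Fin 0 → Fin N),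
        (Fin.cons (a 0) c : Fin 1 → Fin N) = a := fun a c => by
      funext k; rw [Fin.fin_one_eq_zero k]; rfl
    simp [h2]
  | succ m ih =>
    rw [traceTail_succ, ih, act_traceLast, mtrace, add_comm 1 m]
    rfl

end PartialTrace

/-! ### R-matrices acting in an infinite tensor power -/

section RMatrixAction

variable {A : Type*} [Ring A] [Algebra ℂ A] {N : ℕ}

/-- The embedding of three sites. -/
def threeSites (l m n : ℕ) (h1 : l ≠ m) (h2 : m ≠ n) (h3 : l ≠ n) : Fin 3 ↪ ℕ :=
  ⟨![l, m, n], by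
    intro a b hab
    fin_cases a <;> fin_cases b <;> simp_all [h1.symm, h2.symm, h3.symm]⟩

theorem actC_loc_zero {l m n : ℕ} (h1 : l ≠ m) (h2 : m ≠ n) (h3 : l ≠ n) (X : TensorMat N 2 ℂ) :
    actC A (threeSites l m n h1 h2 h3) (loc (0 : Fin 2) X) = actTwo A l m h1 X := by
  have := actC_onSites (A := A) (threeSites l m n h1 h2 h3)
    ⟨adj (0 : Fin 2), adj_injective 0⟩ X
  refine this.trans ?_
  rw [actTwo]
  congr 1
  congr 1
  ext i
  fin_cases i <;> rfl

theorem actC_loc_one {l m n : ℕ} (h1 : l ≠ m) (h2 : m ≠ n) (h3 : l ≠ n) (X : TensorMat N 2 ℂ) :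
    actC A (threeSites l m n h1 h2 h3) (loc (1 : Fin 2) X) = actTwo A m n h2 X := by
  have := actC_onSites (A := A) (threeSites l m n h1 h2 h3)
    ⟨adj (1 : Fin 2), adj_injective 1⟩ X
  refine this.trans ?_
  rw [actTwo]
  congr 1
  congr 1
  ext i
  fin_cases i <;> rfl

/-- With the indices regrouped as in the definition of skew invertibility, Ψ is the inverse matrix
of X, so a linear system with coefficients X is solved by applying Ψ. -/
theorem skew_solve {M : Type*} [AddCommGroup M] [Module ℂ M] {X Ψ : TensorMat N 2 ℂ}
    (h : IsSkewInverse X Ψ) {Q G : Fin N → Fin N → M}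
    (hQ : ∀ y b, ∑ d, ∑ e, X ![y, e] ![b, d] • Q d e = G y b) (p p' : Fin N) :
    Q p p' = ∑ b, ∑ y, Ψ ![p, b] ![p', y] • G y b := by
  simp only [← hQ, Finset.smul_sum, smul_smul]
  symm
  calc _ = ∑ d, ∑ e, (∑ b, ∑ y, Ψ ![p, b] ![p', y] * X ![y, e] ![b, d]) • Q d e := by
        simp only [Finset.sum_smul]
        rw [Finset.sum_congr rfl fun b _ => Finset.sum_comm, Finset.sum_comm]
        refine Finset.sum_congr rfl fun d _ => ?_
        rw [Finset.sum_congr rfl fun b _ => Finset.sum_comm, Finset.sum_comm]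
    _ = Q p p' := by
        simp only [(h _ _ _ _).2]
        rw [Finset.sum_eq_single p]
        · rw [Finset.sum_eq_single p']
          · simp
          · intro e _ he; simp [he]
          · simp
        · intro d _ hd
          refine Finset.sum_eq_zero fun e _ => ?_
          rw [if_neg (fun h => hd h.1.symm), zero_smul]
        · simp

theorem entry_one (n : ℕ) (i j : Fin N) :
    entry n i j (1 : TOp N A) = if i = j then 1 else 0 := by
  rw [entry_apply]
  simp only [mul_one, munit_mul]
  split_ifs
  · exact sum_munit n
  · simp

theorem entry_munit_mul_same (n : ℕ) (i j k l : Fin N) {X : TOp N A} (hX : X ∈ awayFrom N A n) :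
    entry n i j (munit A n k l * X) = if i = k then (if l = j then X else 0) else 0 := by
  rw [entry_munit_mul n i j k l hX]
  split_ifs <;> tauto

theorem entry_actTwo (m n : ℕ) (h : m ≠ n) (X : TensorMat N 2 ℂ) (a c : Fin N) :
    entry m a c (actTwo A m n h X) = ∑ b, ∑ d, X ![a, b] ![c, d] • munit A n b d := by
  rw [actTwo_eq_sum]
  simp only [map_sum, map_smul, entry_munit_mul_same m _ _ _ _ (munit_mem_awayFrom h.symm _ _)]
  rw [Finset.sum_eq_single a]
  · refine Finset.sum_congr rfl fun b _ => ?_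
    rw [Finset.sum_eq_single c]
    · simp
    · intro c' _ hc; simp [hc]
    · simp
  · intro a' _ ha
    simp [ha.symm]
  · simp

theorem ptrace_actTwo (D : Matrix (Fin N) (Fin N) ℂ) (m n : ℕ) (h : m ≠ n)
    (X : TensorMat N 2 ℂ) : ptrace D n (actTwo A m n h X) =
      ∑ a, ∑ c, (∑ b, ∑ d, X ![a, b] ![c, d] * D d b) • munit A m a c := by
  rw [actTwo_eq_sum]
  simp only [map_sum, map_smul, ptrace_mul_left D (munit_mem_awayFrom h _ _), ptrace_munit,
    Finset.sum_smul]
  refine Finset.sum_congr rfl fun a _ => ?_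
  rw [Finset.sum_comm]
  refine Finset.sum_congr rfl fun b _ => Finset.sum_congr rfl fun c _ =>
    Finset.sum_congr rfl fun d _ => ?_
  rw [← Algebra.commutes, ← Algebra.smul_def, smul_smul]

theorem IsSkewInvertible.spec {X : TensorMat N 2 ℂ} (h : IsSkewInvertible X) :
    IsSkewInverse X (skewInv X) := by
  rw [skewInv, dif_pos h]
  exact h.choose_spec

/-- The R-trace of a skew invertible operator over its second factor is the identity. -/
theorem ptrace_skew {X : TensorMat N 2 ℂ} (hX : IsSkewInvertible X) (m n : ℕ) (h : m ≠ n) :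
    ptrace (skewD X) n (actTwo A m n h X) = 1 := by
  have h1 : ∀ a c, ∑ b, ∑ d, X ![a, b] ![c, d] * skewD X d b = if a = c then 1 else 0 := by
    intro a c
    have h2 := fun e => (hX.spec a e c e).1
    -- Since D is a trace of Ψ, this is the first skew-inverse identity traced over the third
    -- factor, and the permutation traces to the identity.
    have h3 : ∑ b, ∑ d, X ![a, b] ![c, d] * skewD X d b =
        ∑ e, ∑ b, ∑ d, X ![a, b] ![c, d] * skewInv X ![d, e] ![b, e] := by
      simp only [skewD, Matrix.of_apply, Finset.mul_sum]
      rw [Finset.sum_comm (s := (Finset.univ : Finset (Fin N))) (t := Finset.univ)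
        (f := fun e b => ∑ d, X ![a, b] ![c, d] * skewInv X ![d, e] ![b, e])]
      exact Finset.sum_congr rfl fun b _ => Finset.sum_comm
    rw [h3]
    simp only [h2]
    rw [Finset.sum_eq_single a]
    · simp
    · intro e _ he; simp [he.symm]
    · simp
  rw [ptrace_actTwo]
  simp only [h1]
  rw [← sum_munit m]
  refine Finset.sum_congr rfl fun a _ => ?_
  rw [Finset.sum_eq_single a]
  · simp
  · intro c _ hc; simp [hc.symm]
  · simp

/-- Invariance of the R-trace under conjugation. -/
theorem ptrace_conj {X : TensorMat N 2 ℂ} (hX : IsSkewInvertible X) {s m n : ℕ} (hsm : s ≠ m)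
    (hmn : m ≠ n) (hsn : s ≠ n) (U V : TensorMat N 2 ℂ)
    (h : ptrace (skewD X) n (actTwo A m n hmn U * actTwo A s m hsm X * actTwo A m n hmn V) = 1) :
    (∀ i j, ptrace (skewD X) n (actTwo A m n hmn U * munit A m i j * actTwo A m n hmn V) =
      algebraMap ℂ _ (skewD X j i)) ∧
    ∀ Z ∈ awayFrom N A n, ptrace (skewD X) n (actTwo A m n hmn U * Z * actTwo A m n hmn V) =
      ptrace (skewD X) m Z := by
  set u := actTwo A m n hmn U
  set v := actTwo A m n hmn V
  set W : Fin N → Fin N → TOp N A := fun i j => ptrace (skewD X) n (u * munit A m i j * v) with hW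
  have hu : u ∈ awayFrom N A s := actTwo_mem_awayFrom hmn hsm.symm hsn.symm U
  have hv : v ∈ awayFrom N A s := actTwo_mem_awayFrom hmn hsm.symm hsn.symm V
  have hWm : ∀ i j, W i j ∈ awayFrom N A s := fun i j =>
    ptrace_mem _ (mul_mem (mul_mem hu (munit_mem_awayFrom hsm.symm i j)) hv)
  -- With X expanded in matrix units, the hypothesis becomes a linear system with coefficients X for
  -- the traces W of the conjugated matrix units. The skew inverse solves it, and the solution is D.
  have h1 : ∑ a, ∑ b, ∑ c, ∑ d, X ![a, b] ![c, d] • (munit A s a c * W b d) = 1 := by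
    rw [← h, actTwo_eq_sum s m]
    simp only [Finset.mul_sum, Finset.sum_mul, map_sum, mul_smul_comm, smul_mul_assoc, map_smul]
    refine Finset.sum_congr rfl fun a _ => Finset.sum_congr rfl fun b _ =>
      Finset.sum_congr rfl fun c _ => Finset.sum_congr rfl fun d _ => ?_
    rw [← mul_assoc, ← ((mem_awayFrom.1 hu) a c).eq, mul_assoc, mul_assoc,
      ptrace_mul_left _ (munit_mem_awayFrom hsn a c), hW]
    simp only [mul_assoc]
  have h2 : ∀ a c, ∑ d, ∑ b, X ![a, b] ![c, d] • W b d = if a = c then 1 else 0 := by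
    intro a c
    have := congrArg (entry s a c) h1
    rw [entry_one] at this
    rw [← this]
    simp only [map_sum, map_smul, entry_munit_mul_same s _ _ _ _ (hWm _ _)]
    rw [Finset.sum_comm]
    symm
    rw [Finset.sum_eq_single a]
    · refine Finset.sum_congr rfl fun b _ => ?_
      rw [Finset.sum_eq_single c]
      · simp
      · intro c' _ hc; simp [hc]
      · simp
    · intro a' _ ha
      simp [ha.symm]
    · simp
  have h3 : ∀ i j, W i j = algebraMap ℂ _ (skewD X j i) := by
    intro i j
    have := skew_solve hX.spec (Q := fun d b => W b d) h2 j i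
    rw [this, skewD, Matrix.of_apply, map_sum]
    refine Finset.sum_congr rfl fun b _ => ?_
    rw [Finset.sum_eq_single b]
    · simp [Algebra.algebraMap_eq_smul_one]
    · intro y _ hy; simp [hy]
    · simp
  refine ⟨h3, fun Z hZ => ?_⟩
  -- A general Z is a combination of matrix units at site m whose coefficients commute with v and
  -- with the trace.
  conv_lhs => rw [← sum_entry m Z]
  simp only [Finset.mul_sum, Finset.sum_mul, map_sum]
  rw [ptrace_apply]
  refine Finset.sum_congr rfl fun i _ => Finset.sum_congr rfl fun j _ => ?_
  have hn : entry m i j Z ∈ awayFrom N A n := entry_mem_of_mem i j hZ hmn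
  have hc : Commute v (entry m i j Z) := actTwo_commute hmn V (entry_mem m i j Z) hn
  rw [mul_assoc, mul_assoc, ← hc.eq, ← mul_assoc, ← mul_assoc, ptrace_mul_right _ hn]
  change W i j * _ = _
  rw [h3, ← Algebra.smul_def]

theorem two_mul_apply (X Y : TensorMat N 2 ℂ) (a b c d : Fin N) :
    (X * Y) ![a, b] ![c, d] = ∑ e, ∑ f, X ![a, b] ![e, f] * Y ![e, f] ![c, d] := by
  rw [Matrix.mul_apply, ← (finTwoArrowEquiv (Fin N)).symm.sum_comp, Fintype.sum_prod_type]
  rfl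

/-- The operator `D ⊗ D`. -/
def tensorSq (D : Matrix (Fin N) (Fin N) ℂ) : TensorMat N 2 ℂ :=
  Matrix.of fun a b => D (a 0) (b 0) * D (a 1) (b 1)

theorem actTwo_tensorSq (D : Matrix (Fin N) (Fin N) ℂ) (m n : ℕ) (h : m ≠ n) :
    actTwo A m n h (tensorSq D) = actOneC A m D * actOneC A n D := by
  rw [actTwo_eq_sum, actOneC_eq_sum, actOneC_eq_sum]
  simp only [Finset.sum_mul, Finset.mul_sum, tensorSq, Matrix.of_apply, Matrix.cons_val_zero,
    Matrix.cons_val_one, smul_mul_smul_comm]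
  symm
  calc _ = ∑ b, ∑ a, ∑ d, ∑ c, (D a c * D b d) • (munit A m a c * munit A n b d) := by
        refine Finset.sum_congr rfl fun b _ => ?_
        rw [Finset.sum_comm]
    _ = _ := by
        rw [Finset.sum_comm]
        exact Finset.sum_congr rfl fun a _ => Finset.sum_congr rfl fun b _ => Finset.sum_comm

/-- Written in entries, each conjugation identity is a linear system for a product of S with D in
one factor, and Ψ solves it. Multiplying by the other D turns (D ⊗ D)S and S(D ⊗ D) into the same
sum of terms ΨDD. -/
theorem skewD_commute_of_conj {X S : TensorMat N 2 ℂ} (hX : IsSkewInvertible X)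
    (h1 : ∀ i j, ptrace (skewD X) 1 (actTwo ℂ 0 1 zero_ne_one S * munit ℂ 0 i j *
      actTwo ℂ 0 1 zero_ne_one X) = algebraMap ℂ _ (skewD X j i))
    (h2 : ∀ i j, ptrace (skewD X) 1 (actTwo ℂ 0 1 zero_ne_one X * munit ℂ 0 i j *
      actTwo ℂ 0 1 zero_ne_one S) = algebraMap ℂ _ (skewD X j i)) :
    tensorSq (skewD X) * S = S * tensorSq (skewD X) := by
  set D := skewD X with hD
  have key : ∀ (Y Z : TensorMat N 2 ℂ), (∀ i j, ptrace D 1 (actTwo ℂ 0 1 zero_ne_one Y *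
      munit ℂ 0 i j * actTwo ℂ 0 1 zero_ne_one Z) = algebraMap ℂ _ (D j i)) →
      ∀ x y a b, ∑ d, ∑ e, ∑ c, D d c * Y ![a, c] ![x, e] * Z ![y, e] ![b, d] =
        if a = b then D y x else 0 := by
    intro Y Z h x y a b
    -- The matrix unit (x, y) of the first factor, as an operator on V ⊗ V.
    set K : TensorMat N 2 ℂ :=
      Matrix.of fun s t => if s 0 = x ∧ t 0 = y ∧ s 1 = t 1 then 1 else 0 with hKdef
    have hYK : ∀ c y' e', (Y * K) ![a, c] ![y', e'] = if y' = y then Y ![a, c] ![x, e'] else 0 := by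
      intro c y' e'
      rw [two_mul_apply, Finset.sum_eq_single x, Finset.sum_eq_single e']
      · simp [hKdef]
      · intro f _ hf; simp [hKdef, hf]
      · simp
      · intro f _ hf; simp [hKdef, hf]
      · simp
    have hK : ∀ c d, (Y * K * Z) ![a, c] ![b, d] = ∑ e, Y ![a, c] ![x, e] * Z ![y, e] ![b, d] := by
      intro c d
      rw [two_mul_apply, Finset.sum_eq_single y]
      · simp [hYK]
      · intro f _ hf; simp [hYK, hf]
      · simp
    have e1 : munit ℂ 0 x y = actTwo ℂ 0 1 zero_ne_one K := by
      rw [hKdef, actTwo_eq_sum, Finset.sum_eq_single x]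
      · rw [← mul_one (munit ℂ 0 x y), ← sum_munit 1, Finset.mul_sum]
        refine Finset.sum_congr rfl fun b _ => ?_
        symm
        rw [Finset.sum_eq_single y, Finset.sum_eq_single b]
        · simp
        all_goals simp +contextual [eq_comm]
      · intro a _ ha; simp [ha]
      · simp
    have h' := congrArg (fun Q => entry 0 a b Q (fun _ => 1) (fun _ => a)) (h x y)
    rw [e1, ← map_mul, ← map_mul, ptrace_actTwo] at h'
    simp only [map_sum, map_smul, Algebra.algebraMap_eq_smul_one, entry_one] at h'
    have e2 : ∀ c d, entry 0 a b (munit ℂ 0 c d) = if a = c then (if d = b then 1 else 0) else 0 := by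
      intro c d
      have := entry_munit_mul_same (A := ℂ) 0 a b c d (one_mem _)
      rwa [mul_one] at this
    simp only [e2] at h'
    rw [Finset.sum_eq_single a, Finset.sum_eq_single b] at h'
    · have e3 : (D y x • if a = b then (1 : TOp N ℂ) else 0) (fun _ => 1) (fun _ => a) =
          if a = b then D y x else 0 := by split_ifs <;> simp
      rw [e3] at h'
      rw [← h']
      simp only [if_true, LinearMap.smul_apply, Module.End.one_apply, Pi.smul_apply, smul_eq_mul,
        mul_one, hK, Finset.sum_mul]
      rw [Finset.sum_congr rfl fun d _ => Finset.sum_comm, Finset.sum_comm]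
      exact Finset.sum_congr rfl fun _ _ => Finset.sum_congr rfl fun _ _ =>
        Finset.sum_congr rfl fun _ _ => by ring
    · intro c _ hc; simp [hc]
    · simp
    · intro c _ hc; simp [hc.symm]
    · simp
  have ha : ∀ a x p p', ∑ c, D p c * S ![a, c] ![x, p'] =
      ∑ y, skewInv X ![p, a] ![p', y] * D y x := by
    intro a x p p'
    have := skew_solve hX.spec (Q := fun d e => ∑ c, D d c * S ![a, c] ![x, e])
      (G := fun y b => if a = b then D y x else 0) (fun y b => by
        rw [← key S X h1 x y a b]
        simp only [smul_eq_mul, Finset.mul_sum]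
        refine Finset.sum_congr rfl fun _ _ => Finset.sum_congr rfl fun _ _ =>
          Finset.sum_congr rfl fun _ _ => ?_
        ring) p p'
    rw [this, Finset.sum_eq_single a]
    · simp
    · intro b _ hb; simp [hb.symm]
    · simp
  have hb : ∀ b y p p', ∑ d, S ![y, p] ![b, d] * D d p' =
      ∑ x, skewInv X ![p, x] ![p', b] * D y x := by
    intro b y p p'
    have := skew_solve hX.spec (Q := fun e c => ∑ d, S ![y, e] ![b, d] * D d c)
      (G := fun a x => if a = b then D y x else 0) (fun a x => by
        rw [← key X S h2 x y a b]
        simp only [smul_eq_mul, Finset.mul_sum]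
        symm
        rw [Finset.sum_comm]
        refine Finset.sum_congr rfl fun _ _ => ?_
        rw [Finset.sum_comm]
        refine Finset.sum_congr rfl fun _ _ => Finset.sum_congr rfl fun _ _ => ?_
        ring) p p'
    rw [this]
    refine Finset.sum_congr rfl fun x _ => ?_
    rw [Finset.sum_eq_single b]
    · simp
    · intro b' _ hb; simp [hb]
    · simp
  ext s t
  obtain ⟨⟨y, p⟩, rfl⟩ := (finTwoArrowEquiv (Fin N)).symm.surjective s
  obtain ⟨⟨b, p'⟩, rfl⟩ := (finTwoArrowEquiv (Fin N)).symm.surjective t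
  change (tensorSq D * S) ![y, p] ![b, p'] = (S * tensorSq D) ![y, p] ![b, p']
  rw [two_mul_apply, two_mul_apply]
  simp only [tensorSq, Matrix.of_apply, Matrix.cons_val_zero, Matrix.cons_val_one]
  trans ∑ a, ∑ x, skewInv X ![p, a] ![p', x] * D y a * D x b
  · refine Finset.sum_congr rfl fun a _ => ?_
    have := congrArg (fun w => D y a * w) (ha a b p p')
    simp only [Finset.mul_sum] at this
    refine Eq.trans ?_ (this.trans ?_)
    · exact Finset.sum_congr rfl fun _ _ => by ring
    · exact Finset.sum_congr rfl fun _ _ => by ring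
  · rw [Finset.sum_comm]
    refine Finset.sum_congr rfl fun x _ => ?_
    have := congrArg (fun w => w * D x b) (hb x y p p')
    simp only [Finset.sum_mul] at this
    refine Eq.trans ?_ (this.symm.trans ?_)
    · exact Finset.sum_congr rfl fun _ _ => by ring
    · exact Finset.sum_congr rfl fun _ _ => by ring

end RMatrixAction

/-! ### Towers of braid operators with a compatible trace -/

/-- The relations between copies of a quantum matrix, R-matrices and partial R-traces on an
infinite tensor power. -/
structure QMTower (q μ : ℂ) (H : Type*) [Ring H] [Algebra ℂ H] where
  r : ℕ → Hˣ
  f : ℕ → Hˣ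
  T : H
  E : ℕ → H →ₗ[ℂ] H
  away : ℕ → Subalgebra ℂ H
  r_away : ∀ {n m}, m ≠ n → m ≠ n + 1 → (r n : H) ∈ away m
  rinv_away : ∀ {n m}, m ≠ n → m ≠ n + 1 → ((r n)⁻¹ : Hˣ).val ∈ away m
  f_away : ∀ {n m}, m ≠ n → m ≠ n + 1 → (f n : H) ∈ away m
  finv_away : ∀ {n m}, m ≠ n → m ≠ n + 1 → ((f n)⁻¹ : Hˣ).val ∈ away m
  r_comm : ∀ {n X}, X ∈ away n → X ∈ away (n + 1) → Commute (r n : H) X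
  f_comm : ∀ {n X}, X ∈ away n → X ∈ away (n + 1) → Commute (f n : H) X
  T_away : ∀ {n}, 0 < n → T ∈ away n
  E_away_self : ∀ n X, E n X ∈ away n
  E_away : ∀ {m} n {X}, X ∈ away m → E n X ∈ away m
  E_mul_left : ∀ {n a} X, a ∈ away n → E n (a * X) = a * E n X
  E_mul_right : ∀ {n a} X, a ∈ away n → E n (X * a) = E n X * a
  E_one : ∀ n, E n 1 = algebraMap ℂ H (bmwEta q μ * μ)
  E_r : ∀ n, E (n + 1) (r n : H) = 1
  E_contr : ∀ n, E (n + 1) (contr q μ (r n : H)) = algebraMap ℂ H μ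
  E_conj_f : ∀ n {X}, X ∈ away (n + 1) → E (n + 1) (f n * X * ((f n)⁻¹ : Hˣ)) = E n X
  E_conj_r : ∀ n {X}, X ∈ away (n + 1) → E (n + 1) (r n * X * ((r n)⁻¹ : Hˣ)) = E n X
  E_conj_r' : ∀ n {X}, X ∈ away (n + 1) → E (n + 1) (((r n)⁻¹ : Hˣ) * X * r n) = E n X
  E_cyc : ∀ n X, E n (E (n + 1) (r n * X)) = E n (E (n + 1) (X * r n))
  good : GoodParams q μ
  eta_ne : bmwEta q μ ≠ 0
  bmw : ∀ n, IsBMWSeq q μ n r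
  f_braid : ∀ n, f n * f (n + 1) * f n = f (n + 1) * f n * f (n + 1)
  compat : ∀ n, r n * f (n + 1) * f n = f (n + 1) * f n * r (n + 1)
  compat' : ∀ n, r (n + 1) * f n * f (n + 1) = f n * f (n + 1) * r n
  rmm : (r 0 : H) * T * (f 0 * T * ((f 0)⁻¹ : Hˣ)) = T * (f 0 * T * ((f 0)⁻¹ : Hˣ)) * r 0

section Tower

variable {A : Type*} [Ring A] [Algebra ℂ A] {N : ℕ}

/-- The R-matrix acting in the tensor factors `m` and `n`. -/
def RMatrix.actU (R : RMatrix N) (A : Type*) [Ring A] [Algebra ℂ A] (m n : ℕ) (h : m ≠ n) :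
    (TOp N A)ˣ where
  val := actTwo A m n h R.mat
  inv := actTwo A m n h R.inv
  val_inv := by rw [← map_mul, RMatrix.mat, RMatrix.inv, Units.mul_inv, map_one]
  inv_val := by rw [← map_mul, RMatrix.mat, RMatrix.inv, Units.inv_mul, map_one]

theorem RMatrix.actU_val (R : RMatrix N) (m n : ℕ) (h : m ≠ n) :
    (R.actU A m n h : TOp N A) = actTwo A m n h R.mat := rfl

theorem IsCompatible.self (R : RMatrix N) : IsCompatible R R := ⟨R.ybe, R.ybe.symm⟩

theorem IsCompatible.act {R F : RMatrix N} (h : IsCompatible R F) (l m n : ℕ) (h1 : l ≠ m)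
    (h2 : m ≠ n) (h3 : l ≠ n) :
    R.actU A l m h1 * F.actU A m n h2 * F.actU A l m h1 =
      F.actU A m n h2 * F.actU A l m h1 * R.actU A m n h2 ∧
    R.actU A m n h2 * F.actU A l m h1 * F.actU A m n h2 =
      F.actU A l m h1 * F.actU A m n h2 * R.actU A l m h1 := by
  constructor
  · have := congrArg (actC A (threeSites l m n h1 h2 h3)) h.1
    simp only [map_mul, actC_loc_zero, actC_loc_one] at this
    exact Units.ext this
  · have := congrArg (actC A (threeSites l m n h1 h2 h3)) h.2
    simp only [map_mul, actC_loc_zero, actC_loc_one] at this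
    exact Units.ext this

theorem actU_mem {R : RMatrix N} {m n p : ℕ} (h : m ≠ n) (hm : m ≠ p) (hn : n ≠ p) :
    (R.actU A m n h : TOp N A) ∈ awayFrom N A p ∧
      ((R.actU A m n h)⁻¹ : (TOp N A)ˣ).val ∈ awayFrom N A p :=
  ⟨actTwo_mem_awayFrom h hm hn _, actTwo_mem_awayFrom h hm hn _⟩

/-- An auxiliary site s is used. Compatibility rewrites F_{mn} R_{sm} F_{mn}⁻¹ as F_{sm}⁻¹ R_{mn}
F_{sm}. Its R-trace over n is 1 because that of R_{mn} is. So the conjugated trace agrees with the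
trace on R_{sm}, and skew invertibility extends this to all operators. -/
theorem IsCompatible.ptrace_conj {R F : RMatrix N} (hc : IsCompatible R F)
    (hs : IsSkewInvertible R.mat) (m n : ℕ) (h : m ≠ n) :
    ((∀ i j, ptrace (skewD R.mat) n ((F.actU A m n h).val * munit A m i j *
      ((F.actU A m n h)⁻¹).val) = algebraMap ℂ _ (skewD R.mat j i)) ∧
    ∀ Z ∈ awayFrom N A n, ptrace (skewD R.mat) n ((F.actU A m n h).val * Z *
      ((F.actU A m n h)⁻¹).val) = ptrace (skewD R.mat) m Z) ∧
    (∀ i j, ptrace (skewD R.mat) n (((F.actU A m n h)⁻¹).val * munit A m i j *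
      (F.actU A m n h).val) = algebraMap ℂ _ (skewD R.mat j i)) ∧
    ∀ Z ∈ awayFrom N A n, ptrace (skewD R.mat) n (((F.actU A m n h)⁻¹).val * Z *
      (F.actU A m n h).val) = ptrace (skewD R.mat) m Z := by
  obtain ⟨s, hsm, hsn⟩ : ∃ s : ℕ, s ≠ m ∧ s ≠ n := ⟨m + n + 1, by omega, by omega⟩
  obtain ⟨c1, c2⟩ := hc.act (A := A) s m n hsm h hsn
  have one : ptrace (skewD R.mat) n (R.actU A m n h : TOp N A) = 1 := ptrace_skew hs m n h
  constructor
  · refine _root_.ptrace_conj hs hsm h hsn F.mat F.inv ?_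
    have e : F.actU A m n h * R.actU A s m hsm * (F.actU A m n h)⁻¹ =
        (F.actU A s m hsm)⁻¹ * R.actU A m n h * F.actU A s m hsm := by
      rw [mul_inv_eq_iff_eq_mul, mul_assoc, mul_assoc, eq_inv_mul_iff_mul_eq, ← mul_assoc, ← c2,
        mul_assoc]
    have e' := congrArg Units.val e
    simp only [Units.val_mul] at e'
    refine (congrArg _ e').trans ?_
    rw [ptrace_mul_right _ (actU_mem hsm hsn h).1, ptrace_mul_left _ (actU_mem hsm hsn h).2, one,
      mul_one, Units.inv_mul]
  · refine _root_.ptrace_conj hs hsm h hsn F.inv F.mat ?_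
    have e : (F.actU A m n h)⁻¹ * R.actU A s m hsm * F.actU A m n h =
        F.actU A s m hsm * R.actU A m n h * (F.actU A s m hsm)⁻¹ := by
      rw [eq_mul_inv_iff_mul_eq, mul_assoc, mul_assoc, inv_mul_eq_iff_eq_mul, ← mul_assoc, c1,
        mul_assoc]
    have e' := congrArg Units.val e
    simp only [Units.val_mul] at e'
    refine (congrArg _ e').trans ?_
    rw [ptrace_mul_right _ (actU_mem hsm hsn h).2, ptrace_mul_left _ (actU_mem hsm hsn h).1, one,
      mul_one, Units.mul_inv]

/-- Conjugation invariance for the pair {R, R} forces D ⊗ D to commute with R⁻¹, hence with R, and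
this is what makes the weighted double trace cyclic. -/
theorem actU_cyclic {R : RMatrix N} (hs : IsSkewInvertible R.mat) (m n : ℕ) (h : m ≠ n)
    (X : TOp N A) : ptrace (skewD R.mat) m (ptrace (skewD R.mat) n ((R.actU A m n h : TOp N A) * X)) =
      ptrace (skewD R.mat) m (ptrace (skewD R.mat) n (X * (R.actU A m n h : TOp N A))) := by
  refine ptrace_ptrace_cyclic _ h R.mat ?_ X
  have h1 := (IsCompatible.self R).ptrace_conj (A := ℂ) hs 0 1 zero_ne_one
  have h2 := skewD_commute_of_conj hs (S := R.inv) h1.2.1 h1.1.1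
  have h3 : Commute R.op.val (tensorSq (skewD R.mat)) := by
    have : Commute (R.op⁻¹).val (tensorSq (skewD R.mat)) := h2.symm
    rwa [Commute.units_inv_left_iff] at this
  have h4 : Commute (actTwo A m n h R.mat) (actTwo A m n h (tensorSq (skewD R.mat))) :=
    h3.map (actTwo A m n h)
  rw [actTwo_tensorSq] at h4
  rwa [((actOneC_commute _ (actOneC_mem_awayFrom h (skewD R.mat)))).eq]

theorem IsBMW.goodParams {q μ : ℂ} {R : RMatrix N} (h : IsBMW q μ R) : GoodParams q μ := by
  refine ⟨h.q_ne.1, fun h0 => ?_, h.μ_ne.1⟩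
  have q0 := h.q_ne.1
  have : (q - 1) * (q + 1) = 0 := by
    field_simp at h0
    linear_combination h0
  rcases mul_eq_zero.1 this with h1 | h1
  · exact h.q_ne.2.1 (sub_eq_zero.1 h1)
  · exact h.q_ne.2.2 (eq_neg_of_add_eq_zero_left h1)

theorem IsBMW.eta_ne {q μ : ℂ} {R : RMatrix N} (h : IsBMW q μ R) : bmwEta q μ ≠ 0 := by
  have hp := h.goodParams
  refine div_ne_zero (mul_ne_zero (sub_ne_zero.2 h.μ_ne.2.1.symm) ?_) (mul_ne_zero hp.m0 hp.q2)
  intro h0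
  exact h.μ_ne.2.2 (by linear_combination h0)

theorem opK_eq (q μ : ℂ) (R : RMatrix N) : opK q μ R = contr q μ R.mat := rfl

theorem IsBMW.cubic {q μ : ℂ} {R : RMatrix N} (h : IsBMW q μ R) :
    contr q μ R.mat * R.mat = μ • contr q μ R.mat := by
  have h1 := minpoly.aeval ℂ R.mat
  rw [h.minpoly_eq] at h1
  simp only [map_mul, map_sub, Polynomial.aeval_X, Polynomial.aeval_C,
    Algebra.algebraMap_eq_smul_one] at h1
  have h2 : (q • 1 - R.mat) * (q⁻¹ • 1 + R.mat) * (R.mat - μ • 1) = 0 := by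
    have e : (q • (1 : TensorMat N 2 ℂ) - R.mat) * (q⁻¹ • 1 + R.mat) =
        -((R.mat - q • 1) * (R.mat - (-q⁻¹) • 1)) := by
      rw [neg_smul, sub_neg_eq_add, ← neg_mul, neg_sub, add_comm (q⁻¹ • _)]
    rw [e, neg_mul, h1, neg_zero]
  have h3 : contr q μ R.mat * (R.mat - μ • 1) = 0 := by
    rw [contr, smul_mul_assoc, h2, smul_zero]
  rw [mul_sub, mul_smul_comm, mul_one] at h3
  exact sub_eq_zero.1 h3

/-- K is a nonzero multiple of a quadratic polynomial in R, while the minimal polynomial has degree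
three. -/
theorem IsBMW.opK_ne {q μ : ℂ} {R : RMatrix N} (h : IsBMW q μ R) : opK q μ R ≠ 0 := by
  intro h0
  have hp := h.goodParams
  rw [opK, smul_eq_zero] at h0
  rcases h0 with h0 | h0
  · exact inv_ne_zero (mul_ne_zero hp.m0 hp.q2) h0
  · have h1 : Polynomial.aeval R.mat ((Polynomial.X - Polynomial.C q) *
        (Polynomial.X - Polynomial.C (-q⁻¹))) = 0 := by
      simp only [map_mul, map_sub, Polynomial.aeval_X, Polynomial.aeval_C,
        Algebra.algebraMap_eq_smul_one, neg_smul, sub_neg_eq_add]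
      have := congrArg Neg.neg h0
      rw [← neg_mul, neg_sub, add_comm (q⁻¹ • _), neg_zero] at this
      exact this
    have h2 := minpoly.degree_le_of_ne_zero ℂ R.mat
      (((Polynomial.monic_X_sub_C q).mul (Polynomial.monic_X_sub_C (-q⁻¹))).ne_zero) h1
    rw [h.minpoly_eq] at h2
    simp only [Polynomial.degree_mul, Polynomial.degree_X_sub_C] at h2
    exact absurd h2 (by decide)

theorem IsBMW.pair {q μ : ℂ} {R : RMatrix N} (h : IsBMW q μ R) (l m n : ℕ) (h1 : l ≠ m)
    (h2 : m ≠ n) (h3 : l ≠ n) : BMWPair q μ (R.actU A l m h1) (R.actU A m n h2) := by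
  have hk : ∀ i j hij, contr q μ (R.actU A i j hij : TOp N A) = actTwo A i j hij (opK q μ R) :=
    fun i j hij => by rw [opK_eq, contr_map]; rfl
  refine ⟨?_, ?_, ?_, ?_, ?_⟩
  · exact congrArg Units.val ((IsCompatible.self R).act (A := A) l m n h1 h2 h3).1
  · rw [hk, RMatrix.actU_val, ← map_mul, opK_eq, h.cubic, map_smul]
  · have := congrArg (actC A (threeSites l m n h1 h2 h3)) h.K_K
    simp only [map_mul, actC_loc_zero, actC_loc_one] at this
    rw [hk, hk]
    exact this
  · have := congrArg (actC A (threeSites l m n h1 h2 h3)) h.K_K_inv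
    simp only [map_mul, actC_loc_zero, actC_loc_one] at this
    rw [hk, hk]
    exact this
  · have := congrArg (actC A (threeSites l m n h1 h2 h3)) h.K_K_K
    simp only [map_mul, actC_loc_zero, actC_loc_one] at this
    simpa only [hk] using this

theorem contr_actU (q μ : ℂ) (R : RMatrix N) (m n : ℕ) (h : m ≠ n) :
    contr q μ (R.actU A m n h : TOp N A) = actTwo A m n h (opK q μ R) := by
  rw [opK_eq, contr_map]; rfl

theorem entry_mul_right {n : ℕ} {a : TOp N A} (ha : a ∈ awayFrom N A n) (i j : Fin N)
    (X : TOp N A) : entry n i j (X * a) = entry n i j X * a := by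
  rw [entry_apply, entry_apply, Finset.sum_mul]
  refine Finset.sum_congr rfl fun e _ => ?_
  rw [mul_assoc, mul_assoc, ← ((mem_awayFrom.1 ha) j e).eq]; simp only [mul_assoc]

/-- Z lives on other sites, so taking a nonzero entry of X at the sites m, n leaves a nonzero
multiple of Z. -/
theorem eq_zero_of_actTwo_mul {X : TensorMat N 2 ℂ} (hX : X ≠ 0) {m n : ℕ} (h : m ≠ n)
    {Z : TOp N A} (hm : Z ∈ awayFrom N A m) (hn : Z ∈ awayFrom N A n)
    (h0 : actTwo A m n h X * Z = 0) : Z = 0 := by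
  obtain ⟨s, t, hst⟩ : ∃ s t, X s t ≠ 0 := by
    by_contra! hc
    exact hX (by ext s t; exact hc s t)
  obtain ⟨⟨a, b⟩, rfl⟩ := (finTwoArrowEquiv (Fin N)).symm.surjective s
  obtain ⟨⟨c, d⟩, rfl⟩ := (finTwoArrowEquiv (Fin N)).symm.surjective t
  change X ![a, b] ![c, d] ≠ 0 at hst
  have h1 := congrArg (fun Q => entry n b d (entry m a c Q)) h0
  simp only [entry_mul_right hm, entry_mul_right hn, map_zero, entry_actTwo, map_sum,
    map_smul] at h1
  have h2 : ∀ k l, entry n b d (munit A n k l) = if b = k then (if l = d then 1 else 0) else 0 := by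
    intro k l
    have := entry_munit_mul_same (A := A) n b d k l (one_mem _)
    rwa [mul_one] at this
  simp only [h2] at h1
  rw [Finset.sum_eq_single b, Finset.sum_eq_single d] at h1
  · simp only [if_true, smul_mul_assoc, one_mul, smul_eq_zero] at h1
    exact h1.resolve_left hst
  · intro l _ hl; simp [hl]
  · simp
  · intro k _ hk; simp [hk.symm]
  · simp

/-- The dimension relation for R-matrices of BMW type. -/
theorem IsBMW.trace_skewD {q μ : ℂ} {R : RMatrix N} (h : IsBMW q μ R)
    (hs : IsSkewInvertible R.mat) : (skewD R.mat).trace = bmwEta q μ * μ := by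
  have hp := h.goodParams
  set x := R.actU ℂ 0 1 zero_ne_one with hx
  set y := R.actU ℂ 1 2 (by omega) with hy
  have hxy : BMWPair q μ x y := h.pair 0 1 2 _ _ (by omega)
  set k := contr q μ (x : TOp N ℂ) with hk
  -- Traced over the third site, the left side becomes κ² = ηκ and the right side μ⁻¹ Tr(D) κ; then
  -- κ ≠ 0 is cancelled.
  have h1 : k * y * k = μ⁻¹ • k := by
    have e : k * contr q μ (y : TOp N ℂ) * k = μ • (k * y * k) := by
      rw [hk, hxy.kk_right, mul_assoc, mul_assoc, contr_comm, hxy.cubic, mul_smul_comm,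
        mul_smul_comm, mul_assoc]
    rw [hxy.kkk] at e
    rw [← hk] at e
    conv_rhs => rw [e, smul_smul, inv_mul_cancel₀ hp.m0, one_smul]
  have hk2 : k ∈ awayFrom N ℂ 2 := by
    rw [hk, contr_actU]
    exact actTwo_mem_awayFrom _ (by omega) (by omega) _
  have h2 := congrArg (ptrace (skewD R.mat) 2) h1
  rw [ptrace_mul_right _ hk2, ptrace_mul_left _ hk2, hy, RMatrix.actU_val, ptrace_skew hs, mul_one,
    map_smul, contr_sq hxy.cubic] at h2
  conv at h2 => rhs; rw [← mul_one k, ptrace_mul_left _ hk2, ptrace_one]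
  rw [← Algebra.commutes, ← Algebra.smul_def, smul_smul, ← hk, ← sub_eq_zero, ← sub_smul] at h2
  have h3 : k ≠ 0 := by
    intro h0
    have := eq_zero_of_actTwo_mul (A := ℂ) h.opK_ne zero_ne_one (Z := 1) (one_mem _) (one_mem _)
      (by rw [mul_one, ← contr_actU]; exact h0)
    obtain ⟨s, -, -⟩ : ∃ s t, opK q μ R s t ≠ 0 := by
      by_contra! hc
      exact h.opK_ne (by ext s t; exact hc s t)
    have h5 := congrFun (LinearMap.congr_fun this (fun _ => 1)) (fun _ => s 0)
    simp at h5
  have h4 := (smul_eq_zero.1 h2).resolve_right h3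
  have m0 := hp.m0
  field_simp at h4
  linear_combination -h4

/-- Let z and w be the traces of the neighbouring contractors κ' and κ over their last sites.
Tracing κκ' = κyx gives κz = μκ. Conjugation invariance gives w = xzx⁻¹, hence κw = μκ. Since w acts
on one site only, K can be cancelled, which leaves w = μ. -/
theorem IsBMW.ptrace_contr {q μ : ℂ} {R : RMatrix N} (h : IsBMW q μ R)
    (hs : IsSkewInvertible R.mat) (n : ℕ) :
    ptrace (skewD R.mat) (n + 1) (contr q μ (R.actU A n (n + 1) (by omega) : TOp N A)) =
      algebraMap ℂ _ μ := by
  have hp := h.goodParams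
  set E := ptrace (A := A) (skewD R.mat) with hE
  set x := R.actU A n (n + 1) (by omega) with hx
  set y := R.actU A (n + 1) (n + 2) (by omega) with hy
  have hxy : BMWPair q μ x y := h.pair n (n + 1) (n + 2) _ _ (by omega)
  set k := contr q μ (x : TOp N A) with hk
  set k' := contr q μ (y : TOp N A) with hk'
  have hx2 : (x : TOp N A) ∈ awayFrom N A (n + 2) ∧ ((x⁻¹ : (TOp N A)ˣ) : TOp N A) ∈
      awayFrom N A (n + 2) := actU_mem _ (by omega) (by omega)
  have hk2 : k ∈ awayFrom N A (n + 2) := by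
    rw [hk, contr_actU]
    exact actTwo_mem_awayFrom _ (by omega) (by omega) _
  have hEy : E (n + 2) (y : TOp N A) = 1 := ptrace_skew hs (n + 1) (n + 2) (by omega)
  have hconj := (IsCompatible.self R).ptrace_conj (A := A) hs (n + 1) (n + 2) (by omega)
  set z := E (n + 2) k' with hz
  set w := E (n + 1) k with hw
  have h1 : z * k = μ • k := by
    rw [hz, ← ptrace_mul_right _ hk2, hk', hxy.kk, ptrace_mul_right _ hk2,
      ptrace_mul_left _ hx2.1, ← hE, hEy, mul_one, contr_comm, hxy.cubic]
  have h2 : k * z = μ • k := by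
    rw [hz, ← ptrace_mul_left _ hk2, hk', hxy.kk_right, ptrace_mul_left _ hk2,
      ptrace_mul_right _ hx2.1, ← hE, hEy, one_mul, hxy.cubic]
  have h3 : w = x * z * (x⁻¹ : (TOp N A)ˣ) := by
    have e : ((y⁻¹ : (TOp N A)ˣ) : TOp N A) * k * y = x * k' * (x⁻¹ : (TOp N A)ˣ) := by
      rw [Units.eq_mul_inv_iff_mul_eq, mul_assoc, mul_assoc, Units.inv_mul_eq_iff_eq_mul, ← hxy.slide',
        mul_assoc]
    rw [hw, ← hconj.2.2 k hk2, e, ptrace_mul_right _ hx2.2, ptrace_mul_left _ hx2.1]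
  have h4 : w = (x⁻¹ : (TOp N A)ˣ) * z * x := by
    have e : (y : TOp N A) * k * (y⁻¹ : (TOp N A)ˣ) = (x⁻¹ : (TOp N A)ˣ) * k' * x := by
      rw [Units.mul_inv_eq_iff_eq_mul, mul_assoc, mul_assoc, Units.eq_inv_mul_iff_mul_eq, ← mul_assoc,
        hxy.slide]
    rw [hw, ← hconj.1.2 k hk2, e, ptrace_mul_right _ hx2.1, ptrace_mul_left _ hx2.2]
  have h5 : k * w = μ • k := by
    rw [h3, ← mul_assoc, ← mul_assoc, hxy.cubic, smul_mul_assoc, h2, smul_mul_assoc,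
      smul_mul_assoc, contr_mul_inv hp hxy.cubic, smul_smul μ μ⁻¹, mul_inv_cancel₀ hp.m0, one_smul]
  have hwa : w ∈ awayFrom N A (n + 1) := ptrace_mem_self _ _ _
  have hwb : w ∈ awayFrom N A (n + 2) := ptrace_mem _ hk2
  -- Here κ' = κ'κκ', and w commutes with κ' because it is trivial on the two sites of κ'.
  have h6 : k' * (w - μ • 1) = 0 := by
    have hc : Commute k' (w - μ • 1) := by
      rw [hk', contr_actU]
      refine actTwo_commute _ _ (sub_mem hwa ?_) (sub_mem hwb ?_) <;>
      exact Subalgebra.smul_mem _ (one_mem _) _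
    rw [hk', ← hxy.symm.kkk, ← hk', mul_assoc, hc.eq, ← mul_assoc, mul_assoc k' k, mul_sub, h5,
      mul_smul_comm, mul_one, sub_self, mul_zero, zero_mul]
  rw [hk', contr_actU] at h6
  have := eq_zero_of_actTwo_mul h.opK_ne _ (sub_mem hwa (Subalgebra.smul_mem _ (one_mem _) _))
    (sub_mem hwb (Subalgebra.smul_mem _ (one_mem _) _)) h6
  rw [Algebra.algebraMap_eq_smul_one]
  exact sub_eq_zero.1 this

theorem actC_loc {n : ℕ} (i : Fin n) (X : TensorMat N 2 ℂ) :
    actC A (firstSites (n + 1)) (loc i X) = actTwo A i (i + 1) (by omega) X := by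
  have := actC_onSites (A := A) (firstSites (n + 1)) ⟨adj i, adj_injective i⟩ X
  refine this.trans ?_
  rw [actTwo]
  congr 1
  congr 1
  ext k
  fin_cases k <;> rfl

theorem act_locA {n : ℕ} (i : Fin n) (X : TensorMat N 2 ℂ) :
    act (firstSites (n + 1)) (locA A i X) = actTwo A i (i + 1) (by omega) X :=
  actC_loc i X

theorem act_firstSite {n : ℕ} (T : Matrix (Fin N) (Fin N) A) :
    act (firstSites (n + 1)) (firstSite n T) = actOne 0 T := by
  have := act_onSites (firstSites (n + 1)) ⟨![0], by intro a b _; exact Subsingleton.elim a b⟩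
    (Matrix.of fun a b : Fin 1 → Fin N => T (a 0) (b 0))
  refine this.trans ?_
  rw [actOne_eq]
  congr 2
  ext i
  rw [Subsingleton.elim i 0]
  rfl

/-- The tower attached to a compatible pair of R-matrices and a quantum matrix `T`. -/
def qmTower {q μ : ℂ} {R F : RMatrix N} (hc : IsCompatible R F) (hs : IsSkewInvertible R.mat)
    (hb : IsBMW q μ R) (T : Matrix (Fin N) (Fin N) A)
    (hT : locA A (0 : Fin 1) R.mat * matCopy F T 1 0 * matCopy F T 1 1 =
      matCopy F T 1 0 * matCopy F T 1 1 * locA A (0 : Fin 1) R.mat) :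
    QMTower q μ (TOp N A) where
  r n := R.actU A n (n + 1) (by omega)
  f n := F.actU A n (n + 1) (by omega)
  T := actOne 0 T
  E := ptrace (skewD R.mat)
  away := awayFrom N A
  r_away h1 h2 := (actU_mem _ h1.symm h2.symm).1
  rinv_away h1 h2 := (actU_mem _ h1.symm h2.symm).2
  f_away h1 h2 := (actU_mem _ h1.symm h2.symm).1
  finv_away h1 h2 := (actU_mem _ h1.symm h2.symm).2
  r_comm h1 h2 := actTwo_commute _ _ h1 h2
  f_comm h1 h2 := actTwo_commute _ _ h1 h2
  T_away h := actOne_mem_awayFrom h.ne _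
  E_away_self n X := ptrace_mem_self _ n X
  E_away n _ h := ptrace_mem _ h
  E_mul_left X h := ptrace_mul_left _ h X
  E_mul_right X h := ptrace_mul_right _ h X
  E_one n := by rw [ptrace_one, hb.trace_skewD hs]
  E_r n := ptrace_skew hs n (n + 1) _
  E_contr n := hb.ptrace_contr hs n
  E_conj_f n X h := (hc.ptrace_conj hs n (n + 1) _).1.2 X h
  E_conj_r n X h := ((IsCompatible.self R).ptrace_conj hs n (n + 1) _).1.2 X h
  E_conj_r' n X h := ((IsCompatible.self R).ptrace_conj hs n (n + 1) _).2.2 X h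
  E_cyc n X := actU_cyclic hs n (n + 1) _ X
  good := hb.goodParams
  eta_ne := hb.eta_ne
  bmw n := ⟨fun i _ => hb.pair i (i + 1) (i + 2) _ _ (by omega),
    fun i j h _ => act_commute (sites i (i + 1) (by omega)) (sites j (j + 1) (by omega)) (by
      intro a b
      have ha : sites i (i + 1) (by omega) a = i + a := by fin_cases a <;> rfl
      have hb : sites j (j + 1) (by omega) b = j + b := by fin_cases b <;> rfl
      omega) _ _,
    fun i _ => (hb.pair i (i + 1) (i + 2) _ (by omega) (by omega)).cubic⟩
  f_braid n := ((IsCompatible.self F).act n (n + 1) (n + 2) _ _ (by omega)).1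
  compat n := (hc.act n (n + 1) (n + 2) _ _ (by omega)).1
  compat' n := (hc.act n (n + 1) (n + 2) _ _ (by omega)).2
  rmm := by
    have h := congrArg (act (firstSites 2)) hT
    have e0 : act (firstSites 2) (matCopy F T 1 0) = actOne 0 T := act_firstSite T
    have e1 : act (firstSites 2) (matCopy F T 1 1) = F.actU A 0 1 zero_ne_one * actOne 0 T *
        ((F.actU A 0 1 zero_ne_one)⁻¹ : (TOp N A)ˣ) := by
      change act (firstSites 2) (locA A 0 F.mat * firstSite 1 T * locA A 0 F.inv) = _
      rw [map_mul, map_mul, act_firstSite, act_locA, act_locA]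
      rfl
    rw [map_mul, map_mul, map_mul, map_mul, e0, e1, act_locA] at h
    exact h

end Tower

/-! ### Words in braid generators -/

/-- A sequence of elements satisfying the braid relations. -/
structure IsBraidSeq {G : Type*} [Group G] (r : ℕ → G) : Prop where
  braid : ∀ n, r n * r (n + 1) * r n = r (n + 1) * r n * r (n + 1)
  far : ∀ i j, i + 2 ≤ j → Commute (r i) (r j)

section BraidWords

variable {G : Type*} [Group G] (r : ℕ → G)

/-- `r_a r_{a + 1} ⋯ r_{a + n - 1}`. -/
def run (a : ℕ) : ℕ → G
  | 0 => 1
  | n + 1 => run a n * r (a + n)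

/-- `run (s + k - 1) n ⋯ run s n`. -/
def crossing (s n : ℕ) : ℕ → G
  | 0 => 1
  | k + 1 => run r (s + k) n * crossing s n k

/-- `r_m ⋯ r_1 r_0 r_1⁻¹ ⋯ r_m⁻¹`. -/
def loopWord : ℕ → G
  | 0 => r 0
  | m + 1 => r (m + 1) * loopWord m * (r (m + 1))⁻¹

variable {r}

theorem run_induction {P : G → Prop} (h1 : P 1) (hm : ∀ a b, P a → P b → P (a * b)) {a n : ℕ}
    (h : ∀ i, a ≤ i → i < a + n → P (r i)) : P (run r a n) := by
  induction n with
  | zero => exact h1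
  | succ n ih => exact hm _ _ (ih fun i h1 h2 => h i h1 (by omega)) (h _ (by omega) (by omega))

theorem crossing_induction {P : G → Prop} (h1 : P 1) (hm : ∀ a b, P a → P b → P (a * b))
    {s n k : ℕ} (h : ∀ i, s ≤ i → i + 1 < s + n + k → P (r i)) : P (crossing r s n k) := by
  induction k with
  | zero => exact h1
  | succ k ih =>
    refine hm _ _ (run_induction h1 hm fun i h1 h2 => h i (by omega) (by omega))
      (ih fun i h1 h2 => h i h1 (by omega))

theorem loopWord_induction {P : G → Prop} (hm : ∀ a b, P a → P b → P (a * b))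
    (hi : ∀ a, P a → P a⁻¹) {m : ℕ} (h : ∀ i, i ≤ m → P (r i)) : P (loopWord r m) := by
  induction m with
  | zero => exact h 0 le_rfl
  | succ m ih =>
    exact hm _ _ (hm _ _ (h _ le_rfl) (ih fun i hi => h i (by omega))) (hi _ (h _ le_rfl))

theorem run_succ_left (a n : ℕ) : run r a (n + 1) = r a * run r (a + 1) n := by
  induction n with
  | zero => simp [run]
  | succ n ih => rw [run, ih, run, mul_assoc]; congr 3; ring

variable (hr : IsBraidSeq r)
include hr

theorem run_shift {a n j : ℕ} (h1 : a ≤ j) (h2 : j + 1 < a + n) :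
    run r a n * r j = r (j + 1) * run r a n := by
  induction n with
  | zero => omega
  | succ n ih =>
    rcases Nat.lt_or_ge (j + 1) (a + n) with h | h
    · rw [run, mul_assoc, ← (hr.far j (a + n) (by omega)).eq, ← mul_assoc, ih h, mul_assoc]
    · obtain ⟨n, rfl⟩ : ∃ k, n = k + 1 := ⟨n - 1, by omega⟩
      obtain rfl : j = a + n := by omega
      have h3 : Commute (run r a n) (r (a + n + 1)) :=
        run_induction (P := fun x => Commute x (r (a + n + 1))) (Commute.one_left _)
          (fun _ _ h h' => h.mul_left h') fun i _ hi => hr.far i _ (by omega)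
      rw [run, run, ← add_assoc a n 1, mul_assoc, mul_assoc, ← mul_assoc (r (a + n)), hr.braid,
        mul_assoc (r (a + n + 1)), ← mul_assoc (run r a n), h3.eq]
      simp only [mul_assoc]

theorem run_cross (a n : ℕ) :
    run r (a + 1) n * run r a n * r (a + n) = r a * (run r (a + 1) n * run r a n) := by
  induction n with
  | zero => simp [run]
  | succ n ih =>
    have h3 : Commute (run r a n) (r (a + n + 1)) :=
      run_induction (P := fun x => Commute x (r (a + n + 1))) (Commute.one_left _)
        (fun _ _ h h' => h.mul_left h') fun i _ hi => hr.far i _ (by omega)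
    have e : run r (a + 1) (n + 1) * run r a (n + 1) =
        run r (a + 1) n * run r a n * (r (a + n + 1) * r (a + n)) := by
      rw [run, run, show a + 1 + n = a + n + 1 by ring]
      simp only [mul_assoc]
      rw [← mul_assoc (r (a + n + 1)), ← h3.eq]
      simp only [mul_assoc]
    rw [e, ← mul_assoc (r a), ← ih]
    simp only [mul_assoc, ← add_assoc]
    rw [← mul_assoc (r (a + n)) (r (a + n + 1)), hr.braid]
    simp only [mul_assoc]

/-- The braid `crossing r s n k` exchanges the block of n strands starting at s with the following
block of k strands: generators inside the first block move k places to the right, and by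
`crossing_right` those inside the second block move n places to the left. -/
theorem crossing_left {s n k j : ℕ} (h1 : s ≤ j) (h2 : j + 1 < s + n) :
    crossing r s n k * r j = r (j + k) * crossing r s n k := by
  induction k with
  | zero => simp [crossing]
  | succ k ih =>
    rw [crossing, mul_assoc, ih, ← mul_assoc, run_shift hr (by omega) (by omega), mul_assoc]
    rfl

theorem crossing_right {s n k j : ℕ} (h : j + 1 < k) :
    crossing r s n k * r (s + n + j) = r (s + j) * crossing r s n k := by
  induction k with
  | zero => omega
  | succ k ih =>
    rcases Nat.lt_or_ge (j + 1) k with h' | h'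
    · have h3 : Commute (run r (s + k) n) (r (s + j)) :=
        run_induction (P := fun x => Commute x (r (s + j))) (Commute.one_left _)
          (fun _ _ h h' => h.mul_left h') fun i hi _ => (hr.far _ i (by omega)).symm
      rw [crossing, mul_assoc, ih h', ← mul_assoc, h3.eq, mul_assoc]
    · obtain ⟨k, rfl⟩ : ∃ l, k = l + 1 := ⟨k - 1, by omega⟩
      obtain rfl : j = k := by omega
      have h3 : Commute (crossing r s n j) (r (s + n + j)) :=
        crossing_induction (P := fun x => Commute x (r (s + n + j))) (Commute.one_left _)
          (fun _ _ h h' => h.mul_left h') fun i _ hi => hr.far i _ (by omega)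
      have h4 := run_cross hr (s + j) n
      rw [crossing, crossing, mul_assoc, mul_assoc, h3.eq, ← mul_assoc, ← mul_assoc,
        show s + n + j = s + j + n by ring, ← add_assoc, h4]
      simp only [mul_assoc]

/-- The crossing keeps strand 0 and carries strand 1 to place m + 1, so the generator linking
strands 0 and 1 becomes the word linking 0 and m + 1. -/
theorem crossing_loopWord (p m : ℕ) :
    crossing r 1 (p + 1) m * r 0 = loopWord r m * crossing r 1 (p + 1) m := by
  induction m with
  | zero => simp [crossing, loopWord]
  | succ m ih =>
    have h3 : Commute (loopWord r m) (run r (m + 2) p) :=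
      run_induction (P := fun x => Commute (loopWord r m) x) (Commute.one_right _)
        (fun _ _ h h' => h.mul_right h') fun i hi _ =>
          loopWord_induction (P := fun x => Commute x (r i))
            (fun _ _ h h' => h.mul_left h') (fun _ h => h.inv_left)
            fun j hj => hr.far j i (by omega)
    rw [crossing, mul_assoc, ih, loopWord, run_succ_left, show 1 + m = m + 1 by ring,
      show m + 1 + 1 = m + 2 by ring]
    simp only [mul_assoc, inv_mul_cancel_left]
    rw [← mul_assoc (run r (m + 2) p), ← h3.eq, mul_assoc]

omit hr in
theorem crossing_succ_eq (s n k : ℕ) :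
    crossing r s n (k + 1) = crossing r (s + 1) n k * run r s n := by
  induction k with
  | zero => simp [crossing]
  | succ k ih =>
    rw [crossing, ih, crossing, mul_assoc]
    congr 2
    ring

/-- These are two expressions for the same braid linking strands 0 and p + 1. -/
theorem run_conj (p : ℕ) :
    (run r 1 p)⁻¹ * r 0 * run r 1 p = run r 0 p * r p * (run r 0 p)⁻¹ := by
  have h1 : run r 0 (p + 1) * run r 0 p = run r 1 p * run r 0 (p + 1) := by
    have : ∀ k ≤ p, run r 0 (p + 1) * run r 0 k = run r 1 k * run r 0 (p + 1) := by
      intro k hk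
      induction k with
      | zero => simp [run]
      | succ k ih =>
        rw [show run r 0 (k + 1) = run r 0 k * r (0 + k) from rfl, ← mul_assoc, ih (by omega),
          mul_assoc, zero_add, run_shift hr (by omega) (by omega),
          show run r 1 (k + 1) = run r 1 k * r (1 + k) from rfl, ← mul_assoc, add_comm 1 k]
    exact this p le_rfl
  have h2 : run r 0 p * r p = run r 0 (p + 1) := by rw [run, zero_add]
  rw [h2, eq_mul_inv_iff_mul_eq, mul_assoc, mul_assoc, inv_mul_eq_iff_eq_mul, ← h1, ← mul_assoc,
    run_succ_left 0 p]

end BraidWords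

/-! ### Induction over the group algebra of a braid group -/

theorem braidAlg_induction {m : ℕ} {P : MonoidAlgebra ℂ (Braid m) → Prop}
    (one : P 1) (mul : ∀ a b, P a → P b → P (a * b)) (add : ∀ a b, P a → P b → P (a + b))
    (smul : ∀ (z : ℂ) a, P a → P (z • a)) (gen : ∀ i : Fin m, P (sigA i))
    (gen_inv : ∀ i : Fin m, P (MonoidAlgebra.of ℂ _ (sig i)⁻¹))
    (α : MonoidAlgebra ℂ (Braid m)) : P α := by
  refine MonoidAlgebra.induction_on α (fun g => ?_) add smul
  obtain ⟨w, rfl⟩ := PresentedGroup.mk_surjective _ g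
  induction w using FreeGroup.induction_on with
  | C1 =>
    rw [map_one, map_one]
    exact one
  | of i => exact gen i
  | inv_of i _ => exact gen_inv i
  | mul a b ha hb =>
    rw [map_mul, map_mul]
    exact mul _ _ ha hb

namespace QMTower

variable {q μ : ℂ} {H : Type*} [Ring H] [Algebra ℂ H] (𝒯 : QMTower q μ H)

/-! ### The copies of the quantum matrix -/

/-- The copies of the quantum matrix. -/
def M : ℕ → H
  | 0 => 𝒯.T
  | k + 1 => 𝒯.f k * M k * ((𝒯.f k)⁻¹ : Hˣ)

/-- `M_s M_{s + 1} ⋯ M_{s + n - 1}`. -/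
def Mseg (s : ℕ) : ℕ → H
  | 0 => 1
  | n + 1 => Mseg s n * 𝒯.M (s + n)

theorem r_braidSeq : IsBraidSeq 𝒯.r where
  braid n := ((𝒯.bmw (n + 2)).pair n (by omega)).braid_units
  far i j h := Units.ext ((𝒯.bmw (j + 1)).far i j h (by omega))

theorem f_braidSeq : IsBraidSeq 𝒯.f where
  braid n := 𝒯.f_braid n
  far i j h := Units.ext (𝒯.f_comm (𝒯.f_away (by omega) (by omega))
    (𝒯.f_away (by omega) (by omega)))

theorem r_f_commute {i j : ℕ} (h : i + 2 ≤ j ∨ j + 2 ≤ i) : Commute (𝒯.r i : H) (𝒯.f j) :=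
  𝒯.r_comm (𝒯.f_away (by omega) (by omega)) (𝒯.f_away (by omega) (by omega))

theorem M_away {k n : ℕ} (h : k < n) : 𝒯.M k ∈ 𝒯.away n := by
  induction k with
  | zero => exact 𝒯.T_away h
  | succ k ih =>
    exact mul_mem (mul_mem (𝒯.f_away (by omega) (by omega)) (ih (by omega)))
      (𝒯.finv_away (by omega) (by omega))

theorem Mseg_away {s n k : ℕ} (h : s + n ≤ k) : 𝒯.Mseg s n ∈ 𝒯.away k := by
  induction n with
  | zero => exact one_mem _
  | succ n ih => exact mul_mem (ih (by omega)) (𝒯.M_away (by omega))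

theorem r_M_of_lt {j k : ℕ} (h : k < j) : Commute (𝒯.r j : H) (𝒯.M k) :=
  𝒯.r_comm (𝒯.M_away h) (𝒯.M_away (by omega))

theorem f_M_of_lt {j k : ℕ} (h : k < j) : Commute (𝒯.f j : H) (𝒯.M k) :=
  𝒯.f_comm (𝒯.M_away h) (𝒯.M_away (by omega))

theorem f_mul_M (k : ℕ) : (𝒯.f k : H) * 𝒯.M k = 𝒯.M (k + 1) * 𝒯.f k := by
  rw [M, mul_assoc, Units.inv_mul, mul_one]

/-- M_{j+2} is the conjugate of M_j by F_{j+1}F_j. The braid relation turns F_j into F_{j+1} on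
passing this word, and F_{j+1} does not meet the sites of M_j. Later copies are conjugated by
elements commuting with F_j. For R_j the same argument uses compatibility instead. -/
theorem f_M_of_ge {j k : ℕ} (h : j + 2 ≤ k) : Commute (𝒯.f j : H) (𝒯.M k) := by
  induction k, h using Nat.le_induction with
  | base =>
    have hb : (𝒯.f j * 𝒯.f (j + 1) * 𝒯.f j : H) = 𝒯.f (j + 1) * 𝒯.f j * 𝒯.f (j + 1) :=
      congrArg Units.val (𝒯.f_braid j)
    have hM : 𝒯.M (j + 2) * (𝒯.f (j + 1) * 𝒯.f j) = 𝒯.f (j + 1) * 𝒯.f j * 𝒯.M j := by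
      rw [← mul_assoc, ← 𝒯.f_mul_M (j + 1), mul_assoc, ← 𝒯.f_mul_M j, mul_assoc]
    have h1 : (𝒯.f j * 𝒯.M (j + 2) : H) * (𝒯.f (j + 1) * 𝒯.f j) =
        𝒯.M (j + 2) * 𝒯.f j * (𝒯.f (j + 1) * 𝒯.f j) := by
      rw [mul_assoc, hM, ← mul_assoc, ← mul_assoc, hb, mul_assoc _ (𝒯.f (j + 1) : H),
        (𝒯.f_M_of_lt (Nat.lt_succ_self j)).eq, ← mul_assoc, ← hM, mul_assoc (𝒯.M (j + 2)),
        ← hb]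
      simp only [mul_assoc]
    have h2 : IsUnit ((𝒯.f (j + 1) : H) * 𝒯.f j) := ⟨𝒯.f (j + 1) * 𝒯.f j, rfl⟩
    exact h2.mul_left_injective h1
  | succ k hk ih =>
    have h1 : Commute (𝒯.f j : H) (𝒯.f k) := by
      have := 𝒯.f_braidSeq.far j k hk
      exact this.map (Units.coeHom H)
    exact (h1.mul_right ih).mul_right h1.units_inv_right

theorem r_M_of_ge {j k : ℕ} (h : j + 2 ≤ k) : Commute (𝒯.r j : H) (𝒯.M k) := by
  induction k, h using Nat.le_induction with
  | base =>
    have hb : (𝒯.r j * 𝒯.f (j + 1) * 𝒯.f j : H) = 𝒯.f (j + 1) * 𝒯.f j * 𝒯.r (j + 1) :=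
      congrArg Units.val (𝒯.compat j)
    have hM : 𝒯.M (j + 2) * (𝒯.f (j + 1) * 𝒯.f j) = 𝒯.f (j + 1) * 𝒯.f j * 𝒯.M j := by
      rw [← mul_assoc, ← 𝒯.f_mul_M (j + 1), mul_assoc, ← 𝒯.f_mul_M j, mul_assoc]
    have h1 : (𝒯.r j * 𝒯.M (j + 2) : H) * (𝒯.f (j + 1) * 𝒯.f j) =
        𝒯.M (j + 2) * 𝒯.r j * (𝒯.f (j + 1) * 𝒯.f j) := by
      rw [mul_assoc, hM, ← mul_assoc, ← mul_assoc, hb, mul_assoc _ (𝒯.r (j + 1) : H),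
        (𝒯.r_M_of_lt (Nat.lt_succ_self j)).eq, ← mul_assoc, ← hM, mul_assoc (𝒯.M (j + 2)),
        ← hb]
      simp only [mul_assoc]
    have h2 : IsUnit ((𝒯.f (j + 1) : H) * 𝒯.f j) := ⟨𝒯.f (j + 1) * 𝒯.f j, rfl⟩
    exact h2.mul_left_injective h1
  | succ k hk ih =>
    have h1 : Commute (𝒯.r j : H) (𝒯.f k) := 𝒯.r_f_commute (Or.inl hk)
    exact (h1.mul_right ih).mul_right h1.units_inv_right

/-- Conjugation by `f_s ⋯ f_{s + p - 1}` shifts the copies. -/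
theorem run_f_M {s p k : ℕ} (h1 : s ≤ k) (h2 : k < s + p) :
    (run 𝒯.f s p).val * 𝒯.M k = 𝒯.M (k + 1) * run 𝒯.f s p := by
  induction p with
  | zero => omega
  | succ p ih =>
    rcases Nat.lt_or_ge k (s + p) with h | h
    · rw [run, Units.val_mul, mul_assoc, (𝒯.f_M_of_lt h).eq, ← mul_assoc, ih h, mul_assoc]
    · obtain rfl : k = s + p := by omega
      have h3 : Commute (run 𝒯.f s p).val (𝒯.M (s + p + 1)) :=
        run_induction (P := fun x : Hˣ => Commute (x : H) (𝒯.M (s + p + 1))) (Commute.one_left _)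
          (fun _ _ h h' => h.mul_left h') fun i _ hi => 𝒯.f_M_of_ge (by omega)
      rw [run, Units.val_mul, mul_assoc, 𝒯.f_mul_M, ← mul_assoc, h3.eq, mul_assoc]

theorem run_f_r {s p j : ℕ} (h1 : s ≤ j) (h2 : j + 1 < s + p) :
    run 𝒯.f s p * 𝒯.r j = 𝒯.r (j + 1) * run 𝒯.f s p := by
  have hc : ∀ {i j : ℕ}, i + 2 ≤ j ∨ j + 2 ≤ i → Commute (𝒯.r i) (𝒯.f j) :=
    fun h => Units.ext (𝒯.r_f_commute h)
  induction p with
  | zero => omega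
  | succ p ih =>
    rcases Nat.lt_or_ge (j + 1) (s + p) with h | h
    · rw [run, mul_assoc, ← (hc (Or.inl (by omega))).eq, ← mul_assoc, ih h, mul_assoc]
    · obtain ⟨p, rfl⟩ : ∃ k, p = k + 1 := ⟨p - 1, by omega⟩
      obtain rfl : j = s + p := by omega
      have h3 : Commute (run 𝒯.f s p) (𝒯.r (s + p + 1)) :=
        run_induction (P := fun x => Commute x (𝒯.r (s + p + 1))) (Commute.one_left _)
          (fun _ _ h h' => h.mul_left h') fun i _ hi => (hc (Or.inr (by omega))).symm
      rw [run, run, ← add_assoc s p 1, mul_assoc, mul_assoc, ← mul_assoc (𝒯.f (s + p)),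
        ← 𝒯.compat', mul_assoc (𝒯.r (s + p + 1)), ← mul_assoc (run 𝒯.f s p), h3.eq]
      simp only [mul_assoc]

theorem run_f_Mseg {s p k n : ℕ} (h1 : s ≤ k) (h2 : k + n ≤ s + p) :
    (run 𝒯.f s p).val * 𝒯.Mseg k n = 𝒯.Mseg (k + 1) n * run 𝒯.f s p := by
  induction n with
  | zero => simp [Mseg]
  | succ n ih =>
    rw [Mseg, ← mul_assoc, ih (by omega), mul_assoc, 𝒯.run_f_M (by omega) (by omega), Mseg,
      ← mul_assoc, show k + n + 1 = k + 1 + n by ring]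

/-- Conjugation by F_jF_{j+1} shifts R_j, M_j and M_{j+1} by one place, so the defining relation
propagates from the first pair of copies to all of them. -/
theorem r_MM (j : ℕ) : Commute (𝒯.r j : H) (𝒯.M j * 𝒯.M (j + 1)) := by
  induction j with
  | zero =>
    have := 𝒯.rmm
    rw [mul_assoc] at this
    exact this
  | succ j ih =>
    have h1 := congrArg Units.val (𝒯.run_f_r (s := j) (p := 2) le_rfl (by omega))
    have h2 := 𝒯.run_f_M (s := j) (p := 2) (k := j) le_rfl (by omega)
    have h3 := 𝒯.run_f_M (s := j) (p := 2) (k := j + 1) (by omega) (by omega)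
    set u := run 𝒯.f j 2
    simp only [Units.val_mul] at h1
    have h4 : (u : H) * (𝒯.M j * 𝒯.M (j + 1)) = 𝒯.M (j + 1) * 𝒯.M (j + 1 + 1) * u := by
      rw [← mul_assoc, h2, mul_assoc, h3, mul_assoc]
    have h5 : (𝒯.r (j + 1) : H) * (𝒯.M (j + 1) * 𝒯.M (j + 1 + 1)) * u =
        𝒯.M (j + 1) * 𝒯.M (j + 1 + 1) * 𝒯.r (j + 1) * u := by
      rw [mul_assoc, ← h4, ← mul_assoc, ← h1, mul_assoc, ih.eq, ← mul_assoc, h4, mul_assoc, h1,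
        ← mul_assoc]
    exact (Units.mul_left_inj u).1 h5

theorem Mseg_add (s a b : ℕ) : 𝒯.Mseg s (a + b) = 𝒯.Mseg s a * 𝒯.Mseg (s + a) b := by
  induction b with
  | zero => simp [Mseg]
  | succ b ih => rw [← add_assoc, Mseg, ih, Mseg, mul_assoc, add_assoc]

theorem r_Mseg_of_le {s n j : ℕ} (h : s + n ≤ j) : Commute (𝒯.r j : H) (𝒯.Mseg s n) :=
  𝒯.r_comm (𝒯.Mseg_away h) (𝒯.Mseg_away (by omega))

theorem r_Mseg_of_lt {s n j : ℕ} (h : j + 1 < s) : Commute (𝒯.r j : H) (𝒯.Mseg s n) := by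
  induction n with
  | zero => exact Commute.one_right _
  | succ n ih => exact ih.mul_right (𝒯.r_M_of_ge (by omega))

theorem r_Mseg {s n j : ℕ} (h1 : s ≤ j) (h2 : j + 1 < s + n) :
    Commute (𝒯.r j : H) (𝒯.Mseg s n) := by
  induction n with
  | zero => omega
  | succ n ih =>
    rcases Nat.lt_or_ge (j + 1) (s + n) with h | h
    · exact (ih h).mul_right (𝒯.r_M_of_ge (by omega))
    · obtain ⟨n, rfl⟩ : ∃ k, n = k + 1 := ⟨n - 1, by omega⟩
      obtain rfl : j = s + n := by omega
      rw [Mseg, Mseg, mul_assoc, ← add_assoc]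
      exact (𝒯.r_Mseg_of_le le_rfl).mul_right (𝒯.r_MM _)

/-! ### The representations of the braid groups -/

/-- The representation `σ_i ↦ r_{s + i}`. -/
def ρ (s : ℕ) {m : ℕ} : MonoidAlgebra ℂ (Braid m) →ₐ[ℂ] H :=
  MonoidAlgebra.lift ℂ _ _ ((Units.coeHom H).comp
    (Braid.lift (fun i : Fin m => 𝒯.r (s + i))
      (fun i j h => by
        have := 𝒯.r_braidSeq.braid (s + i)
        rwa [show s + (i : ℕ) + 1 = s + j by omega] at this)
      (fun i j h => 𝒯.r_braidSeq.far (s + i) (s + j) (by omega))))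

theorem lift_sig {m : ℕ} {G : Type*} [Group G] (f : Fin m → G) (h₁ h₂) (i : Fin m) :
    Braid.lift f h₁ h₂ (sig i) = f i := PresentedGroup.toGroup.of _

theorem ρ_sig (s : ℕ) {m : ℕ} (i : Fin m) : 𝒯.ρ s (sigA i) = 𝒯.r (s + i) := by
  rw [ρ, sigA, MonoidAlgebra.lift_of]
  exact congrArg Units.val (lift_sig _ _ _ i)

theorem ρ_sig_inv (s : ℕ) {m : ℕ} (i : Fin m) :
    𝒯.ρ s (MonoidAlgebra.of ℂ _ (sig i)⁻¹) = ((𝒯.r (s + i))⁻¹ : Hˣ) := by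
  rw [ρ, MonoidAlgebra.lift_of]
  have h : ∀ φ : Braid m →* Hˣ, φ (sig i)⁻¹ = (φ (sig i))⁻¹ := fun φ => map_inv φ _
  exact congrArg Units.val ((h _).trans (congrArg (·⁻¹) (lift_sig _ _ _ i)))

theorem shiftA_sig {m m' s : ℕ} (h : s + m ≤ m') (i : Fin m) :
    shiftA s h (sigA i) = sigA (⟨s + i, by omega⟩ : Fin m') := by
  simp only [shiftA, sigA, MonoidAlgebra.of_apply, MonoidAlgebra.mapDomainAlgHom_apply,
    MonoidAlgebra.mapDomain_single]
  congr 1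

theorem shiftA_sig_inv {m m' s : ℕ} (h : s + m ≤ m') (i : Fin m) :
    shiftA s h (MonoidAlgebra.of ℂ _ (sig i)⁻¹) =
      MonoidAlgebra.of ℂ _ (sig (⟨s + i, by omega⟩ : Fin m'))⁻¹ := by
  simp only [shiftA, MonoidAlgebra.of_apply, MonoidAlgebra.mapDomainAlgHom_apply,
    MonoidAlgebra.mapDomain_single]
  congr 1

theorem ρ_shiftA (s t : ℕ) {m m' : ℕ} (h : t + m ≤ m') (α : MonoidAlgebra ℂ (Braid m)) :
    𝒯.ρ s (shiftA t h α) = 𝒯.ρ (s + t) α := by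
  induction α using braidAlg_induction with
  | one => simp
  | mul a b ha hb => rw [map_mul, map_mul, ha, hb, map_mul]
  | add a b ha hb => rw [map_add, map_add, ha, hb, map_add]
  | smul z a ha => rw [map_smul, map_smul, ha, map_smul]
  | gen i => rw [shiftA_sig, ρ_sig, ρ_sig, add_assoc]
  | gen_inv i => rw [shiftA_sig_inv, ρ_sig_inv, ρ_sig_inv, add_assoc]

theorem ρ_intertwine {s t m : ℕ} {z : H} (h : ∀ i < m, z * 𝒯.r (s + i) = 𝒯.r (t + i) * z)
    (α : MonoidAlgebra ℂ (Braid m)) : z * 𝒯.ρ s α = 𝒯.ρ t α * z := by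
  induction α using braidAlg_induction with
  | one => simp
  | mul a b ha hb => rw [map_mul, map_mul, ← mul_assoc, ha, mul_assoc, hb, mul_assoc]
  | add a b ha hb => rw [map_add, map_add, mul_add, ha, hb, add_mul]
  | smul w a ha => rw [map_smul, map_smul, mul_smul_comm, ha, smul_mul_assoc]
  | gen i => rw [ρ_sig, ρ_sig, h i i.2]
  | gen_inv i =>
    rw [ρ_sig_inv, ρ_sig_inv, Units.mul_inv_eq_iff_eq_mul, mul_assoc, Units.eq_inv_mul_iff_mul_eq,
      h i i.2]

theorem ρ_commute {s m : ℕ} {z : H} (h : ∀ i, s ≤ i → i < s + m → Commute (𝒯.r i : H) z)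
    (α : MonoidAlgebra ℂ (Braid m)) : Commute (𝒯.ρ s α) z :=
  (𝒯.ρ_intertwine (fun i hi => (h _ (by omega) (by omega)).eq.symm) α).symm

theorem ρ_away {s m n : ℕ} (h : n < s ∨ s + m < n) (α : MonoidAlgebra ℂ (Braid m)) :
    𝒯.ρ s α ∈ 𝒯.away n := by
  induction α using braidAlg_induction with
  | one => rw [map_one]; exact one_mem _
  | mul a b ha hb => rw [map_mul]; exact mul_mem ha hb
  | add a b ha hb => rw [map_add]; exact add_mem ha hb
  | smul z a ha => rw [map_smul]; exact Subalgebra.smul_mem _ ha _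
  | gen i => rw [ρ_sig]; exact 𝒯.r_away (by omega) (by omega)
  | gen_inv i => rw [ρ_sig_inv]; exact 𝒯.rinv_away (by omega) (by omega)

theorem ρ_Mseg {s t m n : ℕ} (h1 : t ≤ s) (h2 : s + m < t + n) (α : MonoidAlgebra ℂ (Braid m)) :
    Commute (𝒯.ρ s α) (𝒯.Mseg t n) :=
  𝒯.ρ_commute (fun _ hi hi' => 𝒯.r_Mseg (by omega) (by omega)) α

theorem ρ_ρ_commute {s t m n : ℕ} (h : s + m + 1 ≤ t) (α : MonoidAlgebra ℂ (Braid m))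
    (β : MonoidAlgebra ℂ (Braid n)) : Commute (𝒯.ρ s α) (𝒯.ρ t β) :=
  𝒯.ρ_commute (fun i _ hi => (𝒯.ρ_commute (fun j hj _ =>
    ((𝒯.r_braidSeq.far i j (by omega)).map (Units.coeHom H)).symm) β).symm) α

theorem loopWord_sigConj {m : ℕ} (s : ℕ) (j : ℕ) (h : j < m) :
    𝒯.ρ s (MonoidAlgebra.of ℂ _ (sigConj j h)) = (loopWord (fun i => 𝒯.r (s + i)) j : Hˣ) := by
  induction j with
  | zero => rw [sigConj, loopWord]; exact 𝒯.ρ_sig s _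
  | succ j ih =>
    rw [sigConj, map_mul, map_mul, map_mul, map_mul, ih (by omega), ρ_sig_inv, loopWord]
    change 𝒯.ρ s (sigA _) * _ * _ = _
    rw [ρ_sig]
    rfl

/-! ### Iterated traces -/

/-- The iterated trace over the sites `s, …, s + n - 1`. -/
def TR (s n : ℕ) : H →ₗ[ℂ] H := mtrace 𝒯.E s n

theorem TR_zero (s : ℕ) (X : H) : 𝒯.TR s 0 X = X := rfl

theorem TR_succ (s n : ℕ) (X : H) : 𝒯.TR s (n + 1) X = 𝒯.TR s n (𝒯.E (s + n) X) := rfl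

theorem TR_one (s : ℕ) (X : H) : 𝒯.TR s 1 X = 𝒯.E s X := rfl

theorem TR_add (s a b : ℕ) (X : H) : 𝒯.TR s (a + b) X = 𝒯.TR s a (𝒯.TR (s + a) b X) := by
  induction b generalizing X with
  | zero => rfl
  | succ b ih => rw [← add_assoc, TR_succ, ih, TR_succ, add_assoc]

theorem TR_mul_left {s n : ℕ} {a : H} (h : ∀ j, s ≤ j → j < s + n → a ∈ 𝒯.away j) (X : H) :
    𝒯.TR s n (a * X) = a * 𝒯.TR s n X := by
  induction n generalizing X with
  | zero => rfl
  | succ n ih =>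
    rw [TR_succ, 𝒯.E_mul_left _ (h _ (by omega) (by omega)), ih fun j h1 h2 => h j h1 (by omega),
      TR_succ]

theorem TR_mul_right {s n : ℕ} {a : H} (h : ∀ j, s ≤ j → j < s + n → a ∈ 𝒯.away j) (X : H) :
    𝒯.TR s n (X * a) = 𝒯.TR s n X * a := by
  induction n generalizing X with
  | zero => rfl
  | succ n ih =>
    rw [TR_succ, 𝒯.E_mul_right _ (h _ (by omega) (by omega)), ih fun j h1 h2 => h j h1 (by omega),
      TR_succ]

theorem TR_away {s n m : ℕ} {X : H} (h : X ∈ 𝒯.away m) : 𝒯.TR s n X ∈ 𝒯.away m := by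
  induction n generalizing X with
  | zero => exact h
  | succ n ih => rw [TR_succ]; exact ih (𝒯.E_away _ h)

theorem TR_away_self {s n j : ℕ} (h1 : s ≤ j) (h2 : j < s + n) (X : H) :
    𝒯.TR s n X ∈ 𝒯.away j := by
  induction n generalizing X with
  | zero => omega
  | succ n ih =>
    rw [TR_succ]
    rcases Nat.lt_or_ge j (s + n) with h | h
    · exact ih h _
    · obtain rfl : j = s + n := by omega
      exact 𝒯.TR_away (𝒯.E_away_self _ _)

/-- Both sites of R_j are traced: R_j passes through the traces over later sites, and the double
trace over j, j + 1 is cyclic. -/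
theorem TR_cyc_r {s n j : ℕ} (h1 : s ≤ j) (h2 : j + 1 < s + n) (X : H) :
    𝒯.TR s n (𝒯.r j * X) = 𝒯.TR s n (X * 𝒯.r j) := by
  obtain ⟨a, rfl⟩ : ∃ a, j = s + a := ⟨j - s, by omega⟩
  obtain ⟨b, rfl⟩ : ∃ b, n = a + (2 + b) := ⟨n - a - 2, by omega⟩
  have key : ∀ X, 𝒯.TR s (a + (2 + b)) X = 𝒯.TR s a (𝒯.TR (s + a) 2 (𝒯.TR (s + a + 2) b X)) :=
    fun X => by rw [TR_add, TR_add]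
  have h : ∀ k, s + a + 2 ≤ k → k < s + a + 2 + b → (𝒯.r (s + a) : H) ∈ 𝒯.away k :=
    fun k hk _ => 𝒯.r_away (by omega) (by omega)
  rw [key, key, 𝒯.TR_mul_left h, 𝒯.TR_mul_right h]
  exact congrArg _ (𝒯.E_cyc _ _)

theorem TR_cyc_units {s n : ℕ} {u : Hˣ} (h : ∀ X, 𝒯.TR s n (u * X) = 𝒯.TR s n (X * u)) (X : H) :
    𝒯.TR s n ((u⁻¹ : Hˣ) * X) = 𝒯.TR s n (X * (u⁻¹ : Hˣ)) := by
  have := h ((u⁻¹ : Hˣ) * X * (u⁻¹ : Hˣ))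
  simpa [mul_assoc] using this.symm

theorem TR_cyc_run {s n a k : ℕ} (h1 : s ≤ a) (h2 : a + k < s + n ∨ k = 0) (X : H) :
    𝒯.TR s n (run 𝒯.r a k * X) = 𝒯.TR s n (X * run 𝒯.r a k) := by
  have : ∀ X, 𝒯.TR s n (run 𝒯.r a k * X) = 𝒯.TR s n (X * run 𝒯.r a k) := by
    refine run_induction (P := fun u : Hˣ => ∀ X, 𝒯.TR s n (u * X) = 𝒯.TR s n (X * u)) ?_ ?_ ?_
    · simp
    · intro u v hu hv X
      rw [Units.val_mul, mul_assoc, hu, mul_assoc, hv, mul_assoc]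
    · intro i hi hi' X
      exact 𝒯.TR_cyc_r (by omega) (by omega) X
  exact this X

theorem TR_conj_run {s n a k : ℕ} (h1 : s ≤ a) (h2 : a + k < s + n ∨ k = 0) (X : H) :
    𝒯.TR s n (run 𝒯.r a k * X * ((run 𝒯.r a k)⁻¹ : Hˣ)) = 𝒯.TR s n X := by
  rw [mul_assoc, 𝒯.TR_cyc_run h1 h2, mul_assoc, Units.inv_mul, mul_one]

theorem TR_conj_crossing {s n a l k : ℕ} (h1 : s ≤ a) (h2 : a + l + k ≤ s + n) (X : H) :
    𝒯.TR s n (crossing 𝒯.r a l k * X * ((crossing 𝒯.r a l k)⁻¹ : Hˣ)) = 𝒯.TR s n X := by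
  have : ∀ X, 𝒯.TR s n (crossing 𝒯.r a l k * X) = 𝒯.TR s n (X * crossing 𝒯.r a l k) := by
    refine crossing_induction
      (P := fun u : Hˣ => ∀ X, 𝒯.TR s n (u * X) = 𝒯.TR s n (X * u)) ?_ ?_ ?_
    · simp
    · intro u v hu hv X
      rw [Units.val_mul, mul_assoc, hu, mul_assoc, hv, mul_assoc]
    · intro i hi hi' X
      exact 𝒯.TR_cyc_r (by omega) (by omega) X
  rw [mul_assoc, this, mul_assoc, Units.inv_mul, mul_one]

theorem run_away {a k n : ℕ} (h : n < a ∨ a + k < n) : (run 𝒯.r a k).val ∈ 𝒯.away n :=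
  run_induction (P := fun u : Hˣ => (u : H) ∈ 𝒯.away n) (one_mem _) (fun _ _ h h' => mul_mem h h')
    fun i hi hi' => 𝒯.r_away (by omega) (by omega)

theorem run_f_away {a k n : ℕ} (h : n < a ∨ a + k < n) :
    (run 𝒯.f a k).val ∈ 𝒯.away n ∧ (((run 𝒯.f a k)⁻¹ : Hˣ) : H) ∈ 𝒯.away n :=
  run_induction (P := fun u : Hˣ => (u : H) ∈ 𝒯.away n ∧ ((u⁻¹ : Hˣ) : H) ∈ 𝒯.away n)
    ⟨one_mem _, by rw [inv_one]; exact one_mem _⟩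
    (fun _ _ h h' => ⟨mul_mem h.1 h'.1, by rw [mul_inv_rev]; exact mul_mem h'.2 h.2⟩)
    fun i hi hi' => ⟨𝒯.f_away (by omega) (by omega), 𝒯.finv_away (by omega) (by omega)⟩

/-- The trace is invariant under the block shift. -/
theorem TR_conj_f {s p : ℕ} {X : H} (hX : X ∈ 𝒯.away (s + p)) :
    𝒯.TR (s + 1) p (run 𝒯.f s p * X * ((run 𝒯.f s p)⁻¹ : Hˣ)) = 𝒯.TR s p X := by
  induction p generalizing X with
  | zero => simp [TR_zero, run]
  | succ p ih =>
    have e : (run 𝒯.f s (p + 1)).val * X * ((run 𝒯.f s (p + 1))⁻¹ : Hˣ) =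
        run 𝒯.f s p * (𝒯.f (s + p) * X * ((𝒯.f (s + p))⁻¹ : Hˣ)) * ((run 𝒯.f s p)⁻¹ : Hˣ) := by
      rw [run, mul_inv_rev, Units.val_mul, Units.val_mul]
      simp only [mul_assoc]
    have h1 := 𝒯.run_f_away (a := s) (k := p) (n := s + p + 1) (Or.inr (by omega))
    rw [e, TR_succ, show s + 1 + p = s + p + 1 by ring, 𝒯.E_mul_right _ h1.2,
      𝒯.E_mul_left _ h1.1, 𝒯.E_conj_f (s + p) (by rwa [add_assoc]), ih (𝒯.E_away_self _ _), TR_succ]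

theorem block_shift {s p m : ℕ} (h : m < p) (β : MonoidAlgebra ℂ (Braid m)) :
    (run 𝒯.f s p).val * (𝒯.Mseg s p * 𝒯.ρ s β) * ((run 𝒯.f s p)⁻¹ : Hˣ) =
      𝒯.Mseg (s + 1) p * 𝒯.ρ (s + 1) β := by
  rw [Units.mul_inv_eq_iff_eq_mul, ← mul_assoc, 𝒯.run_f_Mseg le_rfl le_rfl, mul_assoc, mul_assoc,
    𝒯.ρ_intertwine (fun i hi => ?_) β]
  have := congrArg Units.val (𝒯.run_f_r (s := s) (p := p) (j := s + i) (by omega) (by omega))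
  simp only [Units.val_mul] at this
  rw [this, show s + i + 1 = s + 1 + i by ring]

/-- `Tr M_0 ⋯ M_m x` over all sites but the first one. -/
def pw (m : ℕ) (x : H) : H := 𝒯.TR 1 m (𝒯.Mseg 0 (m + 1) * x)

/-- `Tr M_0 ⋯ M_m x` over all sites. -/
def ch (m : ℕ) (x : H) : H := 𝒯.TR 0 (m + 1) (𝒯.Mseg 0 (m + 1) * x)

theorem ch_eq (m : ℕ) (x : H) : 𝒯.ch m x = 𝒯.E 0 (𝒯.pw m x) := by
  rw [ch, pw, add_comm m 1, TR_add]
  rfl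

/-- A characteristic element may be computed on any block of consecutive sites: conjugation by a run
of F's shifts copies and braids together, and the trace is invariant under it. -/
theorem ch_shift {m : ℕ} (β : MonoidAlgebra ℂ (Braid m)) (s : ℕ) :
    𝒯.TR s (m + 1) (𝒯.Mseg s (m + 1) * 𝒯.ρ s β) = 𝒯.ch m (𝒯.ρ 0 β) := by
  induction s with
  | zero => rfl
  | succ s ih =>
    rw [← ih, ← 𝒯.block_shift (Nat.lt_succ_self m), 𝒯.TR_conj_f]
    exact mul_mem (𝒯.Mseg_away le_rfl) (𝒯.ρ_away (Or.inr (by omega)) β)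

/-- Operators acting trivially on every site. -/
def IsScalar (z : H) : Prop := ∀ n, z ∈ 𝒯.away n

theorem ch_isScalar {m : ℕ} (β : MonoidAlgebra ℂ (Braid m)) : 𝒯.IsScalar (𝒯.ch m (𝒯.ρ 0 β)) := by
  intro n
  rcases Nat.lt_or_ge n (m + 1) with h | h
  · exact 𝒯.TR_away_self (by omega) (by omega) _
  · exact 𝒯.TR_away (mul_mem (𝒯.Mseg_away (by omega)) (𝒯.ρ_away (Or.inr (by omega)) β))

variable {𝒯}

theorem IsScalar.commute_r {z : H} (h : 𝒯.IsScalar z) (n : ℕ) : Commute (𝒯.r n : H) z :=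
  𝒯.r_comm (h _) (h _)

theorem IsScalar.commute_f {z : H} (h : 𝒯.IsScalar z) (n : ℕ) : Commute (𝒯.f n : H) z :=
  𝒯.f_comm (h _) (h _)

theorem IsScalar.commute_ρ {z : H} (h : 𝒯.IsScalar z) (s : ℕ) {m : ℕ}
    (α : MonoidAlgebra ℂ (Braid m)) : Commute (𝒯.ρ s α) z :=
  𝒯.ρ_commute (fun i _ _ => h.commute_r i) α

variable (𝒯)

/-- By `ch_shift`, ch(β) is computed on the sites right after those of M^α; the traces over the new
sites do not affect the old operators. -/
theorem pw_mul_ch {m p : ℕ} (α : MonoidAlgebra ℂ (Braid m)) (β : MonoidAlgebra ℂ (Braid p)) :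
    𝒯.pw m (𝒯.ρ 0 α) * 𝒯.ch p (𝒯.ρ 0 β) =
      𝒯.pw (m + p + 1) (𝒯.ρ 0 α * 𝒯.ρ (m + 1) β) := by
  have h1 : 𝒯.ρ 0 α * 𝒯.Mseg (m + 1) (p + 1) = 𝒯.Mseg (m + 1) (p + 1) * 𝒯.ρ 0 α :=
    𝒯.ρ_commute (fun i _ hi => 𝒯.r_Mseg_of_lt (by omega)) α
  have h2 : 𝒯.Mseg 0 (m + p + 1 + 1) * (𝒯.ρ 0 α * 𝒯.ρ (m + 1) β) =
      𝒯.Mseg 0 (m + 1) * 𝒯.ρ 0 α * (𝒯.Mseg (m + 1) (p + 1) * 𝒯.ρ (m + 1) β) := by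
    rw [show m + p + 1 + 1 = (m + 1) + (p + 1) by ring, Mseg_add, zero_add, mul_assoc, mul_assoc,
      ← mul_assoc (𝒯.ρ 0 α), h1, mul_assoc]
  rw [pw, pw, h2, show m + p + 1 = m + (p + 1) by ring, TR_add, add_comm 1 m,
    𝒯.TR_mul_left (fun j hj _ => mul_mem (𝒯.Mseg_away (by omega))
      (𝒯.ρ_away (Or.inr (by omega)) α)), 𝒯.ch_shift, 𝒯.TR_mul_right
      (fun j _ _ => 𝒯.ch_isScalar β j)]

theorem ch_mul_ch {m p : ℕ} (α : MonoidAlgebra ℂ (Braid m)) (β : MonoidAlgebra ℂ (Braid p)) :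
    𝒯.ch m (𝒯.ρ 0 α) * 𝒯.ch p (𝒯.ρ 0 β) =
      𝒯.ch (m + p + 1) (𝒯.ρ 0 α * 𝒯.ρ (m + 1) β) := by
  rw [ch_eq, ch_eq _ (m + p + 1), ← pw_mul_ch, 𝒯.E_mul_right _ (𝒯.ch_isScalar β 0)]

theorem crossing_ρ_left {s n k m : ℕ} (h : m < n) (α : MonoidAlgebra ℂ (Braid m)) :
    (crossing 𝒯.r s n k).val * 𝒯.ρ s α = 𝒯.ρ (s + k) α * (crossing 𝒯.r s n k).val := by
  refine 𝒯.ρ_intertwine (fun i hi => ?_) α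
  have := congrArg Units.val (crossing_left 𝒯.r_braidSeq (s := s) (n := n) (k := k) (j := s + i)
    (by omega) (by omega))
  simp only [Units.val_mul] at this
  rw [this, show s + i + k = s + k + i by ring]

theorem crossing_ρ_right {s n k m : ℕ} (h : m < k) (α : MonoidAlgebra ℂ (Braid m)) :
    (crossing 𝒯.r s n k).val * 𝒯.ρ (s + n) α = 𝒯.ρ s α * (crossing 𝒯.r s n k).val := by
  refine 𝒯.ρ_intertwine (fun i hi => ?_) α
  have := congrArg Units.val (crossing_right 𝒯.r_braidSeq (s := s) (n := n) (k := k) (j := i)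
    (by omega))
  simpa only [Units.val_mul] using this

theorem crossing_Mseg {s n k t l : ℕ} (h1 : t ≤ s) (h2 : s + n + k ≤ t + l) :
    Commute (crossing 𝒯.r s n k).val (𝒯.Mseg t l) :=
  crossing_induction (P := fun u : Hˣ => Commute u.val (𝒯.Mseg t l)) (Commute.one_left _)
    (fun _ _ h h' => h.mul_left h') fun i _ _ => 𝒯.r_Mseg (by omega) (by omega)

theorem run_Mseg {a k t l : ℕ} (h1 : t ≤ a) (h2 : a + k < t + l) :
    Commute (run 𝒯.r a k).val (𝒯.Mseg t l) :=
  run_induction (P := fun u : Hˣ => Commute u.val (𝒯.Mseg t l)) (Commute.one_left _)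
    (fun _ _ h h' => h.mul_left h') fun i _ _ => 𝒯.r_Mseg (by omega) (by omega)

/-- Conjugation by the crossing of the two blocks exchanges α and β. It fixes the product of all
copies of M and drops out of the full trace. -/
theorem ch_comm {m p : ℕ} (α : MonoidAlgebra ℂ (Braid m)) (β : MonoidAlgebra ℂ (Braid p)) :
    Commute (𝒯.ch m (𝒯.ρ 0 α)) (𝒯.ch p (𝒯.ρ 0 β)) := by
  have h1 := 𝒯.crossing_ρ_left (s := 0) (n := p + 1) (k := m + 1) (Nat.lt_succ_self p) β
  have h2 := 𝒯.crossing_ρ_right (s := 0) (n := p + 1) (k := m + 1) (Nat.lt_succ_self m) α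
  set y := crossing 𝒯.r 0 (p + 1) (m + 1) with hy
  rw [zero_add] at h1 h2
  have h3 : Commute y.val (𝒯.Mseg 0 (p + m + 1 + 1)) := 𝒯.crossing_Mseg le_rfl (by omega)
  have h4 : Commute (𝒯.ρ 0 α) (𝒯.ρ (m + 1) β) := 𝒯.ρ_ρ_commute (by omega) α β
  show _ = _
  have h5 : y.val * (𝒯.ρ 0 β * (𝒯.ρ (p + 1) α * (y⁻¹).val)) = 𝒯.ρ 0 α * 𝒯.ρ (m + 1) β := by
    rw [← mul_assoc, h1, mul_assoc, ← mul_assoc y.val, h2, mul_assoc, Units.mul_inv, mul_one,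
      h4.eq]
  have h6 : y.val * (𝒯.Mseg 0 (p + m + 1 + 1) * (𝒯.ρ 0 β * 𝒯.ρ (p + 1) α)) * (y⁻¹).val =
      𝒯.Mseg 0 (p + m + 1 + 1) * (𝒯.ρ 0 α * 𝒯.ρ (m + 1) β) := by
    rw [← h5, ← mul_assoc, h3.eq]
    simp only [mul_assoc]
  rw [ch_mul_ch, ch_mul_ch, ch, ch, ← 𝒯.TR_conj_crossing (s := 0) (n := p + m + 1 + 1) (a := 0)
    (l := p + 1) (k := m + 1) le_rfl (by omega) (_ * (𝒯.ρ 0 β * _)), ← hy, h6, add_comm p m]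

end QMTower

namespace QMTower

variable {q μ : ℂ} {H : Type*} [Ring H] [Algebra ℂ H] (𝒯 : QMTower q μ H)

/-! ### Multiplication operators of the star product -/

/-- `f_{k - 1} ⋯ f_0`. -/
def climb : ℕ → Hˣ
  | 0 => 1
  | k + 1 => 𝒯.f k * climb k

/-- Conjugation by F_{k−1}⋯F_0 moves a descendant from site 0 to site k. At each step the remaining
F's needed for a block shift are supplied by the invariance of the trailing traces. -/
theorem climb_pw {p : ℕ} (β : MonoidAlgebra ℂ (Braid p)) (k : ℕ) :
    (𝒯.climb k).val * 𝒯.pw p (𝒯.ρ 0 β) * ((𝒯.climb k)⁻¹).val =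
      𝒯.TR (k + 1) p (𝒯.Mseg k (p + 1) * 𝒯.ρ k β) := by
  induction k with
  | zero => simp [climb, pw]
  | succ k ih =>
    have e : (𝒯.climb (k + 1)).val * 𝒯.pw p (𝒯.ρ 0 β) * ((𝒯.climb (k + 1))⁻¹).val =
        𝒯.f k * ((𝒯.climb k).val * 𝒯.pw p (𝒯.ρ 0 β) * ((𝒯.climb k)⁻¹).val) *
          ((𝒯.f k)⁻¹ : Hˣ) := by
      rw [climb, mul_inv_rev, Units.val_mul, Units.val_mul]
      simp only [mul_assoc]
    have hX : 𝒯.Mseg k (p + 1) * 𝒯.ρ k β ∈ 𝒯.away (k + 1 + p) :=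
      mul_mem (𝒯.Mseg_away (by omega)) (𝒯.ρ_away (Or.inr (by omega)) β)
    have hf : ∀ j, k + 1 + 1 ≤ j → j < k + 1 + 1 + p → ((𝒯.f k).val ∈ 𝒯.away j ∧
        ((𝒯.f k)⁻¹).val ∈ 𝒯.away j) := fun j _ _ =>
      ⟨𝒯.f_away (by omega) (by omega), 𝒯.finv_away (by omega) (by omega)⟩
    rw [e, ih, ← 𝒯.TR_conj_f hX, ← 𝒯.TR_mul_left (fun j h1 h2 => (hf j h1 h2).1),
      ← 𝒯.TR_mul_right (fun j h1 h2 => (hf j h1 h2).2), ← 𝒯.block_shift (Nat.lt_succ_self p),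
      run_succ_left, mul_inv_rev, Units.val_mul, Units.val_mul]
    simp only [mul_assoc]

theorem loop_away {m n : ℕ} (h : m + 1 < n) : (loopWord 𝒯.r m).val ∈ 𝒯.away n :=
  (loopWord_induction (P := fun u : Hˣ => u.val ∈ 𝒯.away n ∧ (u⁻¹).val ∈ 𝒯.away n)
    (fun _ _ h h' => ⟨mul_mem h.1 h'.1, by rw [mul_inv_rev]; exact mul_mem h'.2 h.2⟩)
    (fun _ h => ⟨h.2, by rw [inv_inv]; exact h.1⟩)
    fun i hi => ⟨𝒯.r_away (by omega) (by omega), 𝒯.rinv_away (by omega) (by omega)⟩).1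

theorem run_inv_away {a k n : ℕ} (h : n < a ∨ a + k < n) :
    ((run 𝒯.r a k)⁻¹).val ∈ 𝒯.away n :=
  run_induction (P := fun u : Hˣ => (u⁻¹).val ∈ 𝒯.away n) (by rw [inv_one]; exact one_mem _)
    (fun _ _ h h' => by rw [mul_inv_rev]; exact mul_mem h' h)
    fun i hi hi' => 𝒯.rinv_away (by omega) (by omega)

/-- Left star multiplication by a descendant. -/
def starL {m : ℕ} (α : MonoidAlgebra ℂ (Braid m)) : H →ₗ[ℂ] H where
  toFun Y := 𝒯.TR 1 (m + 1) (𝒯.Mseg 0 (m + 1) * ((𝒯.climb (m + 1)).val * Y *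
    ((𝒯.climb (m + 1))⁻¹).val) * (𝒯.ρ 0 α * (loopWord 𝒯.r m).val))
  map_add' X Y := by simp only [mul_add, add_mul, map_add]
  map_smul' z X := by simp only [mul_smul_comm, smul_mul_assoc, map_smul, RingHom.id_apply]

/-- Right star multiplication by a descendant. -/
def starR {p : ℕ} (β : MonoidAlgebra ℂ (Braid p)) : H →ₗ[ℂ] H where
  toFun X := 𝒯.TR 1 (p + 1) ((run 𝒯.r 0 (p + 1)).val * 𝒯.Mseg 0 (p + 1) *
    ((𝒯.climb (p + 1)).val * X * ((𝒯.climb (p + 1))⁻¹).val) *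
      (((run 𝒯.r 0 (p + 1))⁻¹).val * 𝒯.ρ 1 β * (𝒯.r 0).val))
  map_add' X Y := by simp only [mul_add, add_mul, map_add]
  map_smul' z X := by simp only [mul_smul_comm, smul_mul_assoc, map_smul, RingHom.id_apply]

/-- The exponent of the star product. -/
def starH {m p : ℕ} (α : MonoidAlgebra ℂ (Braid m)) (β : MonoidAlgebra ℂ (Braid p)) : H :=
  𝒯.ρ 0 α * 𝒯.ρ (m + 1) β * (loopWord 𝒯.r m).val

theorem starL_pw {m p : ℕ} (α : MonoidAlgebra ℂ (Braid m)) (β : MonoidAlgebra ℂ (Braid p)) :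
    𝒯.starL α (𝒯.pw p (𝒯.ρ 0 β)) = 𝒯.pw (m + p + 1) (𝒯.starH α β) := by
  change 𝒯.TR 1 (m + 1) _ = _
  rw [climb_pw, pw, show m + p + 1 = (m + 1) + p by ring, 𝒯.TR_add 1 (m + 1) p, show m + 1 + p + 1 =
    (m + 1) + (p + 1) by ring, 𝒯.Mseg_add 0 (m + 1) (p + 1), zero_add, add_comm 1 (m + 1),
    ← 𝒯.TR_mul_left (s := m + 1 + 1) (fun j h1 _ => 𝒯.Mseg_away (by omega)), ← 𝒯.TR_mul_right (s := m + 1 + 1) (fun j h1 _ =>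
      mul_mem (𝒯.ρ_away (Or.inr (by omega)) α) (𝒯.loop_away (by omega)))]
  congr 2
  rw [starH, (𝒯.ρ_ρ_commute (s := 0) (t := m + 1) (by omega) α β).eq]
  simp only [mul_assoc]

/-- Here the copies of the left factor are placed behind those of β, and the block crossing, which
commutes with the product of all copies, restores the order. It factors as vz. The part v avoids
site 0 and disappears under the trace; the part z meets site 0, which is why it appears in the
definition of `starR`. -/
theorem starR_pw {m p : ℕ} (α : MonoidAlgebra ℂ (Braid m)) (β : MonoidAlgebra ℂ (Braid p)) :
    𝒯.starR β (𝒯.pw m (𝒯.ρ 0 α)) = 𝒯.pw (m + p + 1) (𝒯.starH α β) := by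
  set z := run 𝒯.r 0 (p + 1) with hz
  set v := crossing 𝒯.r 1 (p + 1) m with hv
  have hy : crossing 𝒯.r 0 (p + 1) (m + 1) = v * z := crossing_succ_eq 0 (p + 1) m
  have h1 : (v * z).val * 𝒯.ρ (p + 1) α = 𝒯.ρ 0 α * (v * z).val := by
    have := 𝒯.crossing_ρ_right (s := 0) (n := p + 1) (k := m + 1) (Nat.lt_succ_self m) α
    rwa [zero_add, hy] at this
  have h2 : v.val * 𝒯.ρ 1 β = 𝒯.ρ (m + 1) β * v.val := by
    have := 𝒯.crossing_ρ_left (s := 1) (n := p + 1) (k := m) (Nat.lt_succ_self p) β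
    rwa [add_comm 1 m] at this
  have h3 : v.val * (𝒯.r 0).val = (loopWord 𝒯.r m).val * v.val := by
    have := congrArg Units.val (crossing_loopWord 𝒯.r_braidSeq p m)
    simpa only [Units.val_mul] using this
  have hzM : Commute z.val (𝒯.Mseg 0 (m + p + 1 + 1)) := 𝒯.run_Mseg le_rfl (by omega)
  have hvM : Commute v.val (𝒯.Mseg 0 (m + p + 1 + 1)) := 𝒯.crossing_Mseg (by omega) (by omega)
  have e1 : 𝒯.starR β (𝒯.pw m (𝒯.ρ 0 α)) = 𝒯.TR 1 (m + p + 1) (z.val *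
      (𝒯.Mseg 0 (m + p + 1 + 1) * 𝒯.ρ (p + 1) α) * ((z⁻¹).val * 𝒯.ρ 1 β * (𝒯.r 0).val)) := by
    change 𝒯.TR 1 (p + 1) _ = _
    rw [climb_pw, show m + p + 1 = (p + 1) + m by ring, 𝒯.TR_add 1 (p + 1) m, show p + 1 + m + 1 =
      (p + 1) + (m + 1) by ring, 𝒯.Mseg_add 0 (p + 1) (m + 1), zero_add, add_comm 1 (p + 1),
      ← 𝒯.TR_mul_left (s := p + 1 + 1) (fun j h1 _ => mul_mem (𝒯.run_away (Or.inr (by omega)))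
        (𝒯.Mseg_away (by omega))),
      ← 𝒯.TR_mul_right (s := p + 1 + 1) (fun j h1 _ => mul_mem (mul_mem (𝒯.run_inv_away (Or.inr (by omega)))
        (𝒯.ρ_away (Or.inr (by omega)) β)) (𝒯.r_away (by omega) (by omega)))]
    simp only [mul_assoc, ← hz]
  have e2 : v.val * (z.val * (𝒯.Mseg 0 (m + p + 1 + 1) * 𝒯.ρ (p + 1) α) *
      ((z⁻¹).val * 𝒯.ρ 1 β * (𝒯.r 0).val)) * (v⁻¹).val =
      𝒯.Mseg 0 (m + p + 1 + 1) * 𝒯.starH α β := by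
    rw [Units.mul_inv_eq_iff_eq_mul, starH]
    simp only [mul_assoc]
    rw [← h3, ← mul_assoc (𝒯.ρ (m + 1) β), ← h2, ← mul_assoc z.val, hzM.eq, mul_assoc,
      ← mul_assoc v.val, hvM.eq, mul_assoc]
    congr 1
    have : 𝒯.ρ 0 α * v.val = v.val * (z.val * (𝒯.ρ (p + 1) α * (z⁻¹).val)) := by
      rw [← mul_assoc, ← mul_assoc, Units.eq_mul_inv_iff_mul_eq]
      rw [Units.val_mul] at h1
      rw [mul_assoc, h1]
    rw [← mul_assoc (𝒯.ρ 0 α), ← mul_assoc (𝒯.ρ 0 α), this]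
    simp only [mul_assoc]
  rw [e1, ← 𝒯.TR_conj_crossing (s := 1) (n := m + p + 1) (a := 1) (l := p + 1) (k := m) le_rfl
    (by omega), ← hv, e2, pw]

/-- Conjugation invariance strips the outer generators one site at a time, down to the R-trace of
R_0. -/
theorem E_loopWord (m : ℕ) : 𝒯.E (m + 1) (loopWord 𝒯.r m).val = 1 := by
  induction m with
  | zero => exact 𝒯.E_r 0
  | succ m ih =>
    rw [loopWord, Units.val_mul, Units.val_mul, 𝒯.E_conj_r _ (𝒯.loop_away (by omega)), ih]

theorem starL_one {m : ℕ} (α : MonoidAlgebra ℂ (Braid m)) :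
    𝒯.starL α 1 = 𝒯.pw m (𝒯.ρ 0 α) := by
  change 𝒯.TR 1 (m + 1) _ = _
  rw [mul_one, Units.mul_inv, mul_one, ← mul_assoc, TR_succ, add_comm 1 m, 𝒯.E_mul_left _
    (mul_mem (𝒯.Mseg_away (by omega)) (𝒯.ρ_away (Or.inr (by omega)) α)), E_loopWord, mul_one, pw]

/-- Since z carries `ρ 0 β` to `ρ 1 β`, the braid factors reduce to a conjugation by c = r_1⋯r_p,
which the trace removes, and a conjugate of R_p, whose R-trace over the last site is 1. -/
theorem starR_one {p : ℕ} (β : MonoidAlgebra ℂ (Braid p)) :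
    𝒯.starR β 1 = 𝒯.pw p (𝒯.ρ 0 β) := by
  change 𝒯.TR 1 (p + 1) _ = _
  set z := run 𝒯.r 0 (p + 1) with hz
  set c := run 𝒯.r 1 p with hc
  set d := run 𝒯.r 0 p with hd
  have hzc : z = 𝒯.r 0 * c := run_succ_left 0 p
  have h1 : z.val * 𝒯.ρ 0 β = 𝒯.ρ 1 β * z.val := by
    refine 𝒯.ρ_intertwine (fun i hi => ?_) β
    have := congrArg Units.val (run_shift 𝒯.r_braidSeq (a := 0) (n := p + 1) (j := i)
      (by omega) (by omega))
    simp only [Units.val_mul] at this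
    rw [zero_add, this, add_comm 1 i]
  have h2 : (z⁻¹).val * 𝒯.ρ 1 β = 𝒯.ρ 0 β * (z⁻¹).val := by
    rw [Units.inv_mul_eq_iff_eq_mul, ← mul_assoc, Units.eq_mul_inv_iff_mul_eq, h1]
  have h3 : (z⁻¹).val * (𝒯.r 0).val = (c⁻¹).val := by
    rw [hzc, mul_inv_rev, Units.val_mul, mul_assoc, Units.inv_mul, mul_one]
  have h4 : (c⁻¹).val * z.val = d.val * 𝒯.r p * (d⁻¹).val := by
    have := congrArg Units.val (run_conj 𝒯.r_braidSeq p)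
    rw [mul_assoc, ← hc, ← hzc] at this
    exact this
  rw [mul_one, Units.mul_inv, mul_one, h2, mul_assoc _ (z⁻¹).val, h3]
  have h5 : z.val * 𝒯.Mseg 0 (p + 1) * (𝒯.ρ 0 β * (c⁻¹).val) =
      c.val * (d.val * 𝒯.r p * (d⁻¹).val * (𝒯.Mseg 0 (p + 1) * 𝒯.ρ 0 β)) * (c⁻¹).val := by
    rw [← h4]
    simp only [mul_assoc, Units.mul_inv_cancel_left]
  rw [h5, hc, 𝒯.TR_conj_run le_rfl (by omega), TR_succ, add_comm 1 p,
    𝒯.E_mul_right _ (mul_mem (𝒯.Mseg_away (by omega)) (𝒯.ρ_away (Or.inr (by omega)) β)),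
    𝒯.E_mul_right _ (𝒯.run_inv_away (Or.inr (by omega))),
    𝒯.E_mul_left _ (𝒯.run_away (Or.inr (by omega))), 𝒯.E_r, mul_one, Units.mul_inv, one_mul, pw]

variable {𝒯}

theorem IsScalar.commute_climb {z : H} (h : 𝒯.IsScalar z) (k : ℕ) :
    Commute (𝒯.climb k).val z := by
  induction k with
  | zero => exact Commute.one_left _
  | succ k ih => exact (h.commute_f k).mul_left ih

theorem IsScalar.commute_loop {z : H} (h : 𝒯.IsScalar z) (k : ℕ) :
    Commute (loopWord 𝒯.r k).val z :=
  loopWord_induction (P := fun u : Hˣ => Commute u.val z) (fun _ _ h h' => h.mul_left h')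
    (fun _ h => h.units_inv_left) fun i _ => h.commute_r i

theorem IsScalar.commute_run {z : H} (h : 𝒯.IsScalar z) (a k : ℕ) :
    Commute (run 𝒯.r a k).val z :=
  run_induction (P := fun u : Hˣ => Commute u.val z) (Commute.one_left _)
    (fun _ _ h h' => h.mul_left h') fun i _ _ => h.commute_r i

theorem IsScalar.starL_mul {z : H} (h : 𝒯.IsScalar z) {m : ℕ} (α : MonoidAlgebra ℂ (Braid m))
    (Y : H) : 𝒯.starL α (Y * z) = 𝒯.starL α Y * z := by
  have hc : Commute (𝒯.ρ 0 α * (loopWord 𝒯.r m).val) z :=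
    (h.commute_ρ 0 α).mul_left (h.commute_loop m)
  have hd : Commute ((𝒯.climb (m + 1))⁻¹).val z := (h.commute_climb _).units_inv_left
  change 𝒯.TR 1 (m + 1) _ = 𝒯.TR 1 (m + 1) _ * z
  rw [← 𝒯.TR_mul_right (s := 1) (n := m + 1) fun j _ _ => h j]
  refine congrArg _ ?_
  rw [mul_assoc _ (_ * _) z, hc.eq]
  simp only [mul_assoc]
  rw [← hd.left_comm]

theorem IsScalar.starR_mul {z : H} (h : 𝒯.IsScalar z) {p : ℕ} (β : MonoidAlgebra ℂ (Braid p))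
    (X : H) : 𝒯.starR β (X * z) = 𝒯.starR β X * z := by
  have hc : Commute (((run 𝒯.r 0 (p + 1))⁻¹).val * 𝒯.ρ 1 β * (𝒯.r 0).val) z :=
    ((h.commute_run _ _).units_inv_left.mul_left (h.commute_ρ 1 β)).mul_left (h.commute_r 0)
  have hd : Commute ((𝒯.climb (p + 1))⁻¹).val z := (h.commute_climb _).units_inv_left
  change 𝒯.TR 1 (p + 1) _ = 𝒯.TR 1 (p + 1) _ * z
  rw [← 𝒯.TR_mul_right (s := 1) (n := p + 1) fun j _ _ => h j]
  refine congrArg _ ?_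
  rw [mul_assoc _ (((run 𝒯.r 0 (p + 1))⁻¹).val * 𝒯.ρ 1 β * (𝒯.r 0).val) z, hc.eq]
  simp only [mul_assoc]
  rw [← hd.left_comm]

end QMTower

/-- Bilinear maps determined by compatible families of left and right multiplications. -/
theorem exists_bilinear_of_generators {P ι : Type*} [AddCommGroup P] [Module ℂ P] {v : ι → P}
    (hv : Submodule.span ℂ (Set.range v) = ⊤) (l r : ι → P →ₗ[ℂ] P)
    (h : ∀ i j, l i (v j) = r j (v i)) :
    ∃ b : P →ₗ[ℂ] P →ₗ[ℂ] P, (∀ i y, b (v i) y = l i y) ∧ ∀ x j, b x (v j) = r j x := by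
  set c : (ι →₀ ℂ) →ₗ[ℂ] P := Finsupp.linearCombination ℂ v with hc
  set d : (ι →₀ ℂ) →ₗ[ℂ] P →ₗ[ℂ] P := Finsupp.linearCombination ℂ l with hd
  have hsurj : LinearMap.range c = ⊤ := by
    rw [hc, Finsupp.range_linearCombination, hv]
  obtain ⟨σ, hσ⟩ := c.exists_rightInverse_of_surjective hsurj
  -- On the spanning vectors, the left multiplication by a formal combination x depends only on the
  -- vector that x represents. So linear relations among the v i act as zero, and any linear section
  -- of c gives the same product.
  have hj : ∀ x j, d x (v j) = r j (c x) := by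
    intro x j
    induction x using Finsupp.induction_linear with
    | zero => simp
    | add x y hx hy => simp only [map_add, LinearMap.add_apply, hx, hy]
    | single i z => simp [hc, hd, h]
  have hker : ∀ x, c x = 0 → d x = 0 := by
    intro x hx
    refine LinearMap.ext_on_range hv fun j => ?_
    rw [hj, hx, map_zero, LinearMap.zero_apply]
  refine ⟨d ∘ₗ σ, fun i y => ?_, fun x j => ?_⟩
  · have h1 : c (σ (v i) - Finsupp.single i 1) = 0 := by
      have := LinearMap.congr_fun hσ (v i)
      rw [LinearMap.comp_apply, LinearMap.id_apply] at this
      rw [map_sub, this, hc, Finsupp.linearCombination_single, one_smul, sub_self]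
    have h2 := hker _ h1
    rw [map_sub, sub_eq_zero] at h2
    rw [LinearMap.comp_apply, h2, hd, Finsupp.linearCombination_single, one_smul]
  · have := LinearMap.congr_fun hσ x
    rw [LinearMap.comp_apply, LinearMap.id_apply] at this
    rw [LinearMap.comp_apply, hj, this]

/-! ### Identification of the tower with matrix descendants and characteristic elements. -/

section Transfer

variable {A : Type*} [Ring A] [Algebra ℂ A] {N : ℕ} {q μ : ℂ} {R F : RMatrix N}

/-- The defining relation of the quantum matrix algebra. -/
def IsQuantumMatrix (R F : RMatrix N) (T : Matrix (Fin N) (Fin N) A) : Prop :=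
  locA A (0 : Fin 1) R.mat * matCopy F T 1 0 * matCopy F T 1 1 =
    matCopy F T 1 0 * matCopy F T 1 1 * locA A (0 : Fin 1) R.mat

theorem QMTower.prod_ofFn_M {H : Type*} [Ring H] [Algebra ℂ H] (𝒯 : QMTower q μ H) (n : ℕ) :
    (List.ofFn fun k : Fin n => 𝒯.M k).prod = 𝒯.Mseg 0 n := by
  induction n with
  | zero => rfl
  | succ n ih =>
    rw [List.ofFn_succ', List.concat_eq_append, List.prod_append, List.prod_singleton, Mseg,
      zero_add, ← ih]
    rfl

variable (hc : IsCompatible R F) (hs : IsSkewInvertible R.mat) (hb : IsBMW q μ R)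
  {T : Matrix (Fin N) (Fin N) A} (hT : IsQuantumMatrix R F T)

theorem act_matCopy {m : ℕ} (k : Fin (m + 1)) :
    act (firstSites (m + 1)) (matCopy F T m k) = (qmTower hc hs hb T hT).M k := by
  induction k using Fin.induction with
  | zero => exact act_firstSite T
  | succ i ih =>
    have h : matCopy F T m i.succ =
        locA A i F.mat * matCopy F T m i.castSucc * locA A i F.inv := rfl
    rw [h, map_mul, map_mul, ih, act_locA, act_locA]
    rfl

theorem actC_rho {m : ℕ} (α : MonoidAlgebra ℂ (Braid m)) :
    actC A (firstSites (m + 1)) (rho R α) = (qmTower hc hs hb T hT).ρ 0 α := by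
  have hsig : ∀ i : Fin m, rho R (sigA i) = loc i R.mat := fun i => by
    rw [rho, sigA, MonoidAlgebra.lift_of]
    exact congrArg Units.val (QMTower.lift_sig R.unitAt R.unitAt_braid R.unitAt_comm i)
  have hinv : ∀ i : Fin m, rho R (MonoidAlgebra.of ℂ _ (sig i)⁻¹) = loc i R.inv := fun i => by
    rw [rho, MonoidAlgebra.lift_of]
    have h : ∀ φ : Braid m →* (TensorMat N (m + 1) ℂ)ˣ, φ (sig i)⁻¹ = (φ (sig i))⁻¹ :=
      fun φ => map_inv φ _
    exact congrArg Units.val ((h _).trans (congrArg (·⁻¹) (QMTower.lift_sig R.unitAt R.unitAt_braid R.unitAt_comm i)))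
  have h0 : ∀ i : ℕ, (qmTower hc hs hb T hT).r (0 + i) = (qmTower hc hs hb T hT).r i := fun i => by
    rw [zero_add]
  induction α using braidAlg_induction with
  | one => simp only [map_one]
  | mul a b ha hb => rw [map_mul, map_mul, ha, hb, map_mul]
  | add a b ha hb => rw [map_add, map_add, ha, hb, map_add]
  | smul z a ha => rw [map_smul, map_smul, ha, map_smul]
  | gen i => rw [hsig, QMTower.ρ_sig, actC_loc, h0]; rfl
  | gen_inv i => rw [hinv, QMTower.ρ_sig_inv, actC_loc, h0]; rfl

theorem actOne_matPow {m : ℕ} (α : MonoidAlgebra ℂ (Braid m)) :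
    actOne 0 (matPow R F T α) =
      (qmTower hc hs hb T hT).pw m ((qmTower hc hs hb T hT).ρ 0 α) := by
  rw [matPow, actOne_traceTail, copyProd, map_mul, ← actC_eq, actC_rho hc hs hb hT, map_list_prod,
    List.map_ofFn, QMTower.pw, ← QMTower.prod_ofFn_M]
  congr 4
  ext1 k
  exact act_matCopy hc hs hb hT k

theorem coef_chr {m : ℕ} (α : MonoidAlgebra ℂ (Braid m)) :
    coef N A (chr R F T α) =
      (qmTower hc hs hb T hT).ch m ((qmTower hc hs hb T hT).ρ 0 α) := by
  rw [QMTower.ch_eq, ← actOne_matPow, chr, rTrace]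
  exact (ptrace_actOne (D := skewD R.mat) 0 _).symm

theorem coef_isScalar (c : A) : (qmTower hc hs hb T hT).IsScalar (coef N A c) :=
  fun n => coef_mem_awayFrom c n

include hc hs hb hT in
theorem chr_commute [Nonempty (Fin N)] {m p : ℕ} (α : MonoidAlgebra ℂ (Braid m))
    (β : MonoidAlgebra ℂ (Braid p)) : Commute (chr R F T α) (chr R F T β) := by
  apply coef_injective (N := N)
  rw [map_mul, map_mul, coef_chr hc hs hb hT, coef_chr hc hs hb hT]
  exact (qmTower hc hs hb T hT).ch_comm α β

end Transfer

theorem BMWPair.contr_inv_eq {B : Type*} [Ring B] [Algebra ℂ B] {q μ : ℂ} {x y : Bˣ}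
    (h : BMWPair q μ x y) :
    (x⁻¹).val * contr q μ y.val = y.val * contr q μ x.val * contr q μ y.val := by
  have := h.symm.kk_inv
  rw [mul_assoc, this, ← mul_assoc, ← mul_assoc, Units.mul_inv, one_mul]

namespace QMTower

variable {q μ : ℂ} {H : Type*} [Ring H] [Algebra ℂ H] (𝒯 : QMTower q μ H)

/-! ### Contractors in the tower -/

/-- The contractor `κ_n`. -/
def κ (n : ℕ) : H := contr q μ (𝒯.r n).val

theorem pair (n : ℕ) : BMWPair q μ (𝒯.r n) (𝒯.r (n + 1)) := (𝒯.bmw (n + 2)).pair n (by omega)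

theorem κ_sq (n : ℕ) : 𝒯.κ n * 𝒯.κ n = bmwEta q μ • 𝒯.κ n := contr_sq (𝒯.pair n).cubic

theorem κ_away {n m : ℕ} (h1 : m ≠ n) (h2 : m ≠ n + 1) : 𝒯.κ n ∈ 𝒯.away m := by
  have hr := 𝒯.r_away h1 h2
  exact Subalgebra.smul_mem _ (mul_mem
    (sub_mem (Subalgebra.smul_mem _ (one_mem _) _) hr)
    (add_mem (Subalgebra.smul_mem _ (one_mem _) _) hr)) _

variable {𝒯} in
theorem κ_commute {n : ℕ} {z : H} (h : Commute (𝒯.r n).val z) : Commute (𝒯.κ n) z :=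
  (Commute.contr_right h.symm q μ).symm

theorem ρ_kap (s : ℕ) {m : ℕ} (i : Fin m) : 𝒯.ρ s (kap q μ i) = 𝒯.κ (s + i) := by
  rw [κ, ← 𝒯.ρ_sig s i, ← contr_map]
  rfl

theorem κ_Mseg {s n j : ℕ} (h1 : s ≤ j) (h2 : j + 1 < s + n) : Commute (𝒯.κ j) (𝒯.Mseg s n) :=
  κ_commute (𝒯.r_Mseg h1 h2)

/-- The 2-contraction. -/
def g : H := (bmwEta q μ)⁻¹ • 𝒯.ch 1 (𝒯.κ 0)

theorem g_eq : 𝒯.g = 𝒯.ch 1 (𝒯.ρ 0 ((bmwEta q μ)⁻¹ • kap q μ (0 : Fin 1))) := by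
  have h : 𝒯.ρ 0 (kap q μ (0 : Fin 1)) = 𝒯.κ 0 := 𝒯.ρ_kap 0 0
  simp only [map_smul, h, g, ch, mul_smul_comm]

theorem g_isScalar : 𝒯.IsScalar 𝒯.g := by
  rw [g_eq]
  exact 𝒯.ch_isScalar _

theorem E_κ_mul {n : ℕ} {X Y : H} (hX : X ∈ 𝒯.away (n + 1)) (hY : Y ∈ 𝒯.away (n + 1)) :
    𝒯.E (n + 1) (X * 𝒯.κ n * Y) = μ • (X * Y) := by
  rw [𝒯.E_mul_right _ hY, 𝒯.E_mul_left _ hX, κ, 𝒯.E_contr, Algebra.algebraMap_eq_smul_one,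
    mul_smul_comm, smul_mul_assoc, mul_one]

/-- Two adjacent contracted pairs can be pulled across each other for free: κ_0κ_1 and κ_1κ_2 absorb
products of two generators, and κ_2κ_1κ_2 = κ_2 restores the pair. -/
theorem κκ_crossing :
    𝒯.κ 0 * 𝒯.κ 2 * (crossing 𝒯.r 0 2 2).val = 𝒯.κ 0 * 𝒯.κ 2 ∧
      (crossing 𝒯.r 0 2 2).val * (𝒯.κ 0 * 𝒯.κ 2) = 𝒯.κ 0 * 𝒯.κ 2 := by
  have hc : (crossing 𝒯.r 0 2 2).val =
      (𝒯.r 1).val * (𝒯.r 2).val * ((𝒯.r 0).val * (𝒯.r 1).val) := by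
    simp [crossing, run]
  have h02 : Commute (𝒯.r 0).val (𝒯.r 2).val := (𝒯.bmw 3).far 0 2 le_rfl (by omega)
  have hk02 : Commute (𝒯.κ 0) (𝒯.κ 2) := κ_commute (κ_commute h02.symm).symm
  have hk2 : Commute (𝒯.κ 2) (𝒯.r 0).val := κ_commute h02.symm
  have hk0 : Commute (𝒯.κ 0) (𝒯.r 2).val := κ_commute h02
  have a1 : 𝒯.κ 0 * 𝒯.κ 1 = 𝒯.κ 0 * ((𝒯.r 1).val * (𝒯.r 0).val) := (𝒯.pair 0).kk_right
  have a2 : 𝒯.κ 1 * 𝒯.κ 2 = 𝒯.κ 1 * ((𝒯.r 2).val * (𝒯.r 1).val) := (𝒯.pair 1).kk_right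
  have a3 : 𝒯.κ 2 * 𝒯.κ 1 * 𝒯.κ 2 = 𝒯.κ 2 := (𝒯.pair 1).symm.kkk
  have b1 : 𝒯.κ 1 * 𝒯.κ 0 = (𝒯.r 0).val * (𝒯.r 1).val * 𝒯.κ 0 := (𝒯.pair 0).kk
  have b2 : 𝒯.κ 2 * 𝒯.κ 1 = (𝒯.r 1).val * (𝒯.r 2).val * 𝒯.κ 1 := (𝒯.pair 1).kk
  constructor
  · calc 𝒯.κ 0 * 𝒯.κ 2 * (crossing 𝒯.r 0 2 2).val
        = 𝒯.κ 2 * (𝒯.κ 0 * ((𝒯.r 1).val * (𝒯.r 0).val)) * ((𝒯.r 2).val * (𝒯.r 1).val) := by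
          rw [hc, hk02.eq]
          simp only [mul_assoc]
          rw [← mul_assoc (𝒯.r 2).val, ← h02.eq, mul_assoc]
      _ = 𝒯.κ 0 * (𝒯.κ 2 * 𝒯.κ 1 * 𝒯.κ 2) := by
          rw [← a1, ← mul_assoc (𝒯.κ 2), ← hk02.eq]
          simp only [mul_assoc]
          rw [a2]
      _ = _ := by rw [a3]
  · calc (crossing 𝒯.r 0 2 2).val * (𝒯.κ 0 * 𝒯.κ 2)
        = (𝒯.r 1).val * (𝒯.r 2).val * (((𝒯.r 0).val * (𝒯.r 1).val * 𝒯.κ 0) * 𝒯.κ 2) := by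
          rw [hc]; simp only [mul_assoc]
      _ = (𝒯.κ 2 * 𝒯.κ 1 * 𝒯.κ 2) * 𝒯.κ 0 := by
          rw [← b1, b2]
          simp only [mul_assoc]
          rw [hk02.eq]
      _ = _ := by rw [a3, hk02.eq]

/-- Up to η, the left side is Y = κ_0M_0M_1κ_0. Conjugating Y by the crossing of two pairs moves it
to sites 2, 3, and multiplying by κ_0 then gives Yκ_2. The trace over sites 2 and 3 turns the moved
copy into the scalar Tr Y times κ_0, and Yκ_2 into ημ²Y. -/
theorem Mseg_two_κ_zero : 𝒯.Mseg 0 2 * 𝒯.κ 0 = (μ ^ 2)⁻¹ • (𝒯.κ 0 * 𝒯.g) := by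
  set c := crossing 𝒯.r 0 2 2 with hc
  set Y := 𝒯.κ 0 * 𝒯.Mseg 0 2 * 𝒯.κ 0 with hY
  have hMk : Commute (𝒯.κ 0) (𝒯.Mseg 0 2) := 𝒯.κ_Mseg le_rfl (by omega)
  have hYe : Y = bmwEta q μ • (𝒯.Mseg 0 2 * 𝒯.κ 0) := by
    rw [hY, hMk.eq, mul_assoc, κ_sq, mul_smul_comm]
  have haway : ∀ m, 2 ≤ m → Y ∈ 𝒯.away m := fun m hm =>
    mul_mem (mul_mem (𝒯.κ_away (by omega) (by omega)) (𝒯.Mseg_away (by omega)))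
      (𝒯.κ_away (by omega) (by omega))
  have hk2M : Commute (𝒯.κ 2) (𝒯.Mseg 0 2) := κ_commute (𝒯.r_Mseg_of_le (by omega))
  have hk02 : Commute (𝒯.κ 0) (𝒯.κ 2) :=
    κ_commute (κ_commute ((𝒯.bmw 3).far 0 2 le_rfl (by omega)).symm).symm
  have hck : c.val * 𝒯.κ 2 = 𝒯.κ 0 * c.val := contr_intertwine (by
    have := congrArg Units.val (crossing_right 𝒯.r_braidSeq (s := 0) (n := 2) (k := 2) (j := 0)
      (by omega))
    simpa only [Units.val_mul] using this)
  have key : c.val * Y * (c⁻¹).val * 𝒯.κ 0 = Y * 𝒯.κ 2 := by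
    have e1 : (c⁻¹).val * 𝒯.κ 0 = 𝒯.κ 2 * (c⁻¹).val := by
      rw [Units.inv_mul_eq_iff_eq_mul, ← mul_assoc, Units.eq_mul_inv_iff_mul_eq, hck]
    have e2 : Y * 𝒯.κ 2 * (c⁻¹).val = Y * 𝒯.κ 2 := by
      rw [Units.mul_inv_eq_iff_eq_mul, hY]
      simp only [mul_assoc]
      have := 𝒯.κκ_crossing.1
      simp only [mul_assoc] at this
      rw [← hc] at this
      rw [this]
    have e3 : c.val * (Y * 𝒯.κ 2) = Y * 𝒯.κ 2 := by
      have e4 : Y * 𝒯.κ 2 = 𝒯.κ 0 * 𝒯.κ 2 * (𝒯.Mseg 0 2 * 𝒯.κ 0) := by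
        rw [hY]
        simp only [mul_assoc]
        rw [hk02.eq, ← mul_assoc (𝒯.Mseg 0 2), ← hk2M.eq, mul_assoc]
      rw [e4, ← mul_assoc, 𝒯.κκ_crossing.2]
    rw [mul_assoc (c.val * Y), e1, mul_assoc, ← mul_assoc Y, e2, e3]
  have hE : 𝒯.E 2 (𝒯.E 3 (c.val * Y * (c⁻¹).val)) = 𝒯.E 0 (𝒯.E 1 Y) := by
    have hcv : c.val * Y * (c⁻¹).val = (𝒯.r 1).val * ((𝒯.r 2).val * ((𝒯.r 0).val * ((𝒯.r 1).val * Y *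
        ((𝒯.r 1)⁻¹).val) * ((𝒯.r 0)⁻¹).val) * ((𝒯.r 2)⁻¹).val) * ((𝒯.r 1)⁻¹).val := by
      simp only [hc, crossing, run, one_mul, mul_one, mul_inv_rev, Units.val_mul, add_zero,
        zero_add, mul_assoc, Nat.reduceAdd]
    have m1 : (𝒯.r 1).val * Y * ((𝒯.r 1)⁻¹).val ∈ 𝒯.away 3 :=
      mul_mem (mul_mem (𝒯.r_away (by omega) (by omega)) (haway 3 (by omega)))
        (𝒯.rinv_away (by omega) (by omega))
    have m2 := mul_mem (mul_mem (𝒯.r_away (n := 0) (m := 3) (by omega) (by omega)) m1)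
        (𝒯.rinv_away (n := 0) (m := 3) (by omega) (by omega))
    have m3 : 𝒯.E 1 Y ∈ 𝒯.away 2 := 𝒯.E_away 1 (haway 2 le_rfl)
    have m5 : 𝒯.E 2 ((𝒯.r 0).val * ((𝒯.r 1).val * Y * ((𝒯.r 1)⁻¹).val) * ((𝒯.r 0)⁻¹).val) =
        (𝒯.r 0).val * 𝒯.E 1 Y * ((𝒯.r 0)⁻¹).val := by
      rw [𝒯.E_mul_right (n := 2) _ (𝒯.rinv_away (by omega) (by omega)),
        𝒯.E_mul_left (n := 2) _ (𝒯.r_away (by omega) (by omega)), 𝒯.E_conj_r 1 (haway 2 le_rfl)]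
    have m4 := mul_mem (mul_mem (𝒯.r_away (n := 0) (m := 2) (by omega) (by omega)) m3)
        (𝒯.rinv_away (n := 0) (m := 2) (by omega) (by omega))
    rw [hcv, 𝒯.E_mul_right (n := 3) _ (𝒯.rinv_away (by omega) (by omega)),
      𝒯.E_mul_left (n := 3) _ (𝒯.r_away (by omega) (by omega)), 𝒯.E_conj_r 2 m2, m5,
      𝒯.E_conj_r 1 m4, 𝒯.E_conj_r 0 (𝒯.E_away_self 1 Y)]
  -- The trace of κ_2 over site 3 is μ; site 2 is then empty and contributes ημ.
  have hl : 𝒯.E 2 (𝒯.E 3 (Y * 𝒯.κ 2)) = (bmwEta q μ * μ ^ 2) • Y := by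
    have e1 := 𝒯.E_κ_mul (haway 3 (by omega)) (one_mem (𝒯.away 3))
    have e2 : 𝒯.E 2 Y = (bmwEta q μ * μ) • Y := by
      have := 𝒯.E_mul_left (n := 2) 1 (haway 2 le_rfl)
      rw [mul_one, 𝒯.E_one, Algebra.algebraMap_eq_smul_one, mul_smul_comm, mul_one] at this
      exact this
    rw [mul_one, mul_one] at e1
    rw [e1, map_smul, e2, smul_smul]
    congr 1
    ring
  have hκ : ∀ m, 2 ≤ m → 𝒯.κ 0 ∈ 𝒯.away m := fun m hm => 𝒯.κ_away (by omega) (by omega)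
  rw [← key, 𝒯.E_mul_right (n := 3) _ (hκ 3 (by omega)), 𝒯.E_mul_right (n := 2) _ (hκ 2 le_rfl), hE]
    at hl
  have hg : 𝒯.E 0 (𝒯.E 1 Y) = (bmwEta q μ ^ 2) • 𝒯.g := by
    rw [hYe, map_smul, map_smul, g, smul_smul, pow_two, mul_assoc, mul_inv_cancel₀ 𝒯.eta_ne, mul_one]
    rfl
  have hη := 𝒯.eta_ne
  have hm := 𝒯.good.m0
  have hgk : 𝒯.g * 𝒯.κ 0 = 𝒯.κ 0 * 𝒯.g := (κ_commute (𝒯.g_isScalar.commute_r 0)).eq.symm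
  rw [hg, hYe, smul_mul_assoc, hgk, smul_smul] at hl
  have h2 := congrArg (fun z => (bmwEta q μ ^ 2 * μ ^ 2)⁻¹ • z) hl
  simp only [smul_smul] at h2
  rw [show (bmwEta q μ ^ 2 * μ ^ 2)⁻¹ * bmwEta q μ ^ 2 = (μ ^ 2)⁻¹ by field_simp,
    show (bmwEta q μ ^ 2 * μ ^ 2)⁻¹ * (bmwEta q μ * μ ^ 2 * bmwEta q μ) = 1 by field_simp,
    one_smul] at h2
  exact h2.symm

theorem Mseg_two_κ (n : ℕ) : 𝒯.Mseg n 2 * 𝒯.κ n = (μ ^ 2)⁻¹ • (𝒯.κ n * 𝒯.g) := by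
  induction n with
  | zero => exact 𝒯.Mseg_two_κ_zero
  | succ n ih =>
    have h := 𝒯.block_shift (s := n) (p := 2) (m := 1) (by omega) (kap q μ 0)
    have hk : ∀ s, 𝒯.ρ s (kap q μ (0 : Fin 1)) = 𝒯.κ s := fun s => 𝒯.ρ_kap s 0
    rw [hk, hk, ih] at h
    rw [← h, Units.mul_inv_eq_iff_eq_mul]
    have h1 : (run 𝒯.f n 2).val * 𝒯.κ n = 𝒯.κ (n + 1) * (run 𝒯.f n 2).val := contr_intertwine (by
      have := congrArg Units.val (𝒯.run_f_r (s := n) (p := 2) (j := n) le_rfl (by omega))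
      simpa only [Units.val_mul] using this)
    have h2 : Commute (run 𝒯.f n 2).val 𝒯.g :=
      run_induction (P := fun u : Hˣ => Commute u.val 𝒯.g) (Commute.one_left _)
        (fun _ _ h h' => h.mul_left h') fun i _ _ => 𝒯.g_isScalar.commute_f i
    rw [mul_smul_comm, smul_mul_assoc, ← mul_assoc, h1, mul_assoc, h2.eq, mul_assoc]

/-! ### Cyclicity of descendants -/

theorem TR_cyc_ρ {s n t m : ℕ} (h1 : s ≤ t) (h2 : t + m < s + n) (α : MonoidAlgebra ℂ (Braid m))
    (X : H) : 𝒯.TR s n (𝒯.ρ t α * X) = 𝒯.TR s n (X * 𝒯.ρ t α) := by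
  induction α using braidAlg_induction generalizing X with
  | one => simp
  | mul a b ha hb => rw [map_mul (𝒯.ρ t), mul_assoc, ha, mul_assoc, hb, mul_assoc]
  | add a b ha hb => rw [map_add, add_mul, mul_add, map_add, map_add, ha, hb]
  | smul z a ha => rw [map_smul, smul_mul_assoc, mul_smul_comm, map_smul, map_smul, ha]
  | gen i => rw [ρ_sig]; exact 𝒯.TR_cyc_r (by omega) (by omega) X
  | gen_inv i =>
    rw [ρ_sig_inv]
    exact 𝒯.TR_cyc_units (fun X => 𝒯.TR_cyc_r (by omega) (by omega) X) X

theorem pw_cyc_ρ {n t m : ℕ} (h1 : 1 ≤ t) (h2 : t + m ≤ n) (α : MonoidAlgebra ℂ (Braid m))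
    (y : H) : 𝒯.pw n (𝒯.ρ t α * y) = 𝒯.pw n (y * 𝒯.ρ t α) := by
  rw [pw, pw, ← mul_assoc, ← (𝒯.ρ_Mseg (Nat.zero_le t) (by omega) α).eq, mul_assoc,
    𝒯.TR_cyc_ρ h1 (by omega), mul_assoc]

theorem pw_conj_crossing {n a l k : ℕ} (h1 : 1 ≤ a) (h2 : a + l + k ≤ n + 1) (y : H) :
    𝒯.pw n ((crossing 𝒯.r a l k).val * y * ((crossing 𝒯.r a l k)⁻¹).val) = 𝒯.pw n y := by
  have h := 𝒯.crossing_Mseg (s := a) (n := l) (k := k) (t := 0) (l := n + 1) (by omega) (by omega)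
  rw [pw, pw, ← mul_assoc, ← mul_assoc, ← h.eq, mul_assoc (crossing 𝒯.r a l k).val,
    𝒯.TR_conj_crossing h1 (by omega)]

/-! ### Removing a contracted pair of strands -/

theorem E_conj_κ (s p : ℕ) : 𝒯.E (s + p + 1)
    (((run 𝒯.r (s + 1) p)⁻¹).val * 𝒯.κ s * (run 𝒯.r (s + 1) p).val) = algebraMap ℂ H μ := by
  induction p with
  | zero => simpa [run, κ] using 𝒯.E_contr s
  | succ p ih =>
    have h : ((run 𝒯.r (s + 1) p)⁻¹).val * 𝒯.κ s * (run 𝒯.r (s + 1) p).val ∈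
        𝒯.away (s + 1 + p + 1) :=
      mul_mem (mul_mem (𝒯.run_inv_away (Or.inr (by omega))) (𝒯.κ_away (by omega) (by omega)))
        (𝒯.run_away (Or.inr (by omega)))
    have h2 := 𝒯.E_conj_r' (s + 1 + p) h
    rw [show s + 1 + p = s + p + 1 by omega, ih] at h2
    rw [run, mul_inv_rev, Units.val_mul, Units.val_mul, show s + 1 + p = s + p + 1 by omega,
      show s + (p + 1) + 1 = s + p + 1 + 1 by omega, ← h2]
    simp only [mul_assoc]

/-- Writing κ_{s+1}κ_s = r_s⁻¹r_{s+1}⁻¹κ_s, the contractor κ_s commutes with a braid on later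
strands. The crossing v of two strands with that block shifts the braid by two sites, and v differs
from u exactly by r_{s+1}r_s. -/
theorem κκ_ρ (s : ℕ) {p : ℕ} (β : MonoidAlgebra ℂ (Braid p)) :
    𝒯.κ (s + 1) * 𝒯.κ s * 𝒯.ρ (s + 2) β = (crossing 𝒯.r (s + 1) p 2).val * 𝒯.ρ s β *
      ((crossing 𝒯.r (s + 1) p 2)⁻¹).val * (𝒯.κ (s + 1) * 𝒯.κ s) := by
  set u := crossing 𝒯.r (s + 1) p 2 with hu
  set v := crossing 𝒯.r s (p + 1) 2 with hv
  have hvu : v = 𝒯.r (s + 1) * 𝒯.r s * u := by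
    have hc : Commute (𝒯.r s) (run 𝒯.r (s + 2) p) :=
      run_induction (P := fun u : Hˣ => Commute (𝒯.r s) u) (Commute.one_right _)
        (fun _ _ h h' => h.mul_right h') fun i h1 _ => 𝒯.r_braidSeq.far s i (by omega)
    simp only [hv, hu, crossing, mul_one, add_zero]
    rw [run_succ_left, run_succ_left]
    simp only [mul_assoc]
    rw [← mul_assoc (run 𝒯.r (s + 1 + 1) p), ← hc.eq, mul_assoc]
  have h1 : v.val * 𝒯.ρ s β = 𝒯.ρ (s + 2) β * v.val := 𝒯.crossing_ρ_left (Nat.lt_succ_self p) β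
  have h2 : 𝒯.κ (s + 1) * 𝒯.κ s = ((𝒯.r s)⁻¹).val * ((𝒯.r (s + 1))⁻¹).val * 𝒯.κ s :=
    (𝒯.pair s).kk_inv
  have h3 : Commute (𝒯.κ s) (𝒯.ρ (s + 2) β) := κ_commute
    (𝒯.ρ_commute (fun i h _ => ((𝒯.bmw (i + 1)).far s i (by omega) (by omega)).symm) β).symm
  have h4 : 𝒯.ρ (s + 2) β = v.val * 𝒯.ρ s β * (v⁻¹).val := by
    rw [h1, mul_assoc, Units.mul_inv, mul_one]
  rw [h2, mul_assoc, h3.eq, h4, hvu]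
  simp only [mul_inv_rev, Units.val_mul, mul_assoc, Units.inv_mul_cancel_left]

/-- Conjugation by u moves the contracted pair to the last two sites, where M M κ = μ⁻²κg. Of the
contractors left over, κ_{s+p+1} and a conjugate of κ_s, each contributes a factor μ under the
traces over those sites, so only g remains. -/
theorem pw_cap {s p : ℕ} (β : MonoidAlgebra ℂ (Braid p)) {z : H}
    (hz : ∀ j, s + 1 ≤ j → Commute (𝒯.r j).val z) (hz' : ∀ j, s < j → z ∈ 𝒯.away j)
    (hzg : Commute z 𝒯.g) :
    𝒯.pw (s + p + 2) (𝒯.ρ (s + 2) β * (𝒯.κ (s + 1) * 𝒯.κ s) * z) =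
      𝒯.pw (s + p) (𝒯.ρ s β * z) * 𝒯.g := by
  set u := crossing 𝒯.r (s + 1) p 2 with hu
  set w := run 𝒯.r (s + 1) p with hw
  set Q := (w⁻¹).val * 𝒯.κ s * w.val with hQ
  have hzu : Commute u.val z :=
    crossing_induction (P := fun u : Hˣ => Commute u.val z) (Commute.one_left _)
      (fun _ _ h h' => h.mul_left h') fun i h1 _ => hz i h1
  have huQ : 𝒯.κ (s + 1) * 𝒯.κ s * u.val = u.val * (𝒯.κ (s + p + 1) * Q) := by
    have e1 : u = run 𝒯.r (s + 2) p * w := by simp [hu, hw, crossing]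
    have e2 : Commute (run 𝒯.r (s + 2) p).val (𝒯.κ s) :=
      run_induction (P := fun u : Hˣ => Commute u.val (𝒯.κ s)) (Commute.one_left _)
        (fun _ _ h h' => h.mul_left h') fun i h1 _ =>
          (κ_commute ((𝒯.bmw (i + 1)).far s i (by omega) (by omega))).symm
    have e3 : u.val * 𝒯.κ (s + p + 1) = 𝒯.κ (s + 1) * u.val := contr_intertwine (by
      have := congrArg Units.val (crossing_right 𝒯.r_braidSeq (s := s + 1) (n := p) (k := 2)
        (j := 0) (by omega))
      rw [Units.val_mul, Units.val_mul, show s + 1 + p + 0 = s + p + 1 by omega] at this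
      exact this)
    have e4 : u.val * Q = 𝒯.κ s * u.val := by
      rw [hQ, e1, Units.val_mul]
      simp only [mul_assoc, Units.mul_inv_cancel_left]
      rw [← mul_assoc, e2.eq, mul_assoc]
    rw [← mul_assoc, e3, mul_assoc, mul_assoc, e4]
  have hQ2 : Q ∈ 𝒯.away (s + p + 2) :=
    mul_mem (mul_mem (𝒯.run_inv_away (Or.inr (by omega))) (𝒯.κ_away (by omega) (by omega)))
      (𝒯.run_away (Or.inr (by omega)))
  have hρz : Commute (𝒯.ρ (s + 2) β) z := 𝒯.ρ_commute (fun i h _ => hz i (by omega)) β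
  have e1 : 𝒯.pw (s + p + 2) (𝒯.ρ (s + 2) β * (𝒯.κ (s + 1) * 𝒯.κ s) * z) =
      𝒯.pw (s + p + 2) (𝒯.ρ s β * (𝒯.κ (s + p + 1) * Q) * z) := by
    rw [mul_assoc, 𝒯.pw_cyc_ρ (by omega) (by omega), mul_assoc, ← hρz.eq, ← mul_assoc, κκ_ρ, ← hu,
      ← 𝒯.pw_conj_crossing (n := s + p + 2) (a := s + 1) (l := p) (k := 2) (by omega) (by omega)
        (𝒯.ρ s β * (𝒯.κ (s + p + 1) * Q) * z), ← hu]
    congr 1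
    rw [Units.eq_mul_inv_iff_mul_eq, mul_assoc _ z, ← hzu.eq]
    simp only [← mul_assoc]
    congr 1
    have e5 : (u⁻¹).val * (𝒯.κ (s + 1) * 𝒯.κ s * u.val) = 𝒯.κ (s + p + 1) * Q := by
      rw [huQ, Units.inv_mul_cancel_left]
    simp only [mul_assoc] at e5 ⊢
    rw [e5]
  have hg := 𝒯.g_isScalar
  rw [e1, pw, show s + p + 2 = (s + p) + 1 + 1 by ring, TR_succ, TR_succ, pw,
    show s + p + 1 + 1 + 1 = (s + p + 1) + 2 by ring, Mseg_add, zero_add]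
  have e2 : 𝒯.Mseg 0 (s + p + 1) * 𝒯.Mseg (s + p + 1) 2 * (𝒯.ρ s β * (𝒯.κ (s + p + 1) * Q) * z) =
      (μ ^ 2)⁻¹ • (𝒯.Mseg 0 (s + p + 1) * 𝒯.ρ s β * 𝒯.κ (s + p + 1) * (𝒯.g * (Q * z))) := by
    have h1 : Commute (𝒯.ρ s β) (𝒯.Mseg (s + p + 1) 2) :=
      𝒯.ρ_commute (fun i _ h => 𝒯.r_Mseg_of_lt (by omega)) β
    have h2 := 𝒯.Mseg_two_κ (s + p + 1)
    calc _ = 𝒯.Mseg 0 (s + p + 1) * (𝒯.Mseg (s + p + 1) 2 * 𝒯.ρ s β) * 𝒯.κ (s + p + 1) * (Q * z) := by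
          simp only [mul_assoc]
      _ = 𝒯.Mseg 0 (s + p + 1) * 𝒯.ρ s β * (𝒯.Mseg (s + p + 1) 2 * 𝒯.κ (s + p + 1)) * (Q * z) := by
          rw [← h1.eq]; simp only [mul_assoc]
      _ = _ := by
          rw [h2]; simp only [mul_assoc, mul_smul_comm, smul_mul_assoc]
  have a1 : 𝒯.Mseg 0 (s + p + 1) * 𝒯.ρ s β ∈ 𝒯.away (s + p + 1 + 1) :=
    mul_mem (𝒯.Mseg_away (by omega)) (𝒯.ρ_away (Or.inr (by omega)) β)
  have a2 : 𝒯.Mseg 0 (s + p + 1) * 𝒯.ρ s β ∈ 𝒯.away (s + p + 1) :=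
    mul_mem (𝒯.Mseg_away (by omega)) (𝒯.ρ_away (Or.inr (by omega)) β)
  rw [e2, map_smul, show 1 + (s + p + 1) = s + p + 1 + 1 by ring,
    𝒯.E_κ_mul a1 (mul_mem (hg _) (mul_mem hQ2 (hz' _ (by omega)))), map_smul,
    show 1 + (s + p) = s + p + 1 by ring, map_smul (𝒯.E (s + p + 1)) μ, 𝒯.E_mul_left _ a2, 𝒯.E_mul_left _ (hg _),
    𝒯.E_mul_right _ (hz' _ (by omega)), hQ, E_conj_κ, Algebra.algebraMap_eq_smul_one]
  simp only [smul_mul_assoc, mul_smul_comm, map_smul, smul_smul, one_mul]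
  rw [← 𝒯.TR_mul_right fun j _ _ => hg j, show (μ ^ 2)⁻¹ * (μ * μ) = 1 by
    have := 𝒯.good.m0
    field_simp, one_smul, ← hzg.eq]
  simp only [mul_assoc]

end QMTower

/-! ### Coefficients of the baxterized elements, and elementary contracted descendants. -/

/-- The ratio of the two spectral parameters entering the baxterized elements. -/
def spec (q μ : ℂ) (n : ℕ) : ℂ := μ * q ^ (2 * n) * q⁻¹

/-- The coefficient `(q - q⁻¹) / (1 + μ q^{2n - 1})`. -/
def specCoef (q μ : ℂ) (n : ℕ) : ℂ := (q - q⁻¹) / (1 + spec q μ n)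

/-- The coefficient in the partial trace of an antisymmetrizer. -/
def traceCoef (q μ : ℂ) (n : ℕ) : ℂ := q ^ n / qNum q (n + 1) *
  (bmwEta q μ * μ + ((q ^ (2 * n))⁻¹ - 1) / (q - q⁻¹) +
    ((q ^ (2 * n))⁻¹ - 1) / (q * μ⁻¹ * (q ^ (2 * n))⁻¹ + 1) * μ)

theorem spec_ne {q μ : ℂ} (hp : GoodParams q μ) {n : ℕ}
    (h : q * μ⁻¹ * (q ^ (2 * n))⁻¹ + 1 ≠ 0) : 1 + spec q μ n ≠ 0 := by
  have q0 := hp.q0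
  have m0 := hp.m0
  intro h1
  apply h
  rw [spec] at h1
  have h2 : q + μ * q ^ (2 * n) = 0 := by
    field_simp at h1
    linear_combination h1
  field_simp
  linear_combination h2

/-- This and `bax_coef_two` evaluate q^n times the coefficients of σ and κ in σ⁻(q^{−2n}), the form
in which they enter the recurrences. -/
theorem bax_coef_one {q μ : ℂ} (hp : GoodParams q μ) (n : ℕ) :
    q ^ n * (((q ^ (2 * n))⁻¹ - 1) / (q - q⁻¹)) = -qNum q n := by
  have q0 := hp.q0
  have q2 := hp.q2
  rw [qNum, pow_mul', pow_two]
  generalize q - q⁻¹ = w at q2 ⊢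
  have h : q ^ n ≠ 0 := pow_ne_zero _ q0
  generalize q ^ n = Q at h ⊢
  field_simp
  ring

theorem bax_coef_two {q μ : ℂ} (hp : GoodParams q μ) {n : ℕ}
    (h : q * μ⁻¹ * (q ^ (2 * n))⁻¹ + 1 ≠ 0) :
    q ^ n * (((q ^ (2 * n))⁻¹ - 1) / (q * μ⁻¹ * (q ^ (2 * n))⁻¹ + 1)) =
      -(spec q μ n * specCoef q μ n * qNum q n) := by
  have q0 := hp.q0
  have q2 := hp.q2
  have m0 := hp.m0
  have h2 := spec_ne hp h
  rw [specCoef, qNum]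
  generalize q - q⁻¹ = w at q2 ⊢
  rw [spec] at h2 ⊢
  rw [pow_mul', pow_two] at h h2 ⊢
  have hQ : q ^ n ≠ 0 := pow_ne_zero _ q0
  generalize q ^ n = Q at h h2 hQ ⊢
  have e1 : q * μ⁻¹ * (Q * Q)⁻¹ + 1 = (q + μ * (Q * Q)) / (μ * (Q * Q)) := by field_simp
  have e2 : 1 + μ * (Q * Q) * q⁻¹ = (q + μ * (Q * Q)) / q := by field_simp
  have h3 : q + μ * (Q * Q) ≠ 0 := by
    intro h4
    rw [e1, h4, zero_div] at h
    exact h rfl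
  rw [e1, e2]
  field_simp
  ring

namespace QMTower

variable {q μ : ℂ} {H : Type*} [Ring H] [Algebra ℂ H] (𝒯 : QMTower q μ H)

theorem pw_cyc_r {n j : ℕ} (h1 : 1 ≤ j) (h2 : j + 1 ≤ n) (y : H) :
    𝒯.pw n ((𝒯.r j).val * y) = 𝒯.pw n (y * (𝒯.r j).val) := by
  have h := 𝒯.pw_cyc_ρ (n := n) (t := j) (m := 1) h1 h2 (sigA 0) y
  rw [ρ_sig] at h
  exact h

theorem pw_conj_r {n j : ℕ} (h1 : 1 ≤ j) (h2 : j + 1 ≤ n) (y : H) :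
    𝒯.pw n ((𝒯.r j).val * y * ((𝒯.r j)⁻¹).val) = 𝒯.pw n y := by
  rw [mul_assoc, 𝒯.pw_cyc_r h1 h2, mul_assoc, Units.inv_mul, mul_one]

theorem pw_cyc_κ {n j : ℕ} (h1 : 1 ≤ j) (h2 : j + 1 ≤ n) (y : H) :
    𝒯.pw n (𝒯.κ j * y) = 𝒯.pw n (y * 𝒯.κ j) := by
  have h := 𝒯.pw_cyc_ρ (n := n) (t := j) (m := 1) h1 h2 (kap q μ 0) y
  rw [ρ_kap] at h
  exact h

theorem pw_zero (x : H) : 𝒯.pw 0 x = 𝒯.T * x := by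
  simp [pw, TR_zero, Mseg, M]

theorem pw_κ : 𝒯.pw 1 (𝒯.κ 0) = μ⁻¹ • 𝒯.g := by
  have h := 𝒯.E_κ_mul (n := 0) (one_mem _) (𝒯.g_isScalar 1)
  rw [one_mul, one_mul] at h
  have m0 := 𝒯.good.m0
  rw [pw, TR_one, Mseg_two_κ_zero, map_smul, h, smul_smul]
  congr 1
  field_simp

/-- The contracted pair in the first two strands gives μ⁻¹g, and the remaining strands give ch(β).
-/
theorem pw_two_κ {p : ℕ} (β : MonoidAlgebra ℂ (Braid p)) :
    𝒯.pw (p + 2) (𝒯.ρ 2 β * 𝒯.κ 0) = μ⁻¹ • (𝒯.ch p (𝒯.ρ 0 β) * 𝒯.g) := by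
  have h := 𝒯.pw_mul_ch (kap q μ (0 : Fin 1)) β
  have hk : 𝒯.ρ 0 (kap q μ (0 : Fin 1)) = 𝒯.κ 0 := 𝒯.ρ_kap 0 0
  rw [hk, pw_κ] at h
  rw [𝒯.pw_cyc_ρ (by omega) (by omega), show p + 2 = 1 + p + 1 by ring, ← h, smul_mul_assoc]
  congr 1
  rw [g_eq]
  exact (𝒯.ch_comm _ _).eq

theorem pw_cap_zero {p : ℕ} (β : MonoidAlgebra ℂ (Braid p)) :
    𝒯.pw (p + 2) (𝒯.ρ 2 β * (𝒯.κ 1 * 𝒯.κ 0)) = 𝒯.pw p (𝒯.ρ 0 β) * 𝒯.g := by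
  have h := 𝒯.pw_cap (s := 0) β (z := 1) (fun _ _ => Commute.one_right _) (fun _ _ => one_mem _)
    (Commute.one_left _)
  simpa using h

theorem r_commute_κ {i j : ℕ} (h : i + 2 ≤ j ∨ j + 2 ≤ i) : Commute (𝒯.r i).val (𝒯.κ j) := by
  rcases h with h | h
  · exact (κ_commute ((𝒯.bmw (j + 1)).far i j h (by omega)).symm).symm
  · exact (κ_commute ((𝒯.bmw (i + 1)).far j i h (by omega))).symm

theorem g_commute_κ (n : ℕ) : Commute (𝒯.κ n) 𝒯.g := κ_commute (𝒯.g_isScalar.commute_r n)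

/-- In terms of the star product, multiplication by M sends the descendant of β↑2 σ_2⁻¹κ_1 to that
of β↑1 κ_1, times g. Conjugation by R_1, allowed under the trace, turns r_2⁻¹κ_1r_0 into κ_2κ_1κ_0,
to which `pw_cap` applies. -/
theorem pw_cap_one {p : ℕ} (β : MonoidAlgebra ℂ (Braid p)) :
    𝒯.pw (p + 3) (𝒯.ρ 3 β * (((𝒯.r 2)⁻¹).val * 𝒯.κ 1) * (𝒯.r 0).val) =
      𝒯.pw (p + 1) (𝒯.ρ 1 β * 𝒯.κ 0) * 𝒯.g := by
  have h := 𝒯.pw_cap (s := 1) β (z := 𝒯.κ 0)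
    (fun j hj => 𝒯.r_commute_κ (Or.inr (by omega)))
    (fun j hj => 𝒯.κ_away (by omega) (by omega)) (𝒯.g_commute_κ 0)
  rw [show 1 + p + 2 = p + 3 by ring, show 1 + p = p + 1 by ring] at h
  rw [← h]
  refine Eq.trans (congrArg _ ?_) (𝒯.pw_conj_r (n := p + 3) (j := 1) le_rfl (by omega) _)
  have e1 : ((𝒯.r 2)⁻¹).val * 𝒯.κ 1 = (𝒯.r 1).val * 𝒯.κ 2 * 𝒯.κ 1 := (𝒯.pair 1).symm.contr_inv_eq
  have e2 : 𝒯.κ 1 * (𝒯.r 0).val = 𝒯.κ 1 * 𝒯.κ 0 * ((𝒯.r 1)⁻¹).val := by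
    have : 𝒯.κ 1 * 𝒯.κ 0 = 𝒯.κ 1 * ((𝒯.r 0).val * (𝒯.r 1).val) := (𝒯.pair 0).symm.kk_right
    rw [this, ← mul_assoc, mul_assoc, Units.mul_inv, mul_one]
  have e3 : Commute (𝒯.ρ 3 β) (𝒯.r 1).val :=
    𝒯.ρ_commute (fun i h _ => ((𝒯.bmw (i + 1)).far 1 i (by omega) (by omega)).symm) β
  rw [e1]
  simp only [mul_assoc]
  rw [e2, ← mul_assoc, e3.eq]
  simp only [mul_assoc, Nat.reduceAdd]

/-- This is M^α ⋆ M = μ⁻¹g² for α = σ_2⁻¹κ_1. With `pw_cap_one` it makes M invertible on both sides.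
Conjugations by R_1 and R_2, harmless under the trace, unwind the loop word into a product of
contractors. -/
theorem pw_three_loopWord :
    𝒯.pw 3 (((𝒯.r 1)⁻¹).val * 𝒯.κ 0 * (loopWord 𝒯.r 2).val) = μ⁻¹ • (𝒯.g * 𝒯.g) := by
  have h1 : ((𝒯.r 1)⁻¹).val * 𝒯.κ 0 * (loopWord 𝒯.r 2).val = (𝒯.r 2).val * ((𝒯.r 1).val *
      (((𝒯.r 2)⁻¹).val * ((𝒯.r 1)⁻¹).val * 𝒯.κ 0 * (𝒯.r 1).val * (𝒯.r 0).val) *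
        ((𝒯.r 1)⁻¹).val) * ((𝒯.r 2)⁻¹).val := by
    have e1 : (𝒯.r 2).val * (𝒯.r 1).val * ((𝒯.r 2)⁻¹).val * ((𝒯.r 1)⁻¹).val =
        ((𝒯.r 1)⁻¹).val * (𝒯.r 2).val := by
      have : 𝒯.r 2 * 𝒯.r 1 * (𝒯.r 2)⁻¹ * (𝒯.r 1)⁻¹ = (𝒯.r 1)⁻¹ * 𝒯.r 2 := by
        have := 𝒯.r_braidSeq.braid 1
        simp only [Nat.reduceAdd] at this
        rw [mul_inv_eq_iff_eq_mul, mul_inv_eq_iff_eq_mul, mul_assoc, mul_assoc, ← mul_assoc (𝒯.r 2),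
          ← this]
        group
      simpa only [Units.val_mul] using congrArg Units.val this
    have e2 : Commute (𝒯.r 2).val (𝒯.κ 0) := 𝒯.r_commute_κ (Or.inr le_rfl)
    have e3 : (𝒯.r 2).val * ((𝒯.r 1).val * (((𝒯.r 2)⁻¹).val * ((𝒯.r 1)⁻¹).val * 𝒯.κ 0 *
        (𝒯.r 1).val * (𝒯.r 0).val) * ((𝒯.r 1)⁻¹).val) * ((𝒯.r 2)⁻¹).val =
        ((𝒯.r 2).val * (𝒯.r 1).val * ((𝒯.r 2)⁻¹).val * ((𝒯.r 1)⁻¹).val) * (𝒯.κ 0 *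
        (𝒯.r 1).val * (𝒯.r 0).val * ((𝒯.r 1)⁻¹).val * ((𝒯.r 2)⁻¹).val) := by
      simp only [mul_assoc]
    rw [e3, e1]
    simp only [loopWord, Units.val_mul, mul_assoc, zero_add, Nat.reduceAdd]
    rw [← mul_assoc (𝒯.κ 0), ← e2.eq, mul_assoc]
  have h2 : ((𝒯.r 2)⁻¹).val * ((𝒯.r 1)⁻¹).val * 𝒯.κ 0 * (𝒯.r 1).val * (𝒯.r 0).val =
      (𝒯.r 0).val * (𝒯.r 1).val * 𝒯.κ 2 * 𝒯.κ 1 := by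
    have e1 : 𝒯.κ 0 * 𝒯.κ 1 = 𝒯.κ 0 * ((𝒯.r 1).val * (𝒯.r 0).val) := (𝒯.pair 0).kk_right
    have e2 : ((𝒯.r 1)⁻¹).val * 𝒯.κ 0 = (𝒯.r 0).val * 𝒯.κ 1 * 𝒯.κ 0 := (𝒯.pair 0).symm.contr_inv_eq
    have e3 : 𝒯.κ 1 * 𝒯.κ 0 * 𝒯.κ 1 = 𝒯.κ 1 := (𝒯.pair 0).symm.kkk
    have e4 : ((𝒯.r 2)⁻¹).val * 𝒯.κ 1 = (𝒯.r 1).val * 𝒯.κ 2 * 𝒯.κ 1 :=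
      (𝒯.pair 1).symm.contr_inv_eq
    have e5 : Commute ((𝒯.r 2)⁻¹).val (𝒯.r 0).val :=
      ((𝒯.bmw 3).far 0 2 le_rfl (by omega)).symm.units_inv_left
    calc _ = ((𝒯.r 2)⁻¹).val * (((𝒯.r 1)⁻¹).val * 𝒯.κ 0 * 𝒯.κ 1) := by
          simp only [mul_assoc, e1]
      _ = ((𝒯.r 2)⁻¹).val * ((𝒯.r 0).val * (𝒯.κ 1 * 𝒯.κ 0 * 𝒯.κ 1)) := by
          rw [e2]; simp only [mul_assoc]
      _ = (𝒯.r 0).val * (((𝒯.r 2)⁻¹).val * 𝒯.κ 1) := by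
          rw [e3, ← mul_assoc, e5.eq, mul_assoc]
      _ = _ := by rw [e4]; simp only [mul_assoc]
  have h3 : 𝒯.κ 1 * 𝒯.κ 0 = 𝒯.κ 1 * ((𝒯.r 0).val * (𝒯.r 1).val) := (𝒯.pair 0).symm.kk_right
  have h4 := 𝒯.pw_cap (s := 1) (p := 0) 1 (z := 𝒯.κ 0)
    (fun j hj => 𝒯.r_commute_κ (Or.inr (by omega)))
    (fun j hj => 𝒯.κ_away (by omega) (by omega)) (𝒯.g_commute_κ 0)
  simp only [map_one, one_mul, add_zero, Nat.reduceAdd, pw_κ, smul_mul_assoc] at h4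
  rw [h1, 𝒯.pw_conj_r (by omega) (by omega), 𝒯.pw_conj_r (by omega) (by omega), h2,
    ← 𝒯.pw_cyc_κ (by omega) (by omega), ← h4, 𝒯.pw_cyc_κ (j := 1) (by omega) (by omega)]
  rw [← 𝒯.pw_cyc_κ (j := 1) (by omega) (by omega)]
  rw [mul_assoc (𝒯.κ 2), 𝒯.pw_cyc_κ (j := 2) (by omega) (by omega), h3]
  simp only [mul_assoc]

end QMTower

/-- The element obtained from the antisymmetrizer on `p + 1` strands by adding a strand on the
left. -/
def asymStep (q μ : ℂ) (p : ℕ) : MonoidAlgebra ℂ (Braid (p + 1)) :=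
  q ^ (p + 1) • (shiftA 1 (by omega) (antisym q μ p) *
    baxMinus q μ 0 (q ^ (2 * (p + 1)))⁻¹ * shiftA 1 (by omega) (antisym q μ p))

/-! ### Traces and descendants of antisymmetrizers in the tower. -/

namespace QMTower

variable {q μ : ℂ} {H : Type*} [Ring H] [Algebra ℂ H] (𝒯 : QMTower q μ H)

theorem ρ_baxMinus (s : ℕ) {m : ℕ} (i : Fin m) (z : ℂ) :
    𝒯.ρ s (baxMinus q μ i z) = bax q μ (𝒯.r (s + i)).val z := by
  rw [← 𝒯.ρ_sig s i, ← bax_map]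
  rfl

theorem ρ_antisym (s n : ℕ) :
    𝒯.ρ s (antisym q μ n) = asym q μ (fun i => (𝒯.r (s + i)).val) n := by
  induction n with
  | zero => exact map_one _
  | succ n ih =>
    rw [antisym, asym, map_smul, map_mul, map_mul, ρ_baxMinus, ρ_shiftA, add_zero, ih]
    rfl

theorem bmwSeq (s n : ℕ) : IsBMWSeq q μ n fun i => 𝒯.r (s + i) := (𝒯.bmw (s + n)).shift le_rfl

theorem antisym_sq {p : ℕ} (hp : GoodUpTo q μ p) (s : ℕ) :
    𝒯.ρ s (antisym q μ p) * 𝒯.ρ s (antisym q μ p) = 𝒯.ρ s (antisym q μ p) := by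
  rw [ρ_antisym]
  exact (asym_left hp (𝒯.bmwSeq s p)).2

theorem antisym_r {p : ℕ} (hp : GoodUpTo q μ p) (s : ℕ) {j : ℕ} (hj : j < p) :
    𝒯.ρ s (antisym q μ p) * (𝒯.r (s + j)).val = -q⁻¹ • 𝒯.ρ s (antisym q μ p) := by
  rw [ρ_antisym]
  exact asym_right hp (𝒯.bmwSeq s p) hj

theorem r_antisym {p : ℕ} (hp : GoodUpTo q μ p) (s : ℕ) {j : ℕ} (hj : j < p) :
    (𝒯.r (s + j)).val * 𝒯.ρ s (antisym q μ p) = -q⁻¹ • 𝒯.ρ s (antisym q μ p) := by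
  rw [ρ_antisym]
  exact (asym_left hp (𝒯.bmwSeq s p)).1 j hj

theorem ρ_asymStep_apply (s p : ℕ) : 𝒯.ρ s (asymStep q μ p) = q ^ (p + 1) •
    (𝒯.ρ (s + 1) (antisym q μ p) * bax q μ (𝒯.r s).val (q ^ (2 * (p + 1)))⁻¹ *
      𝒯.ρ (s + 1) (antisym q μ p)) := by
  rw [asymStep, map_smul, map_mul, map_mul, ρ_baxMinus, ρ_shiftA]
  rfl

/-- `asymStep` avoids the division by (p + 2)_q, so it is still meaningful one step beyond a^{(k)},
where it is the element required to vanish for the O(k) type. -/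
theorem ρ_asymStep (s : ℕ) {p : ℕ} (hp : GoodUpTo q μ (p + 1)) :
    𝒯.ρ s (asymStep q μ p) = qNum q (p + 2) • 𝒯.ρ s (antisym q μ (p + 1)) := by
  have h := asym_succ_left hp (𝒯.bmwSeq s (p + 1))
  have hn := hp.num (p + 1) (by omega) le_rfl
  have e : (fun i => (𝒯.r (s + (1 + i))).val) = fun i => (𝒯.r (s + 1 + i)).val := by
    funext i
    rw [add_assoc]
  rw [e] at h
  rw [ρ_asymStep_apply, ρ_antisym, ρ_antisym, h, smul_smul, mul_div_cancel₀ _ hn, add_zero]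

/-- The elements `a_n`. -/
def a : ℕ → H
  | 0 => 1
  | n + 1 => 𝒯.ch n (𝒯.ρ 0 (antisym q μ n))

/-- Under the trace the two outer antisymmetrizers merge into one. The terms 1, σ and κ of the
baxterized element then give M a_{p+1}, the star product of M with a descendant, and a contracted
descendant. -/
theorem pw_asymStep {p : ℕ} (hp : GoodUpTo q μ p)
    (hd : q * μ⁻¹ * (q ^ (2 * (p + 1)))⁻¹ + 1 ≠ 0) :
    𝒯.pw (p + 1) (𝒯.ρ 0 (asymStep q μ p)) = q ^ (p + 1) • (𝒯.T * 𝒯.a (p + 1)) -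
      qNum q (p + 1) • 𝒯.pw (p + 1) (𝒯.ρ 1 (antisym q μ p) * (𝒯.r 0).val) -
      (spec q μ (p + 1) * specCoef q μ (p + 1) * qNum q (p + 1)) •
        𝒯.pw (p + 1) (𝒯.ρ 1 (antisym q μ p) * 𝒯.κ 0) := by
  have hg := hp.toGoodParams
  have h1 : 𝒯.pw (p + 1) (𝒯.ρ 0 (asymStep q μ p)) = q ^ (p + 1) •
      𝒯.pw (p + 1) (𝒯.ρ 1 (antisym q μ p) * bax q μ (𝒯.r 0).val (q ^ (2 * (p + 1)))⁻¹) := by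
    rw [ρ_asymStep_apply]
    have : ∀ x, 𝒯.pw (p + 1) (q ^ (p + 1) • x) = q ^ (p + 1) • 𝒯.pw (p + 1) x := fun x => by
      rw [pw, mul_smul_comm, map_smul, pw]
    rw [this, zero_add, ← 𝒯.pw_cyc_ρ le_rfl (by omega), ← mul_assoc,
      𝒯.antisym_sq hp]
  have h2 : 𝒯.pw (p + 1) (𝒯.ρ 1 (antisym q μ p)) = 𝒯.T * 𝒯.a (p + 1) := by
    have := 𝒯.pw_mul_ch (m := 0) 1 (antisym q μ p)
    rw [map_one, one_mul, pw_zero, mul_one] at this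
    rw [a, this]
    congr 1
    omega
  have h3 : ∀ b x y : H, ∀ A B : ℂ, 𝒯.pw (p + 1) (b * (1 + A • x + B • y)) =
      𝒯.pw (p + 1) b + A • 𝒯.pw (p + 1) (b * x) + B • 𝒯.pw (p + 1) (b * y) := fun b x y A B => by
    simp only [pw, mul_add, mul_one, mul_smul_comm, map_add, map_smul]
  rw [h1, bax, h3, h2, smul_add, smul_add, smul_smul, smul_smul, bax_coef_one hg, bax_coef_two hg hd]
  simp only [neg_smul, sub_eq_add_neg]
  rfl

theorem inv_r (n : ℕ) : (𝒯.r n).val = ((𝒯.r n)⁻¹).val + (q - q⁻¹) • (1 - 𝒯.κ n) := by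
  rw [inv_eq_of_contr 𝒯.good (𝒯.pair n).cubic, κ, sub_add_cancel]

/-- The expansion is as in `pw_asymStep`, but R_1 is first replaced by R_1⁻¹ + (q − q⁻¹)(1 − κ_1),
because R_1⁻¹κ_0 is the form that star multiplication by M simplifies (`pw_cap_one`). -/
theorem pw_asymStep_κ {p : ℕ} (hp : GoodUpTo q μ p)
    (hd : q * μ⁻¹ * (q ^ (2 * (p + 1)))⁻¹ + 1 ≠ 0) :
    𝒯.pw (p + 2) (𝒯.ρ 1 (asymStep q μ p) * 𝒯.κ 0) =
      ((q ^ (p + 1))⁻¹ * μ⁻¹) • (𝒯.a (p + 1) * 𝒯.g) +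
      (specCoef q μ (p + 1) * qNum q (p + 1)) • (𝒯.pw p (𝒯.ρ 0 (antisym q μ p)) * 𝒯.g) -
      qNum q (p + 1) • 𝒯.pw (p + 2) (𝒯.ρ 2 (antisym q μ p) * (((𝒯.r 1)⁻¹).val * 𝒯.κ 0)) := by
  have hg := hp.toGoodParams
  have hlin : ∀ (z : ℂ) x, 𝒯.pw (p + 2) (z • x) = z • 𝒯.pw (p + 2) x := fun z x => by
    rw [pw, mul_smul_comm, map_smul, pw]
  have hc : Commute (𝒯.ρ 2 (antisym q μ p)) (𝒯.κ 0) := (κ_commute (𝒯.ρ_commute (fun i h _ =>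
    ((𝒯.bmw (i + 1)).far 0 i (by omega) (by omega)).symm) _).symm).symm
  have h1 : 𝒯.pw (p + 2) (𝒯.ρ 1 (asymStep q μ p) * 𝒯.κ 0) = q ^ (p + 1) •
      𝒯.pw (p + 2) (𝒯.ρ 2 (antisym q μ p) * (bax q μ (𝒯.r 1).val (q ^ (2 * (p + 1)))⁻¹ *
        𝒯.κ 0)) := by
    rw [ρ_asymStep_apply, smul_mul_assoc, hlin, mul_assoc _ _ (𝒯.κ 0), hc.eq, ← mul_assoc,
      ← 𝒯.pw_cyc_ρ (by omega) (by omega)]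
    simp only [← mul_assoc]
    rw [𝒯.antisym_sq hp]
  have h2 : 𝒯.ρ 2 (antisym q μ p) * (bax q μ (𝒯.r 1).val (q ^ (2 * (p + 1)))⁻¹ * 𝒯.κ 0) =
      (1 + ((q ^ (2 * (p + 1)))⁻¹ - 1) / (q - q⁻¹) * (q - q⁻¹)) •
        (𝒯.ρ 2 (antisym q μ p) * 𝒯.κ 0) +
      (((q ^ (2 * (p + 1)))⁻¹ - 1) / (q - q⁻¹)) •
        (𝒯.ρ 2 (antisym q μ p) * (((𝒯.r 1)⁻¹).val * 𝒯.κ 0)) +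
      (((q ^ (2 * (p + 1)))⁻¹ - 1) / (q * μ⁻¹ * (q ^ (2 * (p + 1)))⁻¹ + 1) -
        ((q ^ (2 * (p + 1)))⁻¹ - 1) / (q - q⁻¹) * (q - q⁻¹)) •
        (𝒯.ρ 2 (antisym q μ p) * (𝒯.κ 1 * 𝒯.κ 0)) := by
    have hb : bax q μ (𝒯.r 1).val (q ^ (2 * (p + 1)))⁻¹ =
        1 + (((q ^ (2 * (p + 1)))⁻¹ - 1) / (q - q⁻¹)) • (𝒯.r 1).val +
          (((q ^ (2 * (p + 1)))⁻¹ - 1) / (q * μ⁻¹ * (q ^ (2 * (p + 1)))⁻¹ + 1)) • 𝒯.κ 1 := rfl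
    rw [hb, inv_r]
    simp only [mul_add, add_mul, mul_sub, sub_mul, one_mul, smul_mul_assoc, mul_smul_comm]
    module
  have hadd : ∀ x y, 𝒯.pw (p + 2) (x + y) = 𝒯.pw (p + 2) x + 𝒯.pw (p + 2) y := fun x y => by
    rw [pw, mul_add, map_add, pw, pw]
  have hq : q ^ (p + 1) ≠ 0 := pow_ne_zero _ hg.q0
  have c1 := bax_coef_one hg (p + 1)
  have c2 := bax_coef_two hg hd
  have hs := spec_ne hg hd
  rw [h1, h2, hadd, hadd, hlin, hlin, hlin, pw_two_κ, pw_cap_zero]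
  generalize ((q ^ (2 * (p + 1)))⁻¹ - 1) / (q - q⁻¹) = A at c1 ⊢
  generalize ((q ^ (2 * (p + 1)))⁻¹ - 1) / (q * μ⁻¹ * (q ^ (2 * (p + 1)))⁻¹ + 1) = B at c2 ⊢
  have hn : qNum q (p + 1) * (q - q⁻¹) = q ^ (p + 1) - (q ^ (p + 1))⁻¹ :=
    div_mul_cancel₀ _ hg.q2
  have hsc : specCoef q μ (p + 1) * (1 + spec q μ (p + 1)) = q - q⁻¹ := div_mul_cancel₀ _ hs
  have k1 : q ^ (p + 1) * (1 + A * (q - q⁻¹)) = (q ^ (p + 1))⁻¹ := by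
    linear_combination (q - q⁻¹) * c1 - hn
  have k2 : q ^ (p + 1) * (B - A * (q - q⁻¹)) = specCoef q μ (p + 1) * qNum q (p + 1) := by
    linear_combination c2 - (q - q⁻¹) * c1 - qNum q (p + 1) * hsc
  rw [smul_add, smul_add, smul_smul, smul_smul, smul_smul (q ^ (p + 1)) (B - _), smul_smul, k1, k2,
    c1, a]
  module

/-- Only the middle baxterized factor meets the last site. Its terms 1, σ, κ have R-traces ημ, 1, μ,
and the two outer factors merge into the smaller antisymmetrizer. -/
theorem E_antisym {p : ℕ} (hp : GoodUpTo q μ p) :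
    𝒯.E p (𝒯.ρ 0 (antisym q μ p)) = traceCoef q μ p •
      (match p with
        | 0 => 1
        | n + 1 => 𝒯.ρ 0 (antisym q μ n)) := by
  cases p with
  | zero =>
    have h1 : traceCoef q μ 0 = bmwEta q μ * μ := by
      have := 𝒯.good.q2
      simp [traceCoef, qNum, this]
    rw [antisym, map_one, E_one, h1, Algebra.algebraMap_eq_smul_one]
  | succ n =>
    have hb : 𝒯.ρ 0 (antisym q μ n) ∈ 𝒯.away (n + 1) := 𝒯.ρ_away (Or.inr (by omega)) _
    have hr : 𝒯.E (n + 1) (𝒯.r n).val = 1 := 𝒯.E_r n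
    have hκ : 𝒯.E (n + 1) (𝒯.κ n) = μ • 1 := by
      rw [κ, E_contr, Algebra.algebraMap_eq_smul_one]
    have h1 : 𝒯.E (n + 1) (bax q μ (𝒯.r n).val (q ^ (2 * (n + 1)))⁻¹) =
        (bmwEta q μ * μ + ((q ^ (2 * (n + 1)))⁻¹ - 1) / (q - q⁻¹) +
          ((q ^ (2 * (n + 1)))⁻¹ - 1) / (q * μ⁻¹ * (q ^ (2 * (n + 1)))⁻¹ + 1) * μ) • 1 := by
      change 𝒯.E (n + 1) (1 + _ • (𝒯.r n).val + _ • 𝒯.κ n) = _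
      rw [map_add, map_add, map_smul, map_smul, E_one, hr, hκ, Algebra.algebraMap_eq_smul_one]
      module
    have h2 : 𝒯.ρ 0 (antisym q μ (n + 1)) = (q ^ (n + 1) / qNum q (n + 2)) •
        (𝒯.ρ 0 (antisym q μ n) * bax q μ (𝒯.r n).val (q ^ (2 * (n + 1)))⁻¹ *
          𝒯.ρ 0 (antisym q μ n)) := by
      rw [antisym, map_smul, map_mul, map_mul, ρ_baxMinus, ρ_shiftA, add_zero, zero_add]
      rfl
    rw [h2, map_smul, 𝒯.E_mul_right _ hb, 𝒯.E_mul_left _ hb, h1, mul_smul_comm, mul_one,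
      smul_mul_assoc, 𝒯.antisym_sq (hp.mono (Nat.le_succ n)), smul_smul]
    rfl

theorem ch_antisym_κ_last {p : ℕ} (hp : GoodUpTo q μ p) :
    𝒯.ch (p + 1) (𝒯.ρ 0 (antisym q μ p) * 𝒯.κ p) =
      (μ⁻¹ * traceCoef q μ p) • (𝒯.a p * 𝒯.g) := by
  have hg := 𝒯.g_isScalar
  have m0 := 𝒯.good.m0
  have h1 : 𝒯.Mseg 0 (p + 1 + 1) * (𝒯.ρ 0 (antisym q μ p) * 𝒯.κ p) =
      (μ ^ 2)⁻¹ • (𝒯.ρ 0 (antisym q μ p) * 𝒯.Mseg 0 p * 𝒯.κ p * 𝒯.g) := by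
    rw [← mul_assoc, ← (𝒯.ρ_Mseg (Nat.zero_le 0) (by omega) _).eq, add_assoc, Mseg_add, zero_add]
    simp only [mul_assoc]
    rw [Mseg_two_κ, mul_smul_comm, mul_smul_comm]
  have h2 : 𝒯.ρ 0 (antisym q μ p) * 𝒯.Mseg 0 p ∈ 𝒯.away (p + 1) :=
    mul_mem (𝒯.ρ_away (Or.inr (by omega)) _) (𝒯.Mseg_away (by omega))
  rw [ch, h1, TR_succ, zero_add, map_smul, 𝒯.E_κ_mul h2 (hg _), smul_smul, map_smul, TR_succ,
    zero_add, 𝒯.E_mul_right _ (hg _), 𝒯.E_mul_right _ (𝒯.Mseg_away (by omega)), E_antisym _ hp,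
    smul_mul_assoc, smul_mul_assoc, map_smul, smul_smul, 𝒯.TR_mul_right fun j _ _ => hg j]
  have hc : (μ ^ 2)⁻¹ * μ * traceCoef q μ p = μ⁻¹ * traceCoef q μ p := by
    field_simp
  rw [hc]
  congr 2
  cases p with
  | zero => simp [TR_zero, Mseg, a]
  | succ n =>
    rw [a, ch, ← (𝒯.ρ_Mseg (Nat.zero_le 0) (by omega) _).eq]

/-- Under the full trace the contractor may be moved from the first strands to the last ones:
conjugation by z shifts the antisymmetrizer, z⁻¹κ_0z = xκ_px⁻¹, and x commutes with the
antisymmetrizer because the generators in x act on it by the same scalar from either side. -/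
theorem ch_antisym_κ {p : ℕ} (hp : GoodUpTo q μ p) :
    𝒯.ch (p + 1) (𝒯.ρ 1 (antisym q μ p) * 𝒯.κ 0) =
      (μ⁻¹ * traceCoef q μ p) • (𝒯.a p * 𝒯.g) := by
  rw [← 𝒯.ch_antisym_κ_last hp]
  have hrun : ∀ a k, a + k ≤ p + 1 → ∀ x, 𝒯.ch (p + 1) ((run 𝒯.r a k).val * x) =
      𝒯.ch (p + 1) (x * (run 𝒯.r a k).val) := fun a k h x => by
    rw [ch, ch, ← mul_assoc, ← (𝒯.run_Mseg (Nat.zero_le a) (by omega)).eq, mul_assoc,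
      𝒯.TR_cyc_run (Nat.zero_le a) (by omega), mul_assoc]
  set z := run 𝒯.r 0 (p + 1) with hz
  set x := run 𝒯.r 0 p with hx
  set y := run 𝒯.r 1 p with hy
  set α := 𝒯.ρ 0 (antisym q μ p) with hα
  have h1 : 𝒯.ρ 1 (antisym q μ p) = z.val * α * (z⁻¹).val := by
    rw [Units.eq_mul_inv_iff_mul_eq]
    refine (𝒯.ρ_intertwine (fun i hi => ?_) _).symm
    have := congrArg Units.val (run_shift 𝒯.r_braidSeq (a := 0) (n := p + 1) (j := i)
      (Nat.zero_le i) (by omega))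
    rw [Units.val_mul, Units.val_mul] at this
    rw [zero_add, add_comm 1 i]
    exact this
  have h2 : z = 𝒯.r 0 * y := run_succ_left 0 p
  have h3 : 𝒯.κ 0 * (y * x).val = (y * x).val * 𝒯.κ p := by
    refine (contr_intertwine ?_).symm
    have := run_conj 𝒯.r_braidSeq p
    rw [← hx, ← hy] at this
    have h : y * x * 𝒯.r p = 𝒯.r 0 * (y * x) := by
      have e : x * 𝒯.r p = y⁻¹ * 𝒯.r 0 * y * x := by rw [this]; group
      rw [mul_assoc, e]
      group
    simpa only [Units.val_mul] using congrArg Units.val h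
  have h4 : Commute α x.val := run_induction (P := fun u : Hˣ => Commute α u.val)
    (Commute.one_right _) (fun _ _ h h' => h.mul_right h') fun i _ hi => by
      have e1 := 𝒯.antisym_r hp 0 (j := i) (by omega)
      have e2 := 𝒯.r_antisym hp 0 (j := i) (by omega)
      rw [zero_add] at e1 e2
      exact e1.trans e2.symm
  have h5 : Commute (𝒯.κ 0) (𝒯.r 0).val := (κ_commute (Commute.refl _))
  have h6 : (z⁻¹).val * 𝒯.κ 0 * z.val = x.val * 𝒯.κ p * (x⁻¹).val := by
    rw [h2, mul_inv_rev, Units.val_mul, Units.val_mul, Units.eq_mul_inv_iff_mul_eq]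
    simp only [mul_assoc]
    rw [Units.inv_mul_eq_iff_eq_mul, Units.inv_mul_eq_iff_eq_mul, ← mul_assoc, h5.eq, mul_assoc]
    rw [Units.val_mul, mul_assoc] at h3
    rw [h3]
  calc _ = 𝒯.ch (p + 1) (z.val * (α * (z⁻¹).val * 𝒯.κ 0)) := by
        rw [h1]; simp only [mul_assoc]
    _ = 𝒯.ch (p + 1) (α * (x.val * 𝒯.κ p * (x⁻¹).val)) := by
        rw [hrun 0 (p + 1) (by omega), ← hz, ← h6]; simp only [mul_assoc]
    _ = 𝒯.ch (p + 1) (x.val * (α * 𝒯.κ p * (x⁻¹).val)) := by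
        rw [← mul_assoc, ← mul_assoc, h4.eq]; simp only [mul_assoc]
    _ = _ := by
        rw [hrun 0 p (by omega), Units.inv_mul_cancel_right]

end QMTower

/-! ### The algebra behind the Cayley–Hamilton identities -/

section Recurrences

variable {B : Type*} [CommRing B]

theorem sum_of_recurrence {X A : ℕ → B} {t : B} (h0 : X 0 = 0)
    (h : ∀ i, X (i + 1) = t * (X i + A i)) (i : ℕ) :
    X i + A i = ∑ j ∈ Finset.range (i + 1), t ^ (i - j) * A j := by
  induction i with
  | zero => simp [h0]
  | succ i ih =>
    rw [Finset.sum_range_succ, h, ih, Finset.mul_sum, Nat.sub_self, pow_zero, one_mul]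
    congr 1
    refine Finset.sum_congr rfl fun j hj => ?_
    rw [← mul_assoc, ← pow_succ', Nat.succ_sub (by have := Finset.mem_range.1 hj; omega)]

/-- The first integral of the recurrences for the descendants of antisymmetrizers. -/
theorem first_integral {k : ℕ} {X A ξ W c d m ρ : ℕ → B} {t z s : B}
    (hX0 : X 0 = 0) (hξ0 : ξ 0 = 0) (hW0 : W 0 = 0)
    (hX : ∀ i, X (i + 1) = t * (X i + A i))
    (hξ : ∀ i ≤ k, ξ (i + 1) = t * (A i + ξ i - c i * W i))
    (hW : ∀ i ≤ k, W (i + 1) = t * z * s * (W i + d i * ξ i - m i * A i))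
    (k1 : ∀ i ≤ k, ρ (i + 1) - s = c (i + 1) * s * m i)
    (k2 : ∀ i ≤ k, c (i + 1) * s = ρ (i + 1) * c i)
    (k3 : ∀ i ≤ k, ρ i = ρ (i + 1) + c (i + 1) * s * d i) {i : ℕ} (hi : i ≤ k + 1) :
    (1 - s * z) * X i = (1 - ρ i * z) * ξ i - c i * W i := by
  induction i with
  | zero => rw [hX0, hξ0, hW0]; ring
  | succ i ih =>
    have h1 := k1 i (by omega)
    have h2 := k2 i (by omega)
    have h3 := k3 i (by omega)
    rw [hX, hξ i (by omega), hW i (by omega)]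
    linear_combination t * ih (by omega) + t * z * A i * h1 + t * z * W i * h2 - t * z * ξ i * h3

/-- The first integral eliminates W from the recurrence for ξ, and the difference ξ − X then follows
the recurrence of H up to the slope γ. -/
theorem xi_eq {k : ℕ} {X A ξ W H c ρ γ : ℕ → B} {t z s : B}
    (hX0 : X 0 = 0) (hξ0 : ξ 0 = 0) (hH0 : H 0 = 0)
    (hX : ∀ i, X (i + 1) = t * (X i + A i))
    (hξ : ∀ i ≤ k, ξ (i + 1) = t * (A i + ξ i - c i * W i))
    (hH : ∀ i, H (i + 1) = t * z * (X i + H i))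
    (hΦ : ∀ i ≤ k, (1 - s * z) * X i = (1 - ρ i * z) * ξ i - c i * W i)
    (k1 : ∀ i ≤ k, ρ i - s = γ (i + 1)) (k2 : ∀ i ≤ k, 1 ≤ i → ρ i * γ i = γ (i + 1))
    {i : ℕ} (hi : i ≤ k + 1) : ξ i = X i + γ i * H i := by
  induction i with
  | zero => rw [hX0, hξ0, hH0]; ring
  | succ i ih =>
    have h1 := k1 i (by omega)
    have h2 : ρ i * γ i * H i = γ (i + 1) * H i := by
      rcases Nat.eq_zero_or_pos i with rfl | h
      · rw [hH0, mul_zero, mul_zero]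
      · rw [k2 i (by omega) h]
    rw [hX, hξ i (by omega), hH]
    linear_combination (-t) * hΦ i (by omega) + t * z * ρ i * ih (by omega) + t * z * X i * h1 +
      t * z * h2

/-- H interleaves powers of t and tz. The factor 1 − z telescopes it into X and Z, the partial sums
of the characteristic polynomial in t and in tz. -/
theorem geometric_recurrence {X A H Z : ℕ → B} {t z : B} (hH0 : H 0 = 0) (hX0 : X 0 = 0)
    (hZ0 : Z 0 = 0) (hX : ∀ i, X (i + 1) = t * (X i + A i))
    (hH : ∀ i, H (i + 1) = t * z * (X i + H i)) (hZ : ∀ i, Z (i + 1) = t * z * (Z i + A i))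
    (i : ℕ) : (1 - z) * H i = z * X i - Z i := by
  induction i with
  | zero => rw [hX0, hH0, hZ0]; ring
  | succ i ih => rw [hX, hH, hZ]; linear_combination t * z * ih

/-- Reversal of the characteristic polynomial. -/
theorem reverse_char {k : ℕ} {a : ℕ → B} {t u z g y : B} (hu : t * u = 1)
    (hz : t * z = y ^ 2 * g * u) (hrec : ∀ j ≤ k, a j * a k = g ^ j * a (k - j)) :
    ∑ j ∈ Finset.range (k + 1), (t * z) ^ (k - j) * (y ^ j * a j) =
      y ^ k * u ^ k * a k * ∑ j ∈ Finset.range (k + 1), t ^ (k - j) * (y ^ j * a j) := by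
  rw [← Finset.sum_range_reflect, Finset.mul_sum]
  refine Finset.sum_congr rfl fun j hj => ?_
  have hj' : j ≤ k := by have := Finset.mem_range.1 hj; omega
  obtain ⟨i, rfl⟩ := Nat.exists_eq_add_of_le hj'
  rw [show j + i + 1 - 1 - j = i by omega, show j + i - i = j by omega, hz,
    show j + i - j = i by omega]
  have h := hrec j hj'
  rw [show j + i - j = i by omega] at h
  have hi : u ^ (j + i) * t ^ i = u ^ j := by
    rw [pow_add, mul_assoc, ← mul_pow, mul_comm u t, hu, one_pow, mul_one]
  calc (y ^ 2 * g * u) ^ j * (y ^ i * a i) = y ^ (j + i) * y ^ j * u ^ j * (g ^ j * a i) := by ring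
    _ = _ := by rw [← h, ← hi]; ring

/-- Put χ = X_k + A_k. By `hχ`, z acts on χ as v. Then (1 − z)(H_k − A_k) = zχ − (Z_k + A_k) = (v −
ε)χ, so the second relation multiplied by 1 − z becomes an invertible constant times χ. -/
theorem plus_identity {k : ℕ} {X A H Z : ℕ → B} {t z s γ v ζ ε : B}
    (hH0 : H 0 = 0) (hX0 : X 0 = 0)
    (hZ0 : Z 0 = 0) (hX : ∀ i, X (i + 1) = t * (X i + A i))
    (hH : ∀ i, H (i + 1) = t * z * (X i + H i)) (hZ : ∀ i, Z (i + 1) = t * z * (Z i + A i))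
    (hs : s * v = 1) (hχ : (1 - s * z) * (X k + A k) = 0)
    (hR : X k + A k + γ * (H k - A k) = 0)
    (hrev : Z k + A k = ζ * (X k + A k)) (hζ : ζ * (X k + A k) = ε * (X k + A k))
    {i : B} (hi : i * (1 - v + γ * (v - ε)) = 1) : X k + A k = 0 := by
  have hg := geometric_recurrence hH0 hX0 hZ0 hX hH hZ k
  have hz : z * (X k + A k) = v * (X k + A k) := by
    linear_combination (-v) * hχ + (-(z * (X k + A k))) * hs
  have : (1 - v + γ * (v - ε)) * (X k + A k) = 0 := by
    linear_combination (1 - z) * hR - γ * hg + γ * hrev + hz - γ * hz + γ * hζ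
  linear_combination i * this - (X k + A k) * hi

/-- Reciprocity for the elements `a_n`. -/
theorem reciprocity {k : ℕ} {a x w Q c d e κ : ℕ → B} {g t u : B} (ht : t * u = 1)
    (hx : ∀ n ≤ k, x (n + 1) = t * (Q n * a n - x n - c n * w n))
    (hw : ∀ n ≤ k, w (n + 1) = u * g * (e n * a n + d n * x n - w n))
    (hx0 : x 0 = 0) (hw0 : w 0 = 0) (hxk : x (k + 1) = 0) (hwk : w (k + 1) = 0) (ha0 : a 0 = 1)
    (k1 : ∀ n m, n + m = k → Q n = κ n * (e m + c n * Q m))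
    (k2 : ∀ n m, n + m = k → d m = c n)
    (k3 : ∀ n m, n + m = k → 1 ≤ m → κ (n + 1) = κ n * (1 + c n * c m))
    (k4 : ∀ n m, n + m = k → e n + κ n * (d n * e m - Q m) = 0)
    (hstep : ∀ n m, n + m + 1 = k →
      g * x (n + 1) * a k = κ (n + 1) * g ^ (n + 1) * (t * w (m + 1)) → a n * a k = g ^ n * a (m + 1) →
      a (n + 1) * a k = g ^ (n + 1) * a m) :
    ∀ n m, n + m = k → g * x n * a k = κ n * g ^ n * (t * w (m + 1)) ∧
      w n * a k = κ n * g ^ n * (u * x (m + 1)) ∧ a n * a k = g ^ n * a m := by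
  intro n
  induction n with
  | zero =>
    intro m hm
    obtain rfl : m = k := by omega
    rw [hx0, hw0, hxk, hwk, ha0]
    simp
  | succ n ih =>
    intro m hm
    -- The pair x, w advances from n to n + 1 while the reflected pair steps back from m + 2 to m +
    -- 1; the identities k1–k4 make the two steps match.
    obtain ⟨i1, i2, i3⟩ := ih (m + 1) (by omega)
    have hW := hw (m + 1) (by omega)
    have hX := hx (m + 1) (by omega)
    rw [hW] at i1
    rw [hX] at i2
    have c1 := k1 n (m + 1) (by omega)
    have c2 := k2 n (m + 1) (by omega)
    have c2' := k2 (m + 1) n (by omega)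
    have c3 := k3 n (m + 1) (by omega) (by omega)
    have c4 := k4 n (m + 1) (by omega)
    have h1 : g * x (n + 1) * a k = κ (n + 1) * g ^ (n + 1) * (t * w (m + 1)) := by
      rw [hx n (by omega), c3]
      rw [c2] at i1
      linear_combination (-t) * i1 - t * c n * g * i2 + t * Q n * g * i3 +
        t * g ^ (n + 1) * a (m + 1) * c1 - t * κ n * g ^ (n + 1) *
        ((e (m + 1) * a (m + 1) + c n * x (m + 1) - w (m + 1)) +
          c n * (Q (m + 1) * a (m + 1) - x (m + 1) - c (m + 1) * w (m + 1))) * ht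
    have h2 : w (n + 1) * a k = κ (n + 1) * g ^ (n + 1) * (u * x (m + 1)) := by
      rw [hw n (by omega), c3, c2']
      rw [c2] at i1
      rw [c2'] at c4
      linear_combination u * c (m + 1) * i1 - u * g * i2 + u * e n * g * i3 +
        u * g ^ (n + 1) * a (m + 1) * c4 + u * κ n * g ^ (n + 1) *
        (c (m + 1) * (e (m + 1) * a (m + 1) + c n * x (m + 1) - w (m + 1)) -
          (Q (m + 1) * a (m + 1) - x (m + 1) - c (m + 1) * w (m + 1))) * ht
    exact ⟨h1, h2, hstep n m (by omega) h1 i3⟩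

/-- Since a is e minus g times its shift, the characteristic polynomial is t²(1 − z)E with E =
sS_{2ℓ}, and the symmetry of e gives H_k − A_k = t²(z + z^ℓ)E. The two relations become (1 − sz)(1 −
z)E = 0 and (1 − z)E + γ(z + z^ℓ)E = 0. On (1 − sz)E the element z acts as 1, so the second relation
leaves 2γ(1 − sz)E = 0; as 2γ is invertible and szt² = g, the claim follows. -/
theorem minus_identity {ℓ : ℕ} {X A H e S : ℕ → B} {a : ℕ → B} {t u z s v g gi γ γi y : B}
    (ht : t * u = 1) (hs : s * v = 1) (hy : y ^ 2 = v) (hg : g * gi = 1) (hγ : 2 * γ * γi = 1)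
    (hz : z = v * g * u ^ 2) (hX0 : X 0 = 0) (hH0 : H 0 = 0)
    (hX : ∀ i, X (i + 1) = t * (X i + A i)) (hH : ∀ i, H (i + 1) = t * z * (X i + H i))
    (hA : ∀ i, A i = y ^ i * a i)
    (hχ : (1 - s * z) * (X (2 * ℓ) + A (2 * ℓ)) = 0)
    (hR : X (2 * ℓ) + A (2 * ℓ) + γ * (H (2 * ℓ) - A (2 * ℓ)) = 0)
    (he0 : e 0 = 0) (he1 : e 1 = 0) (hae : ∀ j ≤ 2 * ℓ, a j = e (j + 2) - g * e j)
    (hek1 : e (2 * ℓ + 1) = 0) (hek2 : e (2 * ℓ + 2) = 0)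
    (hsym : ∀ i j, i + j = 2 * ℓ + 2 → g ^ i * e j = g ^ (ℓ + 1) * e i)
    (hS0 : S 0 = 0) (hS : ∀ i, S (i + 1) = t * S i + y ^ (i + 1) * e (i + 1)) :
    (t ^ 2 - g) * (s * S (2 * ℓ)) = 0 := by
  have hgz : s * t ^ 2 * z = g := by
    rw [hz]
    linear_combination (t ^ 2 * g * u ^ 2) * hs + g * (t * u + 1) * ht
  have hXS : ∀ i ≤ 2 * ℓ, X i = s * t ^ 2 * (1 - z) * S i + s * t * (y ^ (i + 1) * e (i + 1)) +
      g * (y ^ i * e i) := by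
    intro i
    induction i with
    | zero => intro _; rw [hX0, hS0, he0, zero_add, he1]; ring
    | succ i ih =>
      intro hi
      rw [hX, ih (by omega), hA, hae i (by omega), hS]
      have hv : y ^ i * e (i + 2) = s * (y ^ (i + 2) * e (i + 2)) := by
        linear_combination (-(y ^ i * e (i + 2))) * hs - s * y ^ i * e (i + 2) * hy
      linear_combination t * hv + y ^ (i + 1) * e (i + 1) * hgz
  obtain ⟨Z, hZ0, hZ⟩ : ∃ Z : ℕ → B, Z 0 = 0 ∧
      ∀ i, Z (i + 1) = t * z * (Z i + g * (y ^ i * e i)) :=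
    ⟨fun i => Nat.rec 0 (fun i r => t * z * (r + g * (y ^ i * e i))) i, rfl, fun i => rfl⟩
  have hHS : ∀ i ≤ 2 * ℓ, H i = g * S i + Z i := by
    intro i
    induction i with
    | zero => intro _; rw [hH0, hS0, hZ0]; ring
    | succ i ih =>
      intro hi
      rw [hH, ih (by omega), hXS i (by omega), hS, hZ]
      linear_combination (t * (1 - z) * S i + y ^ (i + 1) * e (i + 1)) * hgz
  have hSsum : S (2 * ℓ) = ∑ j ∈ Finset.range (2 * ℓ + 1), t ^ (2 * ℓ - j) * (y ^ j * e j) := by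
    have h : ∀ i, S i = ∑ j ∈ Finset.range (i + 1), t ^ (i - j) * (y ^ j * e j) := by
      intro i
      induction i with
      | zero => simp [hS0, he0]
      | succ i ih =>
        rw [Finset.sum_range_succ, hS, ih, Finset.mul_sum, Nat.sub_self, pow_zero, one_mul]
        congr 1
        refine Finset.sum_congr rfl fun j hj => ?_
        rw [← mul_assoc, ← pow_succ', Nat.succ_sub (by have := Finset.mem_range.1 hj; omega)]
    exact h _
  have hzl : z ^ ℓ = v ^ ℓ * g ^ ℓ * u ^ (2 * ℓ) := by rw [hz, mul_pow, mul_pow, ← pow_mul]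
  have hsym' : ∀ i j, i + j = 2 * ℓ + 2 → 1 ≤ i → g ^ (i - 1) * e j = g ^ ℓ * e i := by
    intro i j hij hi
    obtain ⟨i, rfl⟩ := Nat.exists_eq_add_of_le' hi
    have h := hsym _ j hij
    rw [Nat.add_sub_cancel]
    linear_combination gi * h - (g ^ i * e j - g ^ ℓ * e (i + 1)) * hg
  have hZS : Z (2 * ℓ) + g * (y ^ (2 * ℓ) * e (2 * ℓ)) = z ^ ℓ * t ^ 2 * s * S (2 * ℓ) := by
    rw [sum_of_recurrence hZ0 hZ, hSsum, Finset.mul_sum]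
    have htz : t * z = v * g * u := by
      rw [hz]; linear_combination v * g * u * ht
    have hl : ∀ f : ℕ → B, f 0 = 0 → f 1 = 0 → ∑ j ∈ Finset.range (2 * ℓ + 1), f j =
        ∑ j ∈ Finset.Ico 2 (2 * ℓ + 1), f j := by
      intro f h0 h1
      symm
      refine Finset.sum_subset (fun j hj => ?_) fun j hj hj' => ?_
      · have := Finset.mem_Ico.1 hj
        exact Finset.mem_range.2 this.2
      · have h := Finset.mem_range.1 hj
        have h' : j < 2 := by
          by_contra h2
          exact hj' (Finset.mem_Ico.2 ⟨by omega, h⟩)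
        interval_cases j
        · exact h0
        · exact h1
    rw [hl _ (by simp [he0]) (by simp [he1]), hl _ (by simp [he0]) (by simp [he1])]
    -- The symmetry of e about ℓ + 1 matches the terms j and 2ℓ + 2 − j.
    refine Finset.sum_nbij' (fun j => 2 * ℓ + 2 - j) (fun j => 2 * ℓ + 2 - j) ?_ ?_ ?_ ?_ ?_
    · intro j hj
      have := Finset.mem_Ico.1 hj
      exact Finset.mem_Ico.2 ⟨by omega, by omega⟩
    · intro j hj
      have := Finset.mem_Ico.1 hj
      exact Finset.mem_Ico.2 ⟨by omega, by omega⟩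
    · intro j hj
      have := Finset.mem_Ico.1 hj
      omega
    · intro j hj
      have := Finset.mem_Ico.1 hj
      omega
    · intro j hj
      have hj' := Finset.mem_Ico.1 hj
      obtain ⟨i, hi⟩ : ∃ i, 2 * ℓ = j + i := ⟨2 * ℓ - j, by omega⟩
      obtain ⟨p, rfl⟩ : ∃ p, j = p + 2 := ⟨j - 2, by omega⟩
      have h := hsym' (i + 2) (p + 2) (by omega) (by omega)
      rw [show 2 * ℓ - (p + 2) = i by omega, show 2 * ℓ + 2 - (p + 2) = i + 2 by omega,
        show 2 * ℓ - (i + 2) = p by omega, hzl, htz]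
      rw [show i + 2 - 1 = i + 1 by omega] at h
      have hu : u ^ (2 * ℓ) * t ^ 2 * t ^ p = u ^ i := by
        have h1 : u ^ (p + 2) * t ^ (p + 2) = 1 := by rw [← mul_pow, mul_comm u t, ht, one_pow]
        rw [hi]
        linear_combination u ^ i * h1
      have hvl : v ^ ℓ = y ^ (p + 2 + i) := by rw [← hy, ← pow_mul, hi]
      have hy2 : v ^ i = y ^ (2 * i) := by rw [← hy, ← pow_mul]
      have hys : s * y ^ 2 = 1 := by rw [hy, hs]
      calc (v * g * u) ^ i * (g * (y ^ (p + 2) * e (p + 2)))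
          = v ^ i * u ^ i * y ^ (p + 2) * (g ^ (i + 1) * e (p + 2)) := by ring
        _ = y ^ (2 * i + p + 2) * u ^ i * (g ^ ℓ * e (i + 2)) * 1 := by rw [h, hy2]; ring
        _ = _ := by rw [← hys, ← hu, hvl]; ring
  set E := s * S (2 * ℓ) with hE
  have h1 : X (2 * ℓ) + A (2 * ℓ) = t ^ 2 * (1 - z) * E := by
    rw [hXS _ le_rfl, hA, hae _ le_rfl, hek1, hek2, hE]
    ring
  have h2 : H (2 * ℓ) - A (2 * ℓ) = t ^ 2 * (z + z ^ ℓ) * E := by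
    rw [hHS _ le_rfl, hA, hae _ le_rfl, hek2, hE]
    linear_combination hZS - S (2 * ℓ) * hgz
  rw [h1] at hχ hR
  rw [h2] at hR
  have h3 : (1 - z) * E + γ * (z + z ^ ℓ) * E = 0 := by
    linear_combination u ^ 2 * hR - ((1 - z) * E + γ * (z + z ^ ℓ) * E) * (t * u + 1) * ht
  have h4 : z * ((1 - s * z) * E) = (1 - s * z) * E := by
    linear_combination (-(u ^ 2)) * hχ + ((1 - s * z) * (1 - z) * E) * (t * u + 1) * ht
  have h5 : z ^ ℓ * ((1 - s * z) * E) = (1 - s * z) * E := by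
    generalize ℓ = n
    induction n with
    | zero => ring
    | succ n ih => rw [pow_succ, mul_assoc, h4, ih]
  have h6 : (1 - s * z) * E = 0 := by
    linear_combination γi * ((1 - s * z) * h3 + (1 - γ) * h4 - γ * h5) - ((1 - s * z) * E) * hγ
  linear_combination t ^ 2 * h6 + E * hgz

end Recurrences

/-! ### The coefficients of the recurrences for `μ = q^{1 - k}` -/

/-- The coefficients in the reciprocity relations. -/
def recipCoef (q μ : ℂ) (n : ℕ) : ℂ := q * (spec q μ n + 1) / (spec q μ n + q ^ 2)

theorem spec_succ (q μ : ℂ) (n : ℕ) : spec q μ (n + 1) = q ^ 2 * spec q μ n := by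
  rw [spec, spec]; ring

/-- The ratio of two consecutive slopes. -/
def ratioCoef (q μ : ℂ) (n : ℕ) : ℂ := (1 + (q ^ 2)⁻¹ * spec q μ n) / (1 + spec q μ n)

/-- The slope `(1 - q⁻²) / (1 + μ q^{2n - 3})`. -/
def slopeCoef (q μ : ℂ) (n : ℕ) : ℂ := (1 - (q ^ 2)⁻¹) / (1 + (q ^ 2)⁻¹ * spec q μ n)

/-- Parameters of an R-matrix of the type `O(k)`. -/
structure OrthParams (k : ℕ) (q μ : ℂ) : Prop extends GoodParams q μ where
  μ_eq : μ = q ^ (1 - (k : ℤ))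
  num_ne : ∀ n, 1 ≤ n → n ≤ k → qNum q n ≠ 0
  spec_ne : ∀ n, n ≤ k + 1 → 1 + spec q μ n ≠ 0

namespace OrthParams

variable {k : ℕ} {q μ : ℂ} (hp : OrthParams k q μ)
include hp

theorem μ_inv : μ⁻¹ = q ^ k / q := by
  rw [hp.μ_eq, ← zpow_neg, neg_sub, zpow_sub₀ hp.q0, zpow_natCast, zpow_one]

theorem μ_eq_div : μ = q / q ^ k := by
  rw [← inv_inv μ, hp.μ_inv, inv_div]

theorem spec_eq (n : ℕ) : spec q μ n = q ^ (2 * n) / q ^ k := by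
  have q0 := hp.q0
  have : q ^ k ≠ 0 := pow_ne_zero _ q0
  rw [spec, hp.μ_eq_div]
  field_simp

/-- For μ = q^{1−k} the reflection n ↦ k − n thus inverts the spectral value; the reciprocity
relations rest on this. -/
theorem spec_eq_div {n m : ℕ} (h : n + m = k) : spec q μ n = q ^ n / q ^ m := by
  have q0 := hp.q0
  have h1 : q ^ m ≠ 0 := pow_ne_zero _ q0
  have h2 : q ^ n ≠ 0 := pow_ne_zero _ q0
  rw [hp.spec_eq, ← h, two_mul, pow_add, pow_add]
  field_simp

theorem add_ne {n m : ℕ} (h : n + m = k) : q ^ n + q ^ m ≠ 0 := by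
  have h1 := hp.spec_ne n (by omega)
  have h2 : q ^ m ≠ 0 := pow_ne_zero _ hp.q0
  rw [hp.spec_eq_div h] at h1
  intro h3
  apply h1
  field_simp
  linear_combination h3

theorem add_ne' {n m : ℕ} (h : n + m = k) : q ^ n + q ^ m * q ^ 2 ≠ 0 := by
  rcases Nat.eq_zero_or_pos n with rfl | hn
  · have h1 := hp.spec_ne (k + 1) le_rfl
    have h2 : q ^ k ≠ 0 := pow_ne_zero _ hp.q0
    obtain rfl : m = k := by omega
    rw [hp.spec_eq] at h1
    intro h3
    apply h1
    have : q ^ (2 * (m + 1)) = q ^ m * (q ^ m * q ^ 2) := by ring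
    rw [this]
    field_simp
    linear_combination h3
  · obtain ⟨n, rfl⟩ := Nat.exists_eq_add_of_le' hn
    have h1 := hp.add_ne (n := n) (m := m + 1) (by omega)
    intro h3
    apply h1
    have : q * (q ^ n + q ^ (m + 1)) = 0 := by linear_combination h3
    exact (mul_eq_zero.1 this).resolve_left hp.q0

theorem sq_ne : q ^ 2 - 1 ≠ 0 := by
  have h := hp.q2
  have q0 := hp.q0
  intro h1
  apply h
  field_simp
  linear_combination h1

theorem specCoef_eq {n m : ℕ} (h : n + m = k) :
    specCoef q μ n = (q ^ 2 - 1) * q ^ m / (q * (q ^ n + q ^ m)) := by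
  have q0 := hp.q0
  have h1 : q ^ m ≠ 0 := pow_ne_zero _ q0
  have h2 := hp.add_ne h
  have h3 := hp.spec_ne n (by omega)
  rw [specCoef, div_eq_div_iff h3 (mul_ne_zero q0 h2), hp.spec_eq_div h]
  field_simp
  ring

theorem recipCoef_eq {n m : ℕ} (h : n + m = k) :
    recipCoef q μ n = q * (q ^ n + q ^ m) / (q ^ n + q ^ m * q ^ 2) := by
  have q0 := hp.q0
  have h1 : q ^ m ≠ 0 := pow_ne_zero _ q0
  have h2 := hp.add_ne' h
  have e : q ^ n / q ^ m + q ^ 2 = (q ^ n + q ^ m * q ^ 2) / q ^ m := by field_simp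
  rw [recipCoef, hp.spec_eq_div h, e]
  field_simp

theorem coef_eq {n m : ℕ} (h : n + m = k) :
    spec q μ n * specCoef q μ n = (q ^ 2 - 1) * q ^ n / (q * (q ^ n + q ^ m)) := by
  have q0 := hp.q0
  have h1 : q ^ m ≠ 0 := pow_ne_zero _ q0
  have h2 := hp.add_ne h
  rw [hp.spec_eq_div h, hp.specCoef_eq h]
  field_simp

theorem specCoef_reflect {n m : ℕ} (h : n + m = k) :
    specCoef q μ m = spec q μ n * specCoef q μ n := by
  rw [hp.coef_eq h, hp.specCoef_eq (n := m) (m := n) (by omega), add_comm (q ^ m)]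

/-- Together with `specCoef_reflect`, `recip_b` and `recipCoef_succ`, this verifies the coefficient
hypotheses of `reciprocity`. -/
theorem recip_a {n m : ℕ} (h : n + m = k) : q ^ n = recipCoef q μ n *
    (μ⁻¹ * (q ^ m)⁻¹ + spec q μ n * specCoef q μ n * q ^ m) := by
  have q0 := hp.q0
  have h1 : q ^ m ≠ 0 := pow_ne_zero _ q0
  have h2 := hp.add_ne h
  have h3 := hp.add_ne' h
  rw [hp.recipCoef_eq h, hp.coef_eq h, hp.μ_inv, ← h, pow_add]
  generalize hD : q ^ n + q ^ m * q ^ 2 = D at *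
  generalize q ^ n = α at *
  generalize q ^ m = β at *
  field_simp
  rw [← hD]
  ring

theorem recip_b {n m : ℕ} (h : n + m = k) : μ⁻¹ * (q ^ n)⁻¹ + recipCoef q μ n *
    (specCoef q μ n * (μ⁻¹ * (q ^ m)⁻¹) - q ^ m) = 0 := by
  have q0 := hp.q0
  have h1 : q ^ m ≠ 0 := pow_ne_zero _ q0
  have h4 : q ^ n ≠ 0 := pow_ne_zero _ q0
  have h2 := hp.add_ne h
  have h3 := hp.add_ne' h
  rw [hp.recipCoef_eq h, hp.specCoef_eq h, hp.μ_inv, ← h, pow_add]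
  generalize q ^ n = α at *
  generalize q ^ m = β at *
  field_simp
  ring

theorem recipCoef_succ {n m : ℕ} (h : n + m = k) (hm : 1 ≤ m) : recipCoef q μ (n + 1) =
    recipCoef q μ n * (1 + spec q μ n * specCoef q μ n * (spec q μ m * specCoef q μ m)) := by
  obtain ⟨m, rfl⟩ := Nat.exists_eq_add_of_le' hm
  have q0 := hp.q0
  have h2 := hp.add_ne h
  have h3 := hp.add_ne' h
  have h4 : q ^ (n + 1) + q ^ m * q ^ 2 = q * (q ^ n + q ^ (m + 1)) := by ring
  have h5 : q ^ (n + 1) + q ^ m ≠ 0 := hp.add_ne (by omega)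
  rw [hp.recipCoef_eq h, hp.coef_eq h, hp.coef_eq (n := m + 1) (m := n) (by omega),
    hp.recipCoef_eq (n := n + 1) (m := m) (by omega), add_comm (q ^ (m + 1)), h4]
  rw [pow_succ] at h2 h3 h5 ⊢
  rw [pow_succ q m]
  generalize hD : q ^ n + q ^ m * q = D at *
  generalize hE : q ^ n + q ^ m * q * q ^ 2 = E at *
  generalize hG : q ^ n * q + q ^ m = G at *
  generalize q ^ n = α at *
  generalize q ^ m = β at *
  field_simp
  rw [← hE, ← hD, ← hG]
  ring

/-- This matches the R-trace constants of x_{n+1} and y_{m+1}, so that the traced reflection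
relation becomes a relation between the a's with no constant. -/
theorem recip_num {n m : ℕ} (h : n + m + 1 = k) : recipCoef q μ (n + 1) *
    (qNum q (m + 1) * (μ⁻¹ * traceCoef q μ m)) = qNum q (n + 1) := by
  have q0 := hp.q0
  have h0 := hp.num_ne (m + 1) (by omega) (by omega)
  have h1 : q ^ m ≠ 0 := pow_ne_zero _ q0
  have h4 : q ^ n ≠ 0 := pow_ne_zero _ q0
  have h2 := hp.add_ne (n := n + 1) (m := m) (by omega)
  have h3 := hp.add_ne (n := n) (m := m + 1) (by omega)
  have h5 := hp.sq_ne
  have e1 : recipCoef q μ (n + 1) = (q ^ (n + 1) + q ^ m) / (q ^ n + q ^ (m + 1)) := by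
    have h4 : q ^ (n + 1) + q ^ m * q ^ 2 = q * (q ^ n + q ^ (m + 1)) := by ring
    rw [hp.recipCoef_eq (n := n + 1) (m := m) (by omega), h4]
    field_simp
  have e2 : μ = (q ^ n * q ^ m)⁻¹ := by
    rw [hp.μ_eq_div, ← h, pow_succ, pow_add]
    field_simp
  have e3 : q * (q ^ n * q ^ m) * (q ^ (2 * m))⁻¹ + 1 = (q ^ (n + 1) + q ^ m) / q ^ m := by
    rw [two_mul, pow_add, pow_succ]
    field_simp
  have e4 : q - q⁻¹ = (q ^ 2 - 1) / q := by field_simp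
  rw [e1, traceCoef, bmwEta, e2, inv_inv, e3]
  have e5 : ∀ a : ℂ, qNum q (m + 1) * (q ^ n * q ^ m * (q ^ m / qNum q (m + 1) * a)) =
      q ^ n * q ^ m * q ^ m * a := fun a => by field_simp
  rw [e5, qNum, e4]
  rw [pow_succ] at h2 h3 ⊢
  rw [pow_succ q m, two_mul, pow_add]
  generalize hD : q ^ n + q ^ m * q = D at *
  generalize hG : q ^ n * q + q ^ m = G at *
  generalize hw : q ^ 2 - 1 = w at *
  generalize q ^ n = α at *
  generalize q ^ m = β at *
  field_simp
  rw [← hD, ← hG, ← hw]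
  ring

theorem spec_ne_zero (n : ℕ) : spec q μ n ≠ 0 :=
  mul_ne_zero (mul_ne_zero hp.m0 (pow_ne_zero _ hp.q0)) (inv_ne_zero hp.q0)

theorem inv_mul_spec_succ (n : ℕ) : (q ^ 2)⁻¹ * spec q μ (n + 1) = spec q μ n := by
  rw [spec_succ, inv_mul_cancel_left₀ (pow_ne_zero _ hp.q0)]

/-- The identities `ratio_a` to `ratio_c` are the coefficient hypotheses of `first_integral` with s
= q⁻², and `ratio_d`, `ratio_e` those of `xi_eq`. -/
theorem ratio_a {i : ℕ} (hi : i ≤ k) : ratioCoef q μ (i + 1) - (q ^ 2)⁻¹ =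
    spec q μ (i + 1) * specCoef q μ (i + 1) * (q ^ 2)⁻¹ * (μ⁻¹ * (q ^ (2 * i))⁻¹) := by
  have h1 := hp.spec_ne (i + 1) (by omega)
  have h2 : μ⁻¹ * (q ^ (2 * i))⁻¹ = q⁻¹ * (spec q μ i)⁻¹ := by
    have := hp.q0
    have := hp.m0
    have : q ^ (2 * i) ≠ 0 := pow_ne_zero _ hp.q0
    rw [spec]
    field_simp
  have h3 := hp.spec_ne_zero i
  have q0 := hp.q0
  rw [h2, ratioCoef, hp.inv_mul_spec_succ, specCoef]
  rw [spec_succ] at h1 ⊢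
  generalize spec q μ i = p at *
  generalize hD : 1 + q ^ 2 * p = D at *
  field_simp
  rw [← hD]
  ring

theorem ratio_b {i : ℕ} (hi : i ≤ k) : spec q μ (i + 1) * specCoef q μ (i + 1) * (q ^ 2)⁻¹ =
    ratioCoef q μ (i + 1) * (spec q μ i * specCoef q μ i) := by
  have h1 := hp.spec_ne (i + 1) (by omega)
  have h2 := hp.spec_ne i (by omega)
  have q0 := hp.q0
  rw [ratioCoef, hp.inv_mul_spec_succ, specCoef, specCoef]
  rw [spec_succ] at h1 ⊢
  generalize spec q μ i = p at *
  field_simp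

theorem ratio_c {i : ℕ} (hi : i ≤ k) : ratioCoef q μ i = ratioCoef q μ (i + 1) +
    spec q μ (i + 1) * specCoef q μ (i + 1) * (q ^ 2)⁻¹ * specCoef q μ i := by
  have h1 := hp.spec_ne (i + 1) (by omega)
  have h2 := hp.spec_ne i (by omega)
  have q0 := hp.q0
  rw [ratioCoef, ratioCoef, hp.inv_mul_spec_succ, specCoef, specCoef]
  rw [spec_succ] at h1 ⊢
  generalize spec q μ i = p at *
  field_simp
  ring

theorem ratio_d {i : ℕ} (hi : i ≤ k) : ratioCoef q μ i - (q ^ 2)⁻¹ = slopeCoef q μ (i + 1) := by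
  have h2 := hp.spec_ne i (by omega)
  have q0 := hp.q0
  rw [ratioCoef, slopeCoef, hp.inv_mul_spec_succ]
  generalize spec q μ i = p at *
  field_simp
  ring

theorem ratio_e {i : ℕ} (hi : i ≤ k) (hi' : 1 ≤ i) :
    ratioCoef q μ i * slopeCoef q μ i = slopeCoef q μ (i + 1) := by
  obtain ⟨i, rfl⟩ := Nat.exists_eq_add_of_le' hi'
  have h1 := hp.spec_ne (i + 1) (by omega)
  have h2 := hp.spec_ne i (by omega)
  rw [ratioCoef, slopeCoef, slopeCoef, hp.inv_mul_spec_succ, hp.inv_mul_spec_succ]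
  field_simp

theorem recipCoef_one_ne (hk : 1 ≤ k) : recipCoef q μ 1 ≠ 0 := by
  have h := hp.recipCoef_eq (n := 1) (m := k - 1) (by omega)
  rw [h]
  exact div_ne_zero (mul_ne_zero hp.q0 (hp.add_ne (by omega))) (hp.add_ne' (by omega))

theorem one_add_ne : 1 + q ^ k ≠ 0 := by
  have h := hp.add_ne (n := 0) (m := k) (by omega)
  rwa [pow_zero] at h

theorem sq_add_ne (hk : 1 ≤ k) : q ^ 2 + q ^ k ≠ 0 := by
  obtain ⟨m, rfl⟩ := Nat.exists_eq_add_of_le' hk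
  have h := hp.add_ne (n := 1) (m := m) (by omega)
  intro h1
  apply h
  have : q * (q ^ 1 + q ^ m) = 0 := by linear_combination h1
  exact (mul_eq_zero.1 this).resolve_left hp.q0

theorem slopeCoef_eq (hk : 1 ≤ k) : slopeCoef q μ k = (q ^ 2 - 1) / (q ^ 2 + q ^ k) := by
  have q0 := hp.q0
  have h := hp.sq_add_ne hk
  have e : 1 + (q ^ 2)⁻¹ * q ^ k = (q ^ 2 + q ^ k) / q ^ 2 := by field_simp
  rw [slopeCoef, hp.spec_eq_div (n := k) (m := 0) rfl, pow_zero, div_one, e]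
  field_simp

/-- This constant turns the value of x_k obtained from reciprocity into the form (1 − γ_k) q^k a_k
that the second relation needs. -/
theorem recip_slope (hk : 1 ≤ k) :
    recipCoef q μ 1 * (q ^ k * (1 - slopeCoef q μ k)) = μ⁻¹ := by
  have q0 := hp.q0
  have h1 := hp.sq_add_ne hk
  have h2 := hp.one_add_ne
  obtain ⟨m, rfl⟩ := Nat.exists_eq_add_of_le' hk
  have e1 : recipCoef q μ 1 = (q ^ 2 + q ^ (m + 1)) / (q * (1 + q ^ (m + 1))) := by
    have e2 : q ^ 1 + q ^ m * q ^ 2 = q * (1 + q ^ (m + 1)) := by ring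
    rw [hp.recipCoef_eq (n := 1) (m := m) (by omega), e2, div_eq_div_iff
      (mul_ne_zero q0 h2) (mul_ne_zero q0 h2)]
    ring
  rw [e1, hp.slopeCoef_eq hk, hp.μ_inv]
  generalize q ^ (m + 1) = K at *
  field_simp
  ring

theorem slopeCoef_ne (hk : 1 ≤ k) : slopeCoef q μ k ≠ 0 := by
  rw [hp.slopeCoef_eq hk]
  exact div_ne_zero hp.sq_ne (hp.sq_add_ne hk)

/-- Its value is −2q^k(q² − 1)/(q² + q^k). -/
theorem plus_coef_ne (hk : 1 ≤ k) : 1 - q ^ 2 + slopeCoef q μ k * (q ^ 2 - q ^ k) ≠ 0 := by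
  have h1 := hp.sq_add_ne hk
  have h2 : 1 - q ^ 2 + slopeCoef q μ k * (q ^ 2 - q ^ k) =
      -((q ^ 2 - 1) * (2 * q ^ k)) / (q ^ 2 + q ^ k) := by
    rw [hp.slopeCoef_eq hk]
    field_simp
    ring
  rw [h2]
  exact div_ne_zero (neg_ne_zero.2 (mul_ne_zero hp.sq_ne (mul_ne_zero two_ne_zero
    (pow_ne_zero _ hp.q0)))) h1

end OrthParams

open scoped LaurentPolynomial

universe u v

/-! ### The Cayley–Hamilton identities for an abstract system of descendants -/

/-- The cyclic module generated by `e` over Laurent polynomials in an invertible operator. -/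
theorem exists_cyclic_model {C : Type u} {P : Type v} [CommRing C] [AddCommGroup P] [Module C P]
    (Θ : (Module.End C P)ˣ) (e : P) :
    ∃ (B : Type u) (_ : CommRing B) (_ : Algebra C B) (t u : B) (ev : B →ₗ[C] P),
      t * u = 1 ∧ Function.Injective ev ∧ ev 1 = e ∧ ∀ b, ev (t * b) = Θ.val (ev b) := by
  let φ : C[T;T⁻¹] →ₐ[C] Module.End C P :=
    AddMonoidAlgebra.lift C (Module.End C P) ℤ ((Units.coeHom _).comp (zpowersHom _ Θ))
  have hT : φ (LaurentPolynomial.T 1) = Θ.val := by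
    rw [LaurentPolynomial.T, AddMonoidAlgebra.lift_single, one_smul]
    simp
  -- The annihilator of e. Dividing by it makes evaluation at e injective, so vanishing in P can be
  -- transferred back to B.
  let I : Ideal C[T;T⁻¹] :=
    { carrier := {b | φ b e = 0}
      add_mem' := fun {a b} ha hb => by
        change φ (a + b) e = 0
        rw [map_add, LinearMap.add_apply, show φ a e = 0 from ha, show φ b e = 0 from hb, add_zero]
      zero_mem' := by
        change φ 0 e = 0
        rw [map_zero, LinearMap.zero_apply]
      smul_mem' := fun c b hb => by
        change φ (c * b) e = 0
        rw [map_mul, Module.End.mul_apply, show φ b e = 0 from hb, map_zero] }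
  let ev0 : C[T;T⁻¹] →ₗ[C] P := (LinearMap.applyₗ e) ∘ₗ φ.toLinearMap
  let ev : (C[T;T⁻¹] ⧸ I) →ₗ[C] P := ((I.restrictScalars C).liftQ ev0 (fun b hb => hb)) ∘ₗ
    (Submodule.Quotient.restrictScalarsEquiv C I).symm.toLinearMap
  have hev : ∀ b : C[T;T⁻¹], ev (Ideal.Quotient.mk I b) = φ b e := fun b => rfl
  refine ⟨C[T;T⁻¹] ⧸ I, inferInstance, inferInstance, Ideal.Quotient.mk I (LaurentPolynomial.T 1),
    Ideal.Quotient.mk I (LaurentPolynomial.T (-1)), ev, ?_, ?_, ?_, ?_⟩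
  · rw [← map_mul, ← LaurentPolynomial.T_add]
    simp
  · rw [← LinearMap.ker_eq_bot, LinearMap.ker_eq_bot']
    intro b hb
    obtain ⟨b, rfl⟩ := Ideal.Quotient.mk_surjective b
    rw [hev] at hb
    exact Ideal.Quotient.eq_zero_iff_mem.2 hb
  · rw [← map_one (Ideal.Quotient.mk I), hev, map_one, Module.End.one_apply]
  · intro b
    obtain ⟨b, rfl⟩ := Ideal.Quotient.mk_surjective b
    rw [← map_mul, hev, hev, map_mul, Module.End.mul_apply, hT]

/-- The recurrences satisfied by the descendants of antisymmetrizers. -/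
structure DescentSystem (k : ℕ) (q μ : ℂ) (C P : Type*) [CommRing C] [Algebra ℂ C]
    [AddCommGroup P] [Module C P] where
  Θ : (Module.End C P)ˣ
  e : P
  τ : P →ₗ[C] C
  a : ℕ → C
  g : Cˣ
  x : ℕ → P
  y : ℕ → P
  a_zero : a 0 = 1
  x_zero : x 0 = 0
  y_zero : y 0 = 0
  x_succ : ∀ n ≤ k, x (n + 1) = (algebraMap ℂ C (q ^ n) * a n) • Θ.val e - Θ.val (x n) -
    algebraMap ℂ C (spec q μ n * specCoef q μ n) • y n
  y_succ : ∀ n ≤ k, Θ.val (y (n + 1)) =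
    (g.val * algebraMap ℂ C (μ⁻¹ * (q ^ n)⁻¹) * a n) • Θ.val e +
      (g.val * algebraMap ℂ C (specCoef q μ n)) • Θ.val (x n) - g.val • y n
  x_last : x (k + 1) = 0
  y_last : y (k + 1) = 0
  τ_x : ∀ n, 1 ≤ n → n ≤ k → τ (x n) = algebraMap ℂ C (qNum q n) * a n
  τ_y : ∀ n, n + 1 ≤ k → τ (y (n + 1)) =
    algebraMap ℂ C (qNum q (n + 1) * (μ⁻¹ * traceCoef q μ n)) * (a n * g.val)

namespace DescentSystem

variable {k : ℕ} {q μ : ℂ} {C : Type u} {P : Type v} [CommRing C] [Algebra ℂ C] [AddCommGroup P] [Module C P]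
  (𝒟 : DescentSystem k q μ C P)

/-- A commutative ring carrying the recurrences of a system of descendants. -/
structure Model (B : Type*) [CommRing B] [Algebra C B] where
  t : B
  u : B
  ev : B →ₗ[C] P
  x : ℕ → B
  w : ℕ → B
  mul_inv : t * u = 1
  ev_injective : Function.Injective ev
  ev_one : ev 1 = 𝒟.e
  ev_mul : ∀ b, ev (t * b) = 𝒟.Θ.val (ev b)
  x_zero : x 0 = 0
  w_zero : w 0 = 0
  x_succ : ∀ n ≤ k, x (n + 1) = t * (algebraMap C B (algebraMap ℂ C (q ^ n)) *
    algebraMap C B (𝒟.a n) - x n -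
    algebraMap C B (algebraMap ℂ C (spec q μ n * specCoef q μ n)) * w n)
  w_succ : ∀ n ≤ k, w (n + 1) = u * algebraMap C B 𝒟.g.val *
    (algebraMap C B (algebraMap ℂ C (μ⁻¹ * (q ^ n)⁻¹)) * algebraMap C B (𝒟.a n) +
      algebraMap C B (algebraMap ℂ C (specCoef q μ n)) * x n - w n)
  ev_x : ∀ n ≤ k + 1, ev (x n) = 𝒟.x n
  ev_w : ∀ n ≤ k + 1, ev (t * w n) = 𝒟.y n

theorem exists_model : ∃ (B : Type u) (_ : CommRing B) (_ : Algebra C B), Nonempty (𝒟.Model B) := by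
  obtain ⟨B, _, _, t, u, ev, htu, hinj, h1, hmul⟩ := exists_cyclic_model 𝒟.Θ 𝒟.e
  refine ⟨B, inferInstance, inferInstance, ?_⟩
  -- The second component stands for Θ⁻¹y. With t invertible both recurrences become explicit, and
  -- they are used as the definition; agreement with P is then an induction up to k + 1.
  let xw : ℕ → B × B := fun n => Nat.rec (0, 0) (fun n p =>
    (t * (algebraMap C B (algebraMap ℂ C (q ^ n)) * algebraMap C B (𝒟.a n) - p.1 -
      algebraMap C B (algebraMap ℂ C (spec q μ n * specCoef q μ n)) * p.2),
    u * algebraMap C B 𝒟.g.val *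
      (algebraMap C B (algebraMap ℂ C (μ⁻¹ * (q ^ n)⁻¹)) * algebraMap C B (𝒟.a n) +
      algebraMap C B (algebraMap ℂ C (specCoef q μ n)) * p.1 - p.2))) n
  have hx : ∀ n, (xw (n + 1)).1 = t * (algebraMap C B (algebraMap ℂ C (q ^ n)) *
      algebraMap C B (𝒟.a n) - (xw n).1 -
      algebraMap C B (algebraMap ℂ C (spec q μ n * specCoef q μ n)) * (xw n).2) := fun n => rfl
  have hw : ∀ n, (xw (n + 1)).2 = u * algebraMap C B 𝒟.g.val *
      (algebraMap C B (algebraMap ℂ C (μ⁻¹ * (q ^ n)⁻¹)) * algebraMap C B (𝒟.a n) +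
      algebraMap C B (algebraMap ℂ C (specCoef q μ n)) * (xw n).1 - (xw n).2) := fun n => rfl
  have hsm : ∀ (c : C) (b : B), ev (algebraMap C B c * b) = c • ev b := fun c b => by
    rw [← Algebra.smul_def, map_smul]
  have key : ∀ n ≤ k + 1, ev (xw n).1 = 𝒟.x n ∧ ev (t * (xw n).2) = 𝒟.y n := by
    intro n
    induction n with
    | zero =>
      intro _
      rw [𝒟.x_zero, 𝒟.y_zero]
      simp [xw]
    | succ n ih =>
      intro hn
      obtain ⟨i1, i2⟩ := ih (by omega)
      constructor
      · rw [hx, 𝒟.x_succ n (by omega), ← i1, ← i2, ← h1, ← hmul, ← hmul, ← hsm, ← hsm, ← map_sub,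
          ← map_sub, map_mul (algebraMap C B)]
        congr 1
        ring
      · have hinjΘ : Function.Injective 𝒟.Θ.val := fun p p' h => by
          have := congrArg (𝒟.Θ⁻¹).val h
          rwa [← Module.End.mul_apply, ← Module.End.mul_apply, Units.inv_mul, Module.End.one_apply,
            Module.End.one_apply] at this
        apply hinjΘ
        rw [𝒟.y_succ n (by omega), hw, ← i1, ← i2, ← h1, ← hmul, ← hmul, ← hmul, ← hsm, ← hsm,
          ← hsm, ← map_add, ← map_sub]
        simp only [map_mul (algebraMap C B)]
        congr 1
        linear_combination (t * algebraMap C B 𝒟.g.val *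
          (algebraMap C B (algebraMap ℂ C (μ⁻¹ * (q ^ n)⁻¹)) * algebraMap C B (𝒟.a n) +
          algebraMap C B (algebraMap ℂ C (specCoef q μ n)) * (xw n).1 - (xw n).2)) * htu
  exact ⟨⟨t, u, ev, fun n => (xw n).1, fun n => (xw n).2, htu, hinj, h1, hmul, rfl, rfl,
    fun n _ => hx n, fun n _ => hw n, fun n hn => (key n hn).1, fun n hn => (key n hn).2⟩⟩

namespace Model

variable {𝒟} {B : Type*} [CommRing B] [Algebra C B] (ℳ : 𝒟.Model B)

/-- The embedding of the scalars. -/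
def φ (_ : 𝒟.Model B) : ℂ →+* B := (algebraMap C B).comp (algebraMap ℂ C)

/-- The element `a_n` of the model. -/
def a (_ : 𝒟.Model B) (n : ℕ) : B := algebraMap C B (𝒟.a n)

/-- The element `g` of the model. -/
def g (_ : 𝒟.Model B) : B := algebraMap C B 𝒟.g.val

theorem x_last : ℳ.x (k + 1) = 0 :=
  ℳ.ev_injective (by rw [ℳ.ev_x _ le_rfl, 𝒟.x_last, map_zero])

theorem w_last : ℳ.w (k + 1) = 0 := by
  have h : ℳ.t * ℳ.w (k + 1) = 0 :=
    ℳ.ev_injective (by rw [ℳ.ev_w _ le_rfl, 𝒟.y_last, map_zero])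
  linear_combination ℳ.u * h - ℳ.w (k + 1) * ℳ.mul_inv

theorem φ_mul_inv {c : ℂ} (h : c ≠ 0) : ℳ.φ c * ℳ.φ c⁻¹ = 1 := by
  rw [← map_mul, mul_inv_cancel₀ h, map_one]

theorem ev_pow (n : ℕ) (b : B) : ℳ.ev (ℳ.t ^ n * b) = (𝒟.Θ.val ^ n) (ℳ.ev b) := by
  induction n generalizing b with
  | zero => simp
  | succ n ih => rw [pow_succ, mul_assoc, ih, ℳ.ev_mul, pow_succ, Module.End.mul_apply]

theorem ev_pow_mul (n i : ℕ) (c : C) :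
    ℳ.ev (ℳ.t ^ n * (ℳ.φ (-q) ^ i * algebraMap C B c)) =
      (algebraMap ℂ C ((-q) ^ i) * c) • (𝒟.Θ.val ^ n) 𝒟.e := by
  have h : ℳ.φ (-q) ^ i * algebraMap C B c =
      (algebraMap ℂ C ((-q) ^ i) * c) • (1 : B) := by
    rw [Algebra.smul_def, mul_one, map_mul, ← map_pow]
    rfl
  rw [ℳ.ev_pow, h, map_smul, map_smul, ℳ.ev_one]

theorem recip (hp : OrthParams k q μ) (n m : ℕ) (h : n + m = k) :
    ℳ.g * ℳ.x n * ℳ.a k = ℳ.φ (recipCoef q μ n) * ℳ.g ^ n * (ℳ.t * ℳ.w (m + 1)) ∧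
      ℳ.w n * ℳ.a k = ℳ.φ (recipCoef q μ n) * ℳ.g ^ n * (ℳ.u * ℳ.x (m + 1)) ∧
      ℳ.a n * ℳ.a k = ℳ.g ^ n * ℳ.a m := by
  refine reciprocity (a := ℳ.a) (g := ℳ.g) (Q := fun n => ℳ.φ (q ^ n))
    (c := fun n => ℳ.φ (spec q μ n * specCoef q μ n)) (d := fun n => ℳ.φ (specCoef q μ n))
    (e := fun n => ℳ.φ (μ⁻¹ * (q ^ n)⁻¹)) (κ := fun n => ℳ.φ (recipCoef q μ n))
    ℳ.mul_inv ℳ.x_succ ℳ.w_succ ℳ.x_zero ℳ.w_zero ℳ.x_last ℳ.w_last ?_ ?_ ?_ ?_ ?_ ?_ n m h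
  · rw [a, 𝒟.a_zero, map_one]
  · intro n m h
    simp only [← map_mul, ← map_add]
    exact congrArg _ (hp.recip_a h)
  · intro n m h
    exact congrArg _ (hp.specCoef_reflect h)
  · intro n m h hm
    rw [← map_one ℳ.φ]
    simp only [← map_mul, ← map_add]
    exact congrArg _ (hp.recipCoef_succ h hm)
  · intro n m h
    rw [← map_zero ℳ.φ]
    simp only [← map_mul, ← map_add, ← map_sub]
    exact congrArg _ (hp.recip_b h)
  -- The map τ, applied to the reflection relation between x_{n+1} and y_{m+1}, turns it into a
  -- relation between a_{n+1} and a_m. The constants agree by `recip_num`, after which (n + 1)_q and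
  -- g are cancelled.
  · intro n m h h1 _
    have hsm : ∀ (c : C) (b : B), ℳ.ev (algebraMap C B c * b) = c • ℳ.ev b := fun c b => by
      rw [← Algebra.smul_def, map_smul]
    have e1 : ℳ.g * ℳ.x (n + 1) * ℳ.a k =
        algebraMap C B (𝒟.g.val * 𝒟.a k) * ℳ.x (n + 1) := by
      rw [map_mul, g, a]; ring
    have e2 : ℳ.φ (recipCoef q μ (n + 1)) * ℳ.g ^ (n + 1) * (ℳ.t * ℳ.w (m + 1)) =
        algebraMap C B (algebraMap ℂ C (recipCoef q μ (n + 1)) * 𝒟.g.val ^ (n + 1)) *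
          (ℳ.t * ℳ.w (m + 1)) := by
      rw [map_mul, map_pow]; rfl
    rw [e1, e2] at h1
    have h2 := congrArg (fun b => 𝒟.τ (ℳ.ev b)) h1
    simp only [hsm, map_smul] at h2
    rw [ℳ.ev_x _ (by omega), ℳ.ev_w _ (by omega), 𝒟.τ_x _ (by omega) (by omega),
      𝒟.τ_y _ (by omega), smul_eq_mul, smul_eq_mul] at h2
    have hn : algebraMap ℂ C (recipCoef q μ (n + 1)) * algebraMap ℂ C (qNum q (m + 1) *
        (μ⁻¹ * traceCoef q μ m)) = algebraMap ℂ C (qNum q (n + 1)) := by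
      rw [← map_mul, hp.recip_num h]
    have hi : algebraMap ℂ C (qNum q (n + 1)) * algebraMap ℂ C (qNum q (n + 1))⁻¹ = 1 := by
      rw [← map_mul, mul_inv_cancel₀ (hp.num_ne _ (by omega) (by omega)), map_one]
    have hg : 𝒟.g.val * (𝒟.g⁻¹).val = 1 := 𝒟.g.mul_inv
    have h3 : 𝒟.a (n + 1) * 𝒟.a k = 𝒟.g.val ^ (n + 1) * 𝒟.a m := by
      set γ := 𝒟.g.val
      set δ := (𝒟.g⁻¹).val
      set ν := algebraMap ℂ C (qNum q (n + 1))
      set ν' := algebraMap ℂ C (qNum q (n + 1))⁻¹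
      have h4 : γ * ν * (𝒟.a (n + 1) * 𝒟.a k - γ ^ (n + 1) * 𝒟.a m) = 0 := by
        linear_combination h2 + γ ^ (n + 1) * 𝒟.a m * γ * hn
      linear_combination δ * ν' * h4 - (𝒟.a (n + 1) * 𝒟.a k - γ ^ (n + 1) * 𝒟.a m) *
        (γ * δ * hi + hg)
    have := congrArg (algebraMap C B) h3
    rwa [map_mul, map_mul, map_pow] at this

/-- X_i + A_i is the i-th partial sum of the characteristic polynomial, with A_i = (−q)^i a_i and z
= q²gt⁻². The vanishing of x and w at k + 1 makes the first integral say (1 − q⁻²z)χ = 0. The second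
relation compares the two available values of x_k: one from `xi_eq`, the other from reciprocity. -/
theorem exists_char_sequences (hp : OrthParams k q μ) (hk : 1 ≤ k) : ∃ X H : ℕ → B,
    X 0 = 0 ∧ H 0 = 0 ∧ (∀ i, X (i + 1) = ℳ.t * (X i + ℳ.φ (-q) ^ i * ℳ.a i)) ∧
    (∀ i, H (i + 1) = ℳ.t * (ℳ.φ (q ^ 2) * ℳ.g * ℳ.u ^ 2) * (X i + H i)) ∧
    (1 - ℳ.φ (q ^ 2)⁻¹ * (ℳ.φ (q ^ 2) * ℳ.g * ℳ.u ^ 2)) * (X k + ℳ.φ (-q) ^ k * ℳ.a k) = 0 ∧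
    X k + ℳ.φ (-q) ^ k * ℳ.a k + ℳ.φ (slopeCoef q μ k) * (H k - ℳ.φ (-q) ^ k * ℳ.a k) = 0 := by
  set z : B := ℳ.φ (q ^ 2) * ℳ.g * ℳ.u ^ 2 with hz
  set s : B := ℳ.φ (q ^ 2)⁻¹ with hs
  have q0 := hp.q0
  have hsv : s * ℳ.φ (q ^ 2) = 1 := by
    rw [mul_comm]; exact ℳ.φ_mul_inv (pow_ne_zero _ q0)
  obtain ⟨X, hX0, hX⟩ : ∃ X : ℕ → B, X 0 = 0 ∧
      ∀ i, X (i + 1) = ℳ.t * (X i + ℳ.φ (-q) ^ i * ℳ.a i) :=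
    ⟨fun i => Nat.rec 0 (fun i r => ℳ.t * (r + ℳ.φ (-q) ^ i * ℳ.a i)) i, rfl, fun i => rfl⟩
  obtain ⟨H, hH0, hH⟩ : ∃ H : ℕ → B, H 0 = 0 ∧ ∀ i, H (i + 1) = ℳ.t * z * (X i + H i) :=
    ⟨fun i => Nat.rec 0 (fun i r => ℳ.t * z * (X i + r)) i, rfl, fun i => rfl⟩
  -- The alternating signs turn the coefficients q^i of the recurrences into (−q)^i.
  set ξ : ℕ → B := fun i => -((-1) ^ i * ℳ.x i) with hξd
  set W : ℕ → B := fun i => (-1) ^ i * ℳ.w i with hWd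
  set c : ℕ → B := fun n => ℳ.φ (spec q μ n * specCoef q μ n) with hc
  have hqpow : ∀ i, ℳ.φ (-q) ^ i = (-1) ^ i * ℳ.φ (q ^ i) := fun i => by
    rw [map_neg, neg_pow, map_pow]
  have hm1 : ∀ i : ℕ, ((-1) ^ i * (-1) ^ i : B) = 1 := fun i => by rw [← mul_pow]; simp
  have hξ : ∀ i ≤ k, ξ (i + 1) = ℳ.t * (ℳ.φ (-q) ^ i * ℳ.a i + ξ i - c i * W i) := by
    intro i hi
    have h : ℳ.x (i + 1) = ℳ.t * (ℳ.φ (q ^ i) * ℳ.a i - ℳ.x i - c i * ℳ.w i) := ℳ.x_succ i hi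
    simp only [hξd, hWd]
    rw [h, hqpow]
    ring
  have hW : ∀ i ≤ k, W (i + 1) = ℳ.t * z * s * (W i + ℳ.φ (specCoef q μ i) * ξ i -
      ℳ.φ (μ⁻¹ * (q ^ (2 * i))⁻¹) * (ℳ.φ (-q) ^ i * ℳ.a i)) := by
    intro i hi
    have h : ℳ.w (i + 1) = ℳ.u * ℳ.g * (ℳ.φ (μ⁻¹ * (q ^ i)⁻¹) * ℳ.a i +
      ℳ.φ (specCoef q μ i) * ℳ.x i - ℳ.w i) := ℳ.w_succ i hi
    have e1 : ℳ.t * z * s = ℳ.u * ℳ.g := by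
      rw [hz]
      linear_combination ℳ.t * ℳ.g * ℳ.u ^ 2 * hsv + ℳ.g * ℳ.u * ℳ.mul_inv
    have e2 : ℳ.φ (μ⁻¹ * (q ^ (2 * i))⁻¹) * ℳ.φ (q ^ i) = ℳ.φ (μ⁻¹ * (q ^ i)⁻¹) := by
      rw [← map_mul]
      congr 1
      have : q ^ i ≠ 0 := pow_ne_zero _ q0
      have m0 := hp.m0
      rw [two_mul, pow_add]
      field_simp
    simp only [hξd, hWd]
    rw [h, hqpow, e1, ← e2]
    ring
  have hξ0 : ξ 0 = 0 := by simp only [hξd]; rw [ℳ.x_zero]; ring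
  have hW0 : W 0 = 0 := by simp only [hWd]; rw [ℳ.w_zero]; ring
  have hΦ : ∀ i ≤ k + 1, (1 - s * z) * X i = (1 - ℳ.φ (ratioCoef q μ i) * z) * ξ i - c i * W i := by
    intro i hi
    refine first_integral (ρ := fun n => ℳ.φ (ratioCoef q μ n)) (A := fun n => ℳ.φ (-q) ^ n * ℳ.a n)
      hX0 hξ0 hW0 hX hξ hW ?_ ?_ ?_ hi
    · intro i hi
      simp only [hc, hs, ← map_mul, ← map_sub]
      exact congrArg _ (hp.ratio_a hi)
    · intro i hi
      simp only [hc, hs, ← map_mul]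
      exact congrArg _ (hp.ratio_b hi)
    · intro i hi
      simp only [hc, hs, ← map_mul, ← map_add]
      exact congrArg _ (hp.ratio_c hi)
  have hξX : ∀ i ≤ k + 1, ξ i = X i + ℳ.φ (slopeCoef q μ i) * H i := by
    intro i hi
    refine xi_eq (ρ := fun n => ℳ.φ (ratioCoef q μ n)) (γ := fun n => ℳ.φ (slopeCoef q μ n))
      (A := fun n => ℳ.φ (-q) ^ n * ℳ.a n) hX0 hξ0 hH0 hX hξ hH
      (fun i hi => hΦ i (by omega)) ?_ ?_ hi
    · intro i hi
      simp only [hs, ← map_sub]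
      exact congrArg _ (hp.ratio_d hi)
    · intro i hi hi'
      simp only [← map_mul]
      exact congrArg _ (hp.ratio_e hi hi')
  refine ⟨X, H, hX0, hH0, hX, hH, ?_, ?_⟩
  -- At k + 1 the right side vanishes, and X_{k+1} = tχ with t invertible.
  · have h := hΦ (k + 1) le_rfl
    simp only [hξd, hWd] at h
    rw [ℳ.x_last, ℳ.w_last, hX] at h
    linear_combination ℳ.u * h - (1 - s * z) * (X k + ℳ.φ (-q) ^ k * ℳ.a k) * ℳ.mul_inv
  · have h := hξX k (by omega)
    obtain ⟨m, rfl⟩ := Nat.exists_eq_add_of_le' hk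
    -- Since w_1 = t⁻¹gμ⁻¹ is explicit, the reflection between w_1 and x_k determines x_k as a
    -- multiple of a_k.
    have h1 := (ℳ.recip hp 1 m (by omega)).2.1
    have h2 : ℳ.w (0 + 1) = ℳ.u * ℳ.g * (ℳ.φ (μ⁻¹ * (q ^ 0)⁻¹) * ℳ.a 0 +
      ℳ.φ (specCoef q μ 0) * ℳ.x 0 - ℳ.w 0) := ℳ.w_succ 0 (Nat.zero_le _)
    have ha0 : ℳ.a 0 = 1 := (congrArg _ 𝒟.a_zero).trans (map_one _)
    have hg : ℳ.g * algebraMap C B (𝒟.g⁻¹).val = 1 := by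
      rw [g, ← map_mul, Units.mul_inv, map_one]
    rw [zero_add, ℳ.x_zero, ℳ.w_zero, ha0, pow_zero, inv_one, mul_one, mul_one] at h2
    rw [h2] at h1
    have hκ := hp.recip_slope hk
    have e1 : ℳ.φ (recipCoef q μ 1) * ℳ.x (m + 1) = ℳ.φ μ⁻¹ * ℳ.a (m + 1) := by
      linear_combination (-(ℳ.t * algebraMap C B (𝒟.g⁻¹).val)) * h1 +
        (ℳ.φ μ⁻¹ * ℳ.a (m + 1) - ℳ.φ (recipCoef q μ 1) * ℳ.x (m + 1)) * (ℳ.t * ℳ.u * hg + ℳ.mul_inv)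
    have e2 : ℳ.x (m + 1) = ℳ.φ (q ^ (m + 1) * (1 - slopeCoef q μ (m + 1))) * ℳ.a (m + 1) := by
      have hn := ℳ.φ_mul_inv (hp.recipCoef_one_ne hk)
      have hκ' : ℳ.φ (recipCoef q μ 1) * ℳ.φ (q ^ (m + 1) * (1 - slopeCoef q μ (m + 1))) =
        ℳ.φ μ⁻¹ := by rw [← map_mul, hκ]
      linear_combination ℳ.φ (recipCoef q μ 1)⁻¹ * (e1 - ℳ.a (m + 1) * hκ') +
        (ℳ.φ (q ^ (m + 1) * (1 - slopeCoef q μ (m + 1))) * ℳ.a (m + 1) - ℳ.x (m + 1)) * hn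
    have e3 : ξ (m + 1) = -(1 - ℳ.φ (slopeCoef q μ (m + 1))) *
        (ℳ.φ (-q) ^ (m + 1) * ℳ.a (m + 1)) := by
      simp only [hξd]
      rw [e2, hqpow, map_mul, map_sub, map_one]
      ring
    linear_combination e3 - h

end Model

theorem two_mul_coef (ℓ : ℕ) (q : ℂ) : (-q) ^ (2 * ℓ) = q ^ (2 * ℓ) :=
  (even_two_mul ℓ).neg_pow q

variable {ℓ : ℕ}

/-- The identity in the component with `a_{2ℓ} = g^ℓ`. -/
theorem plus (𝒟 : DescentSystem (2 * ℓ) q μ C P) (hp : OrthParams (2 * ℓ) q μ) (hℓ : 1 ≤ ℓ)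
    (ha : 𝒟.a (2 * ℓ) = 𝒟.g.val ^ ℓ) :
    ∑ i ∈ Finset.range (2 * ℓ + 1),
      (algebraMap ℂ C ((-q) ^ i) * 𝒟.a i) • (𝒟.Θ.val ^ (2 * ℓ - i)) 𝒟.e = 0 := by
  obtain ⟨B, _, _, ⟨ℳ⟩⟩ := 𝒟.exists_model
  obtain ⟨X, H, hX0, hH0, hX, hH, hχ, hR⟩ := ℳ.exists_char_sequences hp (by omega)
  have q0 := hp.q0
  set z : B := ℳ.φ (q ^ 2) * ℳ.g * ℳ.u ^ 2 with hz
  obtain ⟨Z, hZ0, hZ⟩ : ∃ Z : ℕ → B, Z 0 = 0 ∧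
      ∀ i, Z (i + 1) = ℳ.t * z * (Z i + ℳ.φ (-q) ^ i * ℳ.a i) :=
    ⟨fun i => Nat.rec 0 (fun i r => ℳ.t * z * (r + ℳ.φ (-q) ^ i * ℳ.a i)) i, rfl, fun i => rfl⟩
  have hsv : ℳ.φ (q ^ 2)⁻¹ * ℳ.φ (q ^ 2) = 1 := by
    rw [mul_comm]; exact ℳ.φ_mul_inv (pow_ne_zero _ q0)
  have htz : ℳ.t * z = ℳ.φ (-q) ^ 2 * ℳ.g * ℳ.u := by
    rw [hz, ← map_pow, neg_sq]
    linear_combination ℳ.φ (q ^ 2) * ℳ.g * ℳ.u * ℳ.mul_inv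
  have haB : ℳ.a (2 * ℓ) = ℳ.g ^ ℓ := (congrArg _ ha).trans (map_pow _ _ _)
  have hrev := reverse_char (k := 2 * ℓ) (a := ℳ.a) ℳ.mul_inv htz
    (fun j hj => (ℳ.recip hp j (2 * ℓ - j) (by omega)).2.2)
  rw [← sum_of_recurrence hZ0 hZ, ← sum_of_recurrence hX0 hX] at hrev
  have hzχ : z * (X (2 * ℓ) + ℳ.φ (-q) ^ (2 * ℓ) * ℳ.a (2 * ℓ)) =
      ℳ.φ (q ^ 2) * (X (2 * ℓ) + ℳ.φ (-q) ^ (2 * ℓ) * ℳ.a (2 * ℓ)) := by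
    linear_combination (-ℳ.φ (q ^ 2)) * hχ +
      (-(z * (X (2 * ℓ) + ℳ.φ (-q) ^ (2 * ℓ) * ℳ.a (2 * ℓ)))) * hsv
  -- The factor from the reversal equals z^ℓ because a_{2ℓ} = g^ℓ, and z acts on χ as q².
  have hζ : ℳ.φ (-q) ^ (2 * ℓ) * ℳ.u ^ (2 * ℓ) * ℳ.a (2 * ℓ) *
      (X (2 * ℓ) + ℳ.φ (-q) ^ (2 * ℓ) * ℳ.a (2 * ℓ)) =
      ℳ.φ (q ^ (2 * ℓ)) * (X (2 * ℓ) + ℳ.φ (-q) ^ (2 * ℓ) * ℳ.a (2 * ℓ)) := by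
    have h1 : ℳ.φ (-q) ^ (2 * ℓ) * ℳ.u ^ (2 * ℓ) * ℳ.a (2 * ℓ) = z ^ ℓ := by
      rw [haB, hz, ← map_pow, two_mul_coef, pow_mul q, map_pow ℳ.φ]
      ring
    rw [h1, pow_mul q, map_pow ℳ.φ]
    generalize X (2 * ℓ) + ℳ.φ (-q) ^ (2 * ℓ) * ℳ.a (2 * ℓ) = χ at hzχ
    have : ∀ n, z ^ n * χ = ℳ.φ (q ^ 2) ^ n * χ := fun n => by
      induction n with
      | zero => simp
      | succ n ih => rw [pow_succ, mul_assoc, hzχ, mul_left_comm, ih]; ring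
    exact this ℓ
  have hcoef := ℳ.φ_mul_inv (hp.plus_coef_ne (by omega))
  rw [mul_comm] at hcoef
  have hfin := plus_identity hH0 hX0 hZ0 hX hH hZ hsv hχ hR hrev hζ
    (i := ℳ.φ (1 - q ^ 2 + slopeCoef q μ (2 * ℓ) * (q ^ 2 - q ^ (2 * ℓ)))⁻¹)
    (by simpa only [map_add, map_mul, map_sub, map_one] using hcoef)
  rw [sum_of_recurrence hX0 hX] at hfin
  have := congrArg ℳ.ev hfin
  rw [map_sum, map_zero] at this
  rw [← this]
  exact Finset.sum_congr rfl fun i _ => (ℳ.ev_pow_mul _ _ _).symm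

/-- The identity in the component with `a_{2ℓ} = -g^ℓ`. -/
theorem minus (𝒟 : DescentSystem (2 * ℓ) q μ C P) (hp : OrthParams (2 * ℓ) q μ) (hℓ : 1 ≤ ℓ)
    (ha : 𝒟.a (2 * ℓ) = -𝒟.g.val ^ ℓ) (ε : ℕ → C)
    (hlow : ∀ i < ℓ, ε i = 𝒟.a i + if 2 ≤ i then 𝒟.g.val * ε (i - 2) else 0)
    (hsym : ∀ i < ℓ, ε (ℓ - 1 + i) = ε (ℓ - 1 - i) * 𝒟.g.val ^ i) :
    (𝒟.Θ.val ^ 2) (∑ i ∈ Finset.range (2 * ℓ - 1),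
      (algebraMap ℂ C ((-q) ^ i) * ε i) • (𝒟.Θ.val ^ (2 * ℓ - 2 - i)) 𝒟.e) -
      𝒟.g.val • ∑ i ∈ Finset.range (2 * ℓ - 1),
      (algebraMap ℂ C ((-q) ^ i) * ε i) • (𝒟.Θ.val ^ (2 * ℓ - 2 - i)) 𝒟.e = 0 := by
  obtain ⟨B, _, _, ⟨ℳ⟩⟩ := 𝒟.exists_model
  obtain ⟨X, H, hX0, hH0, hX, hH, hχ, hR⟩ := ℳ.exists_char_sequences hp (by omega)
  have q0 := hp.q0
  have hsv : ℳ.φ (q ^ 2)⁻¹ * ℳ.φ (q ^ 2) = 1 := by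
    rw [mul_comm]; exact ℳ.φ_mul_inv (pow_ne_zero _ q0)
  have hy : ℳ.φ (-q) ^ 2 = ℳ.φ (q ^ 2) := by rw [← map_pow, neg_sq]
  have hg : ℳ.g * algebraMap C B (𝒟.g⁻¹).val = 1 := by
    rw [Model.g, ← map_mul, Units.mul_inv, map_one]
  have hgpow : ∀ n, ℳ.g ^ n * algebraMap C B (𝒟.g⁻¹).val ^ n = 1 := fun n => by
    rw [← mul_pow, hg, one_pow]
  have haB : ℳ.a (2 * ℓ) = -ℳ.g ^ ℓ := by
    change algebraMap C B _ = -algebraMap C B _ ^ ℓ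
    rw [ha, map_neg, map_pow]
  have hγ : 2 * ℳ.φ (slopeCoef q μ (2 * ℓ)) * ℳ.φ (2 * slopeCoef q μ (2 * ℓ))⁻¹ = 1 := by
    have h := ℳ.φ_mul_inv (mul_ne_zero two_ne_zero (hp.slopeCoef_ne (by omega)))
    rwa [map_mul, map_ofNat] at h
  -- The sequence ε shifted by 2 and padded with zeros, so that a_j = e_{j+2} − g e_j can hold for
  -- all j ≤ 2ℓ, both ends included.
  set e : ℕ → B := fun n => if 2 ≤ n ∧ n ≤ 2 * ℓ then algebraMap C B (ε (n - 2)) else 0 with he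
  have he0 : e 0 = 0 := if_neg (by omega)
  have he1 : e 1 = 0 := if_neg (by omega)
  have hek1 : e (2 * ℓ + 1) = 0 := if_neg (by omega)
  have hek2 : e (2 * ℓ + 2) = 0 := if_neg (by omega)
  have helow : ∀ j < ℓ, ℳ.a j = e (j + 2) - ℳ.g * e j := by
    intro j hj
    have h1 : e (j + 2) = algebraMap C B (ε j) := if_pos (by omega)
    have h2 : e j = if 2 ≤ j then algebraMap C B (ε (j - 2)) else 0 :=
      if_congr (by omega) rfl rfl
    rw [h1, h2, hlow j hj, map_add]
    split_ifs
    · rw [map_mul]; change ℳ.a j = ℳ.a j + ℳ.g * _ - _; ring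
    · rw [map_zero]; change ℳ.a j = ℳ.a j + 0 - _; ring
  have hesym : ∀ i j, i ≤ ℓ + 1 → i + j = 2 * ℓ + 2 → e j = ℳ.g ^ (ℓ + 1 - i) * e i := by
    intro i j hi hij
    rcases Nat.lt_or_ge i 2 with h | h
    · interval_cases i
      · obtain rfl : j = 2 * ℓ + 2 := by omega
        rw [hek2, he0, mul_zero]
      · obtain rfl : j = 2 * ℓ + 1 := by omega
        rw [hek1, he1, mul_zero]
    · have h1 : e i = algebraMap C B (ε (i - 2)) := if_pos (by omega)
      have h2 : e j = algebraMap C B (ε (j - 2)) := if_pos (by omega)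
      have h3 := hsym (ℓ + 1 - i) (by omega)
      rw [show ℓ - 1 + (ℓ + 1 - i) = j - 2 by omega, show ℓ - 1 - (ℓ + 1 - i) = i - 2 by omega] at h3
      rw [h1, h2, h3, map_mul, map_pow, mul_comm]
      rfl
  have hrec : ∀ n m, n + m = 2 * ℓ → ℳ.a n * ℳ.a (2 * ℓ) = ℳ.g ^ n * ℳ.a m :=
    fun n m h => (ℳ.recip hp n m h).2.2
  have hae : ∀ j ≤ 2 * ℓ, ℳ.a j = e (j + 2) - ℳ.g * e j := by
    intro j hj
    rcases lt_trichotomy j ℓ with h | rfl | h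
    · exact helow j h
    -- Middle coefficient: reciprocity with a_{2ℓ} = −g^ℓ gives 2g^ℓ a_ℓ = 0, while the symmetry of
    -- e gives e_{ℓ+2} = g e_ℓ.
    · have h1 := hrec j j (by omega)
      rw [haB] at h1
      have h2 := hesym j (j + 2) (by omega) (by omega)
      rw [show j + 1 - j = 1 by omega, pow_one] at h2
      have h3 : ℳ.φ 2 * ℳ.φ 2⁻¹ = 1 := ℳ.φ_mul_inv two_ne_zero
      rw [map_ofNat] at h3
      have h4 := hgpow j
      rw [h2]
      linear_combination (-(ℳ.φ 2⁻¹ * algebraMap C B (𝒟.g⁻¹).val ^ j)) * h1 -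
        ℳ.a j * (h3 + 2 * ℳ.φ 2⁻¹ * h4)
    -- Upper half: reciprocity expresses a_j through a_{2ℓ−j}, and the symmetry of e carries the
    -- identity over from the lower half.
    · obtain ⟨m, hm⟩ : ∃ m, 2 * ℓ = j + m := ⟨2 * ℓ - j, by omega⟩
      obtain ⟨r, rfl⟩ : ∃ r, j = ℓ + r + 1 := ⟨j - ℓ - 1, by omega⟩
      have h1 := hrec (ℓ + r + 1) m hm.symm
      rw [haB] at h1
      have h2 := hesym m (ℓ + r + 1 + 2) (by omega) (by omega)
      have h3 := hesym (m + 2) (ℓ + r + 1) (by omega) (by omega)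
      have h4 := helow m (by omega)
      have h5 := hgpow ℓ
      rw [show ℓ + 1 - m = r + 2 by omega] at h2
      rw [show ℓ + 1 - (m + 2) = r by omega] at h3
      rw [h4] at h1
      rw [h2, h3]
      linear_combination (-(algebraMap C B (𝒟.g⁻¹).val ^ ℓ)) * h1 - (ℳ.a (ℓ + r + 1) +
        ℳ.g ^ (r + 1) * (e (m + 2) - ℳ.g * e m)) * h5
  have hsymB : ∀ i j, i + j = 2 * ℓ + 2 → ℳ.g ^ i * e j = ℳ.g ^ (ℓ + 1) * e i := by
    intro i j hij
    rcases Nat.le_total i (ℓ + 1) with h | h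
    · rw [hesym i j h hij, ← mul_assoc, ← pow_add, Nat.add_sub_cancel' h]
    · rw [hesym j i (by omega) (by omega), ← mul_assoc, ← pow_add,
        show ℓ + 1 + (ℓ + 1 - j) = i by omega]
  obtain ⟨S, hS0, hS⟩ : ∃ S : ℕ → B, S 0 = 0 ∧
      ∀ i, S (i + 1) = ℳ.t * S i + ℳ.φ (-q) ^ (i + 1) * e (i + 1) :=
    ⟨fun i => Nat.rec 0 (fun i r => ℳ.t * r + ℳ.φ (-q) ^ (i + 1) * e (i + 1)) i, rfl, fun i => rfl⟩
  have hfin := minus_identity ℳ.mul_inv hsv hy hg hγ rfl hX0 hH0 hX hH (fun i => rfl) hχ hR he0 he1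
    hae hek1 hek2 hsymB hS0 hS
  -- The two leading zeros of e account for the shift by 2 and for the factor (−q)² = q².
  have hS2 : ∀ n ≤ 2 * ℓ - 2, S (n + 2) = ℳ.φ (q ^ 2) *
      ∑ i ∈ Finset.range (n + 1), ℳ.t ^ (n - i) * (ℳ.φ (-q) ^ i * algebraMap C B (ε i)) := by
    intro n
    have hen : ∀ n ≤ 2 * ℓ - 2, e (n + 2) = algebraMap C B (ε n) := fun n hn => if_pos (by omega)
    induction n with
    | zero =>
      intro h
      have h0 := hen 0 h
      rw [zero_add] at h0
      rw [hS, hS, hS0, he1, h0, Finset.sum_range_one]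
      linear_combination algebraMap C B (ε 0) * hy
    | succ n ih =>
      intro hn
      have hsum : ℳ.t * ∑ i ∈ Finset.range (n + 1), ℳ.t ^ (n - i) *
          (ℳ.φ (-q) ^ i * algebraMap C B (ε i)) = ∑ i ∈ Finset.range (n + 1),
          ℳ.t ^ (n + 1 - i) * (ℳ.φ (-q) ^ i * algebraMap C B (ε i)) := by
        rw [Finset.mul_sum]
        refine Finset.sum_congr rfl fun i hi => ?_
        rw [← mul_assoc, ← pow_succ', Nat.succ_sub (by have := Finset.mem_range.1 hi; omega)]
      rw [hS, ih (by omega), Finset.sum_range_succ _ (n + 1), Nat.sub_self, pow_zero, one_mul, hen (n + 1) hn]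
      linear_combination ℳ.φ (q ^ 2) * hsum +
        ℳ.φ (-q) ^ (n + 1) * algebraMap C B (ε (n + 1)) * hy
  have hS3 := hS2 (2 * ℓ - 2) le_rfl
  rw [show 2 * ℓ - 2 + 2 = 2 * ℓ by omega, show 2 * ℓ - 2 + 1 = 2 * ℓ - 1 by omega] at hS3
  rw [hS3, ← mul_assoc (ℳ.φ (q ^ 2)⁻¹), hsv, one_mul, sub_mul] at hfin
  have h := congrArg ℳ.ev hfin
  have hsm : ∀ (c : C) (b : B), ℳ.ev (algebraMap C B c * b) = c • ℳ.ev b := fun c b => by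
    rw [← Algebra.smul_def, map_smul]
  have hE : ℳ.ev (∑ i ∈ Finset.range (2 * ℓ - 1), ℳ.t ^ (2 * ℓ - 2 - i) *
      (ℳ.φ (-q) ^ i * algebraMap C B (ε i))) = ∑ i ∈ Finset.range (2 * ℓ - 1),
      (algebraMap ℂ C ((-q) ^ i) * ε i) • (𝒟.Θ.val ^ (2 * ℓ - 2 - i)) 𝒟.e := by
    rw [map_sum]
    exact Finset.sum_congr rfl fun i _ => ℳ.ev_pow_mul _ _ _
  rw [map_sub, map_zero, ℳ.ev_pow, Model.g, hsm, hE] at h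
  exact h

end DescentSystem

/-! ### Associativity of the star product of exponents -/

theorem loopWord_braid {G : Type*} [Group G] {r : ℕ → G} (hr : IsBraidSeq r) (m : ℕ) :
    loopWord r m * r (m + 1) * loopWord r m = r (m + 1) * loopWord r m * r (m + 1) := by
  induction m with
  | zero => exact hr.braid 0
  | succ m ih =>
    have h1 : loopWord r (m + 1) = (loopWord r m)⁻¹ * r (m + 1) * loopWord r m := by
      rw [loopWord, mul_assoc, eq_comm, mul_assoc, inv_mul_eq_iff_eq_mul, eq_comm, ← mul_assoc,
        ← mul_assoc, mul_inv_eq_iff_eq_mul, ← ih]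
    have h2 : Commute (loopWord r m) (r (m + 1 + 1)) :=
      loopWord_induction (P := fun g => Commute g (r (m + 1 + 1))) (fun _ _ h h' => h.mul_left h')
        (fun _ h => h.inv_left) fun i hi => hr.far _ _ (by omega)
    have h3 : r (m + 1 + 1) =
        (loopWord r m)⁻¹ * r (m + 1 + 1) * loopWord r m := by
      rw [mul_assoc, ← h2.eq, inv_mul_cancel_left]
    have h4 := hr.braid (m + 1)
    rw [h1]
    generalize loopWord r m = w at h3
    rw [h3]
    calc _ = w⁻¹ * (r (m + 1) * r (m + 1 + 1) * r (m + 1)) * w := by group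
      _ = _ := by rw [h4]; group

/-- This is the identity between linking words behind the associativity of ⋆. Each further generator
commutes with the shorter word, which leaves the case p = 0, a braid relation between that word and
the next generator. -/
theorem loopWord_mul_loopWord {G : Type*} [Group G] {r : ℕ → G} (hr : IsBraidSeq r) (m p : ℕ) :
    loopWord r m * loopWord r (m + p + 1) =
      loopWord (fun i => r (m + 1 + i)) p * loopWord r m := by
  induction p with
  | zero =>
    rw [add_zero]
    change loopWord r m * (r (m + 1) * loopWord r m * (r (m + 1))⁻¹) = r (m + 1) * loopWord r m
    rw [← mul_assoc, ← mul_assoc, loopWord_braid hr, mul_inv_cancel_right]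
  | succ p ih =>
    have h2 : Commute (loopWord r m) (r (m + p + 1 + 1)) :=
      loopWord_induction (P := fun g => Commute g (r (m + p + 1 + 1)))
        (fun _ _ h h' => h.mul_left h')
        (fun _ h => h.inv_left) fun i hi => hr.far _ _ (by omega)
    have e : loopWord (fun i => r (m + 1 + i)) (p + 1) = r (m + p + 1 + 1) *
        loopWord (fun i => r (m + 1 + i)) p * (r (m + p + 1 + 1))⁻¹ := by
      rw [loopWord, show m + 1 + (p + 1) = m + p + 1 + 1 by ring]
    have e' : loopWord r (m + (p + 1) + 1) = r (m + p + 1 + 1) * loopWord r (m + p + 1) *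
        (r (m + p + 1 + 1))⁻¹ := rfl
    have h3 := h2.inv_right
    rw [e, e']
    generalize r (m + p + 1 + 1) = x at h2 h3
    rw [← mul_assoc, ← mul_assoc, h2.eq, mul_assoc x, ih, mul_assoc, mul_assoc, h3.eq]
    simp only [mul_assoc]

namespace QMTower

variable {q μ : ℂ} {H : Type*} [Ring H] [Algebra ℂ H] (𝒯 : QMTower q μ H)

theorem ρ_starExp (s : ℕ) {m p : ℕ} (α : MonoidAlgebra ℂ (Braid m))
    (β : MonoidAlgebra ℂ (Braid p)) :
    𝒯.ρ s (starExp α β) =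
      𝒯.ρ s α * 𝒯.ρ (s + (m + 1)) β * (loopWord (fun i => 𝒯.r (s + i)) m).val := by
  rw [starExp, map_mul, map_mul, ρ_shiftA, ρ_shiftA, loopWord_sigConj, add_zero]

theorem ρ_starExp_zero {m p : ℕ} (α : MonoidAlgebra ℂ (Braid m))
    (β : MonoidAlgebra ℂ (Braid p)) : 𝒯.ρ 0 (starExp α β) = 𝒯.starH α β := by
  rw [ρ_starExp, starH]
  simp only [zero_add]

theorem starH_assoc {m p n : ℕ} (α : MonoidAlgebra ℂ (Braid m)) (β : MonoidAlgebra ℂ (Braid p))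
    (γ : MonoidAlgebra ℂ (Braid n)) : 𝒯.starH (starExp α β) γ = 𝒯.starH α (starExp β γ) := by
  have h1 : Commute (𝒯.ρ (m + p + 1 + 1) γ) (loopWord 𝒯.r m).val :=
    loopWord_induction (P := fun u : Hˣ => Commute (𝒯.ρ (m + p + 1 + 1) γ) u.val)
      (fun _ _ h h' => h.mul_right h') (fun _ h => h.units_inv_right)
      fun i hi => 𝒯.ρ_commute (fun j hj _ => by
        exact ((𝒯.r_braidSeq.far i j (by omega)).map (Units.coeHom H)).symm) γ
  have h2 := congrArg Units.val (loopWord_mul_loopWord 𝒯.r_braidSeq m p)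
  rw [Units.val_mul, Units.val_mul] at h2
  rw [starH, ρ_starExp_zero, starH, starH, ρ_starExp, show m + 1 + (p + 1) = m + p + 1 + 1 by ring]
  simp only [mul_assoc]
  rw [← h2, ← mul_assoc (loopWord 𝒯.r m).val, ← h1.eq, mul_assoc]

/-- A run of generators shifts the strands by one, so an element that vanishes in one position
vanishes in the next. -/
theorem ρ_succ_eq_conj (s : ℕ) {m : ℕ} (β : MonoidAlgebra ℂ (Braid m)) :
    ∃ u : Hˣ, 𝒯.ρ (s + 1) β = u.val * 𝒯.ρ s β * (u⁻¹).val := by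
  refine ⟨run 𝒯.r s (m + 1), ?_⟩
  rw [Units.eq_mul_inv_iff_mul_eq]
  refine (𝒯.ρ_intertwine (fun i hi => ?_) _).symm
  have := congrArg Units.val (run_shift 𝒯.r_braidSeq (a := s) (n := m + 1) (j := s + i)
    (Nat.le_add_right _ _) (by omega))
  rw [Units.val_mul, Units.val_mul] at this
  rw [this]
  congr 3
  omega

theorem ρ_succ_eq_zero {s m : ℕ} {β : MonoidAlgebra ℂ (Braid m)} (h : 𝒯.ρ s β = 0) :
    𝒯.ρ (s + 1) β = 0 := by
  obtain ⟨u, hu⟩ := 𝒯.ρ_succ_eq_conj s β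
  rw [hu, h, mul_zero, zero_mul]

end QMTower

/-! ### The star product on the space of descendants -/

/-- The hypotheses on the matrix of generators of an extended quantum matrix algebra. -/
structure IsExtended {A : Type*} [Ring A] [Algebra ℂ A] {N : ℕ} (R F : RMatrix N) (q μ : ℂ)
    (T : Matrix (Fin N) (Fin N) A) (gi : A) : Prop where
  compat : IsCompatible R F
  skew : IsSkewInvertible R.mat
  bmw : IsBMW q μ R
  quantum : IsQuantumMatrix R F T
  inv_mul : gi * gElt R F q μ T = 1
  mul_inv : gElt R F q μ T * gi = 1
  nonempty : Nonempty (Fin N)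

namespace IsExtended

variable {A : Type*} [Ring A] [Algebra ℂ A] {N : ℕ} {R F : RMatrix N} {q μ : ℂ}
  {T : Matrix (Fin N) (Fin N) A} {gi : A} (h : IsExtended R F q μ T gi)

/-- The tower of an extended quantum matrix algebra. -/
def tower (h : IsExtended R F q μ T gi) : QMTower q μ (TOp N A) :=
  qmTower h.compat h.skew h.bmw T h.quantum

theorem actOne_pow {m : ℕ} (α : MonoidAlgebra ℂ (Braid m)) :
    actOne 0 (matPow R F T α) = h.tower.pw m (h.tower.ρ 0 α) :=
  actOne_matPow h.compat h.skew h.bmw h.quantum α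

theorem coef_chr {m : ℕ} (α : MonoidAlgebra ℂ (Braid m)) :
    coef N A (chr R F T α) = h.tower.ch m (h.tower.ρ 0 α) :=
  _root_.coef_chr h.compat h.skew h.bmw h.quantum α

theorem coef_isScalar (c : A) : h.tower.IsScalar (coef N A c) :=
  _root_.coef_isScalar h.compat h.skew h.bmw h.quantum c

-- The elements ch(α) commute among themselves. Since g is one of them, its inverse commutes with
-- them as well, and commuting generators generate a commutative algebra.
include h in
theorem charAlg_comm (x y : charAlg R F T gi) : x * y = y * x := by
  have := h.nonempty
  have h1 : ∀ {m p : ℕ} (α : MonoidAlgebra ℂ (Braid m)) (β : MonoidAlgebra ℂ (Braid p)),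
    Commute (chr R F T α) (chr R F T β) := fun α β =>
    chr_commute h.compat h.skew h.bmw h.quantum α β
  have h2 : ∀ {m : ℕ} (α : MonoidAlgebra ℂ (Braid m)), Commute (chr R F T α) gi := fun α => by
    let u : Aˣ := ⟨gElt R F q μ T, gi, h.mul_inv, h.inv_mul⟩
    have : Commute (chr R F T α) u.val := h1 _ _
    exact this.units_inv_right
  have key : ∀ a ∈ ({x | ∃ (m : ℕ) (α : MonoidAlgebra ℂ (Braid m)), x = chr R F T α} ∪ {gi} : Set A),
      ∀ b ∈ ({x | ∃ (m : ℕ) (α : MonoidAlgebra ℂ (Braid m)), x = chr R F T α} ∪ {gi} : Set A),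
      a * b = b * a := by
    rintro _ (⟨m, α, rfl⟩ | rfl) _ (⟨p, β, rfl⟩ | rfl)
    · exact h1 α β
    · exact h2 α
    · exact (h2 β).symm
    · rfl
  exact (Algebra.isMulCommutative_adjoin ℂ key).is_comm.comm x y

/-- Left star multiplication on matrices. -/
def leftMat (h : IsExtended R F q μ T gi) {m : ℕ} (α : MonoidAlgebra ℂ (Braid m)) :
    Matrix (Fin N) (Fin N) A →ₗ[ℂ] Matrix (Fin N) (Fin N) A :=
  firstEntries ∘ₗ h.tower.starL α ∘ₗ (actOne 0).toLinearMap

/-- Right star multiplication on matrices. -/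
def rightMat (h : IsExtended R F q μ T gi) {m : ℕ} (α : MonoidAlgebra ℂ (Braid m)) :
    Matrix (Fin N) (Fin N) A →ₗ[ℂ] Matrix (Fin N) (Fin N) A :=
  firstEntries ∘ₗ h.tower.starR α ∘ₗ (actOne 0).toLinearMap

theorem leftMat_one {m : ℕ} (α : MonoidAlgebra ℂ (Braid m)) (c : A) :
    h.leftMat α (rightMul 1 c) = rightMul (matPow R F T α) c := by
  change firstEntries (h.tower.starL α (actOne 0 (rightMul 1 c))) = _
  rw [actOne_rightMul, (h.coef_isScalar c).starL_mul, map_one, QMTower.starL_one, ← h.actOne_pow,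
    ← actOne_rightMul, firstEntries_actOne]

theorem leftMat_pow {m p : ℕ} (α : MonoidAlgebra ℂ (Braid m)) (β : MonoidAlgebra ℂ (Braid p))
    (c : A) : h.leftMat α (rightMul (matPow R F T β) c) =
      rightMul (matPow R F T (starExp α β)) c := by
  change firstEntries (h.tower.starL α (actOne 0 (rightMul _ c))) = _
  rw [actOne_rightMul, (h.coef_isScalar c).starL_mul, h.actOne_pow, QMTower.starL_pw,
    ← QMTower.ρ_starExp_zero, ← h.actOne_pow, ← actOne_rightMul, firstEntries_actOne]

theorem rightMat_one {m : ℕ} (α : MonoidAlgebra ℂ (Braid m)) (c : A) :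
    h.rightMat α (rightMul 1 c) = rightMul (matPow R F T α) c := by
  change firstEntries (h.tower.starR α (actOne 0 (rightMul 1 c))) = _
  rw [actOne_rightMul, (h.coef_isScalar c).starR_mul, map_one, QMTower.starR_one, ← h.actOne_pow,
    ← actOne_rightMul, firstEntries_actOne]

theorem rightMat_pow {m p : ℕ} (α : MonoidAlgebra ℂ (Braid m)) (β : MonoidAlgebra ℂ (Braid p))
    (c : A) : h.rightMat β (rightMul (matPow R F T α) c) =
      rightMul (matPow R F T (starExp α β)) c := by
  change firstEntries (h.tower.starR β (actOne 0 (rightMul _ c))) = _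
  rw [actOne_rightMul, (h.coef_isScalar c).starR_mul, h.actOne_pow, QMTower.starR_pw,
    ← QMTower.ρ_starExp_zero, ← h.actOne_pow, ← actOne_rightMul, firstEntries_actOne]

theorem map_mem_descSpace {φ : Matrix (Fin N) (Fin N) A →ₗ[ℂ] Matrix (Fin N) (Fin N) A}
    (h1 : ∀ c ∈ charAlg R F T gi, φ (rightMul 1 c) ∈ descSpace R F T gi)
    (h2 : ∀ (m : ℕ) (α : MonoidAlgebra ℂ (Braid m)), ∀ c ∈ charAlg R F T gi,
      φ (rightMul (matPow R F T α) c) ∈ descSpace R F T gi)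
    (X : Matrix (Fin N) (Fin N) A) (hX : X ∈ descSpace R F T gi) : φ X ∈ descSpace R F T gi := by
  have : descSpace R F T gi ≤ (descSpace R F T gi).comap φ := by
    refine Submodule.span_le.2 ?_
    rintro _ (⟨d, hd, rfl⟩ | ⟨m, α, d, hd, rfl⟩)
    · exact h1 d hd
    · exact h2 m α d hd
  exact this hX

/-- Left star multiplication by a descendant. -/
def left (h : IsExtended R F q μ T gi) {m : ℕ} (α : MonoidAlgebra ℂ (Braid m)) :
    descSpace R F T gi →ₗ[ℂ] descSpace R F T gi :=
  (h.leftMat α).restrict (map_mem_descSpace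
    (fun c hc => by rw [leftMat_one]; exact rightMul_mem R F T gi (matPow_mem R F T gi α) hc)
    (fun m β c hc => by rw [leftMat_pow]; exact rightMul_mem R F T gi (matPow_mem R F T gi _) hc))

/-- Right star multiplication by a descendant. -/
def right (h : IsExtended R F q μ T gi) {m : ℕ} (α : MonoidAlgebra ℂ (Braid m)) :
    descSpace R F T gi →ₗ[ℂ] descSpace R F T gi :=
  (h.rightMat α).restrict (map_mem_descSpace
    (fun c hc => by rw [rightMat_one]; exact rightMul_mem R F T gi (matPow_mem R F T gi α) hc)
    (fun m β c hc => by rw [rightMat_pow]; exact rightMul_mem R F T gi (matPow_mem R F T gi _) hc))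

theorem left_one {m : ℕ} (α : MonoidAlgebra ℂ (Braid m)) (c : charAlg R F T gi) :
    h.left α (descMul (descOne R F T gi) c) = descMul (descPow R F T gi α) c :=
  Subtype.ext (h.leftMat_one α c.1)

theorem left_pow {m p : ℕ} (α : MonoidAlgebra ℂ (Braid m)) (β : MonoidAlgebra ℂ (Braid p))
    (c : charAlg R F T gi) : h.left α (descMul (descPow R F T gi β) c) =
      descMul (descPow R F T gi (starExp α β)) c :=
  Subtype.ext (h.leftMat_pow α β c.1)

theorem right_one {m : ℕ} (α : MonoidAlgebra ℂ (Braid m)) (c : charAlg R F T gi) :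
    h.right α (descMul (descOne R F T gi) c) = descMul (descPow R F T gi α) c :=
  Subtype.ext (h.rightMat_one α c.1)

theorem right_pow {m p : ℕ} (α : MonoidAlgebra ℂ (Braid m)) (β : MonoidAlgebra ℂ (Braid p))
    (c : charAlg R F T gi) : h.right β (descMul (descPow R F T gi α) c) =
      descMul (descPow R F T gi (starExp α β)) c :=
  Subtype.ext (h.rightMat_pow α β c.1)

end IsExtended

section Generators

variable {A : Type*} [Ring A] [Algebra ℂ A] {N : ℕ} (R F : RMatrix N)
  (T : Matrix (Fin N) (Fin N) A) (gi : A)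

/-- The action of an element of the characteristic subalgebra. -/
def descMulLin {R F : RMatrix N} {T : Matrix (Fin N) (Fin N) A} {gi : A} (c : charAlg R F T gi) :
    descSpace R F T gi →ₗ[ℂ] descSpace R F T gi where
  toFun X := descMul X c
  map_add' X Y := Subtype.ext ((rightMulLin c.1).map_add X.1 Y.1)
  map_smul' z X := Subtype.ext ((rightMulLin c.1).map_smul z X.1)

variable {R F T gi}

theorem descMul_descMul (X : descSpace R F T gi) (c d : charAlg R F T gi) :
    descMul (descMul X c) d = descMul X (c * d) :=
  Subtype.ext (rightMul_rightMul X.1 c.1 d.1)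

theorem descMul_one (X : descSpace R F T gi) : descMul X 1 = X :=
  Subtype.ext (rightMul_one X.1)

variable (R F T gi)

/-- The generators of the space of descendants. -/
def descGen : charAlg R F T gi ⊕ (Σ m : ℕ, MonoidAlgebra ℂ (Braid m) × charAlg R F T gi) →
    descSpace R F T gi
  | Sum.inl c => descMul (descOne R F T gi) c
  | Sum.inr ⟨_, α, c⟩ => descMul (descPow R F T gi α) c

theorem span_descGen : Submodule.span ℂ (Set.range (descGen R F T gi)) = ⊤ := by
  refine Submodule.map_injective_of_injective (f := (descSpace R F T gi).subtype)
    Subtype.val_injective ?_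
  rw [Submodule.map_span, Submodule.map_subtype_top]
  refine le_antisymm (Submodule.span_le.2 ?_) (Submodule.span_le.2 ?_)
  · rintro _ ⟨x, _, rfl⟩
    exact x.2
  · rintro _ (⟨d, hd, rfl⟩ | ⟨m, α, d, hd, rfl⟩)
    · exact Submodule.subset_span ⟨_, ⟨Sum.inl ⟨d, hd⟩, rfl⟩, rfl⟩
    · exact Submodule.subset_span ⟨_, ⟨Sum.inr ⟨m, α, ⟨d, hd⟩⟩, rfl⟩, rfl⟩

variable {R F T gi}

theorem desc_ext {M : Type*} [AddCommMonoid M] [Module ℂ M] {φ ψ : descSpace R F T gi →ₗ[ℂ] M}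
    (h1 : ∀ c, φ (descMul (descOne R F T gi) c) = ψ (descMul (descOne R F T gi) c))
    (h2 : ∀ (m : ℕ) (α : MonoidAlgebra ℂ (Braid m)) c,
      φ (descMul (descPow R F T gi α) c) = ψ (descMul (descPow R F T gi α) c)) : φ = ψ := by
  refine LinearMap.ext_on_range (span_descGen R F T gi) ?_
  rintro (c | ⟨m, α, c⟩)
  · exact h1 c
  · exact h2 m α c

/-- P is spanned by Ic and M^α c, and on pairs of such elements the rules leave no freedom. -/
theorem IsStarProduct.ext {star star' : descSpace R F T gi →ₗ[ℂ] descSpace R F T gi →ₗ[ℂ]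
    descSpace R F T gi} (hs : IsStarProduct star) (hs' : IsStarProduct star') : star = star' := by
  refine desc_ext (fun c => ?_) fun m α c => ?_
  · refine LinearMap.ext fun Y => ?_
    rw [hs.mul_left, hs'.mul_left, hs.one_left, hs'.one_left]
  · refine desc_ext (fun d => ?_) fun p β d => ?_
    · rw [hs.mul_left, hs'.mul_left, hs.mul_right, hs'.mul_right, hs.one_right, hs'.one_right]
    · rw [hs.mul_left, hs'.mul_left, hs.mul_right, hs'.mul_right, hs.pow_pow, hs'.pow_pow]

end Generators

namespace IsExtended

variable {A : Type*} [Ring A] [Algebra ℂ A] {N : ℕ} {R F : RMatrix N} {q μ : ℂ}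
  {T : Matrix (Fin N) (Fin N) A} {gi : A} (h : IsExtended R F q μ T gi)
include h

/-- Left and right multiplications by generators are already linear maps on P, and they agree on
pairs of generators because both produce `starExp α β`. The commutativity of C reconciles the two
orders of the coefficients. -/
theorem exists_star : ∃ star : descSpace R F T gi →ₗ[ℂ] descSpace R F T gi →ₗ[ℂ]
    descSpace R F T gi, IsStarProduct star := by
  let l : charAlg R F T gi ⊕ (Σ m : ℕ, MonoidAlgebra ℂ (Braid m) × charAlg R F T gi) →
      descSpace R F T gi →ₗ[ℂ] descSpace R F T gi := fun i => match i with
    | Sum.inl c => descMulLin c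
    | Sum.inr ⟨_, α, c⟩ => descMulLin c ∘ₗ h.left α
  let r : charAlg R F T gi ⊕ (Σ m : ℕ, MonoidAlgebra ℂ (Braid m) × charAlg R F T gi) →
      descSpace R F T gi →ₗ[ℂ] descSpace R F T gi := fun i => match i with
    | Sum.inl c => descMulLin c
    | Sum.inr ⟨_, α, c⟩ => descMulLin c ∘ₗ h.right α
  have hlr : ∀ i j, l i (descGen R F T gi j) = r j (descGen R F T gi i) := by
    rintro (c | ⟨m, α, c⟩) (d | ⟨p, β, d⟩)
    · change descMul (descMul _ d) c = descMul (descMul _ c) d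
      rw [descMul_descMul, descMul_descMul, h.charAlg_comm]
    · change descMul (descMul _ d) c = descMul (h.right β (descMul _ c)) d
      rw [right_one, descMul_descMul, descMul_descMul, h.charAlg_comm]
    · change descMul (h.left α (descMul _ d)) c = descMul (descMul _ c) d
      rw [left_one, descMul_descMul, descMul_descMul, h.charAlg_comm]
    · change descMul (h.left α (descMul _ d)) c = descMul (h.right β (descMul _ c)) d
      rw [left_pow, right_pow, descMul_descMul, descMul_descMul, h.charAlg_comm]
  obtain ⟨b, hb1, hb2⟩ := exists_bilinear_of_generators (span_descGen R F T gi) l r hlr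
  have hgen1 : descOne R F T gi = descGen R F T gi (Sum.inl 1) := (descMul_one _).symm
  have hgen2 : ∀ {m : ℕ} (α : MonoidAlgebra ℂ (Braid m)),
      descPow R F T gi α = descGen R F T gi (Sum.inr ⟨m, α, 1⟩) := fun α => (descMul_one _).symm
  refine ⟨b, ⟨fun m p α β => ?_, fun X => ?_, fun X => ?_, fun X Y c => ?_, fun X Y c => ?_⟩⟩
  · rw [hgen2 α, hb1]
    change descMul (h.left α (descPow R F T gi β)) 1 = _
    rw [descMul_one, ← descMul_one (descPow R F T gi β), left_pow, descMul_one]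
  · rw [hgen1, hb1]
    exact descMul_one X
  · rw [hgen1, hb2]
    exact descMul_one X
  · have : (b.flip Y) ∘ₗ descMulLin c = descMulLin c ∘ₗ b.flip Y := by
      refine desc_ext (fun d => ?_) fun m α d => ?_
      · change b (descMul (descMul _ d) c) Y = descMul (b (descGen R F T gi (Sum.inl d)) Y) c
        rw [descMul_descMul, hb1]
        exact (hb1 (Sum.inl (d * c)) Y).trans (descMul_descMul _ _ _).symm
      · change b (descMul (descMul _ d) c) Y = descMul (b (descGen R F T gi (Sum.inr ⟨m, α, d⟩)) Y) c
        rw [descMul_descMul, hb1]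
        exact (hb1 (Sum.inr ⟨m, α, d * c⟩) Y).trans (descMul_descMul _ _ _).symm
    exact LinearMap.congr_fun this X
  · have : (b X) ∘ₗ descMulLin c = descMulLin c ∘ₗ b X := by
      refine desc_ext (fun d => ?_) fun m α d => ?_
      · change b X (descMul (descMul _ d) c) = descMul (b X (descGen R F T gi (Sum.inl d))) c
        rw [descMul_descMul, hb2]
        exact (hb2 X (Sum.inl (d * c))).trans (descMul_descMul _ _ _).symm
      · change b X (descMul (descMul _ d) c) = descMul (b X (descGen R F T gi (Sum.inr ⟨m, α, d⟩))) c
        rw [descMul_descMul, hb2]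
        exact (hb2 X (Sum.inr ⟨m, α, d * c⟩)).trans (descMul_descMul _ _ _).symm
    exact LinearMap.congr_fun this Y

theorem existsUnique_star : ∃! star : descSpace R F T gi →ₗ[ℂ] descSpace R F T gi →ₗ[ℂ]
    descSpace R F T gi, IsStarProduct star := by
  obtain ⟨star, hs⟩ := h.exists_star
  exact ⟨star, hs, fun _ hs' => hs'.ext hs⟩

theorem descPow_ext {m p : ℕ} {α : MonoidAlgebra ℂ (Braid m)} {β : MonoidAlgebra ℂ (Braid p)}
    (hαβ : h.tower.pw m (h.tower.ρ 0 α) = h.tower.pw p (h.tower.ρ 0 β)) :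
    descPow R F T gi α = descPow R F T gi β := by
  refine Subtype.ext (actOne_injective ?_)
  change actOne 0 (matPow R F T α) = actOne 0 (matPow R F T β)
  rw [h.actOne_pow, h.actOne_pow, hαβ]

/-- Only Y is arbitrary, which is all that the invertibility of Θ and the factor M ⋆ M require; by
C-linearity Y may be a generator. -/
theorem star_assoc {star : descSpace R F T gi →ₗ[ℂ] descSpace R F T gi →ₗ[ℂ]
    descSpace R F T gi} (hs : IsStarProduct star) {m p : ℕ} (α : MonoidAlgebra ℂ (Braid m))
    (β : MonoidAlgebra ℂ (Braid p)) (Y : descSpace R F T gi) :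
    star (star (descPow R F T gi α) (descPow R F T gi β)) Y =
      star (descPow R F T gi α) (star (descPow R F T gi β) Y) := by
  have : star (star (descPow R F T gi α) (descPow R F T gi β)) =
      star (descPow R F T gi α) ∘ₗ star (descPow R F T gi β) := by
    refine desc_ext (fun d => ?_) fun n γ d => ?_
    · rw [LinearMap.comp_apply, hs.mul_right, hs.mul_right, hs.mul_right, hs.one_right,
        hs.one_right]
    · rw [LinearMap.comp_apply, hs.mul_right, hs.mul_right, hs.mul_right, hs.pow_pow, hs.pow_pow,
        hs.pow_pow, hs.pow_pow]
      congr 1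
      apply h.descPow_ext
      rw [QMTower.ρ_starExp_zero, QMTower.ρ_starExp_zero, QMTower.starH_assoc]
      congr 1
      ring
  exact LinearMap.congr_fun this Y

end IsExtended

theorem OrthParams.den {k : ℕ} {q μ : ℂ} (hp : OrthParams k q μ) {n : ℕ} (hn : n ≤ k + 1) :
    q * μ⁻¹ * (q ^ (2 * n))⁻¹ + 1 ≠ 0 := by
  have h1 := hp.spec_ne n hn
  have h2 := hp.spec_ne_zero n
  have q0 := hp.q0
  have m0 := hp.m0
  have h3 : q ^ (2 * n) ≠ 0 := pow_ne_zero _ q0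
  have e : q * μ⁻¹ * (q ^ (2 * n))⁻¹ = (spec q μ n)⁻¹ := by
    rw [spec]
    field_simp
  rw [e]
  intro h
  apply h1
  have : spec q μ n * ((spec q μ n)⁻¹ + 1) = 0 := by rw [h, mul_zero]
  rwa [mul_add, mul_inv_cancel₀ h2, mul_one] at this

theorem OrthParams.goodUpTo {k : ℕ} {q μ : ℂ} (hp : OrthParams k q μ) {p : ℕ} (h : p + 1 ≤ k) :
    GoodUpTo q μ p :=
  ⟨hp.toGoodParams, fun i _ _ => hp.num_ne _ (by omega) (by omega),
    fun i _ _ => hp.den (by omega)⟩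

namespace IsExtended

variable {A : Type*} [Ring A] [Algebra ℂ A] {N : ℕ} {R F : RMatrix N} {q μ : ℂ}
  {T : Matrix (Fin N) (Fin N) A} {gi : A} (h : IsExtended R F q μ T gi)

/-! ### Descendants as operators -/

/-- A descendant as an operator on the infinite tensor power. -/
def toOp (_ : IsExtended R F q μ T gi) : descSpace R F T gi →ₗ[ℂ] TOp N A :=
  (actOne 0).toLinearMap ∘ₗ (descSpace R F T gi).subtype

theorem toOp_injective : Function.Injective h.toOp := fun _ _ hXY =>
  Subtype.ext (actOne_injective hXY)

theorem toOp_mul (X : descSpace R F T gi) (c : charAlg R F T gi) :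
    h.toOp (descMul X c) = h.toOp X * coef N A c.1 := actOne_rightMul 0 X.1 c.1

theorem toOp_pow {m : ℕ} (α : MonoidAlgebra ℂ (Braid m)) :
    h.toOp (descPow R F T gi α) = h.tower.pw m (h.tower.ρ 0 α) := h.actOne_pow α

theorem toOp_one : h.toOp (descOne R F T gi) = 1 := map_one (actOne 0)

theorem toOp_self : h.toOp (descSelf R F T gi) = h.tower.T := rfl

theorem coef_gElt : coef N A (gElt R F q μ T) = h.tower.g := by
  rw [gElt, h.coef_chr, QMTower.g_eq]

theorem coef_aElt (n : ℕ) : coef N A (aElt R F q μ T n) = h.tower.a n := by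
  cases n with
  | zero => exact map_one _
  | succ n => exact h.coef_chr _

theorem coef_algebraMap (z : ℂ) :
    coef N A (algebraMap ℂ (charAlg R F T gi) z).1 = algebraMap ℂ _ z :=
  (coef N A).commutes z

theorem descSelf_eq (R F : RMatrix N) (T : Matrix (Fin N) (Fin N) A) (gi : A) :
    descSelf R F T gi = descPow R F T gi (1 : MonoidAlgebra ℂ (Braid 0)) :=
  Subtype.ext (matPow_zero_one R F T).symm

theorem descMul_algebraMap (X : descSpace R F T gi) (z : ℂ) :
    descMul X (algebraMap ℂ _ z) = z • X := by
  refine Subtype.ext ?_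
  ext i j
  change X.1 i j * algebraMap ℂ A z = z • X.1 i j
  rw [Algebra.smul_def, Algebra.commutes]

section Star

variable {star : descSpace R F T gi →ₗ[ℂ] descSpace R F T gi →ₗ[ℂ] descSpace R F T gi}
  (hs : IsStarProduct star)

theorem toOp_self_star (hs : IsStarProduct star) {p : ℕ} (β : MonoidAlgebra ℂ (Braid p)) :
    h.toOp (star (descSelf R F T gi) (descPow R F T gi β)) =
      h.tower.pw (p + 1) (h.tower.ρ 1 β * (h.tower.r 0).val) := by
  rw [descSelf_eq, hs.pow_pow, toOp_pow, QMTower.ρ_starExp_zero, QMTower.starH, map_one, one_mul,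
    zero_add, zero_add]
  rfl

/-- The descendant inverse to the matrix of generators up to a factor. -/
def inverseExp (q μ : ℂ) : MonoidAlgebra ℂ (Braid 2) :=
  MonoidAlgebra.of ℂ _ (sig (1 : Fin 2))⁻¹ * kap q μ (0 : Fin 2)

theorem ρ_inverseExp {H : Type*} [Ring H] [Algebra ℂ H] (𝒯 : QMTower q μ H) (s : ℕ) :
    𝒯.ρ s (inverseExp q μ) = ((𝒯.r (s + 1))⁻¹).val * 𝒯.κ s := by
  rw [inverseExp, map_mul, QMTower.ρ_sig_inv, QMTower.ρ_kap]
  rfl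

include h in
theorem self_star_inverse (hs : IsStarProduct star) :
    star (descSelf R F T gi) (descPow R F T gi (inverseExp q μ)) =
      descMul (descOne R F T gi) (algebraMap ℂ _ μ⁻¹ * (gChar R F q μ T gi * gChar R F q μ T gi)) := by
  apply h.toOp_injective
  have h1 := h.tower.pw_cap_one (p := 0) 1
  rw [map_one, map_one, one_mul, one_mul, QMTower.pw_κ] at h1
  rw [h.toOp_self_star hs, ρ_inverseExp, h1, toOp_mul, toOp_one, one_mul]
  change _ = coef N A ((algebraMap ℂ (charAlg R F T gi) μ⁻¹).1 *
    (gElt R F q μ T * gElt R F q μ T))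
  rw [map_mul, coef_algebraMap, map_mul, h.coef_gElt, ← Algebra.smul_def, smul_mul_assoc]

include h in
theorem inverse_star_self (hs : IsStarProduct star) :
    star (descPow R F T gi (inverseExp q μ)) (descSelf R F T gi) =
      descMul (descOne R F T gi) (algebraMap ℂ _ μ⁻¹ * (gChar R F q μ T gi * gChar R F q μ T gi)) := by
  apply h.toOp_injective
  have hρ := h.tower.ρ_starExp_zero (inverseExp q μ) (1 : MonoidAlgebra ℂ (Braid 0))
  rw [QMTower.starH, map_one, mul_one, ρ_inverseExp] at hρ
  rw [descSelf_eq, hs.pow_pow, toOp_pow]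
  refine (congrArg (h.tower.pw (2 + 0 + 1)) hρ).trans ?_
  rw [toOp_mul, toOp_one, one_mul]
  change _ = coef N A ((algebraMap ℂ (charAlg R F T gi) μ⁻¹).1 *
    (gElt R F q μ T * gElt R F q μ T))
  rw [map_mul, coef_algebraMap, map_mul, h.coef_gElt, ← Algebra.smul_def]
  exact h.tower.pw_three_loopWord

/-! ### The recurrences for the descendants of antisymmetrizers -/

/-- The descendants `i_q T^{a^{(i)}}`. -/
def descX (R F : RMatrix N) (q μ : ℂ) (T : Matrix (Fin N) (Fin N) A) (gi : A) (k : ℕ) :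
    ℕ → descSpace R F T gi
  | 0 => 0
  | n + 1 => if n < k then qNum q (n + 1) • descPow R F T gi (antisym q μ n) else 0

/-- The descendants `i_q T^{a^{(i)↑1} κ_1}`. -/
def descY (R F : RMatrix N) (q μ : ℂ) (T : Matrix (Fin N) (Fin N) A) (gi : A) (k : ℕ) :
    ℕ → descSpace R F T gi
  | 0 => 0
  | n + 1 => if n < k then qNum q (n + 1) • descPow R F T gi
      (shiftA (m' := n + 1) 1 (by omega) (antisym q μ n) * kap q μ 0) else 0

theorem ρ_shift_kap {H : Type*} [Ring H] [Algebra ℂ H] (𝒯 : QMTower q μ H) {n : ℕ}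
    (α : MonoidAlgebra ℂ (Braid n)) :
    𝒯.ρ 0 (shiftA (m' := n + 1) 1 (by omega) α * kap q μ 0) = 𝒯.ρ 1 α * 𝒯.κ 0 := by
  rw [map_mul, QMTower.ρ_shiftA, QMTower.ρ_kap]
  rfl

variable {k : ℕ} (hp : OrthParams k q μ)
  (hv : ∀ p, p + 1 = k → h.tower.ρ 0 (asymStep q μ p) = 0)

theorem pw_smul {H : Type*} [Ring H] [Algebra ℂ H] (𝒯 : QMTower q μ H) (n : ℕ) (z : ℂ) (x : H) :
    𝒯.pw n (z • x) = z • 𝒯.pw n x := by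
  rw [QMTower.pw, mul_smul_comm, map_smul, QMTower.pw]

-- Below the last step this is `ρ_asymStep`. At p + 2 = k + 1 the left side is 0 by convention and
-- the right side by the O(k) condition, so one formula covers every n up to k.
include hp hv in
theorem toOp_descX_step {p : ℕ} (hpk : p + 1 ≤ k) :
    h.toOp (descX R F q μ T gi k (p + 2)) = h.tower.pw (p + 1) (h.tower.ρ 0 (asymStep q μ p)) := by
  rw [descX]
  split_ifs with hlt
  · rw [map_smul, toOp_pow, QMTower.ρ_asymStep _ _ (hp.goodUpTo hlt), pw_smul]
  · rw [hv p (by omega), map_zero, QMTower.pw, mul_zero, map_zero]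

include hp hv in
theorem toOp_descY_step {p : ℕ} (hpk : p + 1 ≤ k) :
    h.toOp (descY R F q μ T gi k (p + 2)) =
      h.tower.pw (p + 2) (h.tower.ρ 1 (asymStep q μ p) * h.tower.κ 0) := by
  rw [descY]
  split_ifs with hlt
  · rw [map_smul, toOp_pow, ρ_shift_kap, QMTower.ρ_asymStep _ _ (hp.goodUpTo hlt), smul_mul_assoc,
      pw_smul]
  · rw [QMTower.ρ_succ_eq_zero _ (hv p (by omega)), map_zero, QMTower.pw, zero_mul, mul_zero,
      map_zero]

theorem qNum_one (hq : q - q⁻¹ ≠ 0) : qNum q 1 = 1 := by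
  rw [qNum, pow_one, div_self hq]

include h in
theorem descX_one (hk : 1 ≤ k) : descX R F q μ T gi k 1 = descSelf R F T gi := by
  rw [descX, if_pos (by omega), zero_add, qNum_one h.tower.good.q2, one_smul, descSelf_eq]
  rfl

include h in
theorem descY_one (hk : 1 ≤ k) : descY R F q μ T gi k 1 =
    descMul (descOne R F T gi) (algebraMap ℂ _ μ⁻¹ * gChar R F q μ T gi) := by
  apply h.toOp_injective
  have hq1 : qNum q (0 + 1) = 1 := qNum_one h.tower.good.q2
  have hκ : h.tower.pw (0 + 1) (h.tower.κ 0) = μ⁻¹ • h.tower.g := h.tower.pw_κ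
  rw [descY, if_pos (by omega), hq1, one_smul, toOp_pow, ρ_shift_kap,
    antisym, map_one, one_mul, hκ, toOp_mul, toOp_one, one_mul]
  change _ = coef N A ((algebraMap ℂ (charAlg R F T gi) μ⁻¹).1 * gElt R F q μ T)
  rw [map_mul, coef_algebraMap, h.coef_gElt, ← Algebra.smul_def]

include hp hv in
theorem descX_succ (hs : IsStarProduct star) {n : ℕ} (hn : n ≤ k) (hk : 1 ≤ k) :
    descX R F q μ T gi k (n + 1) =
      descMul (star (descSelf R F T gi) (descOne R F T gi))
        (algebraMap ℂ _ (q ^ n) * aChar R F q μ T gi n) -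
      star (descSelf R F T gi) (descX R F q μ T gi k n) -
      descMul (descY R F q μ T gi k n) (algebraMap ℂ _ (spec q μ n * specCoef q μ n)) := by
  rw [hs.one_right]
  cases n with
  | zero =>
    have ha : aChar R F q μ T gi 0 = 1 := rfl
    rw [h.descX_one hk, ha, pow_zero, map_one, mul_one, descMul_one, descX, descY, map_zero,
      descMul_algebraMap, smul_zero, sub_zero, sub_zero]
  | succ p =>
    apply h.toOp_injective
    have hX : descX R F q μ T gi k (p + 1) = qNum q (p + 1) • descPow R F T gi (antisym q μ p) :=
      if_pos (by omega)
    have hY : descY R F q μ T gi k (p + 1) = qNum q (p + 1) • descPow R F T gi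
      (shiftA (m' := p + 1) 1 (by omega) (antisym q μ p) * kap q μ 0) := if_pos (by omega)
    rw [h.toOp_descX_step hp hv hn, QMTower.pw_asymStep _ (hp.goodUpTo hn) (hp.den (by omega)),
      map_sub, map_sub, hX, hY, map_smul, map_smul, h.toOp_self_star hs, descMul_algebraMap,
      map_smul, map_smul, toOp_pow, ρ_shift_kap, toOp_mul, toOp_self, smul_smul]
    have e : coef N A (algebraMap ℂ (charAlg R F T gi) (q ^ (p + 1)) *
        aChar R F q μ T gi (p + 1)).1 = q ^ (p + 1) • h.tower.a (p + 1) := by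
      change coef N A ((algebraMap ℂ (charAlg R F T gi) (q ^ (p + 1))).1 *
        aElt R F q μ T (p + 1)) = _
      rw [map_mul, coef_algebraMap, h.coef_aElt, ← Algebra.smul_def]
    rw [e, mul_smul_comm]

-- The formula of `pw_asymStep_κ` expresses y_{n+1} through one further descendant. Multiplying by M
-- removes the contracted pair in that descendant and turns it into y_n g.
include hp hv in
theorem descY_succ (hs : IsStarProduct star) {n : ℕ} (hn : n ≤ k) (hk : 1 ≤ k) :
    star (descSelf R F T gi) (descY R F q μ T gi k (n + 1)) =
      descMul (star (descSelf R F T gi) (descOne R F T gi))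
        (gChar R F q μ T gi * algebraMap ℂ _ (μ⁻¹ * (q ^ n)⁻¹) * aChar R F q μ T gi n) +
      descMul (star (descSelf R F T gi) (descX R F q μ T gi k n))
        (gChar R F q μ T gi * algebraMap ℂ _ (specCoef q μ n)) -
      descMul (descY R F q μ T gi k n) (gChar R F q μ T gi) := by
  have hzero : ∀ c : charAlg R F T gi, descMul (0 : descSpace R F T gi) c = 0 :=
    fun c => map_zero (descMulLin c)
  cases n with
  | zero =>
    have ha : aChar R F q μ T gi 0 = 1 := rfl
    rw [h.descY_one hk, ha, pow_zero, inv_one, mul_one, mul_one, descX, descY, map_zero,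
      hzero, hzero, add_zero, sub_zero, hs.mul_right, h.charAlg_comm]
  | succ p =>
    -- The exponent a^{(p+1)↑2} σ_2⁻¹κ_1, chosen so that `pw_cap_one` evaluates M ⋆ M^δ.
    set δ : MonoidAlgebra ℂ (Braid (p + 2)) := shiftA 2 (by omega) (antisym q μ p) *
      shiftA 0 (by omega) (inverseExp q μ) with hδ
    have hρδ : ∀ s, h.tower.ρ s δ = h.tower.ρ (s + 2) (antisym q μ p) *
        (((h.tower.r (s + 1))⁻¹).val * h.tower.κ s) := fun s => by
      rw [hδ, map_mul, QMTower.ρ_shiftA, QMTower.ρ_shiftA, add_zero, ρ_inverseExp]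
    have hX : descX R F q μ T gi k (p + 1) = qNum q (p + 1) • descPow R F T gi (antisym q μ p) :=
      if_pos (by omega)
    have hY : descY R F q μ T gi k (p + 1) = qNum q (p + 1) • descPow R F T gi
      (shiftA (m' := p + 1) 1 (by omega) (antisym q μ p) * kap q μ 0) := if_pos (by omega)
    have e1 : coef N A (gChar R F q μ T gi * algebraMap ℂ _ (μ⁻¹ * (q ^ (p + 1))⁻¹) *
        aChar R F q μ T gi (p + 1)).1 =
        ((q ^ (p + 1))⁻¹ * μ⁻¹) • (h.tower.a (p + 1) * h.tower.g) := by
      rw [h.charAlg_comm (_ * _), h.charAlg_comm (gChar R F q μ T gi)]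
      change coef N A (aElt R F q μ T (p + 1) * ((algebraMap ℂ (charAlg R F T gi) _).1 *
        gElt R F q μ T)) = _
      rw [map_mul, map_mul, coef_algebraMap, h.coef_aElt, h.coef_gElt, ← Algebra.smul_def,
        mul_smul_comm, mul_comm μ⁻¹]
    have e2 : coef N A (gChar R F q μ T gi * algebraMap ℂ _ (specCoef q μ (p + 1))).1 =
        specCoef q μ (p + 1) • h.tower.g := by
      rw [h.charAlg_comm]
      change coef N A ((algebraMap ℂ (charAlg R F T gi) _).1 * gElt R F q μ T) = _
      rw [map_mul, coef_algebraMap, h.coef_gElt, ← Algebra.smul_def]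
    have key : descY R F q μ T gi k (p + 2) =
        descMul (descOne R F T gi) (gChar R F q μ T gi * algebraMap ℂ _ (μ⁻¹ * (q ^ (p + 1))⁻¹) *
          aChar R F q μ T gi (p + 1)) +
        descMul (descX R F q μ T gi k (p + 1))
          (gChar R F q μ T gi * algebraMap ℂ _ (specCoef q μ (p + 1))) -
        qNum q (p + 1) • descPow R F T gi δ := by
      apply h.toOp_injective
      rw [h.toOp_descY_step hp hv hn, QMTower.pw_asymStep_κ _ (hp.goodUpTo hn) (hp.den (by omega)),
        map_sub, map_add, map_smul, toOp_mul, toOp_mul, toOp_one, one_mul, hX, map_smul, toOp_pow,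
        toOp_pow, hρδ, e1, e2, smul_mul_assoc, mul_smul_comm, smul_smul,
        mul_comm (specCoef q μ (p + 1))]
    have hcap : star (descSelf R F T gi) (descPow R F T gi δ) = descMul (descPow R F T gi
        (shiftA (m' := p + 1) 1 (by omega) (antisym q μ p) * kap q μ 0)) (gChar R F q μ T gi) := by
      apply h.toOp_injective
      rw [h.toOp_self_star hs, hρδ, toOp_mul, toOp_pow, ρ_shift_kap]
      refine (h.tower.pw_cap_one (antisym q μ p)).trans ?_
      rw [← h.coef_gElt]
      rfl
    have hsm : ∀ (z : ℂ) (X : descSpace R F T gi) (c : charAlg R F T gi),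
        descMul (z • X) c = z • descMul X c := fun z X c => map_smul (descMulLin c) z X
    rw [key, map_sub, map_add, hs.mul_right, hs.mul_right, map_smul, hcap, hY, hsm]

end Star
end IsExtended

/-! ### The system of descendants of an extended quantum matrix algebra -/

namespace IsExtended

variable {A : Type*} [Ring A] [Algebra ℂ A] {N : ℕ} {R F : RMatrix N} {q μ : ℂ}
  {T : Matrix (Fin N) (Fin N) A} {gi : A} (h : IsExtended R F q μ T gi)

/-- The extended characteristic subalgebra is a commutative ring. -/
@[reducible] def charCommRing : CommRing (charAlg R F T gi) :=
  { (inferInstance : Ring (charAlg R F T gi)) with mul_comm := h.charAlg_comm }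

/-- The space of descendants is a module over the extended characteristic subalgebra. -/
@[reducible] def descModule :
    @Module (charAlg R F T gi) (descSpace R F T gi) h.charCommRing.toCommSemiring.toSemiring
      inferInstance :=
  letI := h.charCommRing
  { smul := fun c X => descMul X c
    one_smul := descMul_one
    mul_smul := fun c d X => by
      change descMul X (c * d) = descMul (descMul X d) c
      rw [descMul_descMul, h.charAlg_comm]
    smul_zero := fun c => map_zero (descMulLin c)
    smul_add := fun c => map_add (descMulLin c)
    add_smul := fun c d X => Subtype.ext (by
      ext i j
      exact mul_add (X.1 i j) c.1 d.1)
    zero_smul := fun X => Subtype.ext (by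
      ext i j
      exact mul_zero (X.1 i j)) }

/-- The element `g⁻¹` of the extended characteristic subalgebra. -/
def giChar (R F : RMatrix N) (T : Matrix (Fin N) (Fin N) A) (gi : A) : charAlg R F T gi :=
  ⟨gi, Algebra.subset_adjoin (Or.inr rfl)⟩

include h in
theorem gChar_mul_giChar : gChar R F q μ T gi * giChar R F T gi = 1 := Subtype.ext h.mul_inv

theorem rTrace_rightMul (R : RMatrix N) (X : Matrix (Fin N) (Fin N) A) (c : A) :
    rTrace R (rightMul X c) = rTrace R X * c := by
  simp only [rTrace, Matrix.trace, Matrix.diag_apply, Matrix.mul_apply, rightMul, Matrix.map_apply,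
    Finset.sum_mul, mul_assoc]

theorem rTrace_one (R : RMatrix N) :
    rTrace R (1 : Matrix (Fin N) (Fin N) A) = algebraMap ℂ A (skewD R.mat).trace := by
  rw [rTrace, mul_one, Matrix.trace, Matrix.trace, map_sum]
  rfl

theorem rTrace_mem (X : descSpace R F T gi) : rTrace R X.1 ∈ charAlg R F T gi := by
  obtain ⟨X, hX⟩ := X
  refine Submodule.span_induction ?_ ?_ ?_ ?_ hX
  · rintro _ (⟨c, hc, rfl⟩ | ⟨m, α, c, hc, rfl⟩)
    · rw [rTrace_rightMul, rTrace_one]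
      exact mul_mem (algebraMap_mem _ _) hc
    · rw [rTrace_rightMul]
      exact mul_mem (chr_mem R F T gi α) hc
  · simp [rTrace, zero_mem]
  · intro X Y _ _ hX hY
    simp only [rTrace, mul_add, Matrix.trace_add] at hX hY ⊢
    exact add_mem hX hY
  · intro z X _ hX
    simp only [rTrace, mul_smul_comm, Matrix.trace_smul] at hX ⊢
    exact Subalgebra.smul_mem _ hX z

/-- The R-trace on the space of descendants. -/
def descTrace (R F : RMatrix N) (T : Matrix (Fin N) (Fin N) A) (gi : A) :
    descSpace R F T gi →ₗ[ℂ] charAlg R F T gi where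
  toFun X := ⟨rTrace R X.1, rTrace_mem X⟩
  map_add' X Y := Subtype.ext (by simp [rTrace, mul_add])
  map_smul' z X := Subtype.ext (by simp [rTrace])

theorem descTrace_mul (X : descSpace R F T gi) (c : charAlg R F T gi) :
    descTrace R F T gi (descMul X c) = descTrace R F T gi X * c :=
  Subtype.ext (rTrace_rightMul R X.1 c.1)

variable {k : ℕ}

theorem descTrace_descX {n : ℕ} (h1 : 1 ≤ n) (hn : n ≤ k) :
    descTrace R F T gi (descX R F q μ T gi k n) = algebraMap ℂ _ (qNum q n) * aChar R F q μ T gi n := by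
  obtain ⟨p, rfl⟩ := Nat.exists_eq_add_of_le' h1
  have hX : descX R F q μ T gi k (p + 1) = qNum q (p + 1) • descPow R F T gi (antisym q μ p) :=
    if_pos (by omega)
  rw [hX, map_smul, ← Algebra.smul_def]
  rfl

include h in
theorem descTrace_descY (hp : OrthParams k q μ) {n : ℕ} (hn : n + 1 ≤ k) :
    descTrace R F T gi (descY R F q μ T gi k (n + 1)) =
      algebraMap ℂ _ (qNum q (n + 1) * (μ⁻¹ * traceCoef q μ n)) *
        (aChar R F q μ T gi n * gChar R F q μ T gi) := by
  have := h.nonempty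
  have hY : descY R F q μ T gi k (n + 1) = qNum q (n + 1) • descPow R F T gi
    (shiftA (m' := n + 1) 1 (by omega) (antisym q μ n) * kap q μ 0) := if_pos (by omega)
  rw [hY, map_smul, map_mul, mul_assoc, ← Algebra.smul_def, ← Algebra.smul_def]
  congr 1
  apply Subtype.ext
  apply coef_injective (N := N)
  change coef N A (chr R F T _) = coef N A (_ • (aElt R F q μ T n * gElt R F q μ T))
  rw [h.coef_chr, ρ_shift_kap, map_smul, map_mul, h.coef_aElt, h.coef_gElt]
  exact h.tower.ch_antisym_κ (hp.goodUpTo hn)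

variable {star : descSpace R F T gi →ₗ[ℂ] descSpace R F T gi →ₗ[ℂ] descSpace R F T gi}
  (hs : IsStarProduct star)

/-- Star multiplication by the matrix of generators as an invertible operator over the extended
characteristic subalgebra. -/
def starUnit : letI := h.charCommRing; letI := h.descModule
    (Module.End (charAlg R F T gi) (descSpace R F T gi))ˣ :=
  letI := h.charCommRing
  letI := h.descModule
  -- The products of M with the descendant of σ_2⁻¹κ_1 equal μ⁻¹g² in either order; u = μg⁻²
  -- normalizes this to the identity.
  let u : charAlg R F T gi := algebraMap ℂ _ μ * (giChar R F T gi * giChar R F T gi)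
  have hu : (algebraMap ℂ (charAlg R F T gi) μ⁻¹ * (gChar R F q μ T gi * gChar R F q μ T gi)) * u
      = 1 := by
    have hm : algebraMap ℂ (charAlg R F T gi) μ⁻¹ * algebraMap ℂ _ μ = 1 := by
      rw [← map_mul, inv_mul_cancel₀ h.bmw.goodParams.m0, map_one]
    have hg := h.gChar_mul_giChar
    calc _ = (algebraMap ℂ (charAlg R F T gi) μ⁻¹ * algebraMap ℂ _ μ) *
          ((gChar R F q μ T gi * giChar R F T gi) * (gChar R F q μ T gi * giChar R F T gi)) := by
            simp only [u]; ring
      _ = 1 := by rw [hm, hg, mul_one, mul_one]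
  { val := { toFun := star (descSelf R F T gi)
             map_add' := map_add _
             map_smul' := fun c X => hs.mul_right _ X c }
    inv := { toFun := fun X => descMul (star (descPow R F T gi (inverseExp q μ)) X) u
             map_add' := fun X Y => by rw [map_add]; exact map_add (descMulLin u) _ _
             map_smul' := fun c X => by
              change descMul (star _ (descMul X c)) u = descMul (descMul _ u) c
              rw [hs.mul_right, descMul_descMul, descMul_descMul, h.charAlg_comm] }
    val_inv := by
      apply LinearMap.ext
      intro X
      change star (descSelf R F T gi) (descMul (star _ X) u) = X
      rw [hs.mul_right, descSelf_eq, ← h.star_assoc hs, ← descSelf_eq, h.self_star_inverse hs,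
        hs.mul_left, hs.one_left, descMul_descMul, hu, descMul_one]
    inv_val := by
      apply LinearMap.ext
      intro X
      change descMul (star _ (star (descSelf R F T gi) X)) u = X
      rw [descSelf_eq, ← h.star_assoc hs, ← descSelf_eq, h.inverse_star_self hs,
        hs.mul_left, hs.one_left, descMul_descMul, hu, descMul_one] }

/-- The system of descendants of antisymmetrizers. -/
def descentSystem (hp : OrthParams k q μ) (hv : ∀ p, p + 1 = k → h.tower.ρ 0 (asymStep q μ p) = 0) (hk : 1 ≤ k) :
    letI := h.charCommRing; letI := h.descModule
    DescentSystem k q μ (charAlg R F T gi) (descSpace R F T gi) :=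
  letI := h.charCommRing
  letI := h.descModule
  { Θ := h.starUnit hs
    e := descOne R F T gi
    τ :=
      { toFun := descTrace R F T gi
        map_add' := map_add _
        map_smul' := fun c X => (descTrace_mul X c).trans (mul_comm _ _) }
    a := aChar R F q μ T gi
    g := ⟨gChar R F q μ T gi, giChar R F T gi, h.gChar_mul_giChar,
      (mul_comm _ _).trans h.gChar_mul_giChar⟩
    x := descX R F q μ T gi k
    y := descY R F q μ T gi k
    a_zero := rfl
    x_zero := rfl
    y_zero := rfl
    x_succ := fun _ hn => h.descX_succ hp hv hs hn hk
    y_succ := fun _ hn => h.descY_succ hp hv hs hn hk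
    x_last := if_neg (lt_irrefl k)
    y_last := if_neg (lt_irrefl k)
    τ_x := fun _ h1 hn => descTrace_descX h1 hn
    τ_y := fun _ hn => h.descTrace_descY hp hn }

theorem starUnit_pow (n : ℕ) : letI := h.charCommRing; letI := h.descModule
    ((h.starUnit hs).val ^ n) (descOne R F T gi) = starPow star n := by
  let := h.charCommRing
  let := h.descModule
  induction n with
  | zero => rfl
  | succ n ih =>
    rw [pow_succ', Module.End.mul_apply, ih]
    rfl

/-- The Cayley–Hamilton identity in the case `a_{2ℓ} = g^ℓ`. -/
theorem cayleyHamilton_plus {ℓ : ℕ} (hp : OrthParams (2 * ℓ) q μ)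
    (hv : ∀ p, p + 1 = 2 * ℓ → h.tower.ρ 0 (asymStep q μ p) = 0) (hℓ : 1 ≤ ℓ)
    (ha : aChar R F q μ T gi (2 * ℓ) = gChar R F q μ T gi ^ ℓ) (hs : IsStarProduct star) :
    ∑ i ∈ Finset.range (2 * ℓ + 1),
      (-q) ^ i • descMul (starPow star (2 * ℓ - i)) (aChar R F q μ T gi i) = 0 := by
  let := h.charCommRing
  let := h.descModule
  refine Eq.trans (Finset.sum_congr rfl fun i _ => ?_)
    ((h.descentSystem hs hp hv (by omega)).plus hp hℓ ha)
  refine Eq.trans ?_ (congrArg (descMul · _) (h.starUnit_pow hs _).symm)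
  change _ = descMul (starPow star (2 * ℓ - i)) (algebraMap ℂ (charAlg R F T gi) ((-q) ^ i) *
    aChar R F q μ T gi i)
  rw [← descMul_algebraMap, descMul_descMul, h.charAlg_comm]

-- Splitting off the term j = 0 of the defining sum leaves g times the sum for i − 2.
include h in
theorem epsChar_low {ℓ i : ℕ} (hi : i < ℓ) : epsChar R F q μ T gi ℓ i =
    aChar R F q μ T gi i + if 2 ≤ i then gChar R F q μ T gi * epsChar R F q μ T gi ℓ (i - 2) else 0 := by
  rw [epsChar, if_pos (Nat.succ_le_of_lt hi)]
  split_ifs with h2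
  · rw [epsChar, if_pos (by omega)]
    obtain ⟨n, rfl⟩ := Nat.exists_eq_add_of_le' h2
    have e : (n + 2) / 2 + 1 = (n / 2 + 1) + 1 := by omega
    rw [e, Finset.sum_range_succ', add_comm]
    congr 1
    · rw [mul_zero, Nat.sub_zero, pow_zero, mul_one]
    · rw [Nat.add_sub_cancel, Finset.mul_sum]
      refine Finset.sum_congr rfl fun j _ => ?_
      have : n + 2 - 2 * (j + 1) = n - 2 * j := by omega
      rw [this, pow_succ, h.charAlg_comm (gChar R F q μ T gi), mul_assoc]
  · have e : i / 2 + 1 = 1 := by omega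
    rw [e, Finset.sum_range_one, mul_zero, Nat.sub_zero, pow_zero, mul_one, add_zero]

theorem epsChar_high {ℓ i : ℕ} (hi : i < ℓ) : epsChar R F q μ T gi ℓ (ℓ - 1 + i) =
    epsChar R F q μ T gi ℓ (ℓ - 1 - i) * gChar R F q μ T gi ^ i := by
  rcases Nat.eq_zero_or_pos i with rfl | h0
  · rw [pow_zero, mul_one]
    rfl
  · rw [epsChar, epsChar, if_neg (by omega), if_pos (by omega)]
    have e1 : 2 * ℓ - 2 - (ℓ - 1 + i) = ℓ - 1 - i := by omega
    have e2 : ℓ - 1 + i + 1 - ℓ = i := by omega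
    rw [e1, e2]

/-- The Cayley–Hamilton identity in the case `a_{2ℓ} = -g^ℓ`. -/
theorem cayleyHamilton_minus {ℓ : ℕ} (hp : OrthParams (2 * ℓ) q μ)
    (hv : ∀ p, p + 1 = 2 * ℓ → h.tower.ρ 0 (asymStep q μ p) = 0) (hℓ : 1 ≤ ℓ)
    (ha : aChar R F q μ T gi (2 * ℓ) = -gChar R F q μ T gi ^ ℓ) (hs : IsStarProduct star) :
    star (starPow star 2 - descMul (descOne R F T gi) (gChar R F q μ T gi))
      (∑ i ∈ Finset.range (2 * ℓ - 1),
        (-q) ^ i • descMul (starPow star (2 * ℓ - 2 - i)) (epsChar R F q μ T gi ℓ i)) = 0 := by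
  let := h.charCommRing
  let := h.descModule
  have key := (h.descentSystem hs hp hv (by omega)).minus hp hℓ ha (epsChar R F q μ T gi ℓ)
    (fun i hi => h.epsChar_low hi) (fun i hi => epsChar_high hi)
  have hsum : ∑ i ∈ Finset.range (2 * ℓ - 1),
        (-q) ^ i • descMul (starPow star (2 * ℓ - 2 - i)) (epsChar R F q μ T gi ℓ i) =
      ∑ i ∈ Finset.range (2 * ℓ - 1), (algebraMap ℂ (charAlg R F T gi) ((-q) ^ i) *
        epsChar R F q μ T gi ℓ i) • ((h.starUnit hs).val ^ (2 * ℓ - 2 - i)) (descOne R F T gi) := by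
    refine Finset.sum_congr rfl fun i _ => ?_
    refine Eq.trans ?_ (congrArg (descMul · _) (h.starUnit_pow hs _).symm)
    rw [← descMul_algebraMap, descMul_descMul, h.charAlg_comm]
  rw [hsum]
  refine Eq.trans ?_ key
  have h2 : starPow star 2 = star (descPow R F T gi (1 : MonoidAlgebra ℂ (Braid 0)))
      (descPow R F T gi (1 : MonoidAlgebra ℂ (Braid 0))) := by
    rw [← descSelf_eq, starPow, starPow, starPow, hs.one_right]
  rw [map_sub, LinearMap.sub_apply, hs.mul_left, hs.one_left, h2, h.star_assoc hs, ← descSelf_eq]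
  rfl

end IsExtended

/-! ### Functoriality in the algebra of matrix entries -/

section Functoriality

variable {A B : Type*} [Ring A] [Algebra ℂ A] [Ring B] [Algebra ℂ B] {N : ℕ} (φ : A →ₐ[ℂ] B)

theorem map_onSites {k n : ℕ} (e : Fin k → Fin n) (X : TensorMat N k A) :
    (onSites e X).map φ = onSites e (X.map φ) := by
  ext a b
  simp only [onSites, Matrix.map_apply, Matrix.of_apply, apply_ite φ, map_zero]

theorem map_algebraMap_map {n : Type*} (X : Matrix n n ℂ) :
    (X.map (algebraMap ℂ A)).map φ = X.map (algebraMap ℂ B) := by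
  ext a b
  exact φ.commutes _

theorem matCopy_map (F : RMatrix N) (T : Matrix (Fin N) (Fin N) A) (m : ℕ) (k : Fin (m + 1)) :
    matCopy F (T.map φ) m k = (matCopy F T m k).map φ := by
  induction k using Fin.induction with
  | zero => exact (map_onSites φ _ _).symm
  | succ i ih =>
    change locA B i F.mat * matCopy F (T.map φ) m i.castSucc * locA B i F.inv =
      (locA A i F.mat * matCopy F T m i.castSucc * locA A i F.inv).map φ
    rw [Matrix.map_mul, Matrix.map_mul, ih, locA, locA, locA, locA, map_algebraMap_map,
      map_algebraMap_map]

theorem copyProd_map (R F : RMatrix N) (T : Matrix (Fin N) (Fin N) A) {m : ℕ}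
    (α : MonoidAlgebra ℂ (Braid m)) : copyProd R F (T.map φ) α = (copyProd R F T α).map φ := by
  rw [copyProd, copyProd, Matrix.map_mul, map_algebraMap_map]
  congr 1
  have h := map_list_prod φ.mapMatrix (List.ofFn (matCopy F T m))
  refine Eq.trans ?_ h.symm
  rw [List.map_ofFn]
  congr 2
  funext k
  exact matCopy_map φ F T m k

theorem dTail_map (R : RMatrix N) (m : ℕ) : (dTail A R m).map φ = dTail B R m := by
  ext a b
  simp only [dTail, Matrix.map_apply, Matrix.of_apply, apply_ite φ, map_zero, φ.commutes]

theorem matPow_map (R F : RMatrix N) (T : Matrix (Fin N) (Fin N) A) {m : ℕ}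
    (α : MonoidAlgebra ℂ (Braid m)) : matPow R F (T.map φ) α = (matPow R F T α).map φ := by
  rw [matPow, matPow, copyProd_map, ← dTail_map φ, ← Matrix.map_mul]
  ext i j
  simp only [traceTail, Matrix.of_apply, Matrix.map_apply, map_sum]

/-- Characteristic elements are polynomials with complex coefficients in the entries of the matrix,
so algebra homomorphisms preserve them. This carries the relations imposed on free generators down
to the components. -/
theorem chr_map (R F : RMatrix N) (T : Matrix (Fin N) (Fin N) A) {m : ℕ}
    (α : MonoidAlgebra ℂ (Braid m)) : chr R F (T.map φ) α = φ (chr R F T α) := by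
  rw [chr, chr, matPow_map, rTrace, rTrace, ← map_algebraMap_map φ, ← Matrix.map_mul]
  exact (AddMonoidHom.map_trace φ.toAddMonoidHom _).symm

theorem gElt_map (R F : RMatrix N) (q μ : ℂ) (T : Matrix (Fin N) (Fin N) A) :
    gElt R F q μ (T.map φ) = φ (gElt R F q μ T) := chr_map φ R F T _

theorem aElt_map (R F : RMatrix N) (q μ : ℂ) (T : Matrix (Fin N) (Fin N) A) (n : ℕ) :
    aElt R F q μ (T.map φ) n = φ (aElt R F q μ T n) := by
  cases n with
  | zero => exact (map_one φ).symm
  | succ n => exact chr_map φ R F T _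

theorem isQuantumMatrix_map_iff (R F : RMatrix N) (T : Matrix (Fin N) (Fin N) A) :
    IsQuantumMatrix R F (T.map φ) ↔
      (locA A (0 : Fin 1) R.mat * matCopy F T 1 0 * matCopy F T 1 1).map φ =
        (matCopy F T 1 0 * matCopy F T 1 1 * locA A (0 : Fin 1) R.mat).map φ := by
  rw [IsQuantumMatrix, Matrix.map_mul, Matrix.map_mul, Matrix.map_mul, Matrix.map_mul,
    matCopy_map, matCopy_map, locA, locA, map_algebraMap_map]

end Functoriality

/-! ### The components of the extended quantum matrix algebra -/

section Component

variable {N : ℕ} (R F : RMatrix N) (q μ : ℂ) (ℓ : ℕ) (s : ℂ)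

/-- The projection from the free algebra to a component of the extended quantum matrix algebra. -/
def freeProj : FreeQM N →ₐ[ℂ] ComponentQM R F q μ ℓ s :=
  (componentProj R F q μ ℓ s).comp (extProj R F q μ)

theorem componentM_eq : componentM R F q μ ℓ s = (freeM N).map (freeProj R F q μ ℓ s) := by
  rw [componentM, extM, Matrix.map_map]
  rfl

theorem freeProj_rel {x y : FreeQM N} (h : ExtRel R F q μ x y) :
    freeProj R F q μ ℓ s x = freeProj R F q μ ℓ s y :=
  congrArg (componentProj R F q μ ℓ s) (RingQuot.mkAlgHom_rel ℂ h)

theorem isQuantumMatrix_component : IsQuantumMatrix R F (componentM R F q μ ℓ s) := by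
  rw [componentM_eq, isQuantumMatrix_map_iff]
  ext a b
  exact freeProj_rel R F q μ ℓ s (ExtRel.rmm a b)

theorem componentGInv_mul :
    componentGInv R F q μ ℓ s * gElt R F q μ (componentM R F q μ ℓ s) = 1 := by
  rw [componentM_eq, gElt_map]
  have := freeProj_rel R F q μ ℓ s ExtRel.inv_mul
  rwa [map_mul, map_one] at this

theorem mul_componentGInv :
    gElt R F q μ (componentM R F q μ ℓ s) * componentGInv R F q μ ℓ s = 1 := by
  rw [componentM_eq, gElt_map]
  have := freeProj_rel R F q μ ℓ s ExtRel.mul_inv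
  rwa [map_mul, map_one] at this

theorem componentA_last : componentA R F q μ ℓ s (2 * ℓ) = s • componentG R F q μ ℓ s ^ ℓ := by
  apply Subtype.ext
  change aElt R F q μ ((extM R F q μ).map (componentProj R F q μ ℓ s)) (2 * ℓ) =
    s • gElt R F q μ ((extM R F q μ).map (componentProj R F q μ ℓ s)) ^ ℓ
  rw [aElt_map, gElt_map, ← map_pow, ← map_smul]
  exact RingQuot.mkAlgHom_rel ℂ ComponentRel.rel

end Component

/-! ### R-matrices of orthogonal type -/

namespace IsOrthogonalType

variable {N k : ℕ} {q μ : ℂ} {R : RMatrix N} (hR : IsOrthogonalType k q μ R)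
include hR

/-- Here `spec q μ n` = q^{2n−k}. For 1 ≤ n ≤ k the inequality 1 + spec ≠ 0 is the field `μ_ne`. The
value at n = 0 is inverse to that at n = k, and the value at n = k + 1 is q^{k+2}. -/
theorem orthParams (hq : q ^ (k + 2) ≠ -1) : OrthParams k q μ := by
  have hg := hR.bmw.goodParams
  have q0 := hg.q0
  have hspec : ∀ n, spec q μ n = q ^ (2 * (n : ℤ) - k) := fun n => by
    rw [spec, hR.μ_eq, ← zpow_natCast, ← zpow_add₀ q0, ← zpow_sub_one₀ q0]
    congr 1
    push_cast
    ring
  have hpos : ∀ n, 1 ≤ n → n ≤ k → 1 + spec q μ n ≠ 0 := fun n h1 hn h0 => by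
    apply hR.μ_ne n h1 hn
    have e : spec q μ n * q ^ (1 - 2 * (n : ℤ)) = μ := by
      rw [hspec, ← zpow_add₀ q0, hR.μ_eq]
      congr 1
      ring
    rw [← e, eq_neg_of_add_eq_zero_right h0]
    ring
  refine ⟨hg, hR.μ_eq, fun n h1 hn => ?_, fun n hn => ?_⟩
  · rcases Nat.lt_or_ge 1 n with h | h
    · exact hR.qNum_ne n h hn
    · rw [le_antisymm h h1, qNum, pow_one, div_self hg.q2]
      exact one_ne_zero
  · rcases Nat.eq_zero_or_pos n with rfl | h0
    · intro h
      refine hpos k (by have := hR.two_le; omega) le_rfl ?_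
      have e : spec q μ k * spec q μ 0 = 1 := by
        rw [hspec, hspec, ← zpow_add₀ q0]
        convert zpow_zero q using 2
        push_cast
        ring
      rw [eq_neg_of_add_eq_zero_right h] at e
      linear_combination -e
    · rcases Nat.lt_or_ge k n with h | h
      · obtain rfl : n = k + 1 := by omega
        intro h
        apply hq
        have e : spec q μ (k + 1) = q ^ (k + 2) := by
          rw [hspec, ← zpow_natCast]
          congr 1
          push_cast
          ring
        rw [← e]
        linear_combination h
      · exact hpos n h0 h

/-- The rank of a^{(2)} is nonzero, which is impossible over the zero space. -/
theorem nonempty : Nonempty (Fin N) := by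
  by_contra h
  have := not_nonempty_iff.1 h
  apply hR.rank_ne 2 le_rfl hR.two_le
  rw [Subsingleton.elim (rho R (antisym q μ (2 - 1))) 0, Matrix.rank_zero]

theorem rho_asymStep {p : ℕ} (hp : p + 1 = k) : rho R (asymStep q μ p) = 0 := by
  subst hp
  rw [asymStep, map_smul]
  exact smul_eq_zero_of_right _ hR.vanish

end IsOrthogonalType

/-! ### Application to the components O^±(2ℓ). -/

section Main

variable {N ℓ : ℕ} {q μ : ℂ} {R F : RMatrix N}

theorem isExtended_component {k : ℕ} (hRF : IsCompatible R F) (hR : IsOrthogonalType k q μ R)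
    (s : ℂ) : IsExtended R F q μ (componentM R F q μ ℓ s) (componentGInv R F q μ ℓ s) :=
  ⟨hRF, hR.skew, hR.bmw, isQuantumMatrix_component R F q μ ℓ s, componentGInv_mul R F q μ ℓ s,
    mul_componentGInv R F q μ ℓ s, hR.nonempty⟩

theorem IsExtended.ρ_asymStep_eq_zero {A : Type*} [Ring A] [Algebra ℂ A] {k : ℕ}
    {T : Matrix (Fin N) (Fin N) A} {gi : A} (h : IsExtended R F q μ T gi)
    (hR : IsOrthogonalType k q μ R) (p : ℕ) (hp : p + 1 = k) :
    h.tower.ρ 0 (asymStep q μ p) = 0 := by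
  have := actC_rho h.compat h.skew h.bmw h.quantum (asymStep q μ p)
  rw [hR.rho_asymStep hp, map_zero] at this
  exact this.symm

end Main

end

theorem theorem5p6 {N ℓ : ℕ} (q μ : ℂ) (R F : RMatrix N)
    (hRF : IsCompatible R F) (hF : IsStrictSkewInvertible F.mat)
    (hR : IsOrthogonalType (2 * ℓ) q μ R) (hq : q ^ (2 * ℓ + 2) ≠ -1) :
    ((∃! star : ComponentStar R F q μ ℓ 1, IsStarProduct star) ∧
      ∀ star : ComponentStar R F q μ ℓ 1, IsStarProduct star →
        ∑ i ∈ Finset.range (2 * ℓ + 1),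
          (-q) ^ i • descMul (starPow star (2 * ℓ - i)) (componentA R F q μ ℓ 1 i) = 0) ∧
    ((∃! star : ComponentStar R F q μ ℓ (-1), IsStarProduct star) ∧
      ∀ star : ComponentStar R F q μ ℓ (-1), IsStarProduct star →
        star (starPow star 2 -
            descMul (componentOne R F q μ ℓ (-1)) (componentG R F q μ ℓ (-1)))
          (∑ i ∈ Finset.range (2 * ℓ - 1),
            (-q) ^ i • descMul (starPow star (2 * ℓ - 2 - i))
              (componentEps R F q μ ℓ (-1) i)) = 0) := by
  have hp := hR.orthParams hq
  have hℓ : 1 ≤ ℓ := by have := hR.two_le; omega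
  have h1 := isExtended_component (ℓ := ℓ) hRF hR 1
  have h2 := isExtended_component (ℓ := ℓ) hRF hR (-1)
  refine ⟨⟨h1.existsUnique_star, fun star hs => ?_⟩, h2.existsUnique_star, fun star hs => ?_⟩
  · refine h1.cayleyHamilton_plus hp (h1.ρ_asymStep_eq_zero hR) hℓ ?_ hs
    exact (componentA_last R F q μ ℓ 1).trans (one_smul _ _)
  · refine h2.cayleyHamilton_minus hp (h2.ρ_asymStep_eq_zero hR) hℓ ?_ hs
    exact (componentA_last R F q μ ℓ (-1)).trans (neg_one_smul _ _)
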